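/- **Setting.** A *vertical plane* $(\mathcal P,\pi)$ is an oriented topological space $\mathcal P\cong\mathbb R^2$ with a locally trivial fibration $\pi:\mathcal P\to\mathbb R$, whose fibres (the *vertical lines*, homeomorphic to $\mathbb R$) are oriented upward by the orientations of $\mathcal P$ and $\mathbb R$. A *topological critical point* of a curve $\mathcal C\subset\mathcal P$ is a point of $\mathcal C$ having no neighbourhood in $\mathcal C$ on which $\pi$ is a homeomorphism onto its image. A *generic domain of weakly finite type* is a closed subset $\mathcal D\subset\mathcal P$ which is a topological surface with non-empty boundary $\mathcal C=\partial\mathcal D$, such that $\pi|_{\mathcal C}$ is proper, $\mathcal C$ has finitely many topological critical points, and no two of them lie on the same vertical line. Let $\mathcal D^c$ be the closure of $\mathcal P\setminus\mathcal D$. Let $\rho_{\mathcal D}$ be the quotient map of $\mathcal P$ that collapses to a point each connected component of each $\mathcal D\cap\pi^{-1}(x)$. A *Poincaré–Reeb graph* (in the source) of $\mathcal D$ is the image $G\subset\mathcal D$ of a continuous section of $\rho_{\mathcal D}|_{\mathcal D}:\mathcal D\to\rho_{\mathcal D}(\mathcal D)$. Its vertices are the images under the section of the classes of the topological critical points of $\mathcal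 C$; its open edges are the connected components of the complement of the vertices in $G$. An open edge whose projection is unbounded to the left (right) carries a left (right) *arrowhead*. An edge with an arrowhead carries an upward (downward) *feather* if the vertical intervals of $\mathcal D$ that it represents are unbounded upward (downward). A Poincaré–Reeb graph $G$ of $\mathcal D$, with arrowheads and feathers, is called an *interior graph* of $\mathcal D$, and one $G^c$ of $\mathcal D^c$ an *exterior graph* of $\mathcal D$. A *transversal graph* is a closed subset of $\mathcal P$ partitioned into finitely many vertices and finitely many open edges homeomorphic to $\mathbb R$, such that the closure of each open edge is homeomorphic to a (possibly unbounded) closed interval, is obtained by adding vertices only, and is mapped by $\pi$ homeomorphically onto its image, and such that $\pi$ is proper on the graph; some edges with arrowheads may carry feathers. A *trident completion* of $G$ is a transversal graph $H$ with feathers, having the same vertices as $G$, meeting $G$ only at the vertices, and satisfying the *trident rule*: * at each vertex $v$, for one of the two horizontal directions, one of the graphs $G,H$ has at $v$ exactly one edge $E$, going in that direction, and the other one has exactly three edges at $v$: one going in the opposite direction and two going in that direction, one just below $E$ and one just above $E$; * near infinity, in each of the two horizontal directions: next above an arrow of one of the two graphs that has no upward feather there is an arrow of the other graph (with no arrow of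 either graph in between), and no arrow of either graph is above an arrow with upward feather; similarly with "below" and downward feathers. A *vertical isotopy* between graphs in $\mathcal P$ is an isotopy of $\mathcal P$, starting at the identity and stabilizing each vertical line, whose final homeomorphism carries the first graph, with its vertices, edges, arrowheads and feathers, onto the second. Graphs in vertical planes $(\mathcal P,\pi)$, $(\mathcal P',\pi')$ are *vertically equivalent* if there are orientation preserving homeomorphisms $\Phi:\mathcal P\to\mathcal P'$ and $\psi:\mathbb R\to\mathbb R$ with $\pi'\circ\Phi=\psi\circ\pi$ such that $\Phi$ carries one graph, with its vertices, edges, arrowheads and feathers, onto the other. **Proposition.** Let $\mathcal D$ be a generic domain of weakly finite type in a vertical plane $(\mathcal P,\pi)$, with interior graph $G$ and exterior graph $G^c$. 1. $G$ and $G^c$ have the same (non-arrowhead) vertices; and if $G$ and $G^c$ meet only at vertices, then $G^c$ is a trident completion of $G$. 2. $G$ has a trident completion, and every trident completion of $G$ is vertically isotopic to $G^c$. 3. $G$ determines $G^c$: let $\mathcal D'$ be a generic domain of weakly finite type in a vertical plane $(\mathcal P',\pi')$, with interior graph $G'$ and exterior graph $G'^c$. If $\Phi:\mathcal P\to\mathcal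 P'$ realizes a vertical equivalence of $G$ with $G'$, then $\Phi(G^c)$ is vertically isotopic to $G'^c$. In particular, if $G$ and $G'$ are vertically equivalent, then so are $G^c$ and $G'^c$. -/

import Mathlib

open Set Filter Topology

universe u v

/-! ### Vertical planes -/

/-- A vertical plane: a space homeomorphic to the plane, with a locally trivial fibration
`proj` over `ℝ` (its fibres, the vertical lines, are homeomorphic to `ℝ`), and an orientation.
As the base `ℝ` is oriented, an orientation of the plane is the same as a coherent orientation of
the vertical lines; it is recorded as the strict order `Below` on the vertical lines, and the
local trivializations are required to be compatible with it. -/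
structure VerticalPlane (P : Type*) [TopologicalSpace P] where
  /-- the vertical projection -/
  proj : P → ℝ
  /-- `Below p q`: the points `p`, `q` lie on one vertical line and `p` is strictly below `q` -/
  Below : P → P → Prop
  homeomorphic_plane : Nonempty (P ≃ₜ ℝ × ℝ)
  locally_trivial : ∀ x : ℝ, ∃ e : Bundle.Trivialization ℝ proj, x ∈ e.baseSet ∧
    ∀ p q : P, proj p ∈ e.baseSet → (Below p q ↔ proj q = proj p ∧ (e p).2 < (e q).2)

/-- An orientation preserving homeomorphism of vertical planes, fibred over an orientation
preserving homeomorphism of `ℝ`. -/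
structure VerticalEquiv {P P' : Type*} [TopologicalSpace P] [TopologicalSpace P']
    (A : VerticalPlane P) (A' : VerticalPlane P') where
  /-- the homeomorphism of the planes -/
  toHomeo : P ≃ₜ P'
  /-- the homeomorphism of the bases -/
  base : ℝ ≃ₜ ℝ
  base_strictMono : StrictMono base
  proj_comm : ∀ p : P, A'.proj (toHomeo p) = base (A.proj p)
  below_iff : ∀ p q : P, A'.Below (toHomeo p) (toHomeo q) ↔ A.Below p q

/-- The two horizontal directions. -/
inductive Side where
  | left
  | right

/-- The filter of neighbourhoods in `ℝ` of the end at infinity in a given direction. -/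
def Side.atInf : Side → Filter ℝ
  | Side.left => atBot
  | Side.right => atTop

/-- The opposite direction. -/
def Side.flip : Side → Side
  | Side.left => Side.right
  | Side.right => Side.left

/-- `s.Past a b`: the real number `b` is strictly on the side `s` of `a`. -/
def Side.Past : Side → ℝ → ℝ → Prop
  | Side.left, a, b => b < a
  | Side.right, a, b => a < b

/-! ### Enriched graphs -/

/-- The data of a graph embedded in `P`, enriched by feathers. The open edges are the connected
components of the complement of the vertices in the graph; the arrowhead vertices are not
points of `P`, they are the ends at infinity of the open edges (see `VerticalPlane.arrows`). -/
@[ext]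
structure EnrichedGraph (P : Type*) where
  /-- the underlying set of the graph -/
  carrier : Set P
  /-- the (non-arrowhead) vertices -/
  vertices : Set P
  /-- the open edges which are decorated by an upward feather -/
  up : Set (Set P)
  /-- the open edges which are decorated by a downward feather -/
  down : Set (Set P)

namespace EnrichedGraph

/-- The image of an enriched graph. -/
def map {P P' : Type*} (f : P → P') (G : EnrichedGraph P) : EnrichedGraph P' where
  carrier := f '' G.carrier
  vertices := f '' G.vertices
  up := (fun E => f '' E) '' G.up
  down := (fun E => f '' E) '' G.down

/-- The open edges: the connected components of the complement of the vertices. -/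
def openEdges {P : Type*} [TopologicalSpace P] (G : EnrichedGraph P) : Set (Set P) :=
  {E | ∃ p ∈ G.carrier \ G.vertices, E = connectedComponentIn (G.carrier \ G.vertices) p}

end EnrichedGraph

namespace VerticalPlane

variable {P : Type*} [TopologicalSpace P] (A : VerticalPlane P)

/-! ### Domains of weakly finite type -/

/-- The topological critical set of a curve `C`: the points of `C` having no neighbourhood in `C`
on which the projection is a homeomorphism onto its image. -/
def topCrit (C : Set P) : Set P :=
  {p ∈ C | ¬ ∃ U ∈ 𝓝 p, IsEmbedding ((C ∩ U).domRestrict A.proj)}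

/-- `D` is a closed subset of the plane `P` which is a topological surface with boundary: around each point of its
boundary there is a chart of `P` in which `D` becomes a closed half-plane. -/
def _root_.IsSurfaceWithBoundary (D : Set P) : Prop :=
  IsClosed D ∧ ∀ p ∈ frontier D, ∃ φ : OpenPartialHomeomorph P (ℝ × ℝ), p ∈ φ.source ∧
    ∀ q ∈ φ.source, q ∈ D ↔ 0 ≤ (φ q).2

/-- Domains of weakly finite type. -/
structure IsWeaklyFiniteDomain (D : Set P) : Prop where
  surface : IsSurfaceWithBoundary D
  boundary_nonempty : (frontier D).Nonempty
  proper : IsProperMap ((frontier D).domRestrict A.proj)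
  finite_crit : (A.topCrit (frontier D)).Finite

/-- Generic domains of weakly finite type: no two topological critical points of the boundary
lie on the same vertical line. -/
structure IsGenericDomain (D : Set P) : Prop extends A.IsWeaklyFiniteDomain D where
  generic : InjOn A.proj (A.topCrit (frontier D))

/-! ### The collapse and the Poincaré–Reeb graphs in the source -/

/-- Vertical equivalence of points relative to `D`: the points are on the same vertical line, and
either in the same connected component of its intersection with `D`, or equal and outside `D`. -/
def collapseSetoid (D : Set P) : Setoid P where
  r p q := A.proj p = A.proj q ∧
    (q ∈ connectedComponentIn (A.proj ⁻¹' {A.proj p} ∩ D) p ∨ (p = q ∧ p ∉ D))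
  iseqv := by
    refine ⟨fun p => ⟨rfl, ?_⟩, ?_, ?_⟩
    · by_cases hp : p ∈ D
      · exact Or.inl (mem_connectedComponentIn ⟨rfl, hp⟩)
      · exact Or.inr ⟨rfl, hp⟩
    · rintro p q ⟨h, h1 | ⟨rfl, h1⟩⟩
      · have hp : p ∈ A.proj ⁻¹' {A.proj p} ∩ D := by
          by_contra hp
          rw [connectedComponentIn_eq_empty hp] at h1
          exact h1
        refine ⟨h.symm, Or.inl ?_⟩
        rw [← h, ← connectedComponentIn_eq h1]
        exact mem_connectedComponentIn hp
      · exact ⟨rfl, Or.inr ⟨rfl, h1⟩⟩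
    · rintro p q r ⟨h, h1⟩ ⟨h', h2⟩
      refine ⟨h.trans h', ?_⟩
      rcases h1 with h1 | ⟨rfl, h1⟩
      · rcases h2 with h2 | ⟨rfl, h2⟩
        · rw [← h, ← connectedComponentIn_eq h1] at h2
          exact Or.inl h2
        · exact Or.inl h1
      · exact h2

/-- The `D`-collapse of the plane, with the quotient topology. -/
abbrev Collapse (D : Set P) : Type _ := Quotient (A.collapseSetoid D)

/-- The collapsing map relative to `D`. -/
def collapse (D : Set P) : P → A.Collapse D := Quotient.mk (A.collapseSetoid D)

/-- The Poincaré–Reeb set of `D`, with the topology induced by that of the `D`-collapse. -/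
def PRSet (D : Set P) : Set (A.Collapse D) := A.collapse D '' D

/-- The arrowheads of `G` in the direction `s`, identified with the open edges on which they are:
those which escape to infinity in the direction `s`. -/
def arrows (G : EnrichedGraph P) (s : Side) : Set (Set P) :=
  {E ∈ G.openEdges | ∃ᶠ x in s.atInf, x ∈ A.proj '' E}

/-- The open edges that have at least one arrowhead. -/
def arrowEdges (G : EnrichedGraph P) : Set (Set P) := {E | ∃ s, E ∈ A.arrows G s}

/-- `G` is a Poincaré–Reeb graph in the source of `D`, with its arrowheads and feathers: `G` is
the image of a continuous section of the restriction of the collapsing map to `D`; its vertices are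
the images by this section of the collapsed topological critical points of the boundary; an
edge with an arrowhead carries an upward (downward) feather if the vertical intervals of `D` that
it represents are unbounded upward (downward). -/
def IsPRGraph (D : Set P) (G : EnrichedGraph P) : Prop :=
  ∃ σ : C(A.PRSet D, D), (∀ a, A.collapse D (σ a) = a) ∧
    G.carrier = {p | ∃ a : A.PRSet D, (σ a : P) = p} ∧
    G.vertices = {p | ∃ a : A.PRSet D, (a : A.Collapse D) ∈ A.collapse D '' A.topCrit (frontier D) ∧
      (σ a : P) = p} ∧
    G.up = {E ∈ A.arrowEdges G | ∀ p ∈ E, ∀ q, A.Below p q → q ∈ D} ∧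
    G.down = {E ∈ A.arrowEdges G | ∀ p ∈ E, ∀ q, A.Below q p → q ∈ D}

/-! ### Transversal graphs and the trident rule -/

/-- `G` is a transversal graph, all of whose feathers are on edges with an arrowhead. -/
structure IsTransversalGraph (G : EnrichedGraph P) : Prop where
  closed : IsClosed G.carrier
  vertices_subset : G.vertices ⊆ G.carrier
  vertices_finite : G.vertices.Finite
  edges_finite : G.openEdges.Finite
  open_edge : ∀ E ∈ G.openEdges, Nonempty (E ≃ₜ ℝ)
  edge : ∀ E ∈ G.openEdges, ∃ J : Set ℝ, IsClosed J ∧ J.OrdConnected ∧ Nonempty (closure E ≃ₜ J)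
  ends : ∀ E ∈ G.openEdges, closure E \ E ⊆ G.vertices
  transversal : ∀ E ∈ G.openEdges, IsEmbedding ((closure E).domRestrict A.proj)
  proper : IsProperMap (G.carrier.domRestrict A.proj)
  up_subset : G.up ⊆ A.arrowEdges G
  down_subset : G.down ⊆ A.arrowEdges G

/-- The open edges of `G` which start from the point `v` in the direction `s`. -/
def edgesFrom (G : EnrichedGraph P) (s : Side) (v : P) : Set (Set P) :=
  {E ∈ G.openEdges | v ∈ closure E ∧ ∀ p ∈ E, s.Past (A.proj v) (A.proj p)}

/-- Along the filter `l` on the base, the set `E` is below the set `F`. -/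
def BelowAlong (l : Filter ℝ) (E F : Set P) : Prop :=
  ∀ᶠ x in l, ∀ p ∈ E, ∀ q ∈ F, A.proj p = x → A.proj q = x → A.Below p q

/-- The trident at `v`, opening in the direction `s`: `G` has at `v` a single edge `E`, going in the
direction `s`, while `H` has at `v` three edges, one going in the opposite direction and two
going in the direction `s`, one below `E` and the other one above `E`. -/
def Trident (G H : EnrichedGraph P) (s : Side) (v : P) : Prop :=
  ∃ E F₀ F₁ F₂ : Set P,
    A.edgesFrom G s v = {E} ∧ A.edgesFrom G s.flip v = ∅ ∧
    A.edgesFrom H s.flip v = {F₀} ∧ A.edgesFrom H s v = {F₁, F₂} ∧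
    A.BelowAlong (𝓝 (A.proj v)) F₁ E ∧ A.BelowAlong (𝓝 (A.proj v)) E F₂

/-- The trident rule at a (non-arrowhead) vertex: an exterior vertex of one of the graphs is
an interior vertex of the other one, in the position of a trident. -/
def TridentRule (G H : EnrichedGraph P) (v : P) : Prop :=
  ∃ s : Side, A.Trident G H s v ∨ A.Trident H G s v

/-- The trident rule at the arrowheads of `G` in the direction `s`: just above an arrow without
upward feather there is an arrow of `H`, and nothing is above an arrow with upward feather;
similarly below. -/
def ArrowRule (G H : EnrichedGraph P) (s : Side) : Prop :=
  ∀ E ∈ A.arrows G s,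
    (E ∉ G.up → ∃ F ∈ A.arrows H s, A.BelowAlong s.atInf E F ∧
      ∀ K ∈ A.arrows G s ∪ A.arrows H s,
        ¬ (A.BelowAlong s.atInf E K ∧ A.BelowAlong s.atInf K F)) ∧
    (E ∈ G.up → ∀ K ∈ A.arrows G s ∪ A.arrows H s, ¬ A.BelowAlong s.atInf E K) ∧
    (E ∉ G.down → ∃ F ∈ A.arrows H s, A.BelowAlong s.atInf F E ∧
      ∀ K ∈ A.arrows G s ∪ A.arrows H s,
        ¬ (A.BelowAlong s.atInf F K ∧ A.BelowAlong s.atInf K E)) ∧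
    (E ∈ G.down → ∀ K ∈ A.arrows G s ∪ A.arrows H s, ¬ A.BelowAlong s.atInf K E)

/-- `H` is obtained from `G` by applying the trident rule at each vertex and each arrowhead, and by
completing the edges so started to a transversal graph that meets `G` only at the vertices. -/
structure IsTridentCompletion (G H : EnrichedGraph P) : Prop where
  transversal : A.IsTransversalGraph H
  vertices_eq : H.vertices = G.vertices
  inter_subset : G.carrier ∩ H.carrier ⊆ G.vertices
  trident : ∀ v ∈ G.vertices, A.TridentRule G H v
  arrow : ∀ s, A.ArrowRule G H s ∧ A.ArrowRule H G s

/-! ### Vertical isotopy and vertical equivalence -/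

/-- Vertical isotopy of enriched graphs: an isotopy of the plane that stabilizes each vertical line
carries `G` onto `G'`. -/
def VerticallyIsotopic (G G' : EnrichedGraph P) : Prop :=
  ∃ Φ : unitInterval → (P ≃ₜ P),
    Continuous (fun z : unitInterval × P => Φ z.1 z.2) ∧
    (∀ p, Φ 0 p = p) ∧ (∀ t p, A.proj (Φ t p) = A.proj p) ∧
    G.map (Φ 1) = G'

/-- Vertical equivalence of enriched graphs. -/
def VerticallyEquivalent {P' : Type*} [TopologicalSpace P'] (A' : VerticalPlane P')
    (G : EnrichedGraph P) (G' : EnrichedGraph P') : Prop :=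
  ∃ Φ : VerticalEquiv A A', G.map Φ.toHomeo = G'

end VerticalPlane

/-! ### Transport along vertical equivalences -/

namespace EnrichedGraph

/-! Write `E` for the closure of the complement of `D`. Fibrewise increasing, fibrewise unbounded
functions form a convex class, so local ones glue to a global height (`exists_isHeight`), which
identifies any vertical plane with `ℝ × ℝ` (`coordEquiv`). The same convexity joins two heights by a
segment of heights, so that a vertical isotopy amounts to a vertical equivalence over the identity
of the base.

In coordinates, a Poincaré–Reeb graph is the image of a continuous map `r` on `D` that selects one
point in each component of each fibre (`Retraction`). The boundary is a curve, locally a graph over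
the base except at the critical points `v`, where two branches leave `v` in the same direction;
there one of `D`, `E` fills the fold and the other one surrounds it (`DomainPair`). On the filling
side the component of `v` is the point `v` alone; on the surrounding side continuity squeezes `r v`
between the two branches. So `v` is fixed in both cases, and the two graphs have the same vertices.
The filling domain has one edge at `v`; the surrounding one has three, two of which enclose that
edge: a trident. Beyond the critical points each fibre alternates between segments of `D` and of
`E`, every segment carries exactly one point of the corresponding graph, and the unbounded segments
are the feathers: this is the arrow rule (`IsReeb.isTridentCompletion`).

Uniqueness. Let `H` be a trident completion of `G`, and delete from each graph the vertices that
have no edge on one side. Two disjoint systems of strands remain, and when the vertical line moves,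
a point of one system can only open into a triple, two points of its own system with a point of the
other one in between, or a triple can close (`Weave`). Such moves preserve the alternation along the
fibre and the system to which the extreme points belong. These properties can be read near infinity
from the arrow rule and the feathers of `G`, hence they hold on every line (`Weave.const`). If `H'`
is another completion, each point of `H` has therefore a unique partner in `H'`, the one that cuts
the fibre of `G` at the same place. Near each vertical line a piecewise linear interpolation fixes
`G` and sends `H` to `H'`. Being a height with prescribed values is a convex condition, so these
interpolations glue (`Matching.exists_verticalEquiv`).

Existence, although `G` and `Gc` may cross. Push both graphs off the boundary away from the vertices
(`Retraction.exists_inside`), into `M` for `D` and `M'` for `E`. Then `M'` completes both `G` and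
`M`, while `Gc` completes `M`. By uniqueness for `M`, the graph `M'` is isotopic to `Gc`; by
uniqueness for `G`, every completion of `G` is isotopic to `M'`. The last assertion follows since
vertical equivalences carry trident completions to trident completions. -/

theorem map_map {P P' P'' : Type*} (f : P → P') (g : P' → P'') (G : EnrichedGraph P) :
    (G.map f).map g = G.map (fun p => g (f p)) := by
  ext <;> simp [map, image_image]

theorem map_of_forall_eq {P : Type*} {f : P → P} (hf : ∀ p, f p = p) (G : EnrichedGraph P) :
    G.map f = G := by
  obtain rfl : f = id := funext hf
  ext <;> simp [map]

theorem openEdges_map {P P' : Type*} [TopologicalSpace P] [TopologicalSpace P'] (f : P ≃ₜ P')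
    (G : EnrichedGraph P) : (G.map f).openEdges = (fun E => f '' E) '' G.openEdges := by
  have hd : f '' G.carrier \ f '' G.vertices = f '' (G.carrier \ G.vertices) :=
    (image_sdiff f.injective _ _).symm
  ext E
  simp only [openEdges, map, hd, mem_image, mem_ofPred_eq]
  constructor
  · rintro ⟨_, ⟨p, hp, rfl⟩, rfl⟩
    exact ⟨_, ⟨p, hp, rfl⟩, f.image_connectedComponentIn hp⟩
  · rintro ⟨_, ⟨p, hp, rfl⟩, rfl⟩
    exact ⟨_, ⟨p, hp, rfl⟩, f.image_connectedComponentIn hp⟩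

end EnrichedGraph

namespace VerticalEquiv

variable {P P' P'' : Type*} [TopologicalSpace P] [TopologicalSpace P'] [TopologicalSpace P'']
  {A : VerticalPlane P} {A' : VerticalPlane P'} {A'' : VerticalPlane P''}

/-- The inverse of a vertical equivalence. -/
def symm (Φ : VerticalEquiv A A') : VerticalEquiv A' A where
  toHomeo := Φ.toHomeo.symm
  base := Φ.base.symm
  base_strictMono := fun a b h => by
    by_contra h'
    have := Φ.base_strictMono.monotone (not_lt.1 h')
    simp only [Homeomorph.apply_symm_apply] at this
    exact absurd h (not_lt.2 this)
  proj_comm p := by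
    apply Φ.base.injective
    rw [← Φ.proj_comm]; simp
  below_iff p q := by rw [← Φ.below_iff]; simp

/-- The composition of vertical equivalences. -/
def trans (Φ : VerticalEquiv A A') (Ψ : VerticalEquiv A' A'') : VerticalEquiv A A'' where
  toHomeo := Φ.toHomeo.trans Ψ.toHomeo
  base := Φ.base.trans Ψ.base
  base_strictMono := Ψ.base_strictMono.comp Φ.base_strictMono
  proj_comm p := by simp [Ψ.proj_comm, Φ.proj_comm]
  below_iff p q := by simp [Ψ.below_iff, Φ.below_iff]

theorem map_map_symm (Φ : VerticalEquiv A A') (G : EnrichedGraph P) :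
    (G.map Φ.toHomeo).map Φ.symm.toHomeo = G := by
  rw [EnrichedGraph.map_map]
  exact EnrichedGraph.map_of_forall_eq (fun p => Φ.toHomeo.symm_apply_apply p) G

variable (Φ : VerticalEquiv A A')

theorem map_atInf (s : Side) : map Φ.base s.atInf = s.atInf := by
  let o : ℝ ≃o ℝ := Φ.base_strictMono.orderIsoOfSurjective _ Φ.base.surjective
  cases s
  · exact o.map_atBot
  · exact o.map_atTop

theorem past_iff (s : Side) (a b : ℝ) : s.Past (Φ.base a) (Φ.base b) ↔ s.Past a b := by
  cases s <;> exact Φ.base_strictMono.lt_iff_lt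

theorem proj_image (E : Set P) : A'.proj '' (Φ.toHomeo '' E) = Φ.base '' (A.proj '' E) := by
  simp [image_image, Φ.proj_comm]

theorem mem_arrows_map {G : EnrichedGraph P} {s : Side} {E : Set P} :
    Φ.toHomeo '' E ∈ A'.arrows (G.map Φ.toHomeo) s ↔ E ∈ A.arrows G s := by
  simp only [VerticalPlane.arrows, EnrichedGraph.openEdges_map, mem_ofPred_eq,
    image_injective.2 Φ.toHomeo.injective |>.mem_set_image, Φ.proj_image]
  refine and_congr_right fun _ => ?_
  conv_lhs => rw [← Φ.map_atInf s, frequently_map]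
  simp only [Φ.base.injective.mem_set_image]

theorem arrows_map (G : EnrichedGraph P) (s : Side) :
    A'.arrows (G.map Φ.toHomeo) s = (fun E => Φ.toHomeo '' E) '' A.arrows G s := by
  ext F
  obtain ⟨E, rfl⟩ : ∃ E, Φ.toHomeo '' E = F := ⟨Φ.toHomeo ⁻¹' F, by simp⟩
  rw [Φ.mem_arrows_map, (image_injective.2 Φ.toHomeo.injective).mem_set_image
    (f := fun E => Φ.toHomeo '' E)]

theorem arrowEdges_map (G : EnrichedGraph P) :
    A'.arrowEdges (G.map Φ.toHomeo) = (fun E => Φ.toHomeo '' E) '' A.arrowEdges G := by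
  ext F
  simp only [VerticalPlane.arrowEdges, arrows_map, mem_ofPred_eq, mem_image]
  tauto

theorem edgesFrom_map (G : EnrichedGraph P) (s : Side) (v : P) :
    A'.edgesFrom (G.map Φ.toHomeo) s (Φ.toHomeo v) =
      (fun E => Φ.toHomeo '' E) '' A.edgesFrom G s v := by
  ext F
  obtain ⟨E, rfl⟩ : ∃ E, Φ.toHomeo '' E = F := ⟨Φ.toHomeo ⁻¹' F, by simp⟩
  rw [(image_injective.2 Φ.toHomeo.injective).mem_set_image (f := fun E => Φ.toHomeo '' E)]
  simp only [VerticalPlane.edgesFrom, EnrichedGraph.openEdges_map, mem_ofPred_eq,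
    image_injective.2 Φ.toHomeo.injective |>.mem_set_image, ← Φ.toHomeo.image_closure,
    Φ.toHomeo.injective.mem_set_image, forall_mem_image, Φ.proj_comm, Φ.past_iff]

theorem belowAlong_map {l l' : Filter ℝ} (hl : map Φ.base l = l') (E F : Set P) :
    A'.BelowAlong l' (Φ.toHomeo '' E) (Φ.toHomeo '' F) ↔ A.BelowAlong l E F := by
  rw [← hl]
  simp only [VerticalPlane.BelowAlong, eventually_map, forall_mem_image, Φ.proj_comm,
    Φ.base.injective.eq_iff, Φ.below_iff]

theorem trident_map {G H : EnrichedGraph P} {s : Side} {v : P} (h : A.Trident G H s v) :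
    A'.Trident (G.map Φ.toHomeo) (H.map Φ.toHomeo) s (Φ.toHomeo v) := by
  obtain ⟨E, F₀, F₁, F₂, h1, h2, h3, h4, h5, h6⟩ := h
  have hl : map Φ.base (𝓝 (A.proj v)) = 𝓝 (A'.proj (Φ.toHomeo v)) := by
    rw [Φ.base.map_nhds_eq, Φ.proj_comm]
  refine ⟨Φ.toHomeo '' E, Φ.toHomeo '' F₀, Φ.toHomeo '' F₁, Φ.toHomeo '' F₂, ?_, ?_, ?_, ?_,
    (Φ.belowAlong_map hl _ _).2 h5, (Φ.belowAlong_map hl _ _).2 h6⟩ <;>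
  simp [edgesFrom_map, h1, h2, h3, h4, image_pair]

theorem arrowRule_map {G H : EnrichedGraph P} {s : Side} (h : A.ArrowRule G H s) :
    A'.ArrowRule (G.map Φ.toHomeo) (H.map Φ.toHomeo) s := by
  have hi := image_injective.2 Φ.toHomeo.injective
  have hl := Φ.map_atInf s
  intro F hF
  rw [arrows_map] at hF
  obtain ⟨E, hE, rfl⟩ := hF
  obtain ⟨h1, h2, h3, h4⟩ := h E hE
  have hu : Φ.toHomeo '' E ∈ (G.map Φ.toHomeo).up ↔ E ∈ G.up := hi.mem_set_image
  have hd : Φ.toHomeo '' E ∈ (G.map Φ.toHomeo).down ↔ E ∈ G.down := hi.mem_set_image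
  simp only [hu, hd, arrows_map, ← image_union, exists_mem_image, forall_mem_image,
    Φ.belowAlong_map hl]
  exact ⟨h1, h2, h3, h4⟩

theorem domRestrict_image (S : Set P) : (Φ.toHomeo '' S).domRestrict A'.proj =
    Φ.base ∘ S.domRestrict A.proj ∘ (Φ.toHomeo.image S).symm := by
  ext ⟨_, p, hp, rfl⟩
  have : (Φ.toHomeo.image S).symm ⟨Φ.toHomeo p, mem_image_of_mem _ hp⟩ = ⟨p, hp⟩ := by
    rw [Homeomorph.symm_apply_eq]; rfl
  simp [domRestrict, this, Φ.proj_comm]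

theorem isProperMap_image {S : Set P} (h : IsProperMap (S.domRestrict A.proj)) :
    IsProperMap ((Φ.toHomeo '' S).domRestrict A'.proj) := by
  rw [Φ.domRestrict_image]
  exact Φ.base.isProperMap.comp (h.comp (Homeomorph.isProperMap _))

theorem isEmbedding_image {S : Set P} (h : IsEmbedding (S.domRestrict A.proj)) :
    IsEmbedding ((Φ.toHomeo '' S).domRestrict A'.proj) := by
  rw [Φ.domRestrict_image]
  exact Φ.base.isEmbedding.comp (h.comp (Homeomorph.isEmbedding _))

theorem isTransversalGraph_map {G : EnrichedGraph P} (h : A.IsTransversalGraph G) :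
    A'.IsTransversalGraph (G.map Φ.toHomeo) := by
  constructor
  · exact Φ.toHomeo.isClosedMap _ h.closed
  · exact image_mono h.vertices_subset
  · exact h.vertices_finite.image _
  · rw [EnrichedGraph.openEdges_map]; exact h.edges_finite.image _
  · rw [EnrichedGraph.openEdges_map]
    rintro _ ⟨E, hE, rfl⟩
    exact ⟨(Φ.toHomeo.image E).symm.trans (h.open_edge E hE).some⟩
  · rw [EnrichedGraph.openEdges_map]
    rintro _ ⟨E, hE, rfl⟩
    obtain ⟨J, h1, h2, ⟨h3⟩⟩ := h.edge E hE
    beta_reduce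
    rw [← Φ.toHomeo.image_closure]
    exact ⟨J, h1, h2, ⟨(Φ.toHomeo.image _).symm.trans h3⟩⟩
  · rw [EnrichedGraph.openEdges_map]
    rintro _ ⟨E, hE, rfl⟩
    simp only [← Φ.toHomeo.image_closure, ← image_sdiff Φ.toHomeo.injective]
    exact image_mono (h.ends E hE)
  · rw [EnrichedGraph.openEdges_map]
    rintro _ ⟨E, hE, rfl⟩
    beta_reduce
    rw [← Φ.toHomeo.image_closure]
    exact Φ.isEmbedding_image (h.transversal E hE)
  · exact Φ.isProperMap_image h.proper
  · rw [arrowEdges_map]; exact image_mono h.up_subset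
  · rw [arrowEdges_map]; exact image_mono h.down_subset

theorem isTridentCompletion_map {G H : EnrichedGraph P} (h : A.IsTridentCompletion G H) :
    A'.IsTridentCompletion (G.map Φ.toHomeo) (H.map Φ.toHomeo) where
  transversal := Φ.isTransversalGraph_map h.transversal
  vertices_eq := by simp only [EnrichedGraph.map, h.vertices_eq]
  inter_subset := by
    simp only [EnrichedGraph.map, ← image_inter Φ.toHomeo.injective]
    exact image_mono h.inter_subset
  trident := by
    rintro _ ⟨v, hv, rfl⟩
    obtain ⟨s, hs | hs⟩ := h.trident v hv
    · exact ⟨s, Or.inl (Φ.trident_map hs)⟩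
    · exact ⟨s, Or.inr (Φ.trident_map hs)⟩
  arrow s := ⟨Φ.arrowRule_map (h.arrow s).1, Φ.arrowRule_map (h.arrow s).2⟩

end VerticalEquiv

/-! ### Global coordinates on a vertical plane -/

/-- The standard vertical plane. -/
def stdPlane : VerticalPlane (ℝ × ℝ) where
  proj := Prod.fst
  Below p q := q.1 = p.1 ∧ p.2 < q.2
  homeomorphic_plane := ⟨Homeomorph.refl _⟩
  locally_trivial x := by
    refine ⟨{ toOpenPartialHomeomorph := OpenPartialHomeomorph.refl (ℝ × ℝ)
              baseSet := univ
              open_baseSet := isOpen_univ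
              source_eq := by simp
              target_eq := by simp
              proj_toFun := fun p _ => rfl }, mem_univ _, fun p q _ => Iff.rfl⟩

@[simp] theorem stdPlane_proj : stdPlane.proj = Prod.fst := rfl

theorem stdPlane_below {p q : ℝ × ℝ} : stdPlane.Below p q ↔ q.1 = p.1 ∧ p.2 < q.2 := Iff.rfl

namespace VerticalPlane

variable {P : Type*} [TopologicalSpace P] (A : VerticalPlane P)

theorem continuous_proj : Continuous A.proj := by
  rw [continuous_iff_continuousAt]
  intro p
  obtain ⟨e, he, -⟩ := A.locally_trivial (A.proj p)
  exact e.continuousAt_proj (e.mem_source.2 he)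

variable {A}

theorem Below.proj_eq {p q : P} (h : A.Below p q) : A.proj q = A.proj p := by
  obtain ⟨e, he, H⟩ := A.locally_trivial (A.proj p)
  exact ((H p q he).1 h).1

theorem Below.trans {p q r : P} (h : A.Below p q) (h' : A.Below q r) : A.Below p r := by
  obtain ⟨e, he, H⟩ := A.locally_trivial (A.proj p)
  have h1 := (H p q he).1 h
  have h2 := (H q r (by rwa [h1.1])).1 h'
  exact (H p r he).2 ⟨h2.1.trans h1.1, h1.2.trans h2.2⟩

theorem not_below_self (p : P) : ¬ A.Below p p := by
  obtain ⟨e, he, H⟩ := A.locally_trivial (A.proj p)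
  exact fun h => lt_irrefl _ ((H p p he).1 h).2

theorem below_trichotomy {p q : P} (h : A.proj p = A.proj q) :
    A.Below p q ∨ p = q ∨ A.Below q p := by
  obtain ⟨e, he, H⟩ := A.locally_trivial (A.proj p)
  rcases lt_trichotomy (e p).2 (e q).2 with h1 | h1 | h1
  · exact Or.inl ((H p q he).2 ⟨h.symm, h1⟩)
  · refine Or.inr (Or.inl (e.injOn (e.mem_source.2 he) (e.mem_source.2 (by rwa [← h])) ?_))
    refine Prod.ext ?_ h1
    exact (e.coe_fst (e.mem_source.2 he)).trans
      (h.trans (e.coe_fst (e.mem_source.2 (by rwa [← h]))).symm)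
  · exact Or.inr (Or.inr ((H q p (by rwa [← h])).2 ⟨h, h1⟩))

variable (A)

/-- A function that restricts to an increasing unbounded function on each vertical line. -/
structure IsHeight (F : P → ℝ) (x : ℝ) : Prop where
  lt_of_below : ∀ p q, A.proj p = x → A.Below p q → F p < F q
  exists_le : ∀ c, ∃ p, A.proj p = x ∧ F p ≤ c
  exists_ge : ∀ c, ∃ p, A.proj p = x ∧ c ≤ F p

variable {A}

theorem IsHeight.le_of_not_below {F : P → ℝ} {x : ℝ} (h : A.IsHeight F x) {p q : P}
    (hp : A.proj p = x) (hq : A.proj q = x) (hpq : ¬ A.Below q p) : F p ≤ F q := by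
  rcases below_trichotomy (hp.trans hq.symm) with h1 | rfl | h1
  · exact (h.lt_of_below p q hp h1).le
  · exact le_rfl
  · exact absurd h1 hpq

theorem IsHeight.below_iff {F : P → ℝ} (h : ∀ x, A.IsHeight F x) (p q : P) :
    A.Below p q ↔ A.proj q = A.proj p ∧ F p < F q := by
  refine ⟨fun h' => ⟨h'.proj_eq, (h _).lt_of_below p q rfl h'⟩, fun h' => ?_⟩
  rcases below_trichotomy h'.1 with h1 | rfl | h1
  · exact absurd ((h _).lt_of_below _ _ rfl h1) h'.2.not_gt
  · exact absurd h'.2 (lt_irrefl _)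
  · exact h1

variable (A)

/-- If `F` and `G` are at most `c` at points `p` and `q` of the fibre, then both are at most `c` at
the lower of the two points, so unboundedness survives convex combinations. This convexity serves
twice: to glue local heights, and to deform one height into another. -/
theorem convex_isHeight (x : ℝ) : Convex ℝ {F : C(P, ℝ) | A.IsHeight F x} := by
  intro F hF G hG a b ha hb hab
  have key : ∀ {u v w z : ℝ}, u ≤ v → w ≤ z → a * u + b * w ≤ a * v + b * z := fun h1 h2 => by
    gcongr
  constructor
  · intro p q hp hpq
    have h1 := hF.lt_of_below p q hp hpq
    have h2 := hG.lt_of_below p q hp hpq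
    simp only [ContinuousMap.add_apply, ContinuousMap.smul_apply, smul_eq_mul]
    rcases ha.eq_or_lt with rfl | ha
    · obtain rfl : b = 1 := by linarith
      linarith
    · have := mul_lt_mul_of_pos_left h1 ha
      have := mul_le_mul_of_nonneg_left h2.le hb
      linarith
  · intro c
    obtain ⟨p, hp, hpc⟩ := hF.exists_le c
    obtain ⟨q, hq, hqc⟩ := hG.exists_le c
    have hc : a * c + b * c = c := by rw [← add_mul, hab, one_mul]
    simp only [ContinuousMap.add_apply, ContinuousMap.smul_apply, smul_eq_mul]
    by_cases h : A.Below q p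
    · exact ⟨q, hq, hc ▸ key ((hF.lt_of_below _ _ hq h).le.trans hpc) hqc⟩
    · exact ⟨p, hp, hc ▸ key hpc ((hG.le_of_not_below hp hq h).trans hqc)⟩
  · intro c
    obtain ⟨p, hp, hpc⟩ := hF.exists_ge c
    obtain ⟨q, hq, hqc⟩ := hG.exists_ge c
    have hc : a * c + b * c = c := by rw [← add_mul, hab, one_mul]
    simp only [ContinuousMap.add_apply, ContinuousMap.smul_apply, smul_eq_mul]
    by_cases h : A.Below p q
    · refine ⟨q, hq, ?_⟩
      conv_lhs => rw [← hc]
      exact key (hpc.trans (hF.lt_of_below _ _ hp h).le) hqc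
    · refine ⟨p, hp, ?_⟩
      conv_lhs => rw [← hc]
      exact key hpc (hqc.trans (hG.le_of_not_below hq hp h))

/-- Local choices of functions in a fibrewise convex class glue to a global function. -/
theorem exists_continuousMap_of_local [LocallyCompactSpace P] {t : ℝ → Set C(P, ℝ)}
    (ht : ∀ x, Convex ℝ (t x))
    (hext : ∀ x, ∀ F ∈ t x, ∀ F' : C(P, ℝ), (∀ p, A.proj p = x → F' p = F p) → F' ∈ t x)
    (h : ∀ x, ∃ F : C(P, ℝ), ∀ᶠ y in 𝓝 x, F ∈ t y) :
    ∃ F : C(P, ℝ), ∀ x, F ∈ t x := by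
  -- A partition of unity on the base gives a continuous map `g` from `ℝ` to `C(P, ℝ)`. The diagonal
  -- `p ↦ g (proj p) p` is continuous because `P` is locally compact. On the fibre over `x` it
  -- agrees with `g x`, and `hext` says that only this fibre matters.
  obtain ⟨g, hg⟩ := exists_continuous_forall_mem_convex_of_local_const ht h
  refine ⟨⟨fun p => g (A.proj p) p, ?_⟩, fun x => hext x _ (hg x) _ fun p hp => ?_⟩
  · exact (g.continuous.comp A.continuous_proj).eval continuous_id
  · simp [hp]

theorem locallyCompactSpace {P : Type*} [TopologicalSpace P] (A : VerticalPlane P) :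
    LocallyCompactSpace P :=
  A.homeomorphic_plane.some.isClosedEmbedding.locallyCompactSpace

/-- The second coordinate of a local trivialization is a height over the base set. Multiplied by a
cut-off function it extends continuously by zero to the whole plane, and it is unchanged over a
neighbourhood of `x`, which is what the gluing needs. -/
theorem exists_isHeight : ∃ F : C(P, ℝ), ∀ x, A.IsHeight F x := by
  have := A.locallyCompactSpace
  refine A.exists_continuousMap_of_local (t := fun x => {F : C(P, ℝ) | A.IsHeight F x})
    A.convex_isHeight ?_ ?_
  · intro x F hF F' h
    refine ⟨fun p q hp hpq => ?_, fun c => ?_, fun c => ?_⟩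
    · rw [h p hp, h q (hpq.proj_eq.trans hp)]; exact hF.lt_of_below p q hp hpq
    · obtain ⟨p, hp, hpc⟩ := hF.exists_le c
      exact ⟨p, hp, by rwa [h p hp]⟩
    · obtain ⟨p, hp, hpc⟩ := hF.exists_ge c
      exact ⟨p, hp, by rwa [h p hp]⟩
  · intro x
    obtain ⟨e, he, H⟩ := A.locally_trivial x
    obtain ⟨χ, hχ1, hχ⟩ : ∃ χ : C(ℝ, ℝ), (∀ᶠ y in 𝓝 x, χ y = 1) ∧ tsupport χ ⊆ e.baseSet := by
      obtain ⟨r, hr, hrU⟩ := Metric.isOpen_iff.1 e.open_baseSet x he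
      have hd : Disjoint (Metric.ball x (r/2))ᶜ (Metric.closedBall x (r/4)) := by
        rw [disjoint_left]
        intro y hy hy'
        simp only [mem_compl_iff, Metric.mem_ball, Metric.mem_closedBall, not_lt] at hy hy'
        linarith
      obtain ⟨χ, h0, h1, -⟩ := exists_continuous_zero_one_of_isClosed
        Metric.isOpen_ball.isClosed_compl Metric.isClosed_closedBall hd
      have hs : tsupport χ ⊆ e.baseSet := by
        refine Subset.trans ?_ hrU
        refine (closure_minimal (t := Metric.closedBall x (r/2)) ?_ Metric.isClosed_closedBall).trans
          (Metric.closedBall_subset_ball (by linarith))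
        intro y hy
        by_contra hy'
        exact hy (h0 fun h => hy' (Metric.ball_subset_closedBall h))
      refine ⟨χ, ?_, hs⟩
      filter_upwards [Metric.closedBall_mem_nhds x (show 0 < r / 4 by linarith)] with y hy
      exact h1 hy
    refine ⟨⟨fun p => χ (A.proj p) * (e p).2, ?_⟩, ?_⟩
    · rw [continuous_iff_continuousAt]
      intro p
      have hχp : ContinuousAt (fun p => χ (A.proj p)) p :=
        (χ.continuous.comp A.continuous_proj).continuousAt
      by_cases hp : A.proj p ∈ e.baseSet
      · have h1 : ContinuousAt e p :=
          e.toOpenPartialHomeomorph.continuousOn.continuousAt (e.open_source.mem_nhds (e.mem_source.2 hp))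
        exact hχp.mul h1.snd
      · have h0 : ∀ᶠ y in 𝓝 (A.proj p), χ y = 0 := by
          filter_upwards [(isClosed_tsupport χ).isOpen_compl.mem_nhds fun h => hp (hχ h)] with y hy
          exact image_eq_zero_of_notMem_tsupport hy
        refine (continuousAt_const (y := (0 : ℝ))).congr ?_
        filter_upwards [A.continuous_proj.continuousAt.eventually h0] with q hq
        simp [hq]
    · filter_upwards [hχ1, e.open_baseSet.mem_nhds he] with y hy hye
      have hpt : ∀ c : ℝ, ∃ p, A.proj p = y ∧ χ (A.proj p) * (e p).2 = c := by
        intro c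
        have hc : (y, c) ∈ e.target := e.mem_target.2 hye
        have h1 : A.proj (e.toOpenPartialHomeomorph.symm (y, c)) = y := e.proj_symm_apply hc
        refine ⟨e.toOpenPartialHomeomorph.symm (y, c), h1, ?_⟩
        rw [h1, hy, one_mul, e.apply_symm_apply hc]
      refine ⟨fun p q hp hpq => ?_, fun c => ?_, fun c => ?_⟩
      · have := (H p q (by rwa [hp])).1 hpq
        simp only [ContinuousMap.coe_mk, this.1, hp, hy, one_mul, this.2]
      · obtain ⟨p, hp, hpc⟩ := hpt c
        exact ⟨p, hp, hpc.le⟩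
      · obtain ⟨p, hp, hpc⟩ := hpt c
        exact ⟨p, hp, hpc.ge⟩

theorem IsHeight.surj {F : P → ℝ} {A : VerticalPlane P} (hF : ∀ x, A.IsHeight F x)
    (hc : Continuous F) (x c : ℝ) : ∃ p, A.proj p = x ∧ F p = c := by
  obtain ⟨e, he, H⟩ := A.locally_trivial x
  have hcont : Continuous fun y : ℝ => F (e.toOpenPartialHomeomorph.symm (x, y)) := by
    refine hc.comp (e.toOpenPartialHomeomorph.continuousOn_symm.comp_continuous
      (by fun_prop) fun y => e.mem_target.2 he)
  have hpar : ∀ p, A.proj p = x → e.toOpenPartialHomeomorph.symm (x, (e p).2) = p := by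
    intro p hp
    have h1 : p ∈ e.source := e.mem_source.2 (by rwa [hp])
    have h2 : (x, (e p).2) = e p := Prod.ext ((e.coe_fst h1).trans hp).symm rfl
    rw [h2]; exact e.left_inv h1
  obtain ⟨p, hp, hpc⟩ := (hF x).exists_le c
  obtain ⟨q, hq, hqc⟩ := (hF x).exists_ge c
  obtain ⟨y, hy⟩ := mem_range_of_exists_le_of_exists_ge (c := c) hcont
    ⟨(e p).2, by rwa [hpar p hp]⟩ ⟨(e q).2, by rwa [hpar q hq]⟩
  exact ⟨_, e.proj_symm_apply (e.mem_target.2 he), hy⟩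

/-- A continuous height function on a vertical plane yields global coordinates. -/
theorem IsHeight.bijective {F : P → ℝ} {A : VerticalPlane P} (hF : ∀ x, A.IsHeight F x)
    (hc : Continuous F) : Function.Bijective fun p => (A.proj p, F p) := by
  constructor
  · intro p q h
    rw [Prod.mk.injEq] at h
    rcases below_trichotomy h.1 with h1 | h1 | h1
    · exact absurd h.2 ((hF _).lt_of_below p q rfl h1).ne
    · exact h1
    · exact absurd h.2.symm ((hF _).lt_of_below q p rfl h1).ne
  · rintro ⟨x, c⟩
    obtain ⟨p, hp, hpc⟩ := IsHeight.surj hF hc x c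
    exact ⟨p, Prod.ext hp hpc⟩

/-- Monotonicity on the fibres replaces invariance of domain: if `F q` lies between the values of
`F` at the levels `y₀ - ε` and `y₀ + ε` of a trivialization, then `q` lies between these levels. By
continuity of `F` the two bounds hold for all targets near `(proj p, F p)`. -/
theorem IsHeight.isOpenMap {F : P → ℝ} {A : VerticalPlane P} (hF : ∀ x, A.IsHeight F x)
    (hc : Continuous F) : IsOpenMap fun p => (A.proj p, F p) := by
  rw [isOpenMap_iff_nhds_le]
  intro p W hW
  rw [mem_map] at hW
  obtain ⟨e, he, H⟩ := A.locally_trivial (A.proj p)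
  have hs : p ∈ e.source := e.mem_source.2 he
  set g : ℝ × ℝ → P := fun z => e.toOpenPartialHomeomorph.symm z
  have hgc : ∀ z : ℝ × ℝ, z.1 ∈ e.baseSet → ContinuousAt g z := fun z hz =>
    e.toOpenPartialHomeomorph.continuousOn_symm.continuousAt
      (e.open_target.mem_nhds (e.mem_target.2 hz))
  have hgp : ∀ z : ℝ × ℝ, z.1 ∈ e.baseSet → A.proj (g z) = z.1 := fun z hz =>
    e.proj_symm_apply (e.mem_target.2 hz)
  have heg : ∀ z : ℝ × ℝ, z.1 ∈ e.baseSet → e (g z) = z := fun z hz =>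
    e.apply_symm_apply (e.mem_target.2 hz)
  have hge : ∀ q, A.proj q ∈ e.baseSet → g (A.proj q, (e q).2) = q := fun q hq => by
    have h1 : q ∈ e.source := e.mem_source.2 hq
    have h2 : (A.proj q, (e q).2) = e q := Prod.ext (e.coe_fst h1).symm rfl
    rw [h2]; exact e.left_inv h1
  have hW' : g ⁻¹' ((fun p => (A.proj p, F p)) ⁻¹' W) ∈ 𝓝 (A.proj p, (e p).2) := by
    refine (hgc _ he).preimage_mem_nhds ?_
    rwa [hge p he]
  obtain ⟨U, hU, V, hV, hUV⟩ := mem_nhds_prod_iff.1 hW'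
  obtain ⟨ε, hε, hεV⟩ := Metric.nhds_basis_closedBall.mem_iff.1 hV
  set y₀ := (e p).2
  have hb : ∀ y y' : ℝ, y < y' → ∀ x ∈ e.baseSet, F (g (x, y)) < F (g (x, y')) := by
    intro y y' hy x hx
    refine (hF x).lt_of_below _ _ (hgp _ hx) ((H _ _ (by rwa [hgp _ hx])).2 ⟨?_, ?_⟩)
    · rw [hgp _ hx, hgp _ hx]
    · rwa [heg _ hx, heg _ hx]
  have hlo : ∀ᶠ z : ℝ × ℝ in 𝓝 (A.proj p, F p), F (g (z.1, y₀ - ε)) < z.2 := by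
    have h1 : ContinuousAt (fun z : ℝ × ℝ => F (g (z.1, y₀ - ε))) (A.proj p, F p) :=
      hc.continuousAt.comp ((hgc (A.proj p, y₀ - ε) he).comp_of_eq (by fun_prop) rfl)
    refine h1.eventually_lt continuousAt_snd ?_
    have := hb (y₀ - ε) y₀ (by linarith) _ he
    rwa [hge p he] at this
  have hhi : ∀ᶠ z : ℝ × ℝ in 𝓝 (A.proj p, F p), z.2 < F (g (z.1, y₀ + ε)) := by
    have h1 : ContinuousAt (fun z : ℝ × ℝ => F (g (z.1, y₀ + ε))) (A.proj p, F p) :=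
      hc.continuousAt.comp ((hgc (A.proj p, y₀ + ε) he).comp_of_eq (by fun_prop) rfl)
    refine continuousAt_snd.eventually_lt h1 ?_
    have := hb y₀ (y₀ + ε) (by linarith) _ he
    rwa [hge p he] at this
  have hx : ∀ᶠ z : ℝ × ℝ in 𝓝 (A.proj p, F p), z.1 ∈ e.baseSet ∩ U :=
    continuousAt_fst.eventually (inter_mem (e.open_baseSet.mem_nhds he) hU)
  filter_upwards [hlo, hhi, hx] with z h1 h2 h3
  obtain ⟨q, hq⟩ := (IsHeight.bijective hF hc).2 z
  have hq1 : A.proj q = z.1 := congrArg Prod.fst hq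
  have hq2 : F q = z.2 := congrArg Prod.snd hq
  have hqe := hge q (by rw [hq1]; exact h3.1)
  rw [hq1] at hqe
  have hmem : (z.1, (e q).2) ∈ g ⁻¹' ((fun p => (A.proj p, F p)) ⁻¹' W) := by
    refine hUV ⟨h3.2, hεV ?_⟩
    rw [Real.closedBall_eq_Icc]
    constructor
    · by_contra hlt
      have := hb _ _ (not_le.1 hlt) z.1 h3.1
      rw [hqe, hq2] at this
      exact absurd this h1.not_gt
    · by_contra hlt
      have := hb _ _ (not_le.1 hlt) z.1 h3.1
      rw [hqe, hq2] at this
      exact absurd this h2.not_gt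
  simp only [mem_preimage, hqe] at hmem
  rwa [hq1, hq2] at hmem

/-- The coordinates given by a height function. -/
noncomputable def coordEquiv {F : P → ℝ} (hF : ∀ x, A.IsHeight F x) (hc : Continuous F) :
    VerticalEquiv A stdPlane where
  toHomeo := (Equiv.ofBijective _ (IsHeight.bijective hF hc)).toHomeomorphOfContinuousOpen
    (A.continuous_proj.prodMk hc) (IsHeight.isOpenMap hF hc)
  base := Homeomorph.refl ℝ
  base_strictMono := strictMono_id
  proj_comm _ := rfl
  below_iff p q := (IsHeight.below_iff hF p q).symm

theorem coordEquiv_apply {F : P → ℝ} (hF : ∀ x, A.IsHeight F x) (hc : Continuous F) (p : P) :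
    (A.coordEquiv hF hc).toHomeo p = (A.proj p, F p) := rfl

end VerticalPlane

/-! ### Vertical isotopies -/

namespace VerticalPlane

variable {P : Type*} [TopologicalSpace P] {A : VerticalPlane P}

/-- For `p` below `q`, the difference of heights of their images is positive at time `0` and never
vanishes, as each stage is injective and preserves the fibre. So the final stage preserves the
vertical order. With the converse below, isotopies can be inverted, composed and transported as
vertical equivalences. -/
theorem VerticallyIsotopic.exists_verticalEquiv {G G' : EnrichedGraph P}
    (h : A.VerticallyIsotopic G G') :
    ∃ Ψ : VerticalEquiv A A, (∀ p, A.proj (Ψ.toHomeo p) = A.proj p) ∧ G.map Ψ.toHomeo = G' := by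
  obtain ⟨Φ, hc, h0, hp, rfl⟩ := h
  obtain ⟨F, hF⟩ := A.exists_isHeight
  have key : ∀ p q, A.Below p q → A.Below (Φ 1 p) (Φ 1 q) := by
    intro p q hpq
    have hpos : 0 < F (Φ 0 q) - F (Φ 0 p) := by
      rw [h0, h0]
      exact sub_pos.2 ((hF _).lt_of_below p q rfl hpq)
    have hcont : Continuous fun t => F (Φ t q) - F (Φ t p) := by
      have h1 : ∀ r, Continuous fun t => Φ t r := fun r =>
        hc.comp (by fun_prop : Continuous fun t : unitInterval => (t, r))
      exact (F.continuous.comp (h1 q)).sub (F.continuous.comp (h1 p))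
    have hne : ∀ t, F (Φ t q) - F (Φ t p) ≠ 0 := by
      intro t ht
      have h2 : (A.proj (Φ t q), F (Φ t q)) = (A.proj (Φ t p), F (Φ t p)) :=
        Prod.ext (by simp [hp, hpq.proj_eq]) (sub_eq_zero.1 ht)
      have h3 := (Φ t).injective ((IsHeight.bijective hF F.continuous).1 h2)
      exact not_below_self p (h3 ▸ hpq)
    rw [IsHeight.below_iff hF]
    refine ⟨by simp [hp, hpq.proj_eq], sub_pos.1 ?_⟩
    by_contra hneg
    obtain ⟨t, ht⟩ := mem_range_of_exists_le_of_exists_ge (c := 0) hcont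
      ⟨1, not_lt.1 hneg⟩ ⟨0, hpos.le⟩
    exact hne t ht
  refine ⟨⟨Φ 1, Homeomorph.refl ℝ, strictMono_id, hp 1, fun p q => ⟨fun h => ?_, key p q⟩⟩,
    hp 1, rfl⟩
  have hpr : A.proj p = A.proj q := by rw [← hp 1 p, ← hp 1 q, h.proj_eq]
  rcases below_trichotomy hpr with h1 | rfl | h1
  · exact h1
  · exact absurd h (not_below_self _)
  · exact absurd (h.trans (key _ _ h1)) (not_below_self _)

/-- The functions `K t` on the segment from `F` to `F ∘ Ψ` are all heights. Following the
coordinates of `K t` by the inverse of those of `F` yields the isotopy: the identity for `t = 0` and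
`Ψ` for `t = 1`. -/
theorem verticallyIsotopic_of_verticalEquiv {G G' : EnrichedGraph P} (Ψ : VerticalEquiv A A)
    (hΨ : ∀ p, A.proj (Ψ.toHomeo p) = A.proj p) (h : G.map Ψ.toHomeo = G') :
    A.VerticallyIsotopic G G' := by
  obtain ⟨F, hF⟩ := A.exists_isHeight
  have := A.locallyCompactSpace
  let Θ := A.coordEquiv hF F.continuous
  have hF' : ∀ x, A.IsHeight (fun p => F (Ψ.toHomeo p)) x := by
    intro x
    have hs : ∀ q, A.proj q = x → A.proj (Ψ.toHomeo.symm q) = x := fun q hq => by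
      rw [← hΨ]; simpa using hq
    refine ⟨fun p q hp hpq => ?_, fun c => ?_, fun c => ?_⟩
    · exact (hF x).lt_of_below _ _ ((hΨ p).trans hp) ((Ψ.below_iff p q).2 hpq)
    · obtain ⟨q, hq, hqc⟩ := (hF x).exists_le c
      exact ⟨Ψ.toHomeo.symm q, hs q hq, by simpa using hqc⟩
    · obtain ⟨q, hq, hqc⟩ := (hF x).exists_ge c
      exact ⟨Ψ.toHomeo.symm q, hs q hq, by simpa using hqc⟩
  let F' : C(P, ℝ) := ⟨fun p => F (Ψ.toHomeo p), F.continuous.comp Ψ.toHomeo.continuous⟩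
  let K : unitInterval → C(P, ℝ) := fun t => (1 - (t : ℝ)) • F + (t : ℝ) • F'
  have hK : ∀ t x, A.IsHeight (K t) x := fun t x =>
    A.convex_isHeight x (hF x) (show A.IsHeight F' x from hF' x) (by linarith [t.2.2]) t.2.1 (by ring)
  have hKc : Continuous fun z : unitInterval × P => K z.1 z.2 := by
    change Continuous fun z : unitInterval × P =>
      (1 - (z.1 : ℝ)) * F z.2 + (z.1 : ℝ) * F (Ψ.toHomeo z.2)
    have h1 := F.continuous.comp (continuous_snd : Continuous (Prod.snd : unitInterval × P → P))
    have h2 := F.continuous.comp (Ψ.toHomeo.continuous.comp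
      (continuous_snd : Continuous (Prod.snd : unitInterval × P → P)))
    have h3 : Continuous fun z : unitInterval × P => (z.1 : ℝ) := by fun_prop
    exact ((continuous_const.sub h3).mul h1).add (h3.mul h2)
  refine ⟨fun t => (A.coordEquiv (hK t) (K t).continuous).toHomeo.trans Θ.toHomeo.symm,
    ?_, fun p => ?_, fun t p => ?_, ?_⟩
  · exact Θ.toHomeo.symm.continuous.comp
      ((A.continuous_proj.comp continuous_snd).prodMk hKc)
  · rw [Homeomorph.trans_apply, Homeomorph.symm_apply_eq, coordEquiv_apply, coordEquiv_apply]
    simp [K]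
  · have h1 := Θ.proj_comm (Θ.toHomeo.symm ((A.coordEquiv (hK t) (K t).continuous).toHomeo p))
    rw [Homeomorph.apply_symm_apply] at h1
    exact h1.symm
  · rw [← h]
    congr 1
    funext p
    rw [Homeomorph.trans_apply, Homeomorph.symm_apply_eq, coordEquiv_apply, coordEquiv_apply, hΨ]
    simp [K, F']

theorem VerticallyIsotopic.trans {G G' G'' : EnrichedGraph P} (h : A.VerticallyIsotopic G G')
    (h' : A.VerticallyIsotopic G' G'') : A.VerticallyIsotopic G G'' := by
  obtain ⟨Ψ, h1, rfl⟩ := h.exists_verticalEquiv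
  obtain ⟨Ψ', h2, rfl⟩ := h'.exists_verticalEquiv
  refine verticallyIsotopic_of_verticalEquiv (Ψ.trans Ψ') (fun p => ?_) ?_
  · exact (h2 _).trans (h1 p)
  · rw [EnrichedGraph.map_map]; rfl

theorem VerticallyIsotopic.symm {G G' : EnrichedGraph P} (h : A.VerticallyIsotopic G G') :
    A.VerticallyIsotopic G' G := by
  obtain ⟨Ψ, h1, rfl⟩ := h.exists_verticalEquiv
  refine verticallyIsotopic_of_verticalEquiv Ψ.symm (fun p => ?_) (Ψ.map_map_symm G)
  have := h1 (Ψ.symm.toHomeo p)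
  rw [← this]
  exact congrArg A.proj (Ψ.toHomeo.apply_symm_apply p)

theorem VerticallyIsotopic.map {P' : Type*} [TopologicalSpace P'] {A' : VerticalPlane P'}
    (Φ : VerticalEquiv A A') {G G' : EnrichedGraph P} (h : A.VerticallyIsotopic G G') :
    A'.VerticallyIsotopic (G.map Φ.toHomeo) (G'.map Φ.toHomeo) := by
  obtain ⟨Ψ, h1, rfl⟩ := h.exists_verticalEquiv
  refine verticallyIsotopic_of_verticalEquiv ((Φ.symm.trans Ψ).trans Φ) (fun p => ?_) ?_
  · obtain ⟨q, rfl⟩ := Φ.toHomeo.surjective p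
    have : ((Φ.symm.trans Ψ).trans Φ).toHomeo (Φ.toHomeo q) = Φ.toHomeo (Ψ.toHomeo q) :=
      congrArg (fun z => Φ.toHomeo (Ψ.toHomeo z)) (Φ.toHomeo.symm_apply_apply q)
    rw [this, Φ.proj_comm, Φ.proj_comm, h1]
  · rw [EnrichedGraph.map_map, EnrichedGraph.map_map]
    congr 1
    funext q
    exact congrArg (fun z => Φ.toHomeo (Ψ.toHomeo z)) (Φ.toHomeo.symm_apply_apply q)

end VerticalPlane

/-! ### Closed sets that are locally graphs of continuous functions -/

/-- `K` is a closed subset of the plane, bounded over the bounded subsets of the base, with finite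
fibres, that is locally the graph of a continuous function outside the finite set `V`. -/
structure GraphLike (K V : Set (ℝ × ℝ)) : Prop where
  closed : IsClosed K
  subset : V ⊆ K
  finite : V.Finite
  fib : ∀ x, {y | (x, y) ∈ K}.Finite
  bdd : ∀ x, ∃ R, ∀ᶠ x' in 𝓝 x, ∀ y, (x', y) ∈ K → |y| ≤ R
  loc : ∀ p ∈ K \ V, ∃ f : ℝ → ℝ, (∀ᶠ x in 𝓝 p.1, ContinuousAt f x) ∧
    ∀ᶠ q in 𝓝 p, (q ∈ K ↔ q.2 = f q.1)

/-- The graph of the continuous function `f` on the open interval `I` is contained in `K \ V`. -/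
structure IsSec (K V : Set (ℝ × ℝ)) (I : Set ℝ) (f : ℝ → ℝ) : Prop where
  isOpen : IsOpen I
  ordConnected : I.OrdConnected
  cont : ContinuousOn f I
  mem : ∀ x ∈ I, (x, f x) ∈ K \ V

/-- `E` is the graph of the continuous function `f` on the open interval `I`, and it converges to
points of `V` at the endpoints of `I`. -/
structure EdgeData (K V E : Set (ℝ × ℝ)) (I : Set ℝ) (f : ℝ → ℝ) : Prop
    extends IsSec K V I f where
  nonempty : I.Nonempty
  eq : E = {q | q.1 ∈ I ∧ q.2 = f q.1}
  ends : ∀ b ∈ closure I \ I, ∃ v ∈ V, v.1 = b ∧ Tendsto f (𝓝[I] b) (𝓝 v.2)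

/-- This is the tube lemma for the interval `[-R, R]`, which contains the neighbouring fibres of
`K`. It is the source of all uniform statements about nearby vertical lines. -/
theorem eventually_fibre_subset {K : Set (ℝ × ℝ)} (hK : IsClosed K) {x : ℝ}
    (hb : ∃ R, ∀ᶠ x' in 𝓝 x, ∀ y, (x', y) ∈ K → |y| ≤ R) {Q : ℝ × ℝ → Prop}
    (hW : ∀ y, (x, y) ∈ K → ∀ᶠ q in 𝓝 (x, y), Q q) :
    ∀ᶠ x' in 𝓝 x, ∀ y, (x', y) ∈ K → Q (x', y) := by
  obtain ⟨R, hR⟩ := hb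
  have h := (isCompact_Icc (a := -R) (b := R)).eventually_forall_of_forall_eventually
    (x₀ := x) (P := fun x y => (x, y) ∈ K → Q (x, y)) (by
      intro y _
      by_cases hy : (x, y) ∈ K
      · exact (hW y hy).mono fun z hz _ => hz
      · have hc : ∀ᶠ z in 𝓝 (x, y), z ∈ Kᶜ := hK.isOpen_compl.mem_nhds hy
        exact hc.mono fun z hz h => absurd h hz)
  filter_upwards [h, hR] with x' h1 h2 y hy
  exact h1 y (abs_le.1 (h2 y hy)) hy

namespace GraphLike

variable {K V : Set (ℝ × ℝ)} (h : GraphLike K V)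
include h

theorem exists_isSec {p : ℝ × ℝ} (hp : p ∈ K \ V) :
    ∃ I f, IsSec K V I f ∧ p.1 ∈ I ∧ f p.1 = p.2 ∧
      ∀ᶠ q in 𝓝 p, (q ∈ K ↔ q.2 = f q.1) ∧ q.1 ∈ I := by
  obtain ⟨f, hf, hl⟩ := h.loc p hp
  have hfp : f p.1 = p.2 := (hl.self_of_nhds.1 hp.1).symm
  have hc : Tendsto (fun x => (x, f x)) (𝓝 p.1) (𝓝 p) := by
    have h1 : ContinuousAt (fun x => (x, f x)) p.1 := continuousAt_id.prodMk hf.self_of_nhds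
    have h2 : (p.1, f p.1) = p := Prod.ext rfl hfp
    rw [ContinuousAt, h2] at h1; exact h1
  have hV : ∀ᶠ q in 𝓝 p, q ∉ V := h.finite.isClosed.isOpen_compl.mem_nhds hp.2
  have hall := hf.and ((hc.eventually hl).and (hc.eventually hV))
  obtain ⟨δ, hδ, hball⟩ := Metric.eventually_nhds_iff_ball.1 hall
  refine ⟨Metric.ball p.1 δ, f, ⟨Metric.isOpen_ball, ?_, fun x hx => ?_, fun x hx => ?_⟩,
    Metric.mem_ball_self hδ, hfp, ?_⟩
  · rw [Real.ball_eq_Ioo]; exact ordConnected_Ioo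
  · exact (hball x hx).1.continuousWithinAt
  · exact ⟨(hball x hx).2.1.2 rfl, (hball x hx).2.2⟩
  · filter_upwards [hl, continuousAt_fst.eventually (Metric.ball_mem_nhds p.1 hδ)] with q h1 h2
    exact ⟨h1, h2⟩

end GraphLike

namespace IsSec

variable {K V : Set (ℝ × ℝ)} {I J : Set ℝ} {f g : ℝ → ℝ}

theorem tendsto (hf : IsSec K V I f) {x : ℝ} (hx : x ∈ I) :
    Tendsto (fun x => (x, f x)) (𝓝 x) (𝓝 (x, f x)) :=
  continuousAt_id.prodMk (hf.cont.continuousAt (hf.isOpen.mem_nhds hx))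

/-- The coincidence set is closed by continuity, and open because near a point outside `V` the set
`K` is a single graph, on which both sections must lie. -/
theorem eqOn (h : GraphLike K V) (hf : IsSec K V I f) (hg : IsSec K V J g) {x₀ : ℝ}
    (hI : x₀ ∈ I) (hJ : x₀ ∈ J) (h0 : f x₀ = g x₀) : EqOn f g (I ∩ J) := by
  have hconn : IsPreconnected (I ∩ J) := (hf.ordConnected.inter hg.ordConnected).isPreconnected
  have hsub := hconn.subset_of_closure_inter_subset (u := {x | x ∈ I ∩ J ∧ f x = g x}) ?_
    ⟨x₀, ⟨hI, hJ⟩, ⟨hI, hJ⟩, h0⟩ ?_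
  · exact fun x hx => (hsub hx).2
  · rw [isOpen_iff_mem_nhds]
    rintro x ⟨⟨h1, h2⟩, h3⟩
    obtain ⟨k, -, hk⟩ := h.loc _ (hf.mem x h1)
    have hgt := hg.tendsto h2
    rw [← h3] at hgt
    filter_upwards [(hf.tendsto h1).eventually hk, hgt.eventually hk,
      hf.isOpen.mem_nhds h1, hg.isOpen.mem_nhds h2] with y h4 h5 h6 h7
    exact ⟨⟨h6, h7⟩, (h4.1 (hf.mem y h6).1).trans (h5.1 (hg.mem y h7).1).symm⟩
  · rintro x ⟨hx, h1, h2⟩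
    refine ⟨⟨h1, h2⟩, ?_⟩
    by_contra hne
    have hfx := hf.cont.continuousAt (hf.isOpen.mem_nhds h1)
    have hgx := hg.cont.continuousAt (hg.isOpen.mem_nhds h2)
    obtain ⟨y, hy, hy'⟩ := mem_closure_iff_nhds.1 hx _ ((hfx.ne_iff_eventually_ne hgx).1 hne)
    exact hy hy'.2

theorem union (h : GraphLike K V) (hf : IsSec K V I f) (hg : IsSec K V J g) {x₀ : ℝ}
    (hI : x₀ ∈ I) (hJ : x₀ ∈ J) (h0 : f x₀ = g x₀) :
    ∃ k, IsSec K V (I ∪ J) k ∧ EqOn k f I ∧ EqOn k g J := by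
  classical
  have he := hf.eqOn h hg hI hJ h0
  have h1 : EqOn (fun x => if x ∈ I then f x else g x) f I := fun x hx => if_pos hx
  have h2 : EqOn (fun x => if x ∈ I then f x else g x) g J := fun x hx => by
    by_cases hx' : x ∈ I
    · simp only [hx', if_true]; exact he ⟨hx', hx⟩
    · simp [hx']
  refine ⟨_, ⟨hf.isOpen.union hg.isOpen, ?_, ?_, ?_⟩, h1, h2⟩
  · exact (IsPreconnected.union x₀ hI hJ hf.ordConnected.isPreconnected
      hg.ordConnected.isPreconnected).ordConnected
  · exact (hf.cont.congr h1).union_of_isOpen (hg.cont.congr h2) hf.isOpen hg.isOpen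
  · rintro x (hx | hx)
    · have := hf.mem x hx
      rwa [← h1 hx] at this
    · have := hg.mem x hx
      rwa [← h2 hx] at this

end IsSec

namespace GraphLike

variable {K V : Set (ℝ × ℝ)} (h : GraphLike K V)
include h

/-- There is a maximal section through each point outside `V`. -/
theorem exists_maximal {p : ℝ × ℝ} (hp : p ∈ K \ V) :
    ∃ I f, IsSec K V I f ∧ p.1 ∈ I ∧ f p.1 = p.2 ∧
      ∀ J g, IsSec K V J g → ∀ x ∈ I, x ∈ J → f x = g x → J ⊆ I ∧ EqOn f g J := by
  classical
  -- All sections through `p`. They agree wherever two of them are defined, so they glue over the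
  -- union of their intervals.
  let S : Set (Set ℝ × (ℝ → ℝ)) := {z | IsSec K V z.1 z.2 ∧ p.1 ∈ z.1 ∧ z.2 p.1 = p.2}
  let I : Set ℝ := ⋃ z ∈ S, z.1
  have hI : ∀ x ∈ I, ∃ z ∈ S, x ∈ z.1 := fun x hx => by simpa [I] using hx
  let f : ℝ → ℝ := fun x => if hx : x ∈ I then (hI x hx).choose.2 x else 0
  have hf : ∀ z ∈ S, EqOn f z.2 z.1 := by
    intro z hz x hx
    have hxI : x ∈ I := mem_biUnion hz hx
    have hc := (hI x hxI).choose_spec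
    simp only [f, hxI, dif_pos]
    exact hc.1.1.eqOn h hz.1 hc.1.2.1 hz.2.1 (hc.1.2.2.trans hz.2.2.symm) ⟨hc.2, hx⟩
  obtain ⟨I₀, f₀, h1, h2, h3, -⟩ := h.exists_isSec hp
  have h0 : (I₀, f₀) ∈ S := ⟨h1, h2, h3⟩
  have hpI : p.1 ∈ I := mem_biUnion h0 h2
  have hsec : IsSec K V I f := by
    refine ⟨isOpen_biUnion fun z hz => hz.1.isOpen, ?_, ?_, ?_⟩
    · refine IsPreconnected.ordConnected ?_
      refine isPreconnected_of_forall p.1 fun x hx => ?_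
      obtain ⟨z, hz, hxz⟩ := hI x hx
      exact ⟨z.1, subset_biUnion_of_mem (u := fun z : Set ℝ × (ℝ → ℝ) => z.1) hz, hz.2.1, hxz,
        hz.1.ordConnected.isPreconnected⟩
    · intro x hx
      obtain ⟨z, hz, hxz⟩ := hI x hx
      have hn := hz.1.isOpen.mem_nhds hxz
      refine (((hz.1.cont.continuousAt hn).congr ?_).continuousWithinAt)
      filter_upwards [hn] with y hy using (hf z hz hy).symm
    · intro x hx
      obtain ⟨z, hz, hxz⟩ := hI x hx
      rw [hf z hz hxz]; exact hz.1.mem x hxz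
  have hfp : f p.1 = p.2 := (hf _ h0 h2).trans h3
  refine ⟨I, f, hsec, hpI, hfp, fun J g hg x hx hxJ hxe => ?_⟩
  obtain ⟨k, hk, hk1, hk2⟩ := hsec.union h hg hx hxJ hxe
  have hkS : (I ∪ J, k) ∈ S := ⟨hk, Or.inl hpI, (hk1 hpI).trans hfp⟩
  refine ⟨fun y hy => mem_biUnion hkS (Or.inr hy), fun y hy => ?_⟩
  exact (hf _ hkS (Or.inr hy)).trans (hk2 hy)

/-- The open edges of a graph-like set are graphs over open intervals. -/
theorem exists_edgeData {p : ℝ × ℝ} (hp : p ∈ K \ V) :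
    ∃ I f, EdgeData K V (connectedComponentIn (K \ V) p) I f := by
  obtain ⟨I, f, hsec, hpI, hfp, hmax⟩ := h.exists_maximal hp
  refine ⟨I, f, hsec, ⟨_, hpI⟩, Subset.antisymm ?_ ?_, ?_⟩
  · have hpc : p ∈ connectedComponentIn (K \ V) p := mem_connectedComponentIn hp
    intro q hq
    -- Lying on the maximal section is a locally constant property in `K \ V`: a local section
    -- through `a` that touches the maximal one at a single abscissa is contained in it.
    refine ((isPreconnected_connectedComponentIn (F := K \ V) (x := p)).induction₂'
      (fun a b => (a.1 ∈ I ∧ a.2 = f a.1) → (b.1 ∈ I ∧ b.2 = f b.1)) ?_ ?_ hpc hq)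
      ⟨hpI, hfp.symm⟩
    · intro a ha
      have haK := connectedComponentIn_subset _ _ ha
      obtain ⟨J, g, hg, haJ, hga, hl⟩ := h.exists_isSec haK
      filter_upwards [mem_nhdsWithin_of_mem_nhds hl, self_mem_nhdsWithin] with b hb hbc
      have hbg := hb.1.1 (connectedComponentIn_subset _ _ hbc).1
      constructor
      · rintro ⟨h1, h2⟩
        obtain ⟨h3, h4⟩ := hmax J g hg a.1 h1 haJ (h2.symm.trans hga.symm)
        exact ⟨h3 hb.2, hbg.trans (h4 hb.2).symm⟩
      · rintro ⟨h1, h2⟩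
        obtain ⟨h3, h4⟩ := hmax J g hg b.1 h1 hb.2 (h2.symm.trans hbg)
        exact ⟨h3 haJ, hga.symm.trans (h4 haJ).symm⟩
    · exact fun a b c _ _ _ h1 h2 h3 => h2 (h1 h3)
  · have himg : {q : ℝ × ℝ | q.1 ∈ I ∧ q.2 = f q.1} = (fun x => (x, f x)) '' I := by
      ext ⟨x, y⟩; simp only [mem_image, mem_ofPred_eq, Prod.mk.injEq]
      constructor
      · rintro ⟨h1, h2⟩; exact ⟨x, h1, rfl, h2.symm⟩
      · rintro ⟨x', h1, rfl, rfl⟩; exact ⟨h1, rfl⟩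
    have hpre : IsPreconnected {q : ℝ × ℝ | q.1 ∈ I ∧ q.2 = f q.1} := by
      rw [himg]
      exact hsec.ordConnected.isPreconnected.image _ (continuousOn_id.prodMk hsec.cont)
    refine hpre.subset_connectedComponentIn ⟨hpI, hfp.symm⟩ ?_
    rintro ⟨x, y⟩ ⟨h1, h2⟩
    simp only at h1 h2; subst h2
    exact hsec.mem x h1
  · rintro b ⟨hbc, hbI⟩
    -- the limit at an endpoint exists as the fibre is finite
    obtain ⟨ε, hε, hsep⟩ : ∃ ε > 0, ∀ y ∈ {y | (b, y) ∈ K}, ∀ z ∈ {y | (b, y) ∈ K},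
        y ≠ z → 2 * ε ≤ |y - z| := by
      by_cases hsub : ({y | (b, y) ∈ K} : Set ℝ).Subsingleton
      · exact ⟨1, one_pos, fun y hy z hz hne => absurd (hsub hy hz) hne⟩
      · have hpos := ((h.fib b).infsep_pos_iff_nontrivial).2 (not_subsingleton_iff.1 hsub)
        refine ⟨_, half_pos hpos, fun y hy z hz hne => ?_⟩
        have := infsep_le_dist_of_mem (s := {y | (b, y) ∈ K}) hy hz hne
        rw [Real.dist_eq] at this; linarith
    have hnear : ∀ η > 0, ∀ᶠ x in 𝓝 b, ∀ y, (x, y) ∈ K → ∃ z, (b, z) ∈ K ∧ |y - z| < η := by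
      intro η hη
      refine eventually_fibre_subset h.closed (h.bdd b)
        (Q := fun q => ∃ z, (b, z) ∈ K ∧ |q.2 - z| < η) fun z hz => ?_
      have : Tendsto (fun q : ℝ × ℝ => |q.2 - z|) (𝓝 (b, z)) (𝓝 |z - z|) :=
        Continuous.tendsto (by fun_prop : Continuous fun q : ℝ × ℝ => |q.2 - z|) (b, z)
      rw [sub_self, abs_zero] at this
      exact (this.eventually_lt_const hη).mono fun q hq => ⟨z, hz, hq⟩
    obtain ⟨δ, hδ, hball⟩ := Metric.eventually_nhds_iff_ball.1 (hnear ε hε)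
    have hJ : IsPreconnected (I ∩ Metric.ball b δ) := by
      rw [Real.ball_eq_Ioo]
      exact (hsec.ordConnected.inter ordConnected_Ioo).isPreconnected
    obtain ⟨x₁, hx₁I, hx₁b⟩ : (I ∩ Metric.ball b δ).Nonempty := by
      obtain ⟨x, hx⟩ := mem_closure_iff_nhds.1 hbc _ (Metric.ball_mem_nhds b hδ)
      exact ⟨x, hx.2, hx.1⟩
    obtain ⟨z, hz, hxz⟩ := hball x₁ hx₁b _ (hsec.mem _ hx₁I).1
    -- Near `b` each value of `f` is within `ε` of a point of the fibre over `b`, and distinct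
    -- points of that fibre are at least `2 * ε` apart. On a connected set `f` therefore stays close
    -- to one of them.
    have hstay : f '' (I ∩ Metric.ball b δ) ⊆ {y | |y - z| < ε} := by
      refine (hJ.image f (hsec.cont.mono inter_subset_left)).subset_left_of_subset_union
        (v := {y | ε < |y - z|}) (isOpen_lt (by fun_prop) continuous_const)
        (isOpen_lt continuous_const (by fun_prop)) ?_ ?_ ⟨f x₁, ⟨x₁, ⟨hx₁I, hx₁b⟩, rfl⟩, hxz⟩
      · exact disjoint_left.2 fun y hy hy' => by
          rw [mem_ofPred_eq] at hy hy'; exact lt_asymm hy hy'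
      · rintro _ ⟨x, ⟨hxI, hxb⟩, rfl⟩
        obtain ⟨w, hw, hxw⟩ := hball x hxb _ (hsec.mem _ hxI).1
        by_cases hwz : w = z
        · left; rwa [hwz] at hxw
        · right
          have h1 := hsep w hw z hz hwz
          have h2 := abs_sub_abs_le_abs_sub (w - z) (w - f x)
          have h3 : w - z - (w - f x) = f x - z := by ring
          rw [h3, abs_sub_comm w (f x)] at h2
          simp only [mem_ofPred_eq]; linarith
    have hlim : Tendsto f (𝓝[I] b) (𝓝 z) := by
      rw [Metric.tendsto_nhds]
      intro η hη
      filter_upwards [mem_nhdsWithin_of_mem_nhds (hnear (min η ε) (lt_min hη hε)),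
        mem_nhdsWithin_of_mem_nhds (Metric.ball_mem_nhds b hδ), self_mem_nhdsWithin]
        with x h1 h2 h3
      obtain ⟨w, hw, hxw⟩ := h1 _ (hsec.mem _ h3).1
      have h4 : |f x - z| < ε := hstay ⟨x, ⟨h3, h2⟩, rfl⟩
      obtain rfl : w = z := by
        by_contra hne
        have h5 := hsep w hw z hz hne
        have h6 := abs_sub_abs_le_abs_sub (w - z) (w - f x)
        have h7 : w - z - (w - f x) = f x - z := by ring
        rw [h7, abs_sub_comm w (f x)] at h6
        have := hxw.trans_le (min_le_right _ _)
        linarith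
      rw [Real.dist_eq]
      exact hxw.trans_le (min_le_left _ _)
    refine ⟨(b, z), ?_, rfl, hlim⟩
    -- Otherwise a local section through the limit point would extend the maximal section past its
    -- endpoint `b`.
    by_contra hV
    obtain ⟨J, g, hg, hbJ, hgb, hl⟩ := h.exists_isSec (p := (b, z)) ⟨hz, hV⟩
    have hne : (𝓝[I] b).NeBot := mem_closure_iff_nhdsWithin_neBot.1 hbc
    have hpt : Tendsto (fun x => (x, f x)) (𝓝[I] b) (𝓝 (b, z)) :=
      (tendsto_id.mono_left nhdsWithin_le_nhds).prodMk_nhds hlim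
    obtain ⟨x, hx1, hx2⟩ := ((hpt.eventually hl).and self_mem_nhdsWithin).exists
    exact hbI ((hmax J g hg x hx2 hx1.2 (hx1.1.1 (hsec.mem x hx2).1)).1 hbJ)

end GraphLike

/-! ### Edges of graph-like sets -/

theorem isProperMap_domRestrict_fst {K : Set (ℝ × ℝ)} (hK : IsClosed K)
    (hb : ∀ x, ∃ R, ∀ᶠ x' in 𝓝 x, ∀ y, (x', y) ∈ K → |y| ≤ R) :
    IsProperMap (K.domRestrict (Prod.fst : ℝ × ℝ → ℝ)) := by
  rw [isProperMap_iff_isCompact_preimage]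
  refine ⟨continuous_fst.comp continuous_subtype_val, fun C hC => ?_⟩
  rw [Subtype.isCompact_iff]
  have himg : Subtype.val '' (K.domRestrict (Prod.fst : ℝ × ℝ → ℝ) ⁻¹' C) =
      K ∩ Prod.fst ⁻¹' C := by
    ext q
    constructor
    · rintro ⟨⟨q, hq⟩, h, rfl⟩; exact ⟨hq, h⟩
    · rintro ⟨hq, h⟩; exact ⟨⟨q, hq⟩, h, rfl⟩
  rw [himg]
  obtain ⟨R, hR⟩ : ∃ R, ∀ x ∈ C, ∀ y, (x, y) ∈ K → |y| ≤ R := by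
    refine hC.induction_on (p := fun S => ∃ R, ∀ x ∈ S, ∀ y, (x, y) ∈ K → |y| ≤ R)
      ⟨0, by simp⟩ ?_ ?_ ?_
    · rintro s t hst ⟨R, hR⟩; exact ⟨R, fun x hx => hR x (hst hx)⟩
    · rintro s t ⟨R, hR⟩ ⟨R', hR'⟩
      refine ⟨max R R', ?_⟩
      rintro x (hx | hx) y hy
      · exact (hR x hx y hy).trans (le_max_left _ _)
      · exact (hR' x hx y hy).trans (le_max_right _ _)
    · intro x _
      obtain ⟨R, hR⟩ := hb x
      exact ⟨_, mem_nhdsWithin_of_mem_nhds hR, R, fun x hx => hx⟩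
  refine (hC.prod (isCompact_Icc (a := -R) (b := R))).of_isClosed_subset
    (hK.inter (hC.isClosed.preimage continuous_fst)) ?_
  rintro ⟨x, y⟩ ⟨h1, h2⟩
  exact ⟨h2, abs_le.1 (hR x h2 y h1)⟩

theorem exists_bound_of_isProperMap {K : Set (ℝ × ℝ)}
    (hK : IsProperMap (K.domRestrict (Prod.fst : ℝ × ℝ → ℝ))) (x : ℝ) :
    ∃ R, ∀ᶠ x' in 𝓝 x, ∀ y, (x', y) ∈ K → |y| ≤ R := by
  have h1 := (hK.isCompact_preimage (isCompact_closedBall x 1)).image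
    (continuous_snd.comp continuous_subtype_val)
  obtain ⟨R, hR⟩ := h1.isBounded.exists_norm_le
  refine ⟨R, ?_⟩
  filter_upwards [Metric.closedBall_mem_nhds x one_pos] with x' hx' y hy
  exact hR y ⟨⟨(x', y), hy⟩, hx', rfl⟩

/-! ### Rays and one-sided neighbourhoods in the two horizontal directions -/

namespace Side

/-- The open ray issued from `a` in the direction `s`. -/
def ray (s : Side) (a : ℝ) : Set ℝ := {x | s.Past a x}

theorem isOpen_ray (s : Side) (a : ℝ) : IsOpen (s.ray a) := by
  cases s
  · exact isOpen_Iio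
  · exact isOpen_Ioi

theorem ordConnected_ray (s : Side) (a : ℝ) : (s.ray a).OrdConnected := by
  cases s
  · exact ordConnected_Iio
  · exact ordConnected_Ioi

instance (s : Side) (a : ℝ) : (𝓝[s.ray a] a).NeBot := by
  cases s
  · exact nhdsLT_neBot a
  · exact nhdsGT_neBot a

instance (s : Side) : s.atInf.NeBot := by
  cases s
  · exact atBot_neBot
  · exact atTop_neBot

theorem past_irrefl (s : Side) (a : ℝ) : ¬ s.Past a a := by cases s <;> exact lt_irrefl _

theorem Past.trans {s : Side} {a b c : ℝ} (h : s.Past a b) (h' : s.Past b c) : s.Past a c := by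
  cases s
  · exact lt_trans (α := ℝ) h' h
  · exact lt_trans (α := ℝ) h h'

theorem past_trichotomy (s : Side) (a b : ℝ) : s.Past a b ∨ a = b ∨ s.flip.Past a b := by
  cases s
  · rcases lt_trichotomy a b with h | h | h
    exacts [Or.inr (Or.inr h), Or.inr (Or.inl h), Or.inl h]
  · rcases lt_trichotomy a b with h | h | h
    exacts [Or.inl h, Or.inr (Or.inl h), Or.inr (Or.inr h)]

theorem flip_past {s : Side} {a b : ℝ} : s.flip.Past a b ↔ s.Past b a := by cases s <;> rfl

theorem ray_mem_atInf (s : Side) (a : ℝ) : s.ray a ∈ s.atInf := by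
  cases s
  · exact Iio_mem_atBot a
  · exact Ioi_mem_atTop a

/-- The closed ray issued from `a` in the direction `s`. -/
def cray (s : Side) (a : ℝ) : Set ℝ := {x | a = x ∨ s.Past a x}

theorem ordConnected_cray (s : Side) (a : ℝ) : (s.cray a).OrdConnected := by
  cases s
  · have : Side.left.cray a = Iic a := by
      ext x; exact (or_congr eq_comm Iff.rfl).trans le_iff_eq_or_lt.symm
    rw [this]; exact ordConnected_Iic
  · have : Side.right.cray a = Ici a := by
      ext x; exact le_iff_eq_or_lt.symm
    rw [this]; exact ordConnected_Ici

theorem self_mem_cray (s : Side) (a : ℝ) : a ∈ s.cray a := Or.inl rfl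

theorem cray_mem_atInf (s : Side) (a : ℝ) : s.cray a ∈ s.atInf :=
  mem_of_superset (s.ray_mem_atInf a) fun _ h => Or.inr h

theorem eventually_ray_subset {s : Side} {a : ℝ} {I : Set ℝ} (hI : I.OrdConnected)
    (ha : a ∈ closure I) (hs : I ⊆ s.ray a) : ∀ᶠ x in 𝓝[s.ray a] a, x ∈ I := by
  have hne : I.Nonempty := closure_nonempty_iff.1 ⟨a, ha⟩
  obtain ⟨b, hb⟩ := hne
  cases s
  · have hba : b < a := hs hb
    filter_upwards [Ioo_mem_nhdsLT hba] with x hx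
    obtain ⟨c, hc1, hc2⟩ := mem_closure_iff_nhds.1 ha _ (Ioi_mem_nhds hx.2)
    exact hI.out hb hc2 ⟨hx.1.le, le_of_lt hc1⟩
  · have hba : a < b := hs hb
    filter_upwards [Ioo_mem_nhdsGT hba] with x hx
    obtain ⟨c, hc1, hc2⟩ := mem_closure_iff_nhds.1 ha _ (Iio_mem_nhds hx.1)
    exact hI.out hc2 hb ⟨le_of_lt hc1, hx.2.le⟩

theorem subset_ray {a : ℝ} {I : Set ℝ} (hI : I.OrdConnected) (ha : a ∉ I) {s : Side} {b : ℝ}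
    (hb : b ∈ I) (hab : s.Past a b) : I ⊆ s.ray a := by
  intro x hx
  rcases s.past_trichotomy a x with h | rfl | h
  · exact h
  · exact absurd hx ha
  · cases s
    · exact absurd (hI.out hb hx ⟨le_of_lt (α := ℝ) hab, le_of_lt (α := ℝ) h⟩) ha
    · exact absurd (hI.out hx hb ⟨le_of_lt (α := ℝ) h, le_of_lt (α := ℝ) hab⟩) ha

end Side

/-! ### Open intervals, and edges as graphs over them -/

theorem isOpen_ordConnected_cases {I : Set ℝ} (ho : IsOpen I) (hc : I.OrdConnected)
    (hne : I.Nonempty) :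
    (∃ a b, a < b ∧ I = Ioo a b) ∨ (∃ a, I = Ioi a) ∨ (∃ b, I = Iio b) ∨ I = univ := by
  have hioo : I = Ioo (sInf I) (sSup I) →
      (∃ a b, a < b ∧ I = Ioo a b) ∨ (∃ a, I = Ioi a) ∨ (∃ b, I = Iio b) ∨ I = univ := fun h =>
    Or.inl ⟨_, _, nonempty_Ioo.1 (h ▸ hne), h⟩
  rcases hc.isPreconnected.mem_intervals with h | h | h | h | h | h | h | h | h | h
  · exact hioo (by conv_lhs => rw [← ho.interior_eq, h, interior_Icc])
  · exact hioo (by conv_lhs => rw [← ho.interior_eq, h, interior_Ico])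
  · exact hioo (by conv_lhs => rw [← ho.interior_eq, h, interior_Ioc])
  · exact hioo h
  · exact Or.inr (Or.inl ⟨sInf I, by conv_lhs => rw [← ho.interior_eq, h, interior_Ici]⟩)
  · exact Or.inr (Or.inl ⟨_, h⟩)
  · exact Or.inr (Or.inr (Or.inl ⟨sSup I, by conv_lhs => rw [← ho.interior_eq, h, interior_Iic]⟩))
  · exact Or.inr (Or.inr (Or.inl ⟨_, h⟩))
  · exact Or.inr (Or.inr (Or.inr h))
  · exact absurd h hne.ne_empty

namespace EdgeData

variable {K V E K' V' F : Set (ℝ × ℝ)} {I J : Set ℝ} {f g : ℝ → ℝ}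

theorem mem_iff (hE : EdgeData K V E I f) {q : ℝ × ℝ} : q ∈ E ↔ q.1 ∈ I ∧ q.2 = f q.1 := by
  rw [hE.eq]; rfl

theorem mk_mem (hE : EdgeData K V E I f) {x : ℝ} (hx : x ∈ I) : (x, f x) ∈ E :=
  hE.mem_iff.2 ⟨hx, rfl⟩

theorem subset (hE : EdgeData K V E I f) : E ⊆ K \ V := by
  rintro ⟨x, y⟩ hq
  obtain ⟨h1, h2⟩ := hE.mem_iff.1 hq
  simp only at h1 h2; subst h2
  exact hE.mem x h1

theorem image_fst (hE : EdgeData K V E I f) : Prod.fst '' E = I := by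
  ext x
  constructor
  · rintro ⟨q, hq, rfl⟩; exact (hE.mem_iff.1 hq).1
  · exact fun hx => ⟨_, hE.mk_mem hx, rfl⟩

/-- Over an abscissa in `I`, continuity of `f` would put the limit point on the edge itself. So the
abscissa is an endpoint of `I`, where `f` has a single limit, which is in `V`. -/
theorem mem_closure (hE : EdgeData K V E I f) {q : ℝ × ℝ} (hq : q ∈ closure E) (hqE : q ∉ E) :
    q ∈ V ∧ q.1 ∈ closure I \ I ∧ Tendsto f (𝓝[I] q.1) (𝓝 q.2) := by
  have hne : (𝓝[E] q).NeBot := mem_closure_iff_nhdsWithin_neBot.1 hq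
  have h1 : Tendsto Prod.fst (𝓝[E] q) (𝓝[I] q.1) :=
    tendsto_nhdsWithin_iff.2 ⟨continuousAt_fst.mono_left nhdsWithin_le_nhds,
      eventually_mem_nhdsWithin.mono fun z hz => (hE.mem_iff.1 hz).1⟩
  have h2 : Tendsto (fun z : ℝ × ℝ => f z.1) (𝓝[E] q) (𝓝 q.2) := by
    have : Tendsto Prod.snd (𝓝[E] q) (𝓝 q.2) := continuousAt_snd.mono_left nhdsWithin_le_nhds
    exact this.congr' (eventually_mem_nhdsWithin.mono fun z hz => (hE.mem_iff.1 hz).2)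
  have hcl : q.1 ∈ closure I := mem_closure_iff_nhdsWithin_neBot.2 (h1.neBot)
  have hI : q.1 ∉ I := by
    intro hI
    have h3 := (hE.cont q.1 hI).tendsto.comp h1
    exact hqE (hE.mem_iff.2 ⟨hI, tendsto_nhds_unique h2 h3⟩)
  obtain ⟨v, hv, hv1, hv2⟩ := hE.ends q.1 ⟨hcl, hI⟩
  have h4 := tendsto_nhds_unique h2 (hv2.comp h1)
  have : q = v := Prod.ext hv1.symm h4
  exact ⟨this ▸ hv, ⟨hcl, hI⟩, h4 ▸ hv2⟩

theorem injOn_closure (hE : EdgeData K V E I f) : InjOn Prod.fst (closure E) := by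
  intro q hq q' hq' h
  by_cases h1 : q ∈ E <;> by_cases h2 : q' ∈ E
  · exact Prod.ext h (by rw [(hE.mem_iff.1 h1).2, (hE.mem_iff.1 h2).2, h])
  · exact absurd (h ▸ (hE.mem_iff.1 h1).1) (hE.mem_closure hq' h2).2.1.2
  · exact absurd (h ▸ (hE.mem_iff.1 h2).1) (hE.mem_closure hq h1).2.1.2
  · obtain ⟨-, h3, h4⟩ := hE.mem_closure hq h1
    obtain ⟨-, h5, h6⟩ := hE.mem_closure hq' h2
    have : (𝓝[I] q.1).NeBot := mem_closure_iff_nhdsWithin_neBot.1 h3.1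
    rw [← h] at h6
    exact Prod.ext h (tendsto_nhds_unique h4 h6)

/-- An edge can stop only at a point of `V`, so a connected set of abscissas that avoids those of
`V` cannot leave `I`. -/
theorem subset_of_isPreconnected (hE : EdgeData K V E I f) {S : Set ℝ} (hS : IsPreconnected S)
    {x : ℝ} (hxS : x ∈ S) (hxI : x ∈ I) (hV : ∀ v ∈ V, v.1 ∉ S) : S ⊆ I := by
  refine hS.subset_of_closure_inter_subset hE.isOpen ⟨x, hxS, hxI⟩ ?_
  rintro b ⟨hb, hbS⟩
  by_contra hbI
  obtain ⟨v, hv, rfl, -⟩ := hE.ends b ⟨hb, hbI⟩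
  exact hV v hv hbS

end EdgeData

/-- The real number `x` is beyond all the points of `V` in the direction `s`. -/
def Beyond (V : Set (ℝ × ℝ)) (s : Side) (x : ℝ) : Prop := ∀ v ∈ V, s.Past v.1 x

theorem exists_beyond {V : Set (ℝ × ℝ)} (hV : V.Finite) (s : Side) : ∃ x, Beyond V s x := by
  have : ∀ᶠ x in s.atInf, ∀ v ∈ V, s.Past v.1 x :=
    (hV.eventually_all).2 fun v _ => s.ray_mem_atInf v.1
  exact this.exists

theorem Beyond.notMem_cray {V : Set (ℝ × ℝ)} {s : Side} {x : ℝ} (h : Beyond V s x) :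
    ∀ v ∈ V, v.1 ∉ s.cray x := by
  rintro v hv (h' | h')
  · exact s.past_irrefl x (by have := h v hv; rwa [← h'] at this)
  · exact s.past_irrefl _ ((h v hv).trans h')

namespace EdgeData

variable {K V E K' V' F : Set (ℝ × ℝ)} {I J : Set ℝ} {f g : ℝ → ℝ} {s : Side} {x₁ : ℝ}

theorem cray_subset (hE : EdgeData K V E I f) (hx : Beyond V s x₁) {x : ℝ} (hxI : x ∈ I)
    (hxs : x ∈ s.cray x₁) : s.cray x₁ ⊆ I :=
  hE.subset_of_isPreconnected (s.ordConnected_cray x₁).isPreconnected hxs hxI hx.notMem_cray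

/-- Disjoint curves do not change their order. -/
theorem lt_of_disjoint (hE : EdgeData K V E I f) (hF : EdgeData K' V' F J g) (hd : Disjoint E F)
    {S : Set ℝ} (hS : IsPreconnected S) (hSI : S ⊆ I) (hSJ : S ⊆ J) {x y : ℝ} (hx : x ∈ S)
    (hy : y ∈ S) (h : f x < g x) : f y < g y := by
  have hne : ∀ z ∈ S, f z ≠ g z := fun z hz he =>
    disjoint_left.1 hd (hE.mk_mem (hSI hz)) (he ▸ hF.mk_mem (hSJ hz))
  by_contra hlt
  obtain ⟨z, hz, hz'⟩ := hS.intermediate_value₂ hx hy (hE.cont.mono hSI) (hF.cont.mono hSJ) h.le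
    (not_lt.1 hlt)
  exact hne z hz hz'

/-- Both edges extend over the whole ray from `x₁`, and disjoint curves keep their order there. So
the order near infinity is the order on the single line over `x₁`. -/
theorem belowAlong_atInf (hE : EdgeData K V E I f) (hF : EdgeData K' V' F J g)
    (hd : Disjoint E F) (hx : Beyond V s x₁) (hx' : Beyond V' s x₁) (hI : x₁ ∈ I) (hJ : x₁ ∈ J) :
    stdPlane.BelowAlong s.atInf E F ↔ f x₁ < g x₁ := by
  have hSI := hE.cray_subset hx hI (s.self_mem_cray x₁)
  have hSJ := hF.cray_subset hx' hJ (s.self_mem_cray x₁)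
  have hS := (s.ordConnected_cray x₁).isPreconnected
  constructor
  · intro h
    obtain ⟨x, hx1, hx2⟩ := (h.and (s.cray_mem_atInf x₁)).exists
    exact hE.lt_of_disjoint hF hd hS hSI hSJ hx2 (s.self_mem_cray x₁)
      (hx1 _ (hE.mk_mem (hSI hx2)) _ (hF.mk_mem (hSJ hx2)) rfl rfl).2
  · intro h
    filter_upwards [s.cray_mem_atInf x₁] with x hx p hp q hq hpx hqx
    have := hE.lt_of_disjoint hF hd hS hSI hSJ (s.self_mem_cray x₁) hx h
    simp only [stdPlane_proj] at hpx hqx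
    refine ⟨hqx.trans hpx.symm, ?_⟩
    rwa [(hE.mem_iff.1 hp).2, (hF.mem_iff.1 hq).2, hpx, hqx]

end EdgeData

/-! ### Open edges, and transversal graphs as graph-like sets -/

namespace EnrichedGraph

variable {P : Type*} [TopologicalSpace P] {G : EnrichedGraph P}

theorem openEdges_eq_of_mem {E F : Set P} (hE : E ∈ G.openEdges) (hF : F ∈ G.openEdges) {q : P}
    (hqE : q ∈ E) (hqF : q ∈ F) : E = F := by
  obtain ⟨p, hp, rfl⟩ := hE
  obtain ⟨p', hp', rfl⟩ := hF
  rw [connectedComponentIn_eq hqE, connectedComponentIn_eq hqF]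

theorem subset_of_mem_openEdges {E : Set P} (hE : E ∈ G.openEdges) :
    E ⊆ G.carrier \ G.vertices := by
  obtain ⟨p, hp, rfl⟩ := hE
  exact connectedComponentIn_subset _ _

theorem exists_mem_openEdges {q : P} (hq : q ∈ G.carrier \ G.vertices) :
    ∃ E ∈ G.openEdges, q ∈ E :=
  ⟨_, ⟨q, hq, rfl⟩, mem_connectedComponentIn hq⟩

theorem disjoint_openEdges {E F : Set P} (hE : E ∈ G.openEdges) (hF : F ∈ G.openEdges)
    (h : E ≠ F) : Disjoint E F :=
  disjoint_left.2 fun _ h1 h2 => h (openEdges_eq_of_mem hE hF h1 h2)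

end EnrichedGraph

namespace GraphLike

variable {G : EnrichedGraph (ℝ × ℝ)} (h : GraphLike G.carrier G.vertices)
include h

theorem exists_edgeData' {E : Set (ℝ × ℝ)} (hE : E ∈ G.openEdges) :
    ∃ I f, EdgeData G.carrier G.vertices E I f := by
  obtain ⟨p, hp, rfl⟩ := hE
  exact h.exists_edgeData hp

theorem finite_openEdges : G.openEdges.Finite := by
  -- every edge meets one of finitely many vertical lines
  let X : Set ℝ := Prod.fst '' G.vertices
  have hX : X.Finite := h.finite.image _
  -- Test abscissas for the possible domains of an edge: `0` for the whole line, `a - 1` and `a + 1`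
  -- for half-lines ending at `a`, and midpoints for bounded intervals; the endpoints are abscissas
  -- of vertices.
  let T : Set ℝ := {0} ∪ ((fun a => a - 1) '' X ∪ ((fun a => a + 1) '' X ∪
    (fun z : ℝ × ℝ => (z.1 + z.2) / 2) '' (X ×ˢ X)))
  have hT : T.Finite := (finite_singleton 0).union ((hX.image _).union ((hX.image _).union
    ((hX.prod hX).image _)))
  have hfin : (⋃ t ∈ T, (fun y => connectedComponentIn (G.carrier \ G.vertices) (t, y)) ''
      {y | (t, y) ∈ G.carrier}).Finite := hT.biUnion fun t _ => (h.fib t).image _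
  refine hfin.subset fun E hE => ?_
  obtain ⟨I, f, hd⟩ := h.exists_edgeData' hE
  obtain ⟨t, htT, htI⟩ : ∃ t ∈ T, t ∈ I := by
    have hend : ∀ b ∈ closure I, b ∉ I → b ∈ X := fun b hb hb' => by
      obtain ⟨v, hv, rfl, -⟩ := hd.ends b ⟨hb, hb'⟩; exact ⟨v, hv, rfl⟩
    rcases isOpen_ordConnected_cases hd.isOpen hd.ordConnected hd.nonempty with
      ⟨a, b, hab, rfl⟩ | ⟨a, rfl⟩ | ⟨b, rfl⟩ | rfl
    · rw [closure_Ioo hab.ne] at hend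
      refine ⟨(a + b) / 2, Or.inr (Or.inr (Or.inr ⟨(a, b), ⟨hend a ⟨le_rfl, hab.le⟩ ?_,
        hend b ⟨hab.le, le_rfl⟩ ?_⟩, rfl⟩)), ?_, ?_⟩
      · simp
      · simp
      · linarith
      · linarith
    · rw [closure_Ioi] at hend
      exact ⟨a + 1, Or.inr (Or.inr (Or.inl ⟨a, hend a self_mem_Ici self_notMem_Ioi, rfl⟩)),
        lt_add_one a⟩
    · rw [closure_Iio] at hend
      exact ⟨b - 1, Or.inr (Or.inl ⟨b, hend b self_mem_Iic self_notMem_Iio, rfl⟩), sub_one_lt b⟩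
    · exact ⟨0, Or.inl rfl, mem_univ _⟩
  refine mem_biUnion htT ⟨f t, (hd.mem t htI).1, ?_⟩
  exact EnrichedGraph.openEdges_eq_of_mem ⟨_, hd.mem t htI, rfl⟩ hE
    (mem_connectedComponentIn (hd.mem t htI)) (hd.mk_mem htI)

end GraphLike

theorem nonempty_homeomorph_real {I : Set ℝ} (ho : IsOpen I) (hc : I.OrdConnected)
    (hne : I.Nonempty) : Nonempty (I ≃ₜ ℝ) := by
  have himg : ∀ (e : ℝ ≃ₜ ℝ) (J : Set ℝ), e '' J = I → Nonempty (J ≃ₜ ℝ) → Nonempty (I ≃ₜ ℝ) := by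
    rintro e J rfl ⟨k⟩
    exact ⟨(e.image J).symm.trans k⟩
  have hIoi : Nonempty (Ioi (0 : ℝ) ≃ₜ ℝ) := ⟨Real.expOrderIso.symm.toHomeomorph⟩
  rcases isOpen_ordConnected_cases ho hc hne with ⟨a, b, hab, rfl⟩ | ⟨a, rfl⟩ | ⟨b, rfl⟩ | rfl
  · have hr : 0 < (b - a) / 2 := by linarith
    let e := OpenPartialHomeomorph.univBall ((a + b) / 2) ((b - a) / 2)
    have ht : e.target = Ioo a b := by
      rw [OpenPartialHomeomorph.univBall_target _ hr, Real.ball_eq_Ioo]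
      congr 1 <;> ring
    have hs : e.source = univ := OpenPartialHomeomorph.univBall_source _ _
    exact ⟨(Homeomorph.setCongr ht).symm.trans (e.toHomeomorphSourceTarget.symm.trans
      ((Homeomorph.setCongr hs).trans (Homeomorph.Set.univ ℝ)))⟩
  · exact himg (Homeomorph.addRight a) (Ioi 0) (by simp) hIoi
  · refine himg (Homeomorph.subLeft b) (Ioi 0) (by simp) hIoi
  · exact ⟨Homeomorph.Set.univ ℝ⟩

namespace GraphLike

variable {G : EnrichedGraph (ℝ × ℝ)} (h : GraphLike G.carrier G.vertices)
include h

theorem closure_subset {E : Set (ℝ × ℝ)} (hE : E ∈ G.openEdges) : closure E ⊆ G.carrier :=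
  closure_minimal ((EnrichedGraph.subset_of_mem_openEdges hE).trans sdiff_subset) h.closed

/-- The closure of an edge projects injectively and properly, hence by a closed embedding, and all
the conditions on edges follow. Together with the converse below, transversality and the local
description by graphs can be exchanged freely. -/
theorem isTransversalGraph (hu : G.up ⊆ stdPlane.arrowEdges G)
    (hd : G.down ⊆ stdPlane.arrowEdges G) : stdPlane.IsTransversalGraph G := by
  have hemb : ∀ E ∈ G.openEdges, IsClosedEmbedding ((closure E).domRestrict stdPlane.proj) := by
    intro E hE
    obtain ⟨I, f, hI⟩ := h.exists_edgeData' hE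
    refine IsClosedEmbedding.of_continuous_injective_isClosedMap
      (continuous_fst.comp continuous_subtype_val) (injOn_iff_injective.1 hI.injOn_closure) ?_
    refine (isProperMap_domRestrict_fst isClosed_closure fun x => ?_).isClosedMap
    obtain ⟨R, hR⟩ := h.bdd x
    exact ⟨R, hR.mono fun x' hx' y hy => hx' y (h.closure_subset hE hy)⟩
  refine ⟨h.closed, h.subset, h.finite, h.finite_openEdges, fun E hE => ?_, fun E hE => ?_,
    fun E hE => ?_, fun E hE => (hemb E hE).isEmbedding, isProperMap_domRestrict_fst h.closed h.bdd,
    hu, hd⟩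
  · obtain ⟨I, f, hI⟩ := h.exists_edgeData' hE
    obtain ⟨k⟩ := nonempty_homeomorph_real hI.isOpen hI.ordConnected hI.nonempty
    have h1 : IsEmbedding (E.domRestrict (Prod.fst : ℝ × ℝ → ℝ)) :=
      (hemb E hE).isEmbedding.comp (IsEmbedding.inclusion subset_closure)
    have h2 : range (E.domRestrict (Prod.fst : ℝ × ℝ → ℝ)) = I := by
      rw [range_domRestrict, hI.image_fst]
    exact ⟨h1.toHomeomorph.trans ((Homeomorph.setCongr h2).trans k)⟩
  · refine ⟨range ((closure E).domRestrict stdPlane.proj), (hemb E hE).isClosed_range, ?_,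
      ⟨(hemb E hE).isEmbedding.toHomeomorph⟩⟩
    obtain ⟨p, hp, rfl⟩ := hE
    rw [range_domRestrict]
    exact (isPreconnected_connectedComponentIn.closure.image _
      continuous_fst.continuousOn).ordConnected
  · obtain ⟨I, f, hI⟩ := h.exists_edgeData' hE
    exact fun q hq => (hI.mem_closure hq.1 hq.2).1

end GraphLike

/-- Transversal graphs are graph-like. -/
theorem VerticalPlane.IsTransversalGraph.graphLike {G : EnrichedGraph (ℝ × ℝ)}
    (h : stdPlane.IsTransversalGraph G) : GraphLike G.carrier G.vertices where
  closed := h.closed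
  subset := h.vertices_subset
  finite := h.vertices_finite
  bdd := exists_bound_of_isProperMap h.proper
  fib x := by
    have hV : {y | (x, y) ∈ G.vertices}.Finite :=
      h.vertices_finite.preimage (f := fun y : ℝ => (x, y)) (by simp [InjOn])
    refine (hV.union (h.edges_finite.biUnion (t := fun E => {y | (x, y) ∈ E})
      fun E hE => ?_)).subset ?_
    · refine Subsingleton.finite fun y hy z hz => ?_
      have := (h.transversal E hE).injective (a₁ := ⟨(x, y), subset_closure hy⟩)
        (a₂ := ⟨(x, z), subset_closure hz⟩) rfl
      simpa using this
    · intro y hy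
      by_cases hyV : (x, y) ∈ G.vertices
      · exact Or.inl hyV
      · obtain ⟨E, hE, hyE⟩ := EnrichedGraph.exists_mem_openEdges ⟨hy, hyV⟩
        exact Or.inr (mem_biUnion hE hyE)
  loc p hp := by
    obtain ⟨E, hE, hpE⟩ := EnrichedGraph.exists_mem_openEdges hp
    obtain ⟨e⟩ := h.open_edge E hE
    have hemb : IsEmbedding (E.domRestrict (Prod.fst : ℝ × ℝ → ℝ)) :=
      (h.transversal E hE).comp (IsEmbedding.inclusion subset_closure)
    let u : ℝ → ℝ := fun t => (e.symm t : ℝ × ℝ).1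
    have hu : Continuous u := continuous_fst.comp (continuous_subtype_val.comp e.symm.continuous)
    have hinj : Function.Injective u := hemb.injective.comp e.symm.injective
    -- A continuous injective function on `ℝ` is strictly monotone, so the intermediate value
    -- theorem makes its range open.
    have hran : IsOpen (range u) := by
      rw [isOpen_iff_mem_nhds]
      rintro _ ⟨t, rfl⟩
      have hsub : ∀ a b, uIcc (u a) (u b) ⊆ range u := fun a b =>
        (intermediate_value_uIcc hu.continuousOn).trans (image_subset_range _ _)
      rcases hu.strictMono_of_inj hinj with hm | hm
      · exact mem_of_superset (Ioo_mem_nhds (hm (sub_one_lt t)) (hm (lt_add_one t)))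
          (Ioo_subset_Icc_self.trans (Icc_subset_uIcc.trans (hsub _ _)))
      · exact mem_of_superset (Ioo_mem_nhds (hm (lt_add_one t)) (hm (sub_one_lt t)))
          (Ioo_subset_Icc_self.trans (Icc_subset_uIcc.trans (hsub _ _)))
    have hran' : range (E.domRestrict (Prod.fst : ℝ × ℝ → ℝ)) = range u := by
      refine Subset.antisymm ?_ ?_
      · rintro _ ⟨q, rfl⟩; exact ⟨e q, by simp [u, domRestrict]⟩
      · rintro _ ⟨t, rfl⟩; exact ⟨e.symm t, rfl⟩
    classical
    let k := hemb.toHomeomorph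
    let f : ℝ → ℝ := fun x => if hx : x ∈ range (E.domRestrict (Prod.fst : ℝ × ℝ → ℝ)) then
      (k.symm ⟨x, hx⟩ : ℝ × ℝ).2 else 0
    have hfE : ∀ q ∈ E, q.2 = f q.1 := by
      intro q hq
      have hx : q.1 ∈ range (E.domRestrict (Prod.fst : ℝ × ℝ → ℝ)) := ⟨⟨q, hq⟩, rfl⟩
      have : k ⟨q, hq⟩ = ⟨q.1, hx⟩ := rfl
      simp only [f, hx, dif_pos, ← this, Homeomorph.symm_apply_apply]
    have hEf : ∀ x ∈ range u, (x, f x) ∈ E := by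
      rintro _ ⟨t, rfl⟩
      have : ((u t), f (u t)) = (e.symm t : ℝ × ℝ) := Prod.ext rfl (hfE _ (e.symm t).2).symm
      rw [this]; exact (e.symm t).2
    have hfc : ContinuousOn f (range u) := by
      rw [← hran', continuousOn_iff_continuous_domRestrict]
      have : (range (E.domRestrict (Prod.fst : ℝ × ℝ → ℝ))).domRestrict f =
          fun x => (k.symm x : ℝ × ℝ).2 := by
        ext ⟨x, hx⟩
        simp only [domRestrict, f, hx, dif_pos]
      rw [this]
      exact continuous_snd.comp (continuous_subtype_val.comp k.symm.continuous)
    have hpu : p.1 ∈ range u := hran' ▸ ⟨⟨p, hpE⟩, rfl⟩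
    refine ⟨f, ?_, ?_⟩
    · filter_upwards [hran.mem_nhds hpu] with x hx using hfc.continuousAt (hran.mem_nhds hx)
    -- The other edges stay away from `p`: there are finitely many of them, and their closures add
    -- only vertices.
    · have h1 : ∀ᶠ q in 𝓝 p, ∀ F ∈ G.openEdges, F ≠ E → q ∉ F := by
        refine (h.edges_finite.eventually_all).2 fun F hF => ?_
        by_cases hFE : F = E
        · exact Eventually.of_forall fun q hq => absurd hFE hq
        · have hpF : p ∉ closure F := fun hc => by
            by_cases hpF : p ∈ F
            · exact hFE (EnrichedGraph.openEdges_eq_of_mem hF hE hpF hpE)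
            · exact hp.2 (h.ends F hF ⟨hc, hpF⟩)
          have h2 : ∀ᶠ q in 𝓝 p, q ∈ (closure F)ᶜ := isClosed_closure.isOpen_compl.mem_nhds hpF
          exact h2.mono fun q hq _ hqF => hq (subset_closure hqF)
      have h3 : ∀ᶠ q in 𝓝 p, q ∉ G.vertices :=
        h.vertices_finite.isClosed.isOpen_compl.mem_nhds hp.2
      filter_upwards [h1, h3, continuousAt_fst.eventually (hran.mem_nhds hpu)] with q h4 h5 h6
      constructor
      · intro hq
        obtain ⟨F, hF, hqF⟩ := EnrichedGraph.exists_mem_openEdges ⟨hq, h5⟩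
        by_cases hFE : F = E
        · subst hFE; exact hfE q hqF
        · exact absurd hqF (h4 F hF hFE)
      · intro hq
        have : q = (q.1, f q.1) := Prod.ext rfl hq
        rw [this]
        exact (EnrichedGraph.subset_of_mem_openEdges hE (hEf _ h6)).1

/-! ### Arrows and branches at a vertex -/

/-- The arrow rule, read on a vertical line beyond the vertices. -/
def FibreRule (G H : EnrichedGraph (ℝ × ℝ)) (x : ℝ) : Prop :=
  ∀ E ∈ G.openEdges, ∀ y, (x, y) ∈ E →
    (E ∉ G.up → ∃ y', (x, y') ∈ H.carrier ∧ y < y' ∧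
      ∀ z, (x, z) ∈ G.carrier ∪ H.carrier → ¬ (y < z ∧ z < y')) ∧
    (E ∈ G.up → ∀ z, (x, z) ∈ G.carrier ∪ H.carrier → ¬ y < z) ∧
    (E ∉ G.down → ∃ y', (x, y') ∈ H.carrier ∧ y' < y ∧
      ∀ z, (x, z) ∈ G.carrier ∪ H.carrier → ¬ (y' < z ∧ z < y)) ∧
    (E ∈ G.down → ∀ z, (x, z) ∈ G.carrier ∪ H.carrier → ¬ z < y)

namespace GraphLike

variable {G H : EnrichedGraph (ℝ × ℝ)} {s : Side} {x₁ : ℝ}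

/-- Beyond the vertices nothing can stop an edge, so it goes to infinity in the direction `s`
exactly if it meets the line over `x₁`. -/
theorem mem_arrows_iff (h : GraphLike G.carrier G.vertices) (hx : Beyond G.vertices s x₁)
    {E : Set (ℝ × ℝ)} (hE : E ∈ G.openEdges) :
    E ∈ stdPlane.arrows G s ↔ ∃ y, (x₁, y) ∈ E := by
  obtain ⟨I, f, hI⟩ := h.exists_edgeData' hE
  have h1 : (∃ y, (x₁, y) ∈ E) ↔ x₁ ∈ I :=
    ⟨fun ⟨y, hy⟩ => (hI.mem_iff.1 hy).1, fun hx => ⟨_, hI.mk_mem hx⟩⟩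
  have h2 : E ∈ stdPlane.arrows G s ↔ ∃ᶠ x in s.atInf, x ∈ I := by
    simp only [VerticalPlane.arrows, mem_ofPred_eq, hE, true_and, stdPlane_proj, hI.image_fst]
  rw [h1, h2]
  constructor
  · intro hf
    obtain ⟨x, hx1, hx2⟩ := (hf.and_eventually (s.cray_mem_atInf x₁)).exists
    exact hI.cray_subset hx hx1 hx2 (s.self_mem_cray x₁)
  · intro hx1
    have := hI.cray_subset hx hx1 (s.self_mem_cray x₁)
    have h3 : ∀ᶠ x in s.atInf, x ∈ I := mem_of_superset (s.cray_mem_atInf x₁) this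
    exact h3.frequently

theorem exists_arrow (h : GraphLike G.carrier G.vertices) (hx : Beyond G.vertices s x₁) {y : ℝ}
    (hy : (x₁, y) ∈ G.carrier) : ∃ E ∈ stdPlane.arrows G s, (x₁, y) ∈ E := by
  have hV : (x₁, y) ∉ G.vertices := fun hV => s.past_irrefl x₁ (hx _ hV)
  obtain ⟨E, hE, hyE⟩ := EnrichedGraph.exists_mem_openEdges ⟨hy, hV⟩
  exact ⟨E, (h.mem_arrows_iff hx hE).2 ⟨y, hyE⟩, hyE⟩

theorem belowAlong_atInf_iff (hG : GraphLike G.carrier G.vertices)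
    (hH : GraphLike H.carrier H.vertices) (hx : Beyond G.vertices s x₁)
    (hx' : Beyond H.vertices s x₁) {E F : Set (ℝ × ℝ)} (hE : E ∈ G.openEdges)
    (hF : F ∈ H.openEdges) (hEF : E = F ∨ Disjoint E F) {y z : ℝ} (hy : (x₁, y) ∈ E)
    (hz : (x₁, z) ∈ F) : stdPlane.BelowAlong s.atInf E F ↔ y < z := by
  obtain ⟨I, f, hI⟩ := hG.exists_edgeData' hE
  obtain ⟨J, g, hJ⟩ := hH.exists_edgeData' hF
  obtain ⟨hy1, hy2⟩ := hI.mem_iff.1 hy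
  obtain ⟨hz1, hz2⟩ := hJ.mem_iff.1 hz
  simp only at hy1 hy2 hz1 hz2
  rcases hEF with rfl | hd
  · have h1 : y = z := by
      have := hI.mem_iff.1 hz
      rw [hy2]; exact this.2.symm
    subst h1
    simp only [lt_irrefl, iff_false]
    intro hb
    have hS := hI.cray_subset hx hy1 (s.self_mem_cray x₁)
    obtain ⟨x, hx1, hx2⟩ := (hb.and (s.cray_mem_atInf x₁)).exists
    exact lt_irrefl _ (hx1 _ (hI.mk_mem (hS hx2)) _ (hI.mk_mem (hS hx2)) rfl rfl).2
  · rw [hI.belowAlong_atInf hJ hd hx hx' hy1 hz1, hy2, hz2]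

/-- On a line beyond all the vertices each arrow is seen as one point, each point of the fibre lies
on one arrow, and the order near infinity is the order of these points. The arrow rule thus becomes
a statement about a finite set of real numbers. -/
theorem arrowRule_iff (hG : GraphLike G.carrier G.vertices) (hH : GraphLike H.carrier H.vertices)
    (hx : Beyond G.vertices s x₁) (hx' : Beyond H.vertices s x₁)
    (hint : G.carrier ∩ H.carrier ⊆ G.vertices) :
    stdPlane.ArrowRule G H s ↔ FibreRule G H x₁ := by
  have hdis : ∀ E ∈ G.openEdges, ∀ F ∈ H.openEdges, Disjoint E F := fun E hE F hF =>
    disjoint_left.2 fun q h1 h2 => (EnrichedGraph.subset_of_mem_openEdges hE h1).2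
      (hint ⟨(EnrichedGraph.subset_of_mem_openEdges hE h1).1,
        (EnrichedGraph.subset_of_mem_openEdges hF h2).1⟩)
  have hGG : ∀ E ∈ G.openEdges, ∀ F ∈ G.openEdges, E = F ∨ Disjoint E F := fun E hE F hF =>
    or_iff_not_imp_left.2 (EnrichedGraph.disjoint_openEdges hE hF)
  have hHH : ∀ E ∈ H.openEdges, ∀ F ∈ H.openEdges, E = F ∨ Disjoint E F := fun E hE F hF =>
    or_iff_not_imp_left.2 (EnrichedGraph.disjoint_openEdges hE hF)
  have hord : ∀ E ∈ stdPlane.arrows G s ∪ stdPlane.arrows H s,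
      ∀ F ∈ stdPlane.arrows G s ∪ stdPlane.arrows H s, ∀ y z, (x₁, y) ∈ E → (x₁, z) ∈ F →
      (stdPlane.BelowAlong s.atInf E F ↔ y < z) := by
    rintro E (hE | hE) F (hF | hF) y z hy hz
    · exact belowAlong_atInf_iff hG hG hx hx hE.1 hF.1 (hGG E hE.1 F hF.1) hy hz
    · exact belowAlong_atInf_iff hG hH hx hx' hE.1 hF.1 (Or.inr (hdis E hE.1 F hF.1)) hy hz
    · exact belowAlong_atInf_iff hH hG hx' hx hE.1 hF.1 (Or.inr (hdis F hF.1 E hE.1).symm) hy hz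
    · exact belowAlong_atInf_iff hH hH hx' hx' hE.1 hF.1 (hHH E hE.1 F hF.1) hy hz
  have hpt : ∀ E ∈ stdPlane.arrows G s ∪ stdPlane.arrows H s,
      ∃ z, (x₁, z) ∈ E ∧ (x₁, z) ∈ G.carrier ∪ H.carrier := by
    rintro E (hE | hE)
    · obtain ⟨z, hz⟩ := (hG.mem_arrows_iff hx hE.1).1 hE
      exact ⟨z, hz, Or.inl (EnrichedGraph.subset_of_mem_openEdges hE.1 hz).1⟩
    · obtain ⟨z, hz⟩ := (hH.mem_arrows_iff hx' hE.1).1 hE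
      exact ⟨z, hz, Or.inr (EnrichedGraph.subset_of_mem_openEdges hE.1 hz).1⟩
  have har : ∀ z, (x₁, z) ∈ G.carrier ∪ H.carrier →
      ∃ K ∈ stdPlane.arrows G s ∪ stdPlane.arrows H s, (x₁, z) ∈ K := by
    rintro z (hz | hz)
    · obtain ⟨K, hK, hzK⟩ := hG.exists_arrow hx hz
      exact ⟨K, Or.inl hK, hzK⟩
    · obtain ⟨K, hK, hzK⟩ := hH.exists_arrow hx' hz
      exact ⟨K, Or.inr hK, hzK⟩
  constructor
  · intro hA E hE y hy
    have hEa := (hG.mem_arrows_iff hx hE).2 ⟨y, hy⟩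
    obtain ⟨h1, h2, h3, h4⟩ := hA E hEa
    refine ⟨fun hu => ?_, fun hu z hz hlt => ?_, fun hu => ?_, fun hu z hz hlt => ?_⟩
    · obtain ⟨F, hF, hEF, hn⟩ := h1 hu
      obtain ⟨y', hy'⟩ := (hH.mem_arrows_iff hx' hF.1).1 hF
      refine ⟨y', (EnrichedGraph.subset_of_mem_openEdges hF.1 hy').1,
        (hord E (Or.inl hEa) F (Or.inr hF) y y' hy hy').1 hEF, fun z hz hlt => ?_⟩
      obtain ⟨K, hK, hzK⟩ := har z hz
      exact hn K hK ⟨(hord E (Or.inl hEa) K hK y z hy hzK).2 hlt.1,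
        (hord K hK F (Or.inr hF) z y' hzK hy').2 hlt.2⟩
    · obtain ⟨K, hK, hzK⟩ := har z hz
      exact h2 hu K hK ((hord E (Or.inl hEa) K hK y z hy hzK).2 hlt)
    · obtain ⟨F, hF, hEF, hn⟩ := h3 hu
      obtain ⟨y', hy'⟩ := (hH.mem_arrows_iff hx' hF.1).1 hF
      refine ⟨y', (EnrichedGraph.subset_of_mem_openEdges hF.1 hy').1,
        (hord F (Or.inr hF) E (Or.inl hEa) y' y hy' hy).1 hEF, fun z hz hlt => ?_⟩
      obtain ⟨K, hK, hzK⟩ := har z hz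
      exact hn K hK ⟨(hord F (Or.inr hF) K hK y' z hy' hzK).2 hlt.1,
        (hord K hK E (Or.inl hEa) z y hzK hy).2 hlt.2⟩
    · obtain ⟨K, hK, hzK⟩ := har z hz
      exact h4 hu K hK ((hord K hK E (Or.inl hEa) z y hzK hy).2 hlt)
  · intro hA E hEa
    obtain ⟨y, hy⟩ := (hG.mem_arrows_iff hx hEa.1).1 hEa
    obtain ⟨h1, h2, h3, h4⟩ := hA E hEa.1 y hy
    refine ⟨fun hu => ?_, fun hu K hK hb => ?_, fun hu => ?_, fun hu K hK hb => ?_⟩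
    · obtain ⟨y', hy', hlt, hn⟩ := h1 hu
      obtain ⟨F, hF, hyF⟩ := hH.exists_arrow hx' hy'
      refine ⟨F, hF, (hord E (Or.inl hEa) F (Or.inr hF) y y' hy hyF).2 hlt, fun K hK hb => ?_⟩
      obtain ⟨z, hzK, hz⟩ := hpt K hK
      exact hn z hz ⟨(hord E (Or.inl hEa) K hK y z hy hzK).1 hb.1,
        (hord K hK F (Or.inr hF) z y' hzK hyF).1 hb.2⟩
    · obtain ⟨z, hzK, hz⟩ := hpt K hK
      exact h2 hu z hz ((hord E (Or.inl hEa) K hK y z hy hzK).1 hb)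
    · obtain ⟨y', hy', hlt, hn⟩ := h3 hu
      obtain ⟨F, hF, hyF⟩ := hH.exists_arrow hx' hy'
      refine ⟨F, hF, (hord F (Or.inr hF) E (Or.inl hEa) y' y hyF hy).2 hlt, fun K hK hb => ?_⟩
      obtain ⟨z, hzK, hz⟩ := hpt K hK
      exact hn z hz ⟨(hord F (Or.inr hF) K hK y' z hyF hzK).1 hb.1,
        (hord K hK E (Or.inl hEa) z y hzK hy).1 hb.2⟩
    · obtain ⟨z, hzK, hz⟩ := hpt K hK
      exact h4 hu z hz ((hord K hK E (Or.inl hEa) z y hzK hy).1 hb)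

/-! ### Branches at a vertex -/

theorem exists_edgeData_of_mem_edgesFrom (h : GraphLike G.carrier G.vertices) {v : ℝ × ℝ}
    {E : Set (ℝ × ℝ)} (hE : E ∈ stdPlane.edgesFrom G s v) :
    ∃ I f, EdgeData G.carrier G.vertices E I f ∧ I ⊆ s.ray v.1 ∧
      (∀ᶠ x in 𝓝[s.ray v.1] v.1, x ∈ I) ∧ Tendsto f (𝓝[s.ray v.1] v.1) (𝓝 v.2) := by
  obtain ⟨hE, hvE, hpast⟩ := hE
  obtain ⟨I, f, hI⟩ := h.exists_edgeData' hE
  have hIr : I ⊆ s.ray v.1 := fun x hx => hpast _ (hI.mk_mem hx)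
  have hv : v ∉ E := fun hv => s.past_irrefl _ (hpast v hv)
  obtain ⟨-, h2, h3⟩ := hI.mem_closure hvE hv
  have h4 := Side.eventually_ray_subset hI.ordConnected h2.1 hIr
  exact ⟨I, f, hI, hIr, h4, h3.mono_left (nhdsWithin_le_of_mem h4)⟩

/-- The graph of `g` over a small one-sided interval is connected and avoids the vertices, so it
lies in a single edge, and this edge starts from `v`. -/
theorem exists_mem_edgesFrom (h : GraphLike G.carrier G.vertices) {v : ℝ × ℝ}
    (hv : v ∈ G.vertices) {g : ℝ → ℝ} (hc : ∀ᶠ x in 𝓝[s.ray v.1] v.1, ContinuousAt g x)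
    (hK : ∀ᶠ x in 𝓝[s.ray v.1] v.1, (x, g x) ∈ G.carrier \ G.vertices)
    (hg : Tendsto g (𝓝[s.ray v.1] v.1) (𝓝 v.2)) :
    ∃ E ∈ stdPlane.edgesFrom G s v, ∀ᶠ x in 𝓝[s.ray v.1] v.1, (x, g x) ∈ E := by
  obtain ⟨δ, hδ, hball⟩ := Metric.eventually_nhds_iff_ball.1
    (eventually_nhdsWithin_iff.1 (hc.and hK))
  set J : Set ℝ := s.ray v.1 ∩ Metric.ball v.1 δ with hJ
  have hJn : J ∈ 𝓝[s.ray v.1] v.1 := inter_mem self_mem_nhdsWithin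
    (mem_nhdsWithin_of_mem_nhds (Metric.ball_mem_nhds _ hδ))
  have hJo : J.OrdConnected := by
    rw [hJ, Real.ball_eq_Ioo]; exact (s.ordConnected_ray _).inter ordConnected_Ioo
  obtain ⟨x₀, hx₀⟩ : J.Nonempty := (eventually_mem_set.2 hJn).exists
  have hpre : IsPreconnected ((fun x => (x, g x)) '' J) :=
    hJo.isPreconnected.image _ (continuousOn_id.prodMk fun x hx =>
      (hball x hx.2 hx.1).1.continuousWithinAt)
  have hsub := hpre.subset_connectedComponentIn (mem_image_of_mem _ hx₀)
    (F := G.carrier \ G.vertices) (by rintro _ ⟨x, hx, rfl⟩; exact (hball x hx.2 hx.1).2)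
  have hE : connectedComponentIn (G.carrier \ G.vertices) (x₀, g x₀) ∈ G.openEdges :=
    ⟨_, (hball x₀ hx₀.2 hx₀.1).2, rfl⟩
  set E := connectedComponentIn (G.carrier \ G.vertices) (x₀, g x₀)
  have hlim : ∀ᶠ x in 𝓝[s.ray v.1] v.1, (x, g x) ∈ E :=
    mem_of_superset hJn fun x hx => hsub (mem_image_of_mem _ hx)
  have hpt : Tendsto (fun x => (x, g x)) (𝓝[s.ray v.1] v.1) (𝓝 v) :=
    (tendsto_id.mono_left nhdsWithin_le_nhds).prodMk_nhds hg
  refine ⟨E, ⟨hE, mem_closure_of_tendsto hpt hlim, ?_⟩, hlim⟩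
  obtain ⟨I, f, hI⟩ := h.exists_edgeData' hE
  -- If the edge continued over `v.1`, its point there would be the limit of `g`, that is the vertex
  -- `v`.
  have hvI : v.1 ∉ I := by
    intro hvI
    have h1 : Tendsto f (𝓝[s.ray v.1] v.1) (𝓝 (f v.1)) :=
      (hI.cont.continuousAt (hI.isOpen.mem_nhds hvI)).mono_left nhdsWithin_le_nhds
    have h2 : Tendsto g (𝓝[s.ray v.1] v.1) (𝓝 (f v.1)) :=
      h1.congr' (hlim.mono fun x hx => (hI.mem_iff.1 hx).2.symm)
    have h3 : (v.1, f v.1) = v := Prod.ext rfl (tendsto_nhds_unique h2 hg)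
    exact (hI.mem v.1 hvI).2 (h3 ▸ hv)
  have h0 : x₀ ∈ I := (hI.mem_iff.1 (hsub (mem_image_of_mem _ hx₀))).1
  intro p hp
  exact Side.subset_ray hI.ordConnected hvI h0 hx₀.1 (hI.mem_iff.1 hp).1

end GraphLike

/-- In the direction `s` near `v`, the set `K` is the union of the graphs of the functions `g i`,
which tend to `v`. -/
structure HasBranches {ι : Type*} (K : Set (ℝ × ℝ)) (s : Side) (v : ℝ × ℝ) (g : ι → ℝ → ℝ) :
    Prop where
  cont : ∀ i, ∀ᶠ x in 𝓝[s.ray v.1] v.1, ContinuousAt (g i) x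
  lim : ∀ i, Tendsto (g i) (𝓝[s.ray v.1] v.1) (𝓝 v.2)
  mem_iff : ∀ᶠ q in 𝓝 v, s.Past v.1 q.1 → (q ∈ K ↔ ∃ i, q.2 = g i q.1)

theorem tendsto_mk_of_tendsto {s : Side} {v : ℝ × ℝ} {g : ℝ → ℝ}
    (hg : Tendsto g (𝓝[s.ray v.1] v.1) (𝓝 v.2)) :
    Tendsto (fun x => (x, g x)) (𝓝[s.ray v.1] v.1) (𝓝 v) :=
  (tendsto_id.mono_left nhdsWithin_le_nhds).prodMk_nhds hg

theorem eventually_notMem_of_finite {V : Set (ℝ × ℝ)} (hV : V.Finite) {s : Side} {v : ℝ × ℝ}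
    {g : ℝ → ℝ} (hg : Tendsto g (𝓝[s.ray v.1] v.1) (𝓝 v.2)) :
    ∀ᶠ x in 𝓝[s.ray v.1] v.1, (x, g x) ∉ V := by
  have h1 : ∀ᶠ q in 𝓝 v, q ∉ V \ {v} :=
    (hV.subset sdiff_subset).isClosed.isOpen_compl.mem_nhds fun h => h.2 rfl
  filter_upwards [(tendsto_mk_of_tendsto hg).eventually h1, self_mem_nhdsWithin] with x h2 h3 h4
  refine h2 ⟨h4, fun h5 => s.past_irrefl v.1 ?_⟩
  have : x = v.1 := congrArg Prod.fst h5
  exact this ▸ h3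

/-- This turns a local picture of the carrier into the list of edges at `v`. The family `e` need not
be injective: in a trident the two edges on one side are separated by their order with respect to
the single edge. -/
theorem HasBranches.edgesFrom {ι : Type*} [Finite ι] {G : EnrichedGraph (ℝ × ℝ)} {s : Side}
    {v : ℝ × ℝ} {g : ι → ℝ → ℝ} (hb : HasBranches G.carrier s v g)
    (h : GraphLike G.carrier G.vertices) (hv : v ∈ G.vertices) :
    ∃ e : ι → Set (ℝ × ℝ), stdPlane.edgesFrom G s v = range e ∧
      ∀ i, ∀ᶠ x in 𝓝[s.ray v.1] v.1, (x, g i x) ∈ e i := by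
  have hK : ∀ i, ∀ᶠ x in 𝓝[s.ray v.1] v.1, (x, g i x) ∈ G.carrier \ G.vertices := by
    intro i
    filter_upwards [(tendsto_mk_of_tendsto (hb.lim i)).eventually hb.mem_iff,
      eventually_notMem_of_finite h.finite (hb.lim i), self_mem_nhdsWithin] with x h1 h2 h3
    exact ⟨(h1 h3).2 ⟨i, rfl⟩, h2⟩
  choose e he hge using fun i => h.exists_mem_edgesFrom hv (hb.cont i) (hK i) (hb.lim i)
  refine ⟨e, Subset.antisymm (fun E hE => ?_) (range_subset_iff.2 he), hge⟩
  obtain ⟨I, f, hI, -, h1, h2⟩ := h.exists_edgeData_of_mem_edgesFrom hE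
  obtain ⟨x, hx1, hx2, hx3, hx4⟩ := (h1.and (((tendsto_mk_of_tendsto h2).eventually hb.mem_iff).and
    ((eventually_all.2 hge).and self_mem_nhdsWithin))).exists
  obtain ⟨i, hi⟩ := (hx2 hx4).1 (hI.mem x hx1).1
  simp only at hi
  exact ⟨i, EnrichedGraph.openEdges_eq_of_mem (he i).1 hE.1 (hx3 i) (hi ▸ hI.mk_mem hx1)⟩

/-- Both edges lie strictly on the side `s` of `v`, so the two-sided filter of the definition tests
only that side. -/
theorem belowAlong_nhds {G H : EnrichedGraph (ℝ × ℝ)} {s : Side} {v : ℝ × ℝ}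
    {E F : Set (ℝ × ℝ)} {f g : ℝ → ℝ} (hG : GraphLike G.carrier G.vertices)
    (hH : GraphLike H.carrier H.vertices) (hE : E ∈ stdPlane.edgesFrom G s v)
    (hF : F ∈ stdPlane.edgesFrom H s v) (hf : ∀ᶠ x in 𝓝[s.ray v.1] v.1, (x, f x) ∈ E)
    (hg : ∀ᶠ x in 𝓝[s.ray v.1] v.1, (x, g x) ∈ F) :
    stdPlane.BelowAlong (𝓝 v.1) E F ↔ ∀ᶠ x in 𝓝[s.ray v.1] v.1, f x < g x := by
  constructor
  · intro h
    filter_upwards [mem_nhdsWithin_of_mem_nhds h, hf, hg] with x h1 h2 h3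
    exact (h1 _ h2 _ h3 rfl rfl).2
  · intro h
    obtain ⟨I, k, hI⟩ := hG.exists_edgeData' hE.1
    obtain ⟨J, l, hJ⟩ := hH.exists_edgeData' hF.1
    filter_upwards [eventually_nhdsWithin_iff.1 (h.and (hf.and hg))] with x hx p hp q hq hpx hqx
    simp only [stdPlane_proj] at hpx hqx
    subst hpx
    obtain ⟨h1, h2, h3⟩ := hx (hE.2.2 p hp)
    refine ⟨hqx, ?_⟩
    have h4 : p.2 = f p.1 := (hI.mem_iff.1 hp).2.trans (hI.mem_iff.1 h2).2.symm
    have h5 : q.2 = g p.1 := by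
      rw [(hJ.mem_iff.1 hq).2, hqx]; exact (hJ.mem_iff.1 h3).2.symm
    rwa [h4, h5]

theorem trident_of_hasBranches {G H : EnrichedGraph (ℝ × ℝ)} {s : Side} {v : ℝ × ℝ}
    (hG : GraphLike G.carrier G.vertices) (hH : GraphLike H.carrier H.vertices)
    (hvG : v ∈ G.vertices) (hvH : v ∈ H.vertices) {g h₀ h₁ h₂ : ℝ → ℝ}
    (b1 : HasBranches G.carrier s v fun _ : Unit => g)
    (b2 : HasBranches G.carrier s.flip v fun i : Empty => i.elim)
    (b3 : HasBranches H.carrier s.flip v fun _ : Unit => h₀)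
    (b4 : HasBranches H.carrier s v fun b : Bool => if b then h₂ else h₁)
    (hlt : ∀ᶠ x in 𝓝[s.ray v.1] v.1, h₁ x < g x ∧ g x < h₂ x) :
    stdPlane.Trident G H s v := by
  obtain ⟨e1, h11, h12⟩ := b1.edgesFrom hG hvG
  obtain ⟨e2, h21, -⟩ := b2.edgesFrom hG hvG
  obtain ⟨e3, h31, -⟩ := b3.edgesFrom hH hvH
  obtain ⟨e4, h41, h42⟩ := b4.edgesFrom hH hvH
  have m1 : e1 () ∈ stdPlane.edgesFrom G s v := h11 ▸ mem_range_self _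
  have m4 : ∀ b, e4 b ∈ stdPlane.edgesFrom H s v := fun b => h41 ▸ mem_range_self _
  refine ⟨e1 (), e3 (), e4 false, e4 true, ?_, ?_, ?_, ?_, ?_, ?_⟩
  · rw [h11]; exact range_unique
  · rw [h21]; exact range_eq_empty _
  · rw [h31]; exact range_unique
  · rw [h41]; ext E; simp
  · exact (belowAlong_nhds hH hG (m4 false) m1 (h42 false) (h12 ())).2 (hlt.mono fun x hx => hx.1)
  · exact (belowAlong_nhds hG hH m1 (m4 true) (h12 ()) (h42 true)).2 (hlt.mono fun x hx => hx.2)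

namespace GraphLike

theorem eventually_eq_of_fst_eq {K V : Set (ℝ × ℝ)} (h : GraphLike K V) (v : ℝ × ℝ) :
    ∀ᶠ q in 𝓝 v, q ∈ K → q.1 = v.1 → q = v := by
  have h1 : ∀ᶠ y in 𝓝 v.2, y ∉ {y | (v.1, y) ∈ K} \ {v.2} :=
    ((h.fib v.1).subset sdiff_subset).isClosed.isOpen_compl.mem_nhds fun h => h.2 rfl
  filter_upwards [continuousAt_snd.eventually h1] with q h2 h3 h4
  by_contra hne
  exact h2 ⟨by rwa [mem_ofPred_eq, ← h4], fun h5 => hne (Prod.ext h4 h5)⟩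

variable {G : EnrichedGraph (ℝ × ℝ)} (h : GraphLike G.carrier G.vertices)
include h

/-- There are finitely many edges, and those whose closure misses `v` can be kept away. An edge
whose closure contains `v` lies entirely on one side of it. -/
theorem eventually_mem_edgesFrom (s : Side) {v : ℝ × ℝ} (hv : v ∈ G.vertices) :
    ∀ᶠ q in 𝓝 v, q ∈ G.carrier → s.Past v.1 q.1 → ∃ E ∈ stdPlane.edgesFrom G s v, q ∈ E := by
  have h1 : ∀ᶠ q in 𝓝 v, ∀ E ∈ G.openEdges, q ∈ E → v ∈ closure E := by
    refine (h.finite_openEdges.eventually_all).2 fun E _ => ?_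
    by_cases hvE : v ∈ closure E
    · exact Eventually.of_forall fun _ _ => hvE
    · have h2 : ∀ᶠ q in 𝓝 v, q ∈ (closure E)ᶜ := isClosed_closure.isOpen_compl.mem_nhds hvE
      exact h2.mono fun q hq hqE => absurd (subset_closure hqE) hq
  have h3 : ∀ᶠ q in 𝓝 v, q ∉ G.vertices \ {v} :=
    (h.finite.subset sdiff_subset).isClosed.isOpen_compl.mem_nhds fun h => h.2 rfl
  filter_upwards [h1, h3] with q h4 h5 hq hp
  have hqv : q ∉ G.vertices := fun hqV => h5 ⟨hqV, fun hqv => s.past_irrefl v.1 (by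
    rw [mem_singleton_iff] at hqv; rwa [hqv] at hp)⟩
  obtain ⟨E, hE, hqE⟩ := EnrichedGraph.exists_mem_openEdges ⟨hq, hqv⟩
  have hvE := h4 E hE hqE
  obtain ⟨I, f, hI⟩ := h.exists_edgeData' hE
  obtain ⟨-, h6, -⟩ := hI.mem_closure hvE fun hvE => (hI.subset hvE).2 hv
  have h7 := Side.subset_ray hI.ordConnected h6.2 (hI.mem_iff.1 hqE).1 hp
  exact ⟨E, ⟨hE, hvE, fun p hp => h7 (hI.mem_iff.1 hp).1⟩, hqE⟩

end GraphLike

/-! ### Fibrewise piecewise linear interpolation -/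

/-- The truncation of a real number to the unit interval. -/
noncomputable def trunc01 (t : ℝ) : ℝ := max 0 (min t 1)

theorem trunc01_mono : Monotone trunc01 := fun _ _ h => max_le_max le_rfl (min_le_min_right _ h)

theorem trunc01_nonneg (t : ℝ) : 0 ≤ trunc01 t := le_max_left _ _

theorem trunc01_le_one (t : ℝ) : trunc01 t ≤ 1 := max_le zero_le_one (min_le_right _ _)

theorem trunc01_of_nonpos {t : ℝ} (h : t ≤ 0) : trunc01 t = 0 :=
  max_eq_left ((min_le_left _ _).trans h)

theorem trunc01_of_one_le {t : ℝ} (h : 1 ≤ t) : trunc01 t = 1 := by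
  rw [trunc01, min_eq_right h, max_eq_right zero_le_one]

theorem trunc01_lt {t t' : ℝ} (h : t < t') (h0 : 0 < t') (h1 : t' ≤ 1) :
    trunc01 t < trunc01 t' := by
  have h2 : trunc01 t' = t' := by rw [trunc01, min_eq_left h1, max_eq_right h0.le]
  rw [h2]
  exact max_lt h0 ((min_le_left _ _).trans_lt h)

theorem continuous_trunc01 : Continuous trunc01 := by unfold trunc01; fun_prop

/-- The piecewise linear map with slope `1` outside `[k 0, k N]` that maps `k i` to `k' i`. -/
noncomputable def interp (N : ℕ) (k k' : ℕ → ℝ) (y : ℝ) : ℝ :=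
  k' 0 + min (y - k 0) 0 + (∑ j ∈ Finset.range N,
    (k' (j + 1) - k' j) * trunc01 ((y - k j) / (k (j + 1) - k j))) + max (y - k N) 0

section interp

variable {N : ℕ} {k k' : ℕ → ℝ}

/-- At `k i` the truncated slopes of the intervals below are saturated at `1` and those above
vanish, so the sum telescopes. -/
theorem interp_apply (hk : ∀ i j, i ≤ j → j ≤ N → k i ≤ k j)
    (he : ∀ j < N, k j = k (j + 1) → k' j = k' (j + 1)) {i : ℕ} (hi : i ≤ N) :
    interp N k k' (k i) = k' i := by
  have h1 : min (k i - k 0) 0 = 0 := min_eq_right (sub_nonneg.2 (hk 0 i i.zero_le hi))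
  have h2 : max (k i - k N) 0 = 0 := max_eq_right (sub_nonpos.2 (hk i N hi le_rfl))
  have h3 : (∑ j ∈ Finset.range N,
      (k' (j + 1) - k' j) * trunc01 ((k i - k j) / (k (j + 1) - k j))) =
      ∑ j ∈ Finset.range i, (k' (j + 1) - k' j) := by
    rw [← Finset.sum_subset (Finset.range_mono hi) (f := fun j =>
      (k' (j + 1) - k' j) * trunc01 ((k i - k j) / (k (j + 1) - k j)))]
    · refine Finset.sum_congr rfl fun j hj => ?_
      rw [Finset.mem_range] at hj
      rcases (hk j (j + 1) (Nat.le_succ j) (by omega)).eq_or_lt with h | h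
      -- For coinciding nodes the quotient has denominator `0`, but its coefficient vanishes.
      · rw [he j (by omega) h, sub_self, zero_mul]
      · rw [trunc01_of_one_le, mul_one]
        rw [le_div_iff₀ (sub_pos.2 h), one_mul]
        exact sub_le_sub_right (hk (j + 1) i hj hi) _
    · intro j hj hj'
      rw [Finset.mem_range] at hj hj'
      have hij := hk i j (not_lt.1 hj') hj.le
      have hjj := hk j (j + 1) (Nat.le_succ j) (by omega)
      rw [trunc01_of_nonpos, mul_zero]
      exact div_nonpos_of_nonpos_of_nonneg (by linarith) (by linarith)
  rw [interp, h1, h2, h3, Finset.sum_range_sub]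
  ring

theorem interp_strictMono (hk : ∀ i j, i ≤ j → j ≤ N → k i ≤ k j)
    (hk' : ∀ j < N, k' j ≤ k' (j + 1)) (he : ∀ j < N, k' j = k' (j + 1) → k j = k (j + 1)) :
    StrictMono (interp N k k') := by
  intro y y' hy
  have hm1 : min (y - k 0) 0 ≤ min (y' - k 0) 0 := min_le_min_right _ (by linarith)
  have hm2 : max (y - k N) 0 ≤ max (y' - k N) 0 := max_le_max_right _ (by linarith)
  have hterm : ∀ j ∈ Finset.range N,
      (k' (j + 1) - k' j) * trunc01 ((y - k j) / (k (j + 1) - k j)) ≤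
      (k' (j + 1) - k' j) * trunc01 ((y' - k j) / (k (j + 1) - k j)) := by
    intro j hj
    rw [Finset.mem_range] at hj
    have h1 := hk j (j + 1) (Nat.le_succ j) (by omega)
    exact mul_le_mul_of_nonneg_left (trunc01_mono (by
      exact div_le_div_of_nonneg_right (by linarith) (by linarith))) (sub_nonneg.2 (hk' j hj))
  have hs := Finset.sum_le_sum hterm
  unfold interp
  rcases lt_or_ge y (k 0) with h0 | h0
  · have : min (y - k 0) 0 < min (y' - k 0) 0 := by
      rw [min_eq_left (by linarith)]
      exact lt_min (by linarith) (by linarith)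
    linarith
  rcases lt_or_ge (k N) y' with hN | hN
  · have : max (y - k N) 0 < max (y' - k N) 0 := by
      rw [max_eq_left (by linarith : 0 ≤ y' - k N)]
      exact max_lt (by linarith) (by linarith)
    linarith
  classical
  have hex : ∃ i, y' ≤ k i := ⟨N, hN⟩
  -- Here `j + 1` is the first node at or above `y'`. The corresponding summand is not saturated
  -- just below `y'`, so it grows strictly from `y` to `y'`.
  obtain ⟨j, hj⟩ : ∃ j, Nat.find hex = j + 1 := by
    refine Nat.exists_eq_succ_of_ne_zero fun h => ?_
    have := Nat.find_spec hex
    rw [h] at this; linarith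
  have hj1 : y' ≤ k (j + 1) := hj ▸ Nat.find_spec hex
  have hj2 : k j < y' := not_le.1 (Nat.find_min hex (by omega))
  have hjN : j + 1 ≤ N := hj ▸ Nat.find_min' hex hN
  have hd : 0 < k (j + 1) - k j := by linarith
  have hd' : 0 < k' (j + 1) - k' j := by
    refine sub_pos.2 (lt_of_le_of_ne (hk' j hjN) fun h => ?_)
    have := he j hjN h; linarith
  have hlt := Finset.sum_lt_sum hterm ⟨j, Finset.mem_range.2 hjN, by
    refine mul_lt_mul_of_pos_left (trunc01_lt ?_ ?_ ?_) hd'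
    · exact div_lt_div_of_pos_right (by linarith) hd
    · exact div_pos (by linarith) hd
    · rw [div_le_one hd]; linarith⟩
  linarith

theorem interp_of_le (hk : ∀ i j, i ≤ j → j ≤ N → k i ≤ k j) {y : ℝ} (hy : y ≤ k 0) :
    interp N k k' y = k' 0 + (y - k 0) := by
  have h2 : max (y - k N) 0 = 0 := max_eq_right (by linarith [hk 0 N N.zero_le le_rfl])
  rw [interp, min_eq_left (by linarith), h2, Finset.sum_eq_zero]
  · ring
  · intro j hj
    rw [Finset.mem_range] at hj
    have h1 := hk 0 j j.zero_le hj.le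
    have h3 := hk j (j + 1) (Nat.le_succ j) (by omega)
    rw [trunc01_of_nonpos, mul_zero]
    exact div_nonpos_of_nonpos_of_nonneg (by linarith) (by linarith)

theorem le_interp_of_ge (hk : ∀ i j, i ≤ j → j ≤ N → k i ≤ k j)
    (hk' : ∀ j < N, k' j ≤ k' (j + 1)) {y : ℝ} (hy : k N ≤ y) :
    k' 0 + (y - k N) ≤ interp N k k' y := by
  have h1 : min (y - k 0) 0 = 0 := min_eq_right (by linarith [hk 0 N N.zero_le le_rfl])
  have h2 : 0 ≤ ∑ j ∈ Finset.range N,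
      (k' (j + 1) - k' j) * trunc01 ((y - k j) / (k (j + 1) - k j)) :=
    Finset.sum_nonneg fun j hj => mul_nonneg (sub_nonneg.2 (hk' j (Finset.mem_range.1 hj)))
      (trunc01_nonneg _)
  rw [interp, h1]
  linarith [le_max_left (y - k N) 0]

end interp

/-- Where two nodes come together the quotient has no limit, but truncation keeps it in `[0, 1]`
while its coefficient tends to zero. This is why coincident nodes are required to have coincident
targets. -/
theorem continuous_interp {N : ℕ} {k k' : ℕ → ℝ → ℝ} (hk : ∀ n, Continuous (k n))
    (hk' : ∀ n, Continuous (k' n)) (he : ∀ j < N, ∀ x, k j x = k (j + 1) x → k' j x = k' (j + 1) x) :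
    Continuous fun q : ℝ × ℝ => interp N (fun n => k n q.1) (fun n => k' n q.1) q.2 := by
  have hkc : ∀ n, Continuous fun q : ℝ × ℝ => k n q.1 := fun n => (hk n).comp continuous_fst
  have hkc' : ∀ n, Continuous fun q : ℝ × ℝ => k' n q.1 := fun n => (hk' n).comp continuous_fst
  unfold interp
  refine (((hkc' 0).add ((continuous_snd.sub (hkc 0)).min continuous_const)).add
    (continuous_finsetSum _ fun j hj => ?_)).add
    ((continuous_snd.sub (hkc N)).max continuous_const)
  rw [Finset.mem_range] at hj
  rw [continuous_iff_continuousAt]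
  intro q
  have h1 : Continuous fun q : ℝ × ℝ => k' (j + 1) q.1 - k' j q.1 := (hkc' _).sub (hkc' _)
  by_cases hq : k j q.1 = k (j + 1) q.1
  · have h0 : k' (j + 1) q.1 - k' j q.1 = 0 := by rw [he j hj _ hq, sub_self]
    rw [ContinuousAt, h0, zero_mul]
    have h2 := h1.tendsto q
    rw [h0] at h2
    refine squeeze_zero_norm (fun z => ?_) (by simpa using h2.norm)
    rw [norm_mul, Real.norm_of_nonneg (trunc01_nonneg _)]
    exact mul_le_of_le_one_right (norm_nonneg _) (trunc01_le_one _)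
  · have hd : k (j + 1) q.1 - k j q.1 ≠ 0 := sub_ne_zero.2 (Ne.symm hq)
    exact h1.continuousAt.mul (continuous_trunc01.continuousAt.comp
      ((continuous_snd.sub (hkc j)).continuousAt.div
        ((hkc (j + 1)).sub (hkc j)).continuousAt hd))

/-- Interpolation between two increasing families of functions with the same coincidences. -/
theorem exists_interpolation {N : ℕ} {k k' : ℕ → ℝ → ℝ} {x₀ : ℝ}
    (hk : ∀ n, ∀ᶠ x in 𝓝 x₀, ContinuousAt (k n) x) (hk' : ∀ n, ∀ᶠ x in 𝓝 x₀, ContinuousAt (k' n) x)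
    (hm : ∀ j < N, ∀ᶠ x in 𝓝 x₀, (k j x = k (j + 1) x ∧ k' j x = k' (j + 1) x) ∨
      (k j x < k (j + 1) x ∧ k' j x < k' (j + 1) x)) :
    ∃ F : C(ℝ × ℝ, ℝ), ∀ᶠ x in 𝓝 x₀, stdPlane.IsHeight F x ∧
      ∀ n ≤ N, F (x, k n x) = k' n x := by
  have hall : ∀ᶠ x in 𝓝 x₀, ∀ n ∈ Finset.range (N + 1), ContinuousAt (k n) x ∧
      ContinuousAt (k' n) x ∧ (n < N → (k n x = k (n + 1) x ∧ k' n x = k' (n + 1) x) ∨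
      (k n x < k (n + 1) x ∧ k' n x < k' (n + 1) x)) := by
    refine (Finset.eventually_all _).2 fun n _ => ?_
    by_cases hn : n < N
    · filter_upwards [hk n, hk' n, hm n hn] with x h1 h2 h3 using ⟨h1, h2, fun _ => h3⟩
    · filter_upwards [hk n, hk' n] with x h1 h2 using ⟨h1, h2, fun h => absurd h hn⟩
  obtain ⟨δ, hδ, hball⟩ := Metric.nhds_basis_closedBall.eventually_iff.1 hall
  rw [Real.closedBall_eq_Icc] at hball
  -- Precomposition with the retraction onto a compact interval makes functions that are controlled
  -- only near `x₀` continuous everywhere.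
  let c : ℝ → ℝ := fun x => max (x₀ - δ) (min x (x₀ + δ))
  have hc : Continuous c := by fun_prop
  have hcI : ∀ x, c x ∈ Icc (x₀ - δ) (x₀ + δ) := fun x =>
    ⟨le_max_left _ _, max_le (by linarith) (min_le_right _ _)⟩
  have hcx : ∀ x ∈ Icc (x₀ - δ) (x₀ + δ), c x = x := fun x hx => by
    simp only [c, min_eq_left hx.2, max_eq_right hx.1]
  -- Only the indices up to `N` are controlled on a common interval; the remaining functions are
  -- irrelevant and set to `0`.
  let l : ℕ → ℝ → ℝ := fun n x => if n ≤ N then k n (c x) else 0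
  let l' : ℕ → ℝ → ℝ := fun n x => if n ≤ N then k' n (c x) else 0
  have hmem : ∀ n ≤ N, n ∈ Finset.range (N + 1) := fun n hn => Finset.mem_range.2 (by omega)
  have hl : ∀ n, Continuous (l n) := fun n => by
    by_cases hn : n ≤ N
    · simp only [l, hn, if_true]
      rw [continuous_iff_continuousAt]
      exact fun x => (hball (hcI x) n (hmem n hn)).1.comp hc.continuousAt
    · simp only [l, hn, if_false]; exact continuous_const
  have hl' : ∀ n, Continuous (l' n) := fun n => by
    by_cases hn : n ≤ N
    · simp only [l', hn, if_true]
      rw [continuous_iff_continuousAt]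
      exact fun x => (hball (hcI x) n (hmem n hn)).2.1.comp hc.continuousAt
    · simp only [l', hn, if_false]; exact continuous_const
  have hcase : ∀ j < N, ∀ x, (l j x = l (j + 1) x ∧ l' j x = l' (j + 1) x) ∨
      (l j x < l (j + 1) x ∧ l' j x < l' (j + 1) x) := by
    intro j hj x
    have h1 : j ≤ N := hj.le
    have h2 : j + 1 ≤ N := hj
    simp only [l, l', h1, h2, if_true]
    exact (hball (hcI x) j (hmem j h1)).2.2 hj
  have hmono : ∀ x i j, i ≤ j → j ≤ N → l i x ≤ l j x := by
    intro x i j hij hj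
    induction j, hij using Nat.le_induction with
    | base => exact le_rfl
    | succ j hij ih =>
      refine (ih (by omega)).trans ?_
      rcases hcase j (by omega) x with h | h
      · exact h.1.le
      · exact h.1.le
  have hmono' : ∀ x, ∀ j < N, l' j x ≤ l' (j + 1) x := fun x j hj => by
    rcases hcase j hj x with h | h
    · exact h.2.le
    · exact h.2.le
  have he : ∀ j < N, ∀ x, l j x = l (j + 1) x → l' j x = l' (j + 1) x := fun j hj x hx => by
    rcases hcase j hj x with h | h
    · exact h.2
    · exact absurd hx h.1.ne
  have he' : ∀ j < N, ∀ x, l' j x = l' (j + 1) x → l j x = l (j + 1) x := fun j hj x hx => by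
    rcases hcase j hj x with h | h
    · exact h.1
    · exact absurd hx h.2.ne
  refine ⟨⟨_, continuous_interp hl hl' he⟩, ?_⟩
  filter_upwards [Icc_mem_nhds (show x₀ - δ < x₀ by linarith) (show x₀ < x₀ + δ by linarith)]
    with x hx
  refine ⟨⟨fun p q hp hpq => ?_, fun y => ?_, fun y => ?_⟩, fun n hn => ?_⟩
  · obtain ⟨x', y⟩ := p
    obtain ⟨x'', z⟩ := q
    obtain ⟨h1, h2⟩ := hpq
    simp only at h1 h2
    subst h1
    exact interp_strictMono (hmono _) (hmono' _) (fun j hj => he' j hj _) h2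
  · refine ⟨(x, min (l 0 x) (y - l' 0 x + l 0 x)), rfl, ?_⟩
    change interp N (fun n => l n x) (fun n => l' n x) _ ≤ y
    rw [interp_of_le (hmono x) (min_le_left _ _)]
    linarith [min_le_right (l 0 x) (y - l' 0 x + l 0 x)]
  · refine ⟨(x, max (l N x) (y - l' 0 x + l N x)), rfl, ?_⟩
    change y ≤ interp N (fun n => l n x) (fun n => l' n x) _
    refine le_trans ?_ (le_interp_of_ge (hmono x) (hmono' x) (le_max_left _ _))
    linarith [le_max_right (l N x) (y - l' 0 x + l N x)]
  · have h1 := interp_apply (k := fun n => l n x) (k' := fun n => l' n x) (hmono x)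
      (fun j hj => he j hj x) hn
    have e1 : l n x = k n x := by simp only [l, hn, if_true, hcx x hx]
    have e2 : l' n x = k' n x := by simp only [l', hn, if_true, hcx x hx]
    simp only [e1, e2] at h1
    exact h1

/-! ### Pairs of interlaced curve systems -/

/-- Near `p`, the set `A` is the union of two graphs and the set `B` is the part of a third one that
lies strictly in between; the three graphs meet at `p`, and on each vertical line they are
simultaneously distinct or equal. -/
def Node (A B : Set (ℝ × ℝ)) (p : ℝ × ℝ) : Prop :=
  ∃ k₁ k₂ k₃ : ℝ → ℝ,
    (∀ᶠ x in 𝓝 p.1, ContinuousAt k₁ x ∧ ContinuousAt k₂ x ∧ ContinuousAt k₃ x) ∧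
    (k₁ p.1 = p.2 ∧ k₂ p.1 = p.2 ∧ k₃ p.1 = p.2) ∧
    (∀ᶠ x in 𝓝 p.1, (k₁ x = k₂ x ∧ k₂ x = k₃ x) ∨ (k₁ x < k₂ x ∧ k₂ x < k₃ x)) ∧
    ∀ᶠ q in 𝓝 p, (q ∈ A ↔ q.2 = k₁ q.1 ∨ q.2 = k₃ q.1) ∧ (q ∈ B ↔ q.2 = k₂ q.1 ∧ k₁ q.1 < q.2)

/-- A pair of disjoint curve systems with nodes at all their points. -/
structure Weave (A B : Set (ℝ × ℝ)) : Prop where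
  disj : Disjoint A B
  closed : IsClosed (A ∪ B)
  fib : ∀ x, {y | (x, y) ∈ A ∪ B}.Finite
  bdd : ∀ x, ∃ R, ∀ᶠ x' in 𝓝 x, ∀ y, (x', y) ∈ A ∪ B → |y| ≤ R
  nodeA : ∀ p ∈ A, Node A B p
  nodeB : ∀ p ∈ B, Node B A p

theorem Weave.symm {A B : Set (ℝ × ℝ)} (h : Weave A B) : Weave B A := by
  have e := union_comm B A
  exact ⟨h.disj.symm, e ▸ h.closed, e ▸ h.fib, e ▸ h.bdd, h.nodeB, h.nodeA⟩

/-- The trace of a node on a vertical line. -/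
def Cluster (A B : Set (ℝ × ℝ)) (ε x y₀ : ℝ) : Prop :=
  ∃ k₁ k₂ k₃ : ℝ, (|k₁ - y₀| < ε ∧ |k₂ - y₀| < ε ∧ |k₃ - y₀| < ε) ∧
    ((k₁ = k₂ ∧ k₂ = k₃) ∨ (k₁ < k₂ ∧ k₂ < k₃)) ∧
    ∀ y, |y - y₀| < ε → ((x, y) ∈ A ↔ y = k₁ ∨ y = k₃) ∧ ((x, y) ∈ B ↔ y = k₂ ∧ k₁ < y)

theorem Node.cluster {A B : Set (ℝ × ℝ)} {x₀ y₀ : ℝ} (h : Node A B (x₀, y₀)) :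
    ∃ ε₀ > 0, ∀ ε, 0 < ε → ε ≤ ε₀ → ∀ᶠ x in 𝓝 x₀, Cluster A B ε x y₀ := by
  obtain ⟨k₁, k₂, k₃, hc, ⟨h1, h2, h3⟩, hm, hl⟩ := h
  simp only at h1 h2 h3 hc hm
  obtain ⟨U, hU, W, hW, hUW⟩ := mem_nhds_prod_iff.1 hl
  obtain ⟨ε₀, hε₀, hball⟩ := Metric.mem_nhds_iff.1 hW
  refine ⟨ε₀, hε₀, fun ε hε hle => ?_⟩
  have key : ∀ k : ℝ → ℝ, ContinuousAt k x₀ → k x₀ = y₀ → ∀ᶠ x in 𝓝 x₀, |k x - y₀| < ε := by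
    intro k hk hk0
    have := hk.eventually (Metric.ball_mem_nhds _ hε)
    rw [hk0] at this
    exact this.mono fun x hx => by rwa [Real.dist_eq] at hx
  have hc0 := hc.self_of_nhds
  filter_upwards [hm, hU, key k₁ hc0.1 h1, key k₂ hc0.2.1 h2, key k₃ hc0.2.2 h3]
    with x h4 h5 h6 h7 h8
  refine ⟨k₁ x, k₂ x, k₃ x, ⟨h6, h7, h8⟩, h4, fun y hy => ?_⟩
  have : (x, y) ∈ U ×ˢ W := ⟨h5, hball (by rw [Metric.mem_ball, Real.dist_eq]; linarith)⟩
  exact hUW this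

/-- Between two points of `A` on the vertical line over `x` there is a point of `A ∪ B`. -/
def SepAt (A B : Set (ℝ × ℝ)) (x : ℝ) : Prop :=
  ∀ y z, y < z → (x, y) ∈ A → (x, z) ∈ A → ∃ w, y < w ∧ w < z ∧ (x, w) ∈ A ∪ B

/-- The lowest point of `A ∪ B` on the vertical line over `x` exists and is in `A`. -/
def LowAt (A B : Set (ℝ × ℝ)) (x : ℝ) : Prop :=
  ∃ y, (x, y) ∈ A ∧ ∀ z, (x, z) ∈ A ∪ B → y ≤ z

/-- The highest point of `A ∪ B` on the vertical line over `x` exists and is in `A`. -/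
def TopAt (A B : Set (ℝ × ℝ)) (x : ℝ) : Prop :=
  ∃ y, (x, y) ∈ A ∧ ∀ z, (x, z) ∈ A ∪ B → z ≤ y

namespace Weave

variable {A B : Set (ℝ × ℝ)} (h : Weave A B)
include h

/-- The fibre over `x₀` is finite, so one `ε` suits all its nodes. The windows of radius `ε` are
then disjoint, and together they contain the whole of every nearby fibre. -/
theorem exists_clusters (x₀ : ℝ) : ∃ ε > 0,
    (∀ y z, (x₀, y) ∈ A ∪ B → (x₀, z) ∈ A ∪ B → y < z → y + 2 * ε ≤ z) ∧
    ∀ᶠ x in 𝓝 x₀, (∀ y, (x, y) ∈ A ∪ B → ∃ y₀, (x₀, y₀) ∈ A ∪ B ∧ |y - y₀| < ε) ∧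
      (∀ y₀, (x₀, y₀) ∈ A → Cluster A B ε x y₀) ∧ (∀ y₀, (x₀, y₀) ∈ B → Cluster B A ε x y₀) := by
  have hcl : ∀ y₀ ∈ {y | (x₀, y) ∈ A ∪ B}, ∃ ε₀ > 0, ∀ ε, 0 < ε → ε ≤ ε₀ → ∀ᶠ x in 𝓝 x₀,
      ((x₀, y₀) ∈ A → Cluster A B ε x y₀) ∧ ((x₀, y₀) ∈ B → Cluster B A ε x y₀) := by
    rintro y₀ (hy | hy)
    · obtain ⟨ε₀, h1, h2⟩ := (h.nodeA _ hy).cluster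
      exact ⟨ε₀, h1, fun ε h3 h4 => (h2 ε h3 h4).mono fun x hx =>
        ⟨fun _ => hx, fun hB => absurd hB (disjoint_left.1 h.disj hy)⟩⟩
    · obtain ⟨ε₀, h1, h2⟩ := (h.nodeB _ hy).cluster
      exact ⟨ε₀, h1, fun ε h3 h4 => (h2 ε h3 h4).mono fun x hx =>
        ⟨fun hA => absurd hy (disjoint_left.1 h.disj hA), fun _ => hx⟩⟩
  choose! e he hcl using hcl
  obtain ⟨ε₁, hε₁, hle⟩ : ∃ ε₁ > 0, ∀ y₀ ∈ {y | (x₀, y) ∈ A ∪ B}, ε₁ ≤ e y₀ := by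
    have : ∀ᶠ t in 𝓝[>] (0 : ℝ), ∀ y₀ ∈ {y | (x₀, y) ∈ A ∪ B}, t ≤ e y₀ :=
      ((h.fib x₀).eventually_all).2 fun y₀ hy =>
        mem_nhdsWithin_of_mem_nhds (Iic_mem_nhds (he y₀ hy))
    obtain ⟨t, ht, ht0⟩ := (this.and self_mem_nhdsWithin).exists
    exact ⟨t, ht0, ht⟩
  obtain ⟨ε₂, hε₂, hsep⟩ : ∃ ε₂ > 0, ∀ y z, (x₀, y) ∈ A ∪ B → (x₀, z) ∈ A ∪ B → y < z →
      y + 2 * ε₂ ≤ z := by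
    have : ∀ᶠ t in 𝓝[>] (0 : ℝ), ∀ y ∈ {y | (x₀, y) ∈ A ∪ B}, ∀ z ∈ {y | (x₀, y) ∈ A ∪ B},
        y < z → y + 2 * t ≤ z := by
      refine ((h.fib x₀).eventually_all).2 fun y _ => ((h.fib x₀).eventually_all).2 fun z _ => ?_
      by_cases hyz : y < z
      · filter_upwards [mem_nhdsWithin_of_mem_nhds (Iic_mem_nhds (half_pos (sub_pos.2 hyz)))]
          with t ht _
        rw [mem_Iic] at ht; linarith
      · exact Eventually.of_forall fun t ht => absurd ht hyz
    obtain ⟨t, ht, ht0⟩ := (this.and self_mem_nhdsWithin).exists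
    exact ⟨t, ht0, fun y z hy hz => ht y hy z hz⟩
  have hε : 0 < min ε₁ ε₂ := lt_min hε₁ hε₂
  refine ⟨min ε₁ ε₂, hε, fun y z hy hz hyz => ?_, ?_⟩
  · have := hsep y z hy hz hyz
    linarith [min_le_right ε₁ ε₂]
  · have h1 := eventually_fibre_subset h.closed (h.bdd x₀)
      (Q := fun q => ∃ y₀, (x₀, y₀) ∈ A ∪ B ∧ |q.2 - y₀| < min ε₁ ε₂) fun z hz => by
        have : ∀ᶠ q : ℝ × ℝ in 𝓝 (x₀, z), q.2 ∈ Metric.ball z (min ε₁ ε₂) :=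
          continuousAt_snd.eventually (Metric.ball_mem_nhds _ hε)
        exact this.mono fun q hq => ⟨z, hz, by rwa [Metric.mem_ball, Real.dist_eq] at hq⟩
    have h2 : ∀ᶠ x in 𝓝 x₀, ∀ y₀ ∈ {y | (x₀, y) ∈ A ∪ B},
        ((x₀, y₀) ∈ A → Cluster A B (min ε₁ ε₂) x y₀) ∧
        ((x₀, y₀) ∈ B → Cluster B A (min ε₁ ε₂) x y₀) :=
      ((h.fib x₀).eventually_all).2 fun y₀ hy =>
        hcl y₀ hy _ hε ((min_le_left _ _).trans (hle y₀ hy))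
    filter_upwards [h1, h2] with x h3 h4
    exact ⟨h3, fun y₀ hy => (h4 y₀ (Or.inl hy)).1 hy, fun y₀ hy => (h4 y₀ (Or.inr hy)).2 hy⟩

omit h in
/-- The extreme points of a cluster. -/
theorem _root_.Cluster.ends {ε x y₀ : ℝ} (hc : Cluster A B ε x y₀) :
    ∃ m M, m ≤ M ∧ |m - y₀| < ε ∧ |M - y₀| < ε ∧ (x, m) ∈ A ∧ (x, M) ∈ A ∧
      (∀ y, |y - y₀| < ε → (x, y) ∈ A → y = m ∨ y = M) ∧
      (∀ y, |y - y₀| < ε → (x, y) ∈ B → m < y ∧ y < M) ∧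
      (m < M → ∃ c, m < c ∧ c < M ∧ (x, c) ∈ B) ∧
      (∀ y z, |y - y₀| < ε → |z - y₀| < ε → (x, y) ∈ B → (x, z) ∈ B → y = z) := by
  obtain ⟨k₁, k₂, k₃, ⟨h1, h2, h3⟩, hm, hl⟩ := hc
  refine ⟨k₁, k₃, ?_, h1, h3, ((hl _ h1).1).2 (Or.inl rfl), ((hl _ h3).1).2 (Or.inr rfl),
    fun y hy hyA => ((hl y hy).1).1 hyA, fun y hy hyB => ?_, fun hlt => ?_,
    fun y z hy hz hyB hzB => (((hl y hy).2).1 hyB).1.trans (((hl z hz).2).1 hzB).1.symm⟩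
  · rcases hm with h | h <;> linarith
  · obtain ⟨rfl, h5⟩ := ((hl y hy).2).1 hyB
    rcases hm with h | h
    · linarith
    · exact ⟨h5, h.2⟩
  · rcases hm with h | h
    · linarith
    · exact ⟨k₂, h.1, h.2, ((hl _ h2).2).2 ⟨rfl, h.1⟩⟩

/-- The data that describe the fibre over `x` in terms of a neighbouring fibre. -/
theorem exists_fibre_model (x₀ : ℝ) : ∃ ε > 0,
    (∀ y z, (x₀, y) ∈ A ∪ B → (x₀, z) ∈ A ∪ B → y < z → y + 2 * ε ≤ z) ∧
    ∀ᶠ x in 𝓝 x₀, (∀ y, (x, y) ∈ A ∪ B → ∃ y₀, (x₀, y₀) ∈ A ∪ B ∧ |y - y₀| < ε) ∧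
      ∃ m M : ℝ → ℝ, ∀ y₀, (x₀, y₀) ∈ A ∪ B → m y₀ ≤ M y₀ ∧ |m y₀ - y₀| < ε ∧ |M y₀ - y₀| < ε ∧
        (∀ y, |y - y₀| < ε → (x, y) ∈ A ∪ B → m y₀ ≤ y ∧ y ≤ M y₀) ∧
        ((x₀, y₀) ∈ A → (x, m y₀) ∈ A ∧ (x, M y₀) ∈ A ∧
          (∀ y, |y - y₀| < ε → (x, y) ∈ A → y = m y₀ ∨ y = M y₀) ∧
          (∀ y, |y - y₀| < ε → (x, y) ∈ B → m y₀ < y ∧ y < M y₀) ∧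
          (m y₀ < M y₀ → ∃ c, m y₀ < c ∧ c < M y₀ ∧ (x, c) ∈ B)) ∧
        ((x₀, y₀) ∈ B → (x, m y₀) ∈ B ∧ (x, M y₀) ∈ B ∧
          (∀ y, |y - y₀| < ε → (x, y) ∈ B → y = m y₀ ∨ y = M y₀) ∧
          (∀ y, |y - y₀| < ε → (x, y) ∈ A → m y₀ < y ∧ y < M y₀) ∧
          (∀ y z, |y - y₀| < ε → |z - y₀| < ε → (x, y) ∈ A → (x, z) ∈ A → y = z)) := by
  obtain ⟨ε, hε, hsep, hev⟩ := h.exists_clusters x₀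
  refine ⟨ε, hε, hsep, hev.mono ?_⟩
  rintro x ⟨h1, hA, hB⟩
  refine ⟨h1, ?_⟩
  have : ∀ y₀, ∃ m M : ℝ, (x₀, y₀) ∈ A ∪ B → m ≤ M ∧ |m - y₀| < ε ∧ |M - y₀| < ε ∧
        (∀ y, |y - y₀| < ε → (x, y) ∈ A ∪ B → m ≤ y ∧ y ≤ M) ∧
        ((x₀, y₀) ∈ A → (x, m) ∈ A ∧ (x, M) ∈ A ∧
          (∀ y, |y - y₀| < ε → (x, y) ∈ A → y = m ∨ y = M) ∧
          (∀ y, |y - y₀| < ε → (x, y) ∈ B → m < y ∧ y < M) ∧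
          (m < M → ∃ c, m < c ∧ c < M ∧ (x, c) ∈ B)) ∧
        ((x₀, y₀) ∈ B → (x, m) ∈ B ∧ (x, M) ∈ B ∧
          (∀ y, |y - y₀| < ε → (x, y) ∈ B → y = m ∨ y = M) ∧
          (∀ y, |y - y₀| < ε → (x, y) ∈ A → m < y ∧ y < M) ∧
          (∀ y z, |y - y₀| < ε → |z - y₀| < ε → (x, y) ∈ A → (x, z) ∈ A → y = z)) := by
    intro y₀
    by_cases hy : (x₀, y₀) ∈ A ∪ B
    · rcases hy with hy | hy
      · obtain ⟨m, M, h2, h3, h4, h5, h6, h7, h8, h9, -⟩ := (hA y₀ hy).ends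
        refine ⟨m, M, fun _ => ⟨h2, h3, h4, ?_, fun _ => ⟨h5, h6, h7, h8, h9⟩,
          fun hB => absurd hB (disjoint_left.1 h.disj hy)⟩⟩
        rintro y hy' (hyA | hyB)
        · rcases h7 y hy' hyA with rfl | rfl
          · exact ⟨le_rfl, h2⟩
          · exact ⟨h2, le_rfl⟩
        · exact ⟨(h8 y hy' hyB).1.le, (h8 y hy' hyB).2.le⟩
      · obtain ⟨m, M, h2, h3, h4, h5, h6, h7, h8, -, h9⟩ := (hB y₀ hy).ends
        refine ⟨m, M, fun _ => ⟨h2, h3, h4, ?_, fun hA => absurd hy (disjoint_left.1 h.disj hA),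
          fun _ => ⟨h5, h6, h7, h8, h9⟩⟩⟩
        rintro y hy' (hyA | hyB)
        · exact ⟨(h8 y hy' hyA).1.le, (h8 y hy' hyA).2.le⟩
        · rcases h7 y hy' hyB with rfl | rfl
          · exact ⟨le_rfl, h2⟩
          · exact ⟨h2, le_rfl⟩
    · exact ⟨0, 0, fun h => absurd h hy⟩
  choose m M hmM using this
  exact ⟨m, M, fun y₀ hy => hmM y₀ hy⟩

/-- Passing to a nearby line, a point of `A` either persists or opens into `A`, `B`, `A` in this
vertical order, and similarly with the roles exchanged. Neither change makes two neighbouring points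
of the same kind, nor alters the kind of the lowest or the highest point. -/
theorem eventually_iff (x₀ : ℝ) : ∀ᶠ x in 𝓝 x₀, (SepAt A B x ↔ SepAt A B x₀) ∧
    (LowAt A B x ↔ LowAt A B x₀) ∧ (TopAt A B x ↔ TopAt A B x₀) ∧
    ((∃ y, (x, y) ∈ A ∪ B) ↔ ∃ y, (x₀, y) ∈ A ∪ B) := by
  obtain ⟨ε, hε, hsep, hev⟩ := h.exists_fibre_model x₀
  filter_upwards [hev]
  rintro x ⟨hnear, m, M, hm⟩
  have hd := disjoint_left.1 h.disj
  have hord : ∀ y₀ z₀ y z, (x₀, y₀) ∈ A ∪ B → (x₀, z₀) ∈ A ∪ B → |y - y₀| < ε → |z - z₀| < ε →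
      y₀ < z₀ → y < z := by
    intro y₀ z₀ y z hy₀ hz₀ hy hz hlt
    have := hsep y₀ z₀ hy₀ hz₀ hlt
    linarith [(abs_lt.1 hy).2, (abs_lt.1 hz).1]
  have hmK : ∀ y₀, (x₀, y₀) ∈ A ∪ B → (x, m y₀) ∈ A ∪ B ∧ (x, M y₀) ∈ A ∪ B := by
    intro y₀ hy₀
    obtain ⟨-, -, -, -, h5, h6⟩ := hm y₀ hy₀
    rcases hy₀ with hy₀ | hy₀
    · exact ⟨Or.inl (h5 hy₀).1, Or.inl (h5 hy₀).2.1⟩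
    · exact ⟨Or.inr (h6 hy₀).1, Or.inr (h6 hy₀).2.1⟩
  refine ⟨⟨fun hS y₀ z₀ hlt hy₀ hz₀ => ?_, fun hS y z hlt hy hz => ?_⟩, ⟨?_, ?_⟩, ⟨?_, ?_⟩, ?_, ?_⟩
  · obtain ⟨-, -, h1, h2, h3, -⟩ := hm y₀ (Or.inl hy₀)
    obtain ⟨-, h4, -, h5, h6, -⟩ := hm z₀ (Or.inl hz₀)
    obtain ⟨w, hw1, hw2, hw⟩ := hS _ _ (hord y₀ z₀ _ _ (Or.inl hy₀) (Or.inl hz₀) h1 h4 hlt)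
      (h3 hy₀).2.1 (h6 hz₀).1
    obtain ⟨w₀, hw₀, hww⟩ := hnear w hw
    refine ⟨w₀, ?_, ?_, hw₀⟩
    · by_contra hle
      rcases (not_lt.1 hle).lt_or_eq with h7 | rfl
      · exact absurd (hord w₀ y₀ w _ hw₀ (Or.inl hy₀) hww h1 h7) hw1.not_gt
      · exact absurd (h2 w hww hw).2 hw1.not_ge
    · by_contra hle
      rcases (not_lt.1 hle).lt_or_eq with h7 | rfl
      · exact absurd (hord z₀ w₀ _ w (Or.inl hz₀) hw₀ h4 hww h7) hw2.not_gt
      · exact absurd (h5 w hww hw).1 hw2.not_ge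
  · obtain ⟨y₀, hy₀, hyy⟩ := hnear y (Or.inl hy)
    obtain ⟨z₀, hz₀, hzz⟩ := hnear z (Or.inl hz)
    have hyz : y₀ ≤ z₀ := by
      by_contra hlt'
      exact absurd (hord z₀ y₀ z y hz₀ hy₀ hzz hyy (not_le.1 hlt')) hlt.not_gt
    obtain ⟨-, a2, a3, a4, a5, a6⟩ := hm y₀ hy₀
    obtain ⟨-, b2, b3, b4, b5, b6⟩ := hm z₀ hz₀
    -- Two points of `A` in one window are the ends of a triple with a point of `B` inside; a window
    -- around a point of `B` contains at most one point of `A`.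
    rcases hyz.eq_or_lt with rfl | hlt₀
    · rcases hy₀ with hy₀ | hy₀
      · obtain ⟨-, -, c1, -, c2⟩ := a5 hy₀
        have hmy := (a4 y hyy (Or.inl hy)).1
        have hzM := (a4 z hzz (Or.inl hz)).2
        obtain ⟨c, hc1, hc2, hc⟩ := c2 (by linarith)
        have hy' : y = m y₀ := by
          rcases c1 y hyy hy with h' | h'
          · exact h'
          · exfalso; linarith
        have hz' : z = M y₀ := by
          rcases c1 z hzz hz with h' | h'
          · exfalso; linarith
          · exact h'
        exact ⟨c, by linarith, by linarith, Or.inr hc⟩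
      · exact absurd ((a6 hy₀).2.2.2.2 y z hyy hzz hy hz) hlt.ne
    -- For different windows: if one of them belongs to a point of `B`, an extreme point of that
    -- window separates; otherwise a window in between does.
    · by_cases hyA : (x₀, y₀) ∈ A
      · by_cases hzA : (x₀, z₀) ∈ A
        · obtain ⟨w₀, hw1, hw2, hw₀⟩ := hS y₀ z₀ hlt₀ hyA hzA
          refine ⟨m w₀, hord y₀ w₀ _ _ hy₀ hw₀ hyy (hm w₀ hw₀).2.1 hw1,
            hord w₀ z₀ _ _ hw₀ hz₀ (hm w₀ hw₀).2.1 hzz hw2, (hmK w₀ hw₀).1⟩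
        · have hzB := hz₀.resolve_left hzA
          exact ⟨m z₀, hord y₀ z₀ _ _ hy₀ hz₀ hyy b2 hlt₀, ((b6 hzB).2.2.2.1 z hzz hz).1,
            (hmK z₀ hz₀).1⟩
      · have hyB := hy₀.resolve_left hyA
        exact ⟨M y₀, ((a6 hyB).2.2.2.1 y hyy hy).2, hord y₀ z₀ _ _ hy₀ hz₀ a3 hzz hlt₀,
          (hmK y₀ hy₀).2⟩
  · rintro ⟨y, hy, hlow⟩
    obtain ⟨y₀, hy₀, hyy⟩ := hnear y (Or.inl hy)
    have hyA : (x₀, y₀) ∈ A := by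
      by_contra hyA
      have := ((hm y₀ hy₀).2.2.2.2.2 (hy₀.resolve_left hyA)).2.2.2.1 y hyy hy
      exact absurd (hlow _ (hmK y₀ hy₀).1) this.1.not_ge
    refine ⟨y₀, hyA, fun z₀ hz₀ => ?_⟩
    by_contra hlt
    exact absurd (hlow _ (hmK z₀ hz₀).1)
      (hord z₀ y₀ _ _ hz₀ hy₀ (hm z₀ hz₀).2.1 hyy (not_le.1 hlt)).not_ge
  · rintro ⟨y₀, hy₀, hlow⟩
    refine ⟨m y₀, ((hm y₀ (Or.inl hy₀)).2.2.2.2.1 hy₀).1, fun z hz => ?_⟩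
    obtain ⟨z₀, hz₀, hzz⟩ := hnear z hz
    rcases (hlow z₀ hz₀).eq_or_lt with rfl | hlt
    · exact ((hm _ hz₀).2.2.2.1 z hzz hz).1
    · exact (hord y₀ z₀ _ _ (Or.inl hy₀) hz₀ (hm y₀ (Or.inl hy₀)).2.1 hzz hlt).le
  · rintro ⟨y, hy, hlow⟩
    obtain ⟨y₀, hy₀, hyy⟩ := hnear y (Or.inl hy)
    have hyA : (x₀, y₀) ∈ A := by
      by_contra hyA
      have := ((hm y₀ hy₀).2.2.2.2.2 (hy₀.resolve_left hyA)).2.2.2.1 y hyy hy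
      exact absurd (hlow _ (hmK y₀ hy₀).2) this.2.not_ge
    refine ⟨y₀, hyA, fun z₀ hz₀ => ?_⟩
    by_contra hlt
    exact absurd (hlow _ (hmK z₀ hz₀).1)
      (hord y₀ z₀ _ _ hy₀ hz₀ hyy (hm z₀ hz₀).2.1 (not_le.1 hlt)).not_ge
  · rintro ⟨y₀, hy₀, hlow⟩
    refine ⟨M y₀, ((hm y₀ (Or.inl hy₀)).2.2.2.2.1 hy₀).2.1, fun z hz => ?_⟩
    obtain ⟨z₀, hz₀, hzz⟩ := hnear z hz
    rcases (hlow z₀ hz₀).eq_or_lt with rfl | hlt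
    · exact ((hm _ hz₀).2.2.2.1 z hzz hz).2
    · exact (hord z₀ y₀ _ _ hz₀ (Or.inl hy₀) hzz (hm y₀ (Or.inl hy₀)).2.2.1 hlt).le
  · rintro ⟨y, hy⟩
    obtain ⟨y₀, hy₀, -⟩ := hnear y hy
    exact ⟨y₀, hy₀⟩
  · rintro ⟨y₀, hy₀⟩
    exact ⟨_, (hmK y₀ hy₀).1⟩

/-- The base is connected, so these locally constant properties need to be checked only on one
vertical line, which will be taken beyond the vertices. -/
theorem const (x x' : ℝ) : (SepAt A B x ↔ SepAt A B x') ∧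
    (LowAt A B x ↔ LowAt A B x') ∧ (TopAt A B x ↔ TopAt A B x') ∧
    ((∃ y, (x, y) ∈ A ∪ B) ↔ ∃ y, (x', y) ∈ A ∪ B) := by
  refine PreconnectedSpace.induction₂' (fun x x' => (SepAt A B x ↔ SepAt A B x') ∧
    (LowAt A B x ↔ LowAt A B x') ∧ (TopAt A B x ↔ TopAt A B x') ∧
    ((∃ y, (x, y) ∈ A ∪ B) ↔ ∃ y, (x', y) ∈ A ∪ B)) ?_ ?_ x x'
  · intro x
    filter_upwards [h.eventually_iff x] with y hy
    exact ⟨⟨hy.1.symm, hy.2.1.symm, hy.2.2.1.symm, hy.2.2.2.symm⟩, hy⟩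
  · exact ⟨fun a b c h1 h2 => ⟨h1.1.trans h2.1, h1.2.1.trans h2.2.1, h1.2.2.1.trans h2.2.2.1,
      h1.2.2.2.trans h2.2.2.2⟩⟩

end Weave

/-! ### Matching two interlaced pairs with a common first term -/

/-- The points `b` and `b'` over `x` determine the same cut of the fibre of `A`. -/
def SameCut (A : Set (ℝ × ℝ)) (x b b' : ℝ) : Prop := ∀ a, (x, a) ∈ A → (a < b ↔ a < b')

namespace Weave

variable {A B B' : Set (ℝ × ℝ)}

/-- The lowest point of the finite fibre above `b` cannot be in `B`, since separation would produce
a still lower one. -/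
theorem exists_between (h : Weave A B) {x : ℝ} (hs : SepAt B A x) {b c : ℝ} (hb : (x, b) ∈ B)
    (hc : (x, c) ∈ B) (hbc : b < c) : ∃ a, (x, a) ∈ A ∧ b < a ∧ a < c := by
  obtain ⟨w, hw1, hw2, hw⟩ := hs b c hbc hb hc
  have hfin : {w | (x, w) ∈ A ∪ B ∧ b < w ∧ w < c}.Finite := (h.fib x).subset fun w hw => hw.1
  obtain ⟨z, ⟨hz, hz1, hz2⟩, hmin⟩ := hfin.exists_minimal (s := {w | (x, w) ∈ A ∪ B ∧ b < w ∧ w < c})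
    ⟨w, hw.symm, hw1, hw2⟩
  rcases hz with hz | hz
  · exact ⟨z, hz, hz1, hz2⟩
  · obtain ⟨u, hu1, hu2, hu⟩ := hs b z hz1 hb hz
    exact absurd (hmin (y := u) ⟨hu.symm, hu1, hu2.trans hz2⟩ hu2.le) hu2.not_ge

theorem sameCut_unique (h : Weave A B) {x : ℝ} (hs : SepAt B A x) {b c : ℝ} (hb : (x, b) ∈ B)
    (hc : (x, c) ∈ B) (hbc : SameCut A x b c) : b = c := by
  rcases lt_trichotomy b c with hlt | heq | hlt
  · obtain ⟨a, ha, h1, h2⟩ := h.exists_between hs hb hc hlt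
    exact absurd ((hbc a ha).2 h2) h1.not_gt
  · exact heq
  · obtain ⟨a, ha, h1, h2⟩ := h.exists_between hs hc hb hlt
    exact absurd ((hbc a ha).1 h2) h1.not_gt

/-- If `A` has points on both sides of `b`, the nearest ones `l` and `r` are consecutive in `A`, and
alternation puts a point of `B'` between them. If nothing of `A` is above (or below) `b`, the
extreme point of the fibre is in `B`, and the hypothesis on extreme points provides the partner. -/
theorem exists_sameCut (h : Weave A B) (h' : Weave A B') {x : ℝ} (hs : SepAt A B' x)
    (hL : LowAt B A x → LowAt B' A x) (hT : TopAt B A x → TopAt B' A x) {b : ℝ}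
    (hb : (x, b) ∈ B) : ∃ b', (x, b') ∈ B' ∧ SameCut A x b b' := by
  have hne : ∀ a, (x, a) ∈ A → a ≠ b := fun a ha hab =>
    disjoint_left.1 h.disj ha (hab ▸ hb)
  have hfA : {a | (x, a) ∈ A}.Finite := (h.fib x).subset fun a ha => Or.inl ha
  by_cases hl : ∃ a, (x, a) ∈ A ∧ a < b
  · by_cases hr : ∃ a, (x, a) ∈ A ∧ b < a
    · obtain ⟨l, ⟨hlA, hlb⟩, hlmax⟩ := (hfA.subset (t := {a | (x, a) ∈ A ∧ a < b})
        fun a ha => ha.1).exists_maximal hl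
      obtain ⟨r, ⟨hrA, hbr⟩, hrmin⟩ := (hfA.subset (t := {a | (x, a) ∈ A ∧ b < a})
        fun a ha => ha.1).exists_minimal hr
      obtain ⟨b', hb', h1, h2⟩ := h'.symm.exists_between hs hlA hrA (hlb.trans hbr)
      refine ⟨b', hb', fun a ha => ⟨fun hab => ?_, fun hab => ?_⟩⟩
      · by_contra hcon
        have hla : l < a := h1.trans_le (not_lt.1 hcon)
        exact absurd (hlmax (y := a) ⟨ha, hab⟩ hla.le) hla.not_ge
      · by_contra hcon
        have hba : b < a := lt_of_le_of_ne (not_lt.1 hcon) (hne a ha).symm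
        have har : a < r := hab.trans h2
        exact absurd (hrmin (y := a) ⟨ha, hba⟩ har.le) har.not_ge
    · push Not at hr
      obtain ⟨t, ht, htmax⟩ := (h.fib x).exists_maximal (s := {y | (x, y) ∈ A ∪ B}) ⟨b, Or.inr hb⟩
      have htop : TopAt B A x := by
        refine ⟨t, ht.resolve_left fun htA => ?_, fun z hz => ?_⟩
        · exact hne t htA (le_antisymm (hr t htA) (by
            rcases le_total b t with h1 | h1
            · exact h1
            · exact htmax (y := b) (Or.inr hb) h1))
        · rcases le_total z t with h1 | h1
          · exact h1
          · exact htmax (y := z) hz.symm h1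
      obtain ⟨b', hb', hmax⟩ := hT htop
      refine ⟨b', hb', fun a ha => ⟨fun _ => ?_, fun _ => lt_of_le_of_ne (hr a ha) (hne a ha)⟩⟩
      exact lt_of_le_of_ne (hmax a (Or.inr ha)) fun hab => disjoint_left.1 h'.disj ha (hab ▸ hb')
  · push Not at hl
    obtain ⟨t, ht, htmin⟩ := (h.fib x).exists_minimal (s := {y | (x, y) ∈ A ∪ B}) ⟨b, Or.inr hb⟩
    have hlow : LowAt B A x := by
      refine ⟨t, ht.resolve_left fun htA => ?_, fun z hz => ?_⟩
      · exact hne t htA (le_antisymm (by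
          rcases le_total t b with h1 | h1
          · exact h1
          · exact htmin (y := b) (Or.inr hb) h1) (hl t htA))
      · rcases le_total t z with h1 | h1
        · exact h1
        · exact htmin (y := z) hz.symm h1
    obtain ⟨b', hb', hmin⟩ := hL hlow
    exact ⟨b', hb', fun a ha => ⟨fun h1 => absurd h1 (hl a ha).not_gt,
      fun h1 => absurd h1 (hmin a (Or.inr ha)).not_gt⟩⟩

end Weave

theorem eventually_mk {x₀ y : ℝ} {k : ℝ → ℝ} (hk : ContinuousAt k x₀) (hy : k x₀ = y)
    {Q : ℝ × ℝ → Prop} (hQ : ∀ᶠ q in 𝓝 (x₀, y), Q q) : ∀ᶠ x in 𝓝 x₀, Q (x, k x) := by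
  subst hy
  exact (continuousAt_id.prodMk hk).eventually hQ

/-- Two interlaced pairs `(A, B)`, `(A, B')` of the same combinatorial type. -/
structure Matching (A B B' : Set (ℝ × ℝ)) : Prop where
  weave : Weave A B
  weave' : Weave A B'
  sepA : ∀ x, SepAt A B x
  sepB : ∀ x, SepAt B A x
  sepA' : ∀ x, SepAt A B' x
  sepB' : ∀ x, SepAt B' A x
  low : ∀ x, LowAt B A x ↔ LowAt B' A x
  top : ∀ x, TopAt B A x ↔ TopAt B' A x
  special : ∀ p ∈ closure A, (p ∈ B ↔ p ∈ B')

namespace Matching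

variable {A B B' : Set (ℝ × ℝ)} (h : Matching A B B')
include h

/-- The point `y'` corresponds to `y` on the vertical line over `x`. -/
def _root_.Partner (A B B' : Set (ℝ × ℝ)) (x y y' : ℝ) : Prop :=
  ((x, y) ∈ A ∧ y' = y) ∨ ((x, y) ∈ B ∧ (x, y') ∈ B' ∧ SameCut A x y y')

theorem partner_lt {x y z y' z' : ℝ} (hy : Partner A B B' x y y') (hz : Partner A B B' x z z')
    (hyz : y < z) : y' < z' := by
  rcases hy with ⟨hyA, rfl⟩ | ⟨hyB, hyB', hyc⟩ <;> rcases hz with ⟨hzA, rfl⟩ | ⟨hzB, hzB', hzc⟩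
  · exact hyz
  · exact (hzc _ hyA).1 hyz
  · have h1 : ¬ z' < y' := fun h1 => absurd ((hyc _ hzA).2 h1) hyz.not_gt
    refine lt_of_le_of_ne (not_lt.1 h1) fun he => disjoint_left.1 h.weave'.disj hzA (he ▸ hyB')
  · obtain ⟨a, ha, h1, h2⟩ := h.weave.exists_between (h.sepB x) hyB hzB hyz
    have h3 : ¬ a < y' := fun h3 => absurd ((hyc _ ha).2 h3) h1.not_gt
    exact (not_lt.1 h3).trans_lt ((hzc _ ha).1 h2)

/-- The node of `(A, B)` at a point and the node of `(A, B')` at its partner split over the same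
abscissas, which is the input of the interpolation. There are three cases. At a point of `A` the
outer graphs of both nodes are the same strands of `A`. At a point of `B` in the closure of `A` the
partner is the point itself, and the middle graphs agree where they count. At any other point of `B`
neither node splits. -/
theorem exists_pair {x₀ y : ℝ} (hy : (x₀, y) ∈ A ∪ B) :
    ∃ (y' : ℝ) (k k' : Fin 3 → ℝ → ℝ), Partner A B B' x₀ y y' ∧
      (∀ j, ∀ᶠ x in 𝓝 x₀, ContinuousAt (k j) x) ∧ (∀ j, ∀ᶠ x in 𝓝 x₀, ContinuousAt (k' j) x) ∧
      (∀ j, k j x₀ = y) ∧ (∀ j, k' j x₀ = y') ∧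
      (∀ᶠ x in 𝓝 x₀, ((k 0 x = k 1 x ∧ k 1 x = k 2 x) ∧ (k' 0 x = k' 1 x ∧ k' 1 x = k' 2 x)) ∨
        ((k 0 x < k 1 x ∧ k 1 x < k 2 x) ∧ (k' 0 x < k' 1 x ∧ k' 1 x < k' 2 x))) ∧
      ∀ᶠ q in 𝓝 (x₀, y), (q ∈ A → ∃ j, q.2 = k j q.1 ∧ k' j q.1 = q.2) ∧
        (q ∈ B → ∃ j, q.2 = k j q.1 ∧ (q.1, k' j q.1) ∈ B') := by
  have hfst : ∀ {Q : ℝ → Prop}, (∀ᶠ x in 𝓝 x₀, Q x) → ∀ {z : ℝ}, ∀ᶠ q : ℝ × ℝ in 𝓝 (x₀, z), Q q.1 :=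
    fun hQ _ => continuousAt_fst.eventually hQ
  -- the values of the defining equivalences along the branches
  have along : ∀ {z : ℝ} {S T : Set (ℝ × ℝ)} {l₁ l₂ l₃ k : ℝ → ℝ},
      (∀ᶠ q in 𝓝 (x₀, z), (q ∈ S ↔ q.2 = l₁ q.1 ∨ q.2 = l₃ q.1) ∧
        (q ∈ T ↔ q.2 = l₂ q.1 ∧ l₁ q.1 < q.2)) → ContinuousAt k x₀ → k x₀ = z →
      ∀ᶠ x in 𝓝 x₀, ((x, k x) ∈ S ↔ k x = l₁ x ∨ k x = l₃ x) ∧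
        ((x, k x) ∈ T ↔ k x = l₂ x ∧ l₁ x < k x) := fun hl hk hkz => eventually_mk hk hkz hl
  have pack : ∀ {y' : ℝ} (k₁ k₂ k₃ l₁ l₂ l₃ : ℝ → ℝ), Partner A B B' x₀ y y' →
      (∀ᶠ x in 𝓝 x₀, ContinuousAt k₁ x ∧ ContinuousAt k₂ x ∧ ContinuousAt k₃ x) →
      (∀ᶠ x in 𝓝 x₀, ContinuousAt l₁ x ∧ ContinuousAt l₂ x ∧ ContinuousAt l₃ x) →
      (k₁ x₀ = y ∧ k₂ x₀ = y ∧ k₃ x₀ = y) → (l₁ x₀ = y' ∧ l₂ x₀ = y' ∧ l₃ x₀ = y') →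
      (∀ᶠ x in 𝓝 x₀, ((k₁ x = k₂ x ∧ k₂ x = k₃ x) ∧ (l₁ x = l₂ x ∧ l₂ x = l₃ x)) ∨
        ((k₁ x < k₂ x ∧ k₂ x < k₃ x) ∧ (l₁ x < l₂ x ∧ l₂ x < l₃ x))) →
      (∀ᶠ q in 𝓝 (x₀, y), (q ∈ A → ∃ j, q.2 = ![k₁, k₂, k₃] j q.1 ∧ ![l₁, l₂, l₃] j q.1 = q.2) ∧
        (q ∈ B → ∃ j, q.2 = ![k₁, k₂, k₃] j q.1 ∧ (q.1, ![l₁, l₂, l₃] j q.1) ∈ B')) →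
      _ := fun k₁ k₂ k₃ l₁ l₂ l₃ h1 h2 h3 h4 h5 h6 h7 =>
    (⟨_, ![k₁, k₂, k₃], ![l₁, l₂, l₃], h1,
      Fin.forall_fin_succ.2 ⟨h2.mono fun x hx => hx.1, Fin.forall_fin_two.2
        ⟨h2.mono fun x hx => hx.2.1, h2.mono fun x hx => hx.2.2⟩⟩,
      Fin.forall_fin_succ.2 ⟨h3.mono fun x hx => hx.1, Fin.forall_fin_two.2
        ⟨h3.mono fun x hx => hx.2.1, h3.mono fun x hx => hx.2.2⟩⟩,
      Fin.forall_fin_succ.2 ⟨h4.1, Fin.forall_fin_two.2 ⟨h4.2.1, h4.2.2⟩⟩,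
      Fin.forall_fin_succ.2 ⟨h5.1, Fin.forall_fin_two.2 ⟨h5.2.1, h5.2.2⟩⟩, h6, h7⟩ :
      ∃ (y' : ℝ) (k k' : Fin 3 → ℝ → ℝ), Partner A B B' x₀ y y' ∧
      (∀ j, ∀ᶠ x in 𝓝 x₀, ContinuousAt (k j) x) ∧ (∀ j, ∀ᶠ x in 𝓝 x₀, ContinuousAt (k' j) x) ∧
      (∀ j, k j x₀ = y) ∧ (∀ j, k' j x₀ = y') ∧
      (∀ᶠ x in 𝓝 x₀, ((k 0 x = k 1 x ∧ k 1 x = k 2 x) ∧ (k' 0 x = k' 1 x ∧ k' 1 x = k' 2 x)) ∨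
        ((k 0 x < k 1 x ∧ k 1 x < k 2 x) ∧ (k' 0 x < k' 1 x ∧ k' 1 x < k' 2 x))) ∧
      ∀ᶠ q in 𝓝 (x₀, y), (q ∈ A → ∃ j, q.2 = k j q.1 ∧ k' j q.1 = q.2) ∧
        (q ∈ B → ∃ j, q.2 = k j q.1 ∧ (q.1, k' j q.1) ∈ B'))
  rcases hy with hyA | hyB
  · obtain ⟨k₁, k₂, k₃, hc, hk0, hm, hl⟩ := h.weave.nodeA _ hyA
    obtain ⟨l₁, l₂, l₃, hc', hl0, hm', hl'⟩ := h.weave'.nodeA _ hyA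
    simp only at hc hk0 hm hc' hl0 hm'
    have hc0 := hc.self_of_nhds
    have hc0' := hc'.self_of_nhds
    -- Both nodes describe the same set `A` near the same point, so its lower and upper strands
    -- coincide.
    have hx : ∀ᶠ x in 𝓝 x₀, k₁ x = l₁ x ∧ k₃ x = l₃ x := by
      filter_upwards [hm, hm', along hl hc0'.1 hl0.1, along hl hc0'.2.2 hl0.2.2,
        along hl hc0.1 hk0.1, along hl hc0.2.2 hk0.2.2, along hl' hc0.1 hk0.1,
        along hl' hc0.2.2 hk0.2.2, along hl' hc0'.1 hl0.1, along hl' hc0'.2.2 hl0.2.2]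
        with x h1 h2 a1 a2 a3 a4 a5 a6 a7 a8
      have b1 := a1.1.1 (a7.1.2 (Or.inl rfl))
      have b2 := a2.1.1 (a8.1.2 (Or.inr rfl))
      have b3 := a5.1.1 (a3.1.2 (Or.inl rfl))
      have b4 := a6.1.1 (a4.1.2 (Or.inr rfl))
      have h1' : k₁ x ≤ k₃ x := by rcases h1 with h1 | h1 <;> linarith
      have h2' : l₁ x ≤ l₃ x := by rcases h2 with h2 | h2 <;> linarith
      constructor
      · rcases b1 with b1 | b1 <;> rcases b3 with b3 | b3 <;> linarith
      · rcases b2 with b2 | b2 <;> rcases b4 with b4 | b4 <;> linarith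
    have hpat : ∀ᶠ x in 𝓝 x₀, ((k₁ x = k₂ x ∧ k₂ x = k₃ x) ∧ (l₁ x = l₂ x ∧ l₂ x = l₃ x)) ∨
        ((k₁ x < k₂ x ∧ k₂ x < k₃ x) ∧ (l₁ x < l₂ x ∧ l₂ x < l₃ x)) := by
      filter_upwards [hm, hm', hx] with x h1 h2 h3
      rcases h1 with h1 | h1 <;> rcases h2 with h2 | h2
      · exact Or.inl ⟨h1, h2⟩
      · exfalso; linarith
      · exfalso; linarith
      · exact Or.inr ⟨h1, h2⟩
    refine pack k₁ k₂ k₃ l₁ l₂ l₃ (Or.inl ⟨hyA, rfl⟩) hc hc' hk0 hl0 hpat ?_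
    filter_upwards [hl, hfst hx, hfst hpat, hfst (along hl' hc0'.2.1 hl0.2.1)] with q h1 h2 h3 h4
    constructor
    · intro hq
      rcases h1.1.1 hq with h5 | h5
      · exact ⟨0, h5, h2.1.symm.trans h5.symm⟩
      · exact ⟨2, h5, h2.2.symm.trans h5.symm⟩
    · intro hq
      obtain ⟨h5, h6⟩ := h1.2.1 hq
      refine ⟨1, h5, h4.2.2 ⟨rfl, ?_⟩⟩
      rcases h3 with h3 | h3
      · exfalso; rw [h5] at h6; linarith
      · exact h3.2.1
  · by_cases hsp : (x₀, y) ∈ closure A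
    · have hyB' := (h.special _ hsp).1 hyB
      obtain ⟨k₁, k₂, k₃, hc, hk0, hm, hl⟩ := h.weave.nodeB _ hyB
      obtain ⟨l₁, l₂, l₃, hc', hl0, hm', hl'⟩ := h.weave'.nodeB _ hyB'
      simp only at hc hk0 hm hc' hl0 hm'
      have hc0 := hc.self_of_nhds
      have hc0' := hc'.self_of_nhds
      have hx : ∀ᶠ x in 𝓝 x₀, (k₁ x < k₂ x → k₂ x = l₂ x ∧ l₁ x < l₂ x) ∧
          (l₁ x < l₂ x → k₁ x < k₂ x) := by
        filter_upwards [along hl hc0.2.1 hk0.2.1, along hl hc0'.2.1 hl0.2.1,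
          along hl' hc0.2.1 hk0.2.1, along hl' hc0'.2.1 hl0.2.1] with x a1 a2 a3 a4
        constructor
        · intro hlt
          have := a3.2.1 (a1.2.2 ⟨rfl, hlt⟩)
          exact ⟨this.1, this.1 ▸ this.2⟩
        · intro hlt
          have := a2.2.1 (a4.2.2 ⟨rfl, hlt⟩)
          exact this.1 ▸ this.2
      have hpat : ∀ᶠ x in 𝓝 x₀, ((k₁ x = k₂ x ∧ k₂ x = k₃ x) ∧ (l₁ x = l₂ x ∧ l₂ x = l₃ x)) ∨
          ((k₁ x < k₂ x ∧ k₂ x < k₃ x) ∧ (l₁ x < l₂ x ∧ l₂ x < l₃ x)) := by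
        filter_upwards [hm, hm', hx] with x h1 h2 h3
        rcases h1 with h1 | h1 <;> rcases h2 with h2 | h2
        · exact Or.inl ⟨h1, h2⟩
        · exact absurd h1.1 (h3.2 h2.1).ne
        · exact absurd h2.1 (h3.1 h1.1).2.ne
        · exact Or.inr ⟨h1, h2⟩
      refine pack k₁ k₂ k₃ l₁ l₂ l₃ (Or.inr ⟨hyB, hyB', fun a _ => Iff.rfl⟩) hc hc' hk0 hl0 hpat ?_
      filter_upwards [hl, hfst hx, hfst (along hl' hc0'.1 hl0.1),
        hfst (along hl' hc0'.2.2 hl0.2.2)] with q h1 h2 h3 h4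
      constructor
      · intro hq
        obtain ⟨h5, h6⟩ := h1.2.1 hq
        rw [h5] at h6
        exact ⟨1, h5, (h2.1 h6).1.symm.trans h5.symm⟩
      · intro hq
        rcases h1.1.1 hq with h5 | h5
        · exact ⟨0, h5, h3.1.2 (Or.inl rfl)⟩
        · exact ⟨2, h5, h4.1.2 (Or.inr rfl)⟩
    · obtain ⟨y', hyB', hcut⟩ := h.weave.exists_sameCut h.weave' (h.sepA' x₀) (h.low x₀).1
        (h.top x₀).1 hyB
      -- Were the partner in the closure of `A`, it would also belong to `B`; uniqueness of the cut
      -- would identify it with `y`, which is not in that closure.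
      have hsp' : (x₀, y') ∉ closure A := by
        intro hsp'
        have h1 := (h.special _ hsp').2 hyB'
        have h2 := h.weave.sameCut_unique (h.sepB x₀) hyB h1 hcut
        exact hsp (h2 ▸ hsp')
      obtain ⟨k₁, k₂, k₃, hc, hk0, hm, hl⟩ := h.weave.nodeB _ hyB
      obtain ⟨l₁, l₂, l₃, hc', hl0, hm', hl'⟩ := h.weave'.nodeB _ hyB'
      simp only at hc hk0 hm hc' hl0 hm'
      have hc0 := hc.self_of_nhds
      have hc0' := hc'.self_of_nhds
      have hA : ∀ᶠ q in 𝓝 (x₀, y), q ∉ A := by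
        have : ∀ᶠ q in 𝓝 (x₀, y), q ∈ (closure A)ᶜ := isClosed_closure.isOpen_compl.mem_nhds hsp
        exact this.mono fun q hq hqA => hq (subset_closure hqA)
      have hA' : ∀ᶠ q in 𝓝 (x₀, y'), q ∉ A := by
        have : ∀ᶠ q in 𝓝 (x₀, y'), q ∈ (closure A)ᶜ := isClosed_closure.isOpen_compl.mem_nhds hsp'
        exact this.mono fun q hq hqA => hq (subset_closure hqA)
      -- A triple of distinct values would have a point of `A` in its middle, but there is no point
      -- of `A` nearby.
      have hpat : ∀ᶠ x in 𝓝 x₀, ((k₁ x = k₂ x ∧ k₂ x = k₃ x) ∧ (l₁ x = l₂ x ∧ l₂ x = l₃ x)) ∨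
          ((k₁ x < k₂ x ∧ k₂ x < k₃ x) ∧ (l₁ x < l₂ x ∧ l₂ x < l₃ x)) := by
        filter_upwards [hm, hm', along hl hc0.2.1 hk0.2.1, along hl' hc0'.2.1 hl0.2.1,
          eventually_mk hc0.2.1 hk0.2.1 hA, eventually_mk hc0'.2.1 hl0.2.1 hA']
          with x h1 h2 h3 h4 h5 h6
        refine Or.inl ⟨h1.resolve_right fun h7 => h5 (h3.2.2 ⟨rfl, h7.1⟩),
          h2.resolve_right fun h7 => h6 (h4.2.2 ⟨rfl, h7.1⟩)⟩
      refine pack k₁ k₂ k₃ l₁ l₂ l₃ (Or.inr ⟨hyB, hyB', hcut⟩) hc hc' hk0 hl0 hpat ?_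
      filter_upwards [hl, hA, hfst (along hl' hc0'.1 hl0.1),
        hfst (along hl' hc0'.2.2 hl0.2.2)] with q h1 h2 h3 h4
      refine ⟨fun hq => absurd hq h2, fun hq => ?_⟩
      rcases h1.1.1 hq with h5 | h5
      · exact ⟨0, h5, h3.1.2 (Or.inl rfl)⟩
      · exact ⟨2, h5, h4.1.2 (Or.inr rfl)⟩

end Matching

theorem Set.Finite.exists_enum {S : Set ℝ} (hS : S.Finite) (hne : S.Nonempty) :
    ∃ (m : ℕ) (u : ℕ → ℝ), (∀ i, u i ∈ S) ∧ (∀ i < m, u i < u (i + 1)) ∧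
      ∀ y ∈ S, ∃ i ≤ m, u i = y := by
  classical
  have hcard : 0 < hS.toFinset.card := Finset.card_pos.2 (by simpa using hne)
  obtain ⟨m, hm⟩ : ∃ m, hS.toFinset.card = m + 1 := ⟨_, (Nat.succ_pred_eq_of_pos hcard).symm⟩
  let e := hS.toFinset.orderEmbOfFin hm
  refine ⟨m, fun i => e ⟨min i m, by omega⟩, fun i => ?_, fun i hi => ?_, fun y hy => ?_⟩
  · exact hS.mem_toFinset.1 (Finset.orderEmbOfFin_mem _ hm _)
  · refine e.strictMono ?_
    rw [Fin.mk_lt_mk]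
    omega
  · have : y ∈ Set.range e := by
      rw [Finset.range_orderEmbOfFin]
      exact hS.mem_toFinset.2 hy
    obtain ⟨⟨i, hi⟩, rfl⟩ := this
    have : min i m = i := by omega
    exact ⟨i, by omega, by simp [this]⟩

namespace Matching

variable {A B B' : Set (ℝ × ℝ)} (h : Matching A B B')
include h

omit h in
theorem _root_.VerticalPlane.IsHeight.lt_iff {F : ℝ × ℝ → ℝ} {x y z : ℝ}
    (hF : stdPlane.IsHeight F x) : F (x, y) < F (x, z) ↔ y < z := by
  have key : ∀ {y z : ℝ}, y < z → F (x, y) < F (x, z) := fun {y z} hyz =>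
    hF.lt_of_below (x, y) (x, z) rfl ⟨rfl, hyz⟩
  refine ⟨fun hlt => ?_, key⟩
  by_contra hcon
  rcases (not_lt.1 hcon).eq_or_lt with rfl | h1
  · exact lt_irrefl _ hlt
  · exact absurd (key h1) hlt.not_gt

/-- The nodes over `x₀`, listed upwards, contribute three graphs each. Inside a node `exists_pair`
ensures equal coincidences of sources and targets; between consecutive nodes the order is strict for
both, since partners keep their order. -/
theorem exists_local (x₀ : ℝ) : ∃ F : C(ℝ × ℝ, ℝ), ∀ᶠ x in 𝓝 x₀, stdPlane.IsHeight F x ∧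
    (∀ a, (x, a) ∈ A → F (x, a) = a) ∧ ∀ b, (x, b) ∈ B → (x, F (x, b)) ∈ B' := by
  have hfin := h.weave.fib x₀
  by_cases hne : {y | (x₀, y) ∈ A ∪ B}.Nonempty
  · obtain ⟨m, u, hu, hlt, hsurj⟩ := hfin.exists_enum hne
    choose y' k k' hP hk hk' hk0 hk0' hpat hloc using fun i => h.exists_pair (hu i)
    have hmod : ∀ n : ℕ, n % 3 < 3 := fun n => Nat.mod_lt _ (by norm_num)
    -- The index `3 * i + r` stands for the graph number `r` of the node number `i`, so the last
    -- index is `3 * m + 2`.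
    obtain ⟨F, hF⟩ := exists_interpolation (N := 3 * m + 2) (x₀ := x₀)
      (k := fun n => k (n / 3) ⟨n % 3, hmod n⟩) (k' := fun n => k' (n / 3) ⟨n % 3, hmod n⟩)
      (fun n => hk _ _) (fun n => hk' _ _) (by
        intro j hj
        obtain ⟨i, r, hr, rfl⟩ : ∃ i r, r < 3 ∧ j = 3 * i + r :=
          ⟨j / 3, j % 3, hmod j, (Nat.div_add_mod j 3).symm⟩
        interval_cases r
        · have e1 : (3 * i + 0) / 3 = i := by omega
          have e2 : (3 * i + 0 + 1) / 3 = i := by omega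
          have e3 : (3 * i + 0) % 3 = 0 := by omega
          have e4 : (3 * i + 0 + 1) % 3 = 1 := by omega
          simp only [e1, e2, e3, e4]
          filter_upwards [hpat i] with x hx
          rcases hx with hx | hx
          · exact Or.inl ⟨hx.1.1, hx.2.1⟩
          · exact Or.inr ⟨hx.1.1, hx.2.1⟩
        · have e1 : (3 * i + 1) / 3 = i := by omega
          have e2 : (3 * i + 1 + 1) / 3 = i := by omega
          have e3 : (3 * i + 1) % 3 = 1 := by omega
          have e4 : (3 * i + 1 + 1) % 3 = 2 := by omega
          simp only [e1, e2, e3, e4]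
          filter_upwards [hpat i] with x hx
          rcases hx with hx | hx
          · exact Or.inl ⟨hx.1.2, hx.2.2⟩
          · exact Or.inr ⟨hx.1.2, hx.2.2⟩
        · have e1 : (3 * i + 2) / 3 = i := by omega
          have e2 : (3 * i + 2 + 1) / 3 = i + 1 := by omega
          have e3 : (3 * i + 2) % 3 = 2 := by omega
          have e4 : (3 * i + 2 + 1) % 3 = 0 := by omega
          simp only [e1, e2, e3, e4]
          have hi := hlt i (by omega)
          have h1 : k i ⟨2, by norm_num⟩ x₀ < k (i + 1) ⟨0, by norm_num⟩ x₀ := by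
            rw [hk0, hk0]; exact hi
          have h2 : k' i ⟨2, by norm_num⟩ x₀ < k' (i + 1) ⟨0, by norm_num⟩ x₀ := by
            rw [hk0', hk0']; exact h.partner_lt (hP i) (hP (i + 1)) hi
          filter_upwards [(hk i _).self_of_nhds.eventually_lt (hk (i + 1) _).self_of_nhds h1,
            (hk' i _).self_of_nhds.eventually_lt (hk' (i + 1) _).self_of_nhds h2] with x h3 h4
          exact Or.inr ⟨h3, h4⟩)
    refine ⟨F, ?_⟩
    have hsub := eventually_fibre_subset h.weave.closed (h.weave.bdd x₀)
      (Q := fun q => ∃ i ≤ m, (q ∈ A → ∃ j, q.2 = k i j q.1 ∧ k' i j q.1 = q.2) ∧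
        (q ∈ B → ∃ j, q.2 = k i j q.1 ∧ (q.1, k' i j q.1) ∈ B')) (by
        intro z hz
        obtain ⟨i, hi, rfl⟩ := hsurj z hz
        exact (hloc i).mono fun q hq => ⟨i, hi, hq⟩)
    filter_upwards [hF, hsub] with x hx hx'
    have hval : ∀ i ≤ m, ∀ j : Fin 3, F (x, k i j x) = k' i j x := by
      intro i hi j
      have := hx.2 (3 * i + j) (by omega)
      have e1 : (3 * i + (j : ℕ)) / 3 = i := by omega
      have e2 : (3 * i + (j : ℕ)) % 3 = j := by omega
      simpa only [e1, e2] using this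
    refine ⟨hx.1, fun a ha => ?_, fun b hb => ?_⟩
    · obtain ⟨i, hi, h1, -⟩ := hx' a (Or.inl ha)
      obtain ⟨j, h2, h3⟩ := h1 ha
      have := hval i hi j
      rw [← h2, h3] at this
      exact this
    · obtain ⟨i, hi, -, h1⟩ := hx' b (Or.inr hb)
      obtain ⟨j, h2, h3⟩ := h1 hb
      have := hval i hi j
      rw [← h2] at this
      rw [this]
      exact h3
  · refine ⟨⟨Prod.snd, continuous_snd⟩, ?_⟩
    have hsub := eventually_fibre_subset h.weave.closed (h.weave.bdd x₀) (Q := fun q => False)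
      fun z hz => absurd ⟨z, hz⟩ hne
    filter_upwards [hsub] with x hx
    exact ⟨⟨fun p q _ hpq => hpq.2, fun c => ⟨(x, c), rfl, le_rfl⟩, fun c => ⟨(x, c), rfl, le_rfl⟩⟩,
      fun a ha => (hx a (Or.inl ha)).elim, fun b hb => (hx b (Or.inr hb)).elim⟩

/-- The condition to be glued prescribes the value of `F` at each point of `B` as its partner. Mere
membership of the image in `B'` would not be a convex condition. -/
theorem exists_verticalEquiv : ∃ Ψ : VerticalEquiv stdPlane stdPlane,
    (∀ p, (Ψ.toHomeo p).1 = p.1) ∧ (∀ p ∈ A, Ψ.toHomeo p = p) ∧ Ψ.toHomeo '' B = B' := by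
  obtain ⟨F, hF⟩ := stdPlane.exists_continuousMap_of_local
    (t := fun x => {F | stdPlane.IsHeight F x ∧ (∀ a, (x, a) ∈ A → F (x, a) = a) ∧
      ∀ b b', (x, b) ∈ B → (x, b') ∈ B' → SameCut A x b b' → F (x, b) = b'})
    (by
      intro x F hF F' hF' s t hs ht hst
      refine ⟨stdPlane.convex_isHeight x hF.1 hF'.1 hs ht hst, fun a ha => ?_,
        fun b b' hb hb' hc => ?_⟩
      · have h1 := hF.2.1 a ha
        have h2 := hF'.2.1 a ha
        simp only [ContinuousMap.add_apply, ContinuousMap.smul_apply, smul_eq_mul, h1, h2]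
        rw [← add_mul, hst, one_mul]
      · have h1 := hF.2.2 b b' hb hb' hc
        have h2 := hF'.2.2 b b' hb hb' hc
        simp only [ContinuousMap.add_apply, ContinuousMap.smul_apply, smul_eq_mul, h1, h2]
        rw [← add_mul, hst, one_mul])
    (by
      intro x F hF F' hFF
      have e : ∀ y, F' (x, y) = F (x, y) := fun y => hFF (x, y) rfl
      refine ⟨⟨fun p q hp hpq => ?_, fun c => ?_, fun c => ?_⟩, fun a ha => ?_,
        fun b b' hb hb' hc => ?_⟩
      · rw [hFF p hp, hFF q (hpq.proj_eq.trans hp)]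
        exact hF.1.lt_of_below p q hp hpq
      · obtain ⟨p, hp, hpc⟩ := hF.1.exists_le c
        exact ⟨p, hp, (hFF p hp).trans_le hpc⟩
      · obtain ⟨p, hp, hpc⟩ := hF.1.exists_ge c
        exact ⟨p, hp, hpc.trans_eq (hFF p hp).symm⟩
      · rw [e, hF.2.1 a ha]
      · rw [e, hF.2.2 b b' hb hb' hc])
    (by
      intro x₀
      obtain ⟨F, hF⟩ := h.exists_local x₀
      refine ⟨F, hF.mono fun x hx => ⟨hx.1, hx.2.1, fun b b' hb hb' hc => ?_⟩⟩
      -- The local solution sends `b` to some point of `B'`. Being increasing and the identity on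
      -- `A`, it preserves the cut of `A`, so that point is the prescribed one.
      refine h.weave'.sameCut_unique (h.sepB' x) (hx.2.2 b hb) hb' fun a ha => ?_
      rw [← hc a ha]
      conv_lhs => rw [← hx.2.1 a ha]
      exact hx.1.lt_iff)
  refine ⟨stdPlane.coordEquiv (fun x => (hF x).1) F.continuous, fun p => ?_, fun p hp => ?_, ?_⟩
  · rw [VerticalPlane.coordEquiv_apply]; rfl
  · rw [VerticalPlane.coordEquiv_apply]
    exact Prod.ext rfl ((hF p.1).2.1 p.2 hp)
  · ext ⟨x, b'⟩
    constructor
    · rintro ⟨⟨x', b⟩, hb, he⟩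
      rw [VerticalPlane.coordEquiv_apply, Prod.ext_iff] at he
      obtain ⟨rfl, rfl⟩ : x' = x ∧ F (x', b) = b' := he
      obtain ⟨b', hb', hc⟩ := h.weave.exists_sameCut h.weave' (h.sepA' x') (h.low x').1 (h.top x').1 hb
      rwa [(hF x').2.2 b b' hb hb' hc]
    · intro hb'
      obtain ⟨b, hb, hc⟩ := h.weave'.exists_sameCut h.weave (h.sepA x) (h.low x).2 (h.top x).2 hb'
      refine ⟨(x, b), hb, ?_⟩
      rw [VerticalPlane.coordEquiv_apply]
      exact Prod.ext rfl ((hF x).2.2 b b' hb hb' fun a ha => (hc a ha).symm)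

end Matching

/-! ### Trident completions as interlaced pairs -/

namespace Side

theorem eventually_nhds (s : Side) {a : ℝ} {Q : ℝ → Prop} (h0 : Q a)
    (h1 : ∀ᶠ x in 𝓝[s.ray a] a, Q x) (h2 : ∀ᶠ x in 𝓝[s.flip.ray a] a, Q x) :
    ∀ᶠ x in 𝓝 a, Q x := by
  filter_upwards [eventually_nhdsWithin_iff.1 h1, eventually_nhdsWithin_iff.1 h2] with x h3 h4
  rcases s.past_trichotomy a x with h | rfl | h
  exacts [h3 h, h0, h4 h]

theorem flip_past_irrefl {s : Side} {a b : ℝ} (h : s.Past a b) : ¬ s.flip.Past a b :=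
  fun h' => s.past_irrefl a (h.trans (flip_past.1 h'))

/-- Two functions on the two sides of a point, with the same limit, glue. -/
theorem exists_glue (s : Side) {v : ℝ × ℝ} {a b : ℝ → ℝ}
    (ha : ∀ᶠ x in 𝓝[s.ray v.1] v.1, ContinuousAt a x) (ha' : Tendsto a (𝓝[s.ray v.1] v.1) (𝓝 v.2))
    (hb : ∀ᶠ x in 𝓝[s.flip.ray v.1] v.1, ContinuousAt b x)
    (hb' : Tendsto b (𝓝[s.flip.ray v.1] v.1) (𝓝 v.2)) :
    ∃ k : ℝ → ℝ, (∀ᶠ x in 𝓝 v.1, ContinuousAt k x) ∧ k v.1 = v.2 ∧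
      (∀ x, s.Past v.1 x → k x = a x) ∧ ∀ x, s.flip.Past v.1 x → k x = b x := by
  classical
  let k : ℝ → ℝ := fun x => if s.Past v.1 x then a x else if s.flip.Past v.1 x then b x else v.2
  have k1 : ∀ x, s.Past v.1 x → k x = a x := fun x hx => if_pos hx
  have k2 : ∀ x, s.flip.Past v.1 x → k x = b x := fun x hx => by
    have : ¬ s.Past v.1 x := fun h => flip_past_irrefl h hx
    simp only [k, this, hx, if_true, if_false]
  have k0 : k v.1 = v.2 := by simp only [k, s.past_irrefl, s.flip.past_irrefl, if_false]
  refine ⟨k, s.eventually_nhds ?_ ?_ ?_, k0, k1, k2⟩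
  · rw [ContinuousAt, k0, tendsto_def]
    intro W hW
    refine s.eventually_nhds (Q := fun x => k x ∈ W) ?_ ?_ ?_
    · rw [k0]; exact mem_of_mem_nhds hW
    · filter_upwards [ha'.eventually hW, self_mem_nhdsWithin] with x hx hx'
      rwa [k1 x hx']
    · filter_upwards [hb'.eventually hW, self_mem_nhdsWithin] with x hx hx'
      rwa [k2 x hx']
  · filter_upwards [ha, self_mem_nhdsWithin] with x hx hx'
    refine hx.congr ?_
    filter_upwards [(s.isOpen_ray v.1).mem_nhds hx'] with y hy
    exact (k1 y hy).symm
  · filter_upwards [hb, self_mem_nhdsWithin] with x hx hx'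
    refine hx.congr ?_
    filter_upwards [(s.flip.isOpen_ray v.1).mem_nhds hx'] with y hy
    exact (k2 y hy).symm

end Side

/-- The vertices from which no edge starts in one of the two directions. -/
def EnrichedGraph.extVertices (G : EnrichedGraph (ℝ × ℝ)) : Set (ℝ × ℝ) :=
  {v ∈ G.vertices | ∃ s, stdPlane.edgesFrom G s v = ∅}

/-- The edges of a graph, together with the vertices that have edges on both sides. -/
def EnrichedGraph.strands (G : EnrichedGraph (ℝ × ℝ)) : Set (ℝ × ℝ) := G.carrier \ G.extVertices

section

variable {G H : EnrichedGraph (ℝ × ℝ)}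

theorem eventually_notMem_finite {V : Set (ℝ × ℝ)} (hV : V.Finite) (v : ℝ × ℝ) :
    ∀ᶠ q in 𝓝 v, q ∈ V → q = v := by
  have h1 : ∀ᶠ q in 𝓝 v, q ∉ V \ {v} :=
    (hV.subset sdiff_subset).isClosed.isOpen_compl.mem_nhds fun h => h.2 rfl
  exact h1.mono fun q hq hqV => by_contra fun hne => hq ⟨hqV, hne⟩

/-- The lower, middle and upper graphs are `F₁`, `E` and `F₂`, each continued on the other side by
`F₀`. There and at `v` the three coincide, so that only points of `H` are counted, in accordance
with the deletion of the exterior vertex `v` from `G`. -/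
theorem VerticalPlane.Trident.node {s : Side} {v : ℝ × ℝ} (h : stdPlane.Trident G H s v)
    (hG : GraphLike G.carrier G.vertices) (hH : GraphLike H.carrier H.vertices)
    (hvG : v ∈ G.vertices) (hvH : v ∈ H.vertices) :
    v ∈ G.extVertices ∧ v ∉ H.extVertices ∧ v ∈ closure G.strands ∧
      Node H.strands G.strands v := by
  obtain ⟨E, F₀, F₁, F₂, hE, hE0, hF0, hF, hF1E, hEF2⟩ := h
  have mE : E ∈ stdPlane.edgesFrom G s v := hE ▸ rfl
  have m0 : F₀ ∈ stdPlane.edgesFrom H s.flip v := hF0 ▸ rfl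
  have m1 : F₁ ∈ stdPlane.edgesFrom H s v := hF ▸ Or.inl rfl
  have m2 : F₂ ∈ stdPlane.edgesFrom H s v := hF ▸ Or.inr rfl
  have hGext : v ∈ G.extVertices := ⟨hvG, s.flip, hE0⟩
  have hHext : v ∉ H.extVertices := by
    rintro ⟨-, t, ht⟩
    have : t = s ∨ t = s.flip := by cases t <;> cases s <;> simp [Side.flip]
    rcases this with rfl | rfl
    · rw [ht] at m1; exact m1
    · rw [ht] at m0; exact m0
  have hEs : E ⊆ G.strands := fun q hq => ⟨(EnrichedGraph.subset_of_mem_openEdges mE.1 hq).1,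
    fun h => (EnrichedGraph.subset_of_mem_openEdges mE.1 hq).2 h.1⟩
  refine ⟨hGext, hHext, closure_mono hEs mE.2.1, ?_⟩
  obtain ⟨I, g, hI, hIr, hIe, hIt⟩ := hG.exists_edgeData_of_mem_edgesFrom mE
  obtain ⟨J₀, f₀, hJ₀, hJ₀r, hJ₀e, hJ₀t⟩ := hH.exists_edgeData_of_mem_edgesFrom m0
  obtain ⟨J₁, f₁, hJ₁, hJ₁r, hJ₁e, hJ₁t⟩ := hH.exists_edgeData_of_mem_edgesFrom m1
  obtain ⟨J₂, f₂, hJ₂, hJ₂r, hJ₂e, hJ₂t⟩ := hH.exists_edgeData_of_mem_edgesFrom m2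
  have hlt1 := (belowAlong_nhds hH hG m1 mE (hJ₁e.mono fun x hx => hJ₁.mk_mem hx)
    (hIe.mono fun x hx => hI.mk_mem hx)).1 hF1E
  have hlt2 := (belowAlong_nhds hG hH mE m2 (hIe.mono fun x hx => hI.mk_mem hx)
    (hJ₂e.mono fun x hx => hJ₂.mk_mem hx)).1 hEF2
  have cont : ∀ {t : Side} {K V E : Set (ℝ × ℝ)} {I : Set ℝ} {f : ℝ → ℝ}, EdgeData K V E I f →
      (∀ᶠ x in 𝓝[t.ray v.1] v.1, x ∈ I) → ∀ᶠ x in 𝓝[t.ray v.1] v.1, ContinuousAt f x :=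
    fun hI h => h.mono fun x hx => hI.cont.continuousAt (hI.isOpen.mem_nhds hx)
  obtain ⟨k₁, hk₁, hk₁0, hk₁s, hk₁f⟩ := s.exists_glue (cont hJ₁ hJ₁e) hJ₁t (cont hJ₀ hJ₀e) hJ₀t
  obtain ⟨k₂, hk₂, hk₂0, hk₂s, hk₂f⟩ := s.exists_glue (cont hI hIe) hIt (cont hJ₀ hJ₀e) hJ₀t
  obtain ⟨k₃, hk₃, hk₃0, hk₃s, hk₃f⟩ := s.exists_glue (cont hJ₂ hJ₂e) hJ₂t (cont hJ₀ hJ₀e) hJ₀t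
  refine ⟨k₁, k₂, k₃, hk₁.and (hk₂.and hk₃), ⟨hk₁0, hk₂0, hk₃0⟩, ?_, ?_⟩
  · refine s.eventually_nhds (Or.inl ⟨hk₁0.trans hk₂0.symm, hk₂0.trans hk₃0.symm⟩) ?_ ?_
    · filter_upwards [hlt1, hlt2, self_mem_nhdsWithin] with x h1 h2 h3
      rw [hk₁s x h3, hk₂s x h3, hk₃s x h3]
      exact Or.inr ⟨h1, h2⟩
    · filter_upwards [self_mem_nhdsWithin] with x h3
      rw [hk₁f x h3, hk₂f x h3, hk₃f x h3]
      exact Or.inl ⟨rfl, rfl⟩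
  have fs : ∀ {Q : ℝ → Prop} {t : Side}, (∀ᶠ x in 𝓝[t.ray v.1] v.1, Q x) →
      ∀ᶠ q : ℝ × ℝ in 𝓝 v, t.Past v.1 q.1 → Q q.1 := fun h =>
    continuousAt_fst.eventually (eventually_nhdsWithin_iff.1 h)
  filter_upwards [hG.eventually_mem_edgesFrom s hvG, hG.eventually_mem_edgesFrom s.flip hvG,
    hH.eventually_mem_edgesFrom s hvH, hH.eventually_mem_edgesFrom s.flip hvH,
    eventually_notMem_finite hG.finite v, eventually_notMem_finite hH.finite v,
    hG.eventually_eq_of_fst_eq v, hH.eventually_eq_of_fst_eq v,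
    fs hIe, fs hJ₀e, fs hJ₁e, fs hJ₂e, fs hlt1, fs hlt2]
    with q a1 a2 a3 a4 a5 a6 a7 a8 b1 b2 b3 b4 b5 b6
  have sH : q ∈ H.strands ↔ q ∈ H.carrier := by
    refine ⟨fun h => h.1, fun h => ⟨h, fun h' => ?_⟩⟩
    rw [a6 h'.1] at h'
    exact hHext h'
  have sG : q ∈ G.strands ↔ q ∈ G.carrier ∧ q ≠ v := by
    refine ⟨fun h => ⟨h.1, fun h' => h.2 (h' ▸ hGext)⟩, fun h => ⟨h.1, fun h' => h.2 (a5 h'.1)⟩⟩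
  rw [sH, sG]
  rcases s.past_trichotomy v.1 q.1 with hq | hq | hq
  · rw [hk₁s _ hq, hk₂s _ hq, hk₃s _ hq]
    refine ⟨⟨fun h => ?_, ?_⟩, ⟨fun h => ?_, fun h => ?_⟩⟩
    · obtain ⟨F, hF', hqF⟩ := a3 h hq
      rw [hF] at hF'
      rcases hF' with rfl | rfl
      · exact Or.inl (hJ₁.mem_iff.1 hqF).2
      · exact Or.inr (hJ₂.mem_iff.1 hqF).2
    · rintro (h | h)
      · exact (hJ₁.subset (hJ₁.mem_iff.2 ⟨b3 hq, h⟩)).1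
      · exact (hJ₂.subset (hJ₂.mem_iff.2 ⟨b4 hq, h⟩)).1
    · obtain ⟨F, hF', hqF⟩ := a1 h.1 hq
      rw [hE] at hF'
      obtain rfl : F = E := hF'
      have := (hI.mem_iff.1 hqF).2
      exact ⟨this, this ▸ b5 hq⟩
    · refine ⟨(hI.subset (hI.mem_iff.2 ⟨b1 hq, h.1⟩)).1, fun h' => s.past_irrefl v.1 ?_⟩
      rwa [h'] at hq
  · have hk : ∀ {k : ℝ → ℝ}, k v.1 = v.2 → (q.2 = k q.1 ↔ q = v) := fun {k} hk => by
      rw [← hq, hk]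
      exact ⟨fun h => Prod.ext hq.symm h, fun h => by rw [h]⟩
    rw [hk hk₁0, hk hk₂0, hk hk₃0, or_self]
    refine ⟨⟨fun h => a8 h hq.symm, fun h => h ▸ hH.subset hvH⟩,
      ⟨fun h => absurd (a7 h.1 hq.symm) h.2, fun h => ?_⟩⟩
    rw [h.1, hk₁0] at h
    exact absurd h.2 (lt_irrefl _)
  · rw [hk₁f _ hq, hk₂f _ hq, hk₃f _ hq, or_self]
    refine ⟨⟨fun h => ?_, fun h => (hJ₀.subset (hJ₀.mem_iff.2 ⟨b2 hq, h⟩)).1⟩,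
      ⟨fun h => ?_, fun h => ?_⟩⟩
    · obtain ⟨F, hF', hqF⟩ := a4 h hq
      rw [hF0] at hF'
      obtain rfl : F = F₀ := hF'
      exact (hJ₀.mem_iff.1 hqF).2
    · obtain ⟨F, hF', hqF⟩ := a2 h.1 hq
      rw [hE0] at hF'
      exact hF'.elim
    · exact absurd h.1 h.2.ne'

theorem GraphLike.node (hG : GraphLike G.carrier G.vertices) (hH : IsClosed H.carrier)
    {p : ℝ × ℝ} (hp : p ∈ G.carrier \ G.vertices) (hpH : p ∉ H.carrier) :
    Node G.strands H.strands p := by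
  obtain ⟨f, hf, hl⟩ := hG.loc p hp
  have h0 : f p.1 = p.2 := (hl.self_of_nhds.1 hp.1).symm
  refine ⟨f, f, f, hf.mono fun x hx => ⟨hx, hx, hx⟩, ⟨h0, h0, h0⟩,
    Eventually.of_forall fun x => Or.inl ⟨rfl, rfl⟩, ?_⟩
  have h1 : ∀ᶠ q in 𝓝 p, q ∈ H.carrierᶜ := hH.isOpen_compl.mem_nhds hpH
  have h2 : ∀ᶠ q in 𝓝 p, q ∈ G.verticesᶜ := hG.finite.isClosed.isOpen_compl.mem_nhds hp.2
  filter_upwards [hl, h1, h2] with q h3 h4 h5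
  rw [or_self, ← h3]
  exact ⟨⟨fun h => h.1, fun h => ⟨h, fun h' => h5 h'.1⟩⟩,
    ⟨fun h => absurd h.1 h4, fun h => absurd (h3.1 h.1) h.2.ne'⟩⟩

namespace VerticalPlane.IsTridentCompletion

theorem symm {P : Type*} [TopologicalSpace P] {A : VerticalPlane P} {G H : EnrichedGraph P}
    (hG : A.IsTransversalGraph G) (h : A.IsTridentCompletion G H) : A.IsTridentCompletion H G where
  transversal := hG
  vertices_eq := h.vertices_eq.symm
  inter_subset := by
    rw [inter_comm, h.vertices_eq]
    exact h.inter_subset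
  trident v hv := by
    obtain ⟨s, hs⟩ := h.trident v (h.vertices_eq ▸ hv)
    exact ⟨s, hs.symm⟩
  arrow s := (h.arrow s).symm

variable (hG : stdPlane.IsTransversalGraph G) (h : stdPlane.IsTridentCompletion G H)
include hG h

theorem mem_extVertices_iff {v : ℝ × ℝ} (hv : v ∈ G.vertices) :
    v ∈ G.extVertices ↔ v ∉ H.extVertices := by
  have hvH : v ∈ H.vertices := h.vertices_eq ▸ hv
  obtain ⟨s, hs | hs⟩ := h.trident v hv
  · have := hs.node hG.graphLike h.transversal.graphLike hv hvH
    exact ⟨fun _ => this.2.1, fun _ => this.1⟩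
  · have := hs.node h.transversal.graphLike hG.graphLike hvH hv
    exact ⟨fun h1 => absurd h1 this.2.1, fun h1 => absurd this.1 h1⟩

theorem node {p : ℝ × ℝ} (hp : p ∈ G.strands) : Node G.strands H.strands p := by
  by_cases hpV : p ∈ G.vertices
  · have hvH : p ∈ H.vertices := h.vertices_eq ▸ hpV
    obtain ⟨s, hs | hs⟩ := h.trident p hpV
    · exact absurd (hs.node hG.graphLike h.transversal.graphLike hpV hvH).1 hp.2
    · exact (hs.node h.transversal.graphLike hG.graphLike hvH hpV).2.2.2
  · exact hG.graphLike.node h.transversal.closed ⟨hp.1, hpV⟩ fun hpH =>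
      hpV (h.inter_subset ⟨hp.1, hpH⟩)

theorem strands_union : G.strands ∪ H.strands = G.carrier ∪ H.carrier := by
  refine Subset.antisymm (union_subset_union sdiff_subset sdiff_subset) ?_
  have key : ∀ v ∈ G.vertices, v ∈ G.strands ∪ H.strands := fun v hv => by
    by_cases hx : v ∈ G.extVertices
    · exact Or.inr ⟨h.transversal.vertices_subset (h.vertices_eq ▸ hv),
        (h.mem_extVertices_iff hG hv).1 hx⟩
    · exact Or.inl ⟨hG.vertices_subset hv, hx⟩
  rintro p (hp | hp)
  · by_cases hx : p ∈ G.extVertices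
    · exact key p hx.1
    · exact Or.inl ⟨hp, hx⟩
  · by_cases hx : p ∈ H.extVertices
    · exact key p (h.vertices_eq ▸ hx.1)
    · exact Or.inr ⟨hp, hx⟩

/-- The trident rule makes every common vertex exterior for exactly one of the graphs. Deleting
exterior vertices therefore makes the graphs disjoint without changing their union. -/
theorem weave : Weave G.strands H.strands where
  disj := disjoint_left.2 fun p hp hp' => by
    have hpV := h.inter_subset ⟨hp.1, hp'.1⟩
    exact hp.2 ((h.mem_extVertices_iff hG hpV).2 hp'.2)
  closed := by
    rw [h.strands_union hG]
    exact hG.closed.union h.transversal.closed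
  fib x := by
    rw [h.strands_union hG]
    exact (hG.graphLike.fib x).union (h.transversal.graphLike.fib x)
  bdd x := by
    rw [h.strands_union hG]
    obtain ⟨R, hR⟩ := hG.graphLike.bdd x
    obtain ⟨R', hR'⟩ := h.transversal.graphLike.bdd x
    refine ⟨max R R', ?_⟩
    filter_upwards [hR, hR'] with x' h1 h2 y hy
    rcases hy with hy | hy
    · exact (h1 y hy).trans (le_max_left _ _)
    · exact (h2 y hy).trans (le_max_right _ _)
  nodeA p hp := h.node hG hp
  nodeB p hp := (h.symm hG).node h.transversal hp

theorem fibreRule {s : Side} {x : ℝ} (hx : Beyond G.vertices s x) :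
    FibreRule G H x ∧ FibreRule H G x := by
  have hx' : Beyond H.vertices s x := h.vertices_eq ▸ hx
  exact ⟨(hG.graphLike.arrowRule_iff h.transversal.graphLike hx hx' h.inter_subset).1 (h.arrow s).1,
    (h.transversal.graphLike.arrowRule_iff hG.graphLike hx' hx (h.symm hG).inter_subset).1
      (h.arrow s).2⟩

omit hG h in
theorem _root_.Beyond.notMem {V : Set (ℝ × ℝ)} {s : Side} {x : ℝ} (hx : Beyond V s x) (y : ℝ) :
    (x, y) ∉ V := fun hV => s.past_irrefl x (hx _ hV)

/-- It suffices to look beyond the vertices. There an arrow of `G` with another one above it has no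
upward feather, so the arrow rule puts an arrow of `H` next above it. -/
theorem sepAt (x : ℝ) : SepAt G.strands H.strands x := by
  obtain ⟨x₁, hx₁⟩ := exists_beyond hG.vertices_finite Side.left
  refine ((h.weave hG).const x x₁).1.2 fun y z hyz hy hz => ?_
  obtain ⟨E, hE, hyE⟩ := EnrichedGraph.exists_mem_openEdges ⟨hy.1, hx₁.notMem y⟩
  obtain ⟨h1, h2, -⟩ := (h.fibreRule hG hx₁).1 E hE y hyE
  obtain ⟨w, hw, hyw, hnot⟩ := h1 fun hup => h2 hup z (Or.inl hz.1) hyz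
  refine ⟨w, hyw, ?_, ?_⟩
  · refine lt_of_le_of_ne (not_lt.1 fun h3 => hnot z (Or.inl hz.1) ⟨hyz, h3⟩) ?_
    rintro rfl
    exact hx₁.notMem w (h.inter_subset ⟨hz.1, hw⟩)
  · rw [h.strands_union hG]
    exact Or.inr hw

/-- The arrow rule hides `H` from below exactly when an arrow of `G` has a downward feather. Up to
nonemptiness of the fibre the criterion involves only `G`, so it gives the same answer for all
completions of `G`. -/
theorem lowAt_iff {s : Side} {x₁ : ℝ} (hx₁ : Beyond G.vertices s x₁) :
    LowAt H.strands G.strands x₁ ↔ (∃ y, (x₁, y) ∈ G.carrier ∪ H.carrier) ∧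
      ¬ ∃ E ∈ G.openEdges, E ∈ G.down ∧ ∃ y, (x₁, y) ∈ E := by
  have hK : H.strands ∪ G.strands = G.carrier ∪ H.carrier := by
    rw [union_comm, h.strands_union hG]
  rw [LowAt, hK]
  constructor
  · rintro ⟨y, hy, hmin⟩
    refine ⟨⟨y, Or.inr hy.1⟩, ?_⟩
    rintro ⟨E, hE, hEd, z, hz⟩
    have hzG := (EnrichedGraph.subset_of_mem_openEdges hE hz).1
    refine ((h.fibreRule hG hx₁).1 E hE z hz).2.2.2 hEd y (Or.inr hy.1)
      (lt_of_le_of_ne (hmin z (Or.inl hzG)) ?_)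
    rintro rfl
    exact hx₁.notMem y (h.inter_subset ⟨hzG, hy.1⟩)
  · rintro ⟨hne, hno⟩
    have hfin : {y | (x₁, y) ∈ G.carrier ∪ H.carrier}.Finite :=
      (hG.graphLike.fib x₁).union (h.transversal.graphLike.fib x₁)
    obtain ⟨y, hy, hmin⟩ := hfin.exists_minimal hne
    have hle : ∀ z, (x₁, z) ∈ G.carrier ∪ H.carrier → y ≤ z := fun z hz =>
      (le_total y z).elim id fun h1 => hmin hz h1
    rcases hy with hy | hy
    · obtain ⟨E, hE, hyE⟩ := EnrichedGraph.exists_mem_openEdges ⟨hy, hx₁.notMem y⟩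
      obtain ⟨w, hw, hwy, -⟩ := ((h.fibreRule hG hx₁).1 E hE y hyE).2.2.1 fun hd =>
        hno ⟨E, hE, hd, y, hyE⟩
      exact absurd (hle w (Or.inr hw)) hwy.not_ge
    · refine ⟨y, ⟨hy, fun hx => ?_⟩, hle⟩
      exact hx₁.notMem y (h.vertices_eq ▸ hx.1)

theorem topAt_iff {s : Side} {x₁ : ℝ} (hx₁ : Beyond G.vertices s x₁) :
    TopAt H.strands G.strands x₁ ↔ (∃ y, (x₁, y) ∈ G.carrier ∪ H.carrier) ∧
      ¬ ∃ E ∈ G.openEdges, E ∈ G.up ∧ ∃ y, (x₁, y) ∈ E := by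
  have hK : H.strands ∪ G.strands = G.carrier ∪ H.carrier := by
    rw [union_comm, h.strands_union hG]
  rw [TopAt, hK]
  constructor
  · rintro ⟨y, hy, hmax⟩
    refine ⟨⟨y, Or.inr hy.1⟩, ?_⟩
    rintro ⟨E, hE, hEd, z, hz⟩
    have hzG := (EnrichedGraph.subset_of_mem_openEdges hE hz).1
    refine ((h.fibreRule hG hx₁).1 E hE z hz).2.1 hEd y (Or.inr hy.1)
      (lt_of_le_of_ne (hmax z (Or.inl hzG)) ?_)
    rintro rfl
    exact hx₁.notMem z (h.inter_subset ⟨hzG, hy.1⟩)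
  · rintro ⟨hne, hno⟩
    have hfin : {y | (x₁, y) ∈ G.carrier ∪ H.carrier}.Finite :=
      (hG.graphLike.fib x₁).union (h.transversal.graphLike.fib x₁)
    obtain ⟨y, hy, hmax⟩ := hfin.exists_maximal hne
    have hle : ∀ z, (x₁, z) ∈ G.carrier ∪ H.carrier → z ≤ y := fun z hz =>
      (le_total z y).elim id fun h1 => hmax hz h1
    rcases hy with hy | hy
    · obtain ⟨E, hE, hyE⟩ := EnrichedGraph.exists_mem_openEdges ⟨hy, hx₁.notMem y⟩
      obtain ⟨w, hw, hwy, -⟩ := ((h.fibreRule hG hx₁).1 E hE y hyE).1 fun hd =>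
        hno ⟨E, hE, hd, y, hyE⟩
      exact absurd (hle w (Or.inr hw)) hwy.not_ge
    · refine ⟨y, ⟨hy, fun hx => ?_⟩, hle⟩
      exact hx₁.notMem y (h.vertices_eq ▸ hx.1)

theorem subset_closure_strands : G.carrier ⊆ closure G.strands := by
  intro p hp
  by_cases hx : p ∈ G.extVertices
  · have hpH : p ∈ H.vertices := h.vertices_eq ▸ hx.1
    obtain ⟨s, hs | hs⟩ := h.trident p hx.1
    · exact (hs.node hG.graphLike h.transversal.graphLike hx.1 hpH).2.2.1
    · exact absurd hx (hs.node h.transversal.graphLike hG.graphLike hpH hx.1).2.1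
  · exact subset_closure ⟨hp, hx⟩

theorem mem_strands_iff {p : ℝ × ℝ} (hp : p ∈ G.carrier) : p ∈ H.strands ↔ p ∈ G.extVertices := by
  constructor
  · intro hpH
    exact (h.mem_extVertices_iff hG (h.inter_subset ⟨hp, hpH.1⟩)).2 hpH.2
  · intro hx
    exact ⟨h.transversal.vertices_subset (h.vertices_eq ▸ hx.1), (h.mem_extVertices_iff hG hx.1).1 hx⟩

theorem matching {H' : EnrichedGraph (ℝ × ℝ)} (hne : G.carrier.Nonempty)
    (h' : stdPlane.IsTridentCompletion G H') : Matching G.strands H.strands H'.strands := by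
  obtain ⟨x₁, hx₁⟩ := exists_beyond hG.vertices_finite Side.left
  -- Emptiness of the fibre does not depend on the line, and a point of `G` exists on some line.
  have hnon : ∀ {H : EnrichedGraph (ℝ × ℝ)}, stdPlane.IsTridentCompletion G H →
      ∃ y, (x₁, y) ∈ G.carrier ∪ H.carrier := by
    intro H h
    obtain ⟨p, hp⟩ := hne
    rw [← h.strands_union hG]
    refine (((h.weave hG).const x₁ p.1).2.2.2).2 ⟨p.2, ?_⟩
    rw [h.strands_union hG]
    exact Or.inl hp
  refine ⟨h.weave hG, h'.weave hG, h.sepAt hG, (h.symm hG).sepAt h.transversal, h'.sepAt hG,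
    (h'.symm hG).sepAt h'.transversal, fun x => ?_, fun x => ?_, fun p hp => ?_⟩
  · rw [((h.weave hG).symm.const x x₁).2.1, ((h'.weave hG).symm.const x x₁).2.1,
      h.lowAt_iff hG hx₁, h'.lowAt_iff hG hx₁]
    exact and_congr_left fun _ => ⟨fun _ => hnon h', fun _ => hnon h⟩
  · rw [((h.weave hG).symm.const x x₁).2.2.1, ((h'.weave hG).symm.const x x₁).2.2.1,
      h.topAt_iff hG hx₁, h'.topAt_iff hG hx₁]
    exact and_congr_left fun _ => ⟨fun _ => hnon h', fun _ => hnon h⟩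
  -- At points of `G`, lying on a strand of a completion means being an exterior vertex of `G`,
  -- which does not depend on the completion.
  · have hpG : p ∈ G.carrier := closure_minimal sdiff_subset hG.closed hp
    rw [h.mem_strands_iff hG hpG, h'.mem_strands_iff hG hpG]

omit hG in
-- By the arrow rule an arrow of `H` has an upward feather exactly if no arrow is above it. So the
-- feathers of a completion are determined by the underlying graphs.
theorem mem_up_iff (E : Set (ℝ × ℝ)) : E ∈ H.up ↔ ∃ s, E ∈ stdPlane.arrows H s ∧
    ∀ K ∈ stdPlane.arrows G s ∪ stdPlane.arrows H s, ¬ stdPlane.BelowAlong s.atInf E K := by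
  constructor
  · intro hE
    obtain ⟨s, hs⟩ := h.transversal.up_subset hE
    exact ⟨s, hs, fun K hK => ((h.arrow s).2 E hs).2.1 hE K hK.symm⟩
  · rintro ⟨s, hs, hno⟩
    by_contra hE
    obtain ⟨F, hF, hEF, -⟩ := ((h.arrow s).2 E hs).1 hE
    exact hno F (Or.inl hF) hEF

omit hG in
theorem mem_down_iff (E : Set (ℝ × ℝ)) : E ∈ H.down ↔ ∃ s, E ∈ stdPlane.arrows H s ∧
    ∀ K ∈ stdPlane.arrows G s ∪ stdPlane.arrows H s, ¬ stdPlane.BelowAlong s.atInf K E := by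
  constructor
  · intro hE
    obtain ⟨s, hs⟩ := h.transversal.down_subset hE
    exact ⟨s, hs, fun K hK => ((h.arrow s).2 E hs).2.2.2 hE K hK.symm⟩
  · rintro ⟨s, hs, hno⟩
    by_contra hE
    obtain ⟨F, hF, hEF, -⟩ := ((h.arrow s).2 E hs).2.2.1 hE
    exact hno F (Or.inl hF) hEF

omit hG in
theorem eq_of_carrier_eq {H' : EnrichedGraph (ℝ × ℝ)} (h' : stdPlane.IsTridentCompletion G H')
    (hc : H.carrier = H'.carrier) : H = H' := by
  have hV : H.vertices = H'.vertices := h.vertices_eq.trans h'.vertices_eq.symm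
  have ha : ∀ s, stdPlane.arrows H s = stdPlane.arrows H' s := fun s => by
    simp only [arrows, EnrichedGraph.openEdges, hc, hV]
  refine EnrichedGraph.ext hc hV ?_ ?_
  · ext E; rw [h.mem_up_iff, h'.mem_up_iff]; simp only [ha]
  · ext E; rw [h.mem_down_iff, h'.mem_down_iff]; simp only [ha]

end VerticalPlane.IsTridentCompletion

theorem EnrichedGraph.map_of_forall_mem_eq {P : Type*} [TopologicalSpace P] {A : VerticalPlane P}
    {G : EnrichedGraph P} (hG : A.IsTransversalGraph G) {f : P → P}
    (hf : ∀ p ∈ G.carrier, f p = p) : G.map f = G := by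
  have key : ∀ S ⊆ G.carrier, f '' S = S := fun S hS => by
    rw [image_congr fun p hp => hf p (hS hp), image_id']
  have hE : ∀ 𝒮 ⊆ A.arrowEdges G, (fun E => f '' E) '' 𝒮 = 𝒮 := fun 𝒮 h𝒮 => by
    rw [image_congr (g := id) fun E hE => ?_, image_id]
    obtain ⟨s, hs⟩ := h𝒮 hE
    exact key E ((EnrichedGraph.subset_of_mem_openEdges hs.1).trans sdiff_subset)
  exact EnrichedGraph.ext (key _ Subset.rfl) (key _ hG.vertices_subset) (hE _ hG.up_subset)
    (hE _ hG.down_subset)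

/-- The equivalence found on the strands fixes those of `G`, hence their closure, which contains
`G`. It carries `H` to a completion of `G` with the carrier of `H'`, and the feathers then agree
automatically. -/
theorem VerticalPlane.IsTridentCompletion.verticallyIsotopic_std {H' : EnrichedGraph (ℝ × ℝ)}
    (hG : stdPlane.IsTransversalGraph G) (hne : G.carrier.Nonempty)
    (h : stdPlane.IsTridentCompletion G H) (h' : stdPlane.IsTridentCompletion G H') :
    stdPlane.VerticallyIsotopic H H' := by
  obtain ⟨Ψ, hΨ, hΨG, hΨH⟩ := (h.matching hG hne h').exists_verticalEquiv
  have hfix : ∀ p ∈ G.carrier, Ψ.toHomeo p = p := fun p hp =>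
    closure_minimal (t := {p | Ψ.toHomeo p = p}) hΨG
      (isClosed_eq Ψ.toHomeo.continuous continuous_id) (h.subset_closure_strands hG hp)
  refine verticallyIsotopic_of_verticalEquiv Ψ hΨ ?_
  have h1 := Ψ.isTridentCompletion_map h
  rw [EnrichedGraph.map_of_forall_mem_eq hG hfix] at h1
  refine h1.eq_of_carrier_eq h' ?_
  have hdec : ∀ {H : EnrichedGraph (ℝ × ℝ)}, stdPlane.IsTridentCompletion G H →
      H.carrier = H.strands ∪ G.vertices := fun {H} h => by
    refine Subset.antisymm (fun p hp => ?_) (union_subset sdiff_subset ?_)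
    · by_cases hx : p ∈ H.extVertices
      · exact Or.inr (h.vertices_eq ▸ hx.1)
      · exact Or.inl ⟨hp, hx⟩
    · rw [← h.vertices_eq]; exact h.transversal.vertices_subset
  change Ψ.toHomeo '' H.carrier = H'.carrier
  rw [hdec h, hdec h', image_union, hΨH, image_congr (s := G.vertices) (g := id)
    fun p hp => hfix p (hG.vertices_subset hp), image_id]

end

theorem VerticalPlane.IsTridentCompletion.verticallyIsotopic {P : Type*} [TopologicalSpace P]
    {A : VerticalPlane P} {G H H' : EnrichedGraph P} (hG : A.IsTransversalGraph G)
    (hne : G.carrier.Nonempty) (h : A.IsTridentCompletion G H) (h' : A.IsTridentCompletion G H') :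
    A.VerticallyIsotopic H H' := by
  obtain ⟨F, hF⟩ := A.exists_isHeight
  let Φ := A.coordEquiv hF F.continuous
  have := VerticalPlane.IsTridentCompletion.verticallyIsotopic_std (Φ.isTransversalGraph_map hG)
    (hne.image _) (Φ.isTridentCompletion_map h) (Φ.isTridentCompletion_map h')
  have h2 := this.map Φ.symm
  rwa [Φ.map_map_symm, Φ.map_map_symm] at h2

/-! ### Domains with boundary and their complements -/

theorem IsClosed.mem_closure_compl_iff {P : Type*} [TopologicalSpace P] {D : Set P}
    (hD : IsClosed D) {q : P} : q ∈ closure Dᶜ ↔ q ∉ D ∨ q ∈ frontier D := by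
  rw [closure_compl, hD.frontier_eq, mem_compl_iff, Set.mem_sdiff]
  have := @interior_subset _ _ D q
  tauto

namespace IsSurfaceWithBoundary

variable {P : Type*} [TopologicalSpace P] {D : Set P}

theorem tendsto_chart (φ : OpenPartialHomeomorph P (ℝ × ℝ)) {q : P} (hq : q ∈ φ.source) (c : ℝ) :
    ∀ᶠ t in 𝓝[>] (0 : ℝ), ((φ q).1, (φ q).2 + c * t) ∈ φ.target := by
  have h1 : Tendsto (fun t : ℝ => ((φ q).1, (φ q).2 + c * t)) (𝓝[>] 0) (𝓝 (φ q)) := by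
    have : Continuous fun t : ℝ => ((φ q).1, (φ q).2 + c * t) := by fun_prop
    have h := this.tendsto 0
    simp only [mul_zero, add_zero] at h
    exact h.mono_left nhdsWithin_le_nhds
  exact h1.eventually (φ.open_target.mem_nhds (φ.map_source hq))

theorem exists_near (φ : OpenPartialHomeomorph P (ℝ × ℝ)) {q : P} (hq : q ∈ φ.source) {c : ℝ}
    {S : Set P} (hS : ∀ t > 0, ∀ q' ∈ φ.source, φ q' = ((φ q).1, (φ q).2 + c * t) → q' ∈ S) :
    q ∈ closure S := by
  have h1 : Tendsto (fun t : ℝ => φ.symm ((φ q).1, (φ q).2 + c * t)) (𝓝[>] 0) (𝓝 q) := by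
    have : Continuous fun t : ℝ => ((φ q).1, (φ q).2 + c * t) := by fun_prop
    have h := this.tendsto 0
    simp only [mul_zero, add_zero] at h
    have h2 := (φ.symm.continuousAt (φ.map_source hq)).tendsto.comp
      (h.mono_left (nhdsWithin_le_nhds (s := Ioi 0)))
    rwa [φ.left_inv hq] at h2
  refine mem_closure_of_tendsto h1 ?_
  filter_upwards [tendsto_chart φ hq c, self_mem_nhdsWithin] with t ht ht0
  exact hS t ht0 _ (φ.map_target ht) (φ.right_inv ht)

/-- A positive second chart coordinate stays positive nearby, which gives an interior point of `D`.
From coordinate zero, moving down in the chart leaves `D` at once. -/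
theorem mem_frontier_iff (hc : IsClosed D) {φ : OpenPartialHomeomorph P (ℝ × ℝ)}
    (hφ : ∀ q ∈ φ.source, q ∈ D ↔ 0 ≤ (φ q).2) {q : P} (hq : q ∈ φ.source) :
    q ∈ frontier D ↔ (φ q).2 = 0 := by
  rw [hc.frontier_eq, Set.mem_sdiff, hφ q hq]
  constructor
  · rintro ⟨h1, h2⟩
    by_contra hne
    refine h2 (mem_interior_iff_mem_nhds.2 ?_)
    have hpos : 0 < (φ q).2 := lt_of_le_of_ne h1 (Ne.symm hne)
    have h3 : ∀ᶠ q' in 𝓝 q, 0 < (φ q').2 :=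
      (continuousAt_snd.comp (φ.continuousAt hq)).eventually (Ioi_mem_nhds hpos)
    filter_upwards [h3, φ.open_source.mem_nhds hq] with q' h4 h5
    exact (hφ q' h5).2 h4.le
  · intro h0
    refine ⟨h0.ge, ?_⟩
    rw [← mem_compl_iff, ← closure_compl]
    refine exists_near φ hq (c := -1) fun t ht q' hq' he => ?_
    rw [mem_compl_iff, hφ q' hq', he, h0]
    simpa using ht

variable (hD : IsSurfaceWithBoundary D)
include hD

theorem subset_closure_interior : frontier D ⊆ closure (interior D) := by
  intro p hp
  obtain ⟨φ, hpφ, hφ⟩ := hD.2 p hp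
  have h0 := (mem_frontier_iff hD.1 hφ hpφ).1 hp
  refine exists_near φ hpφ (c := 1) fun t ht q' hq' he => ?_
  have h1 : q' ∈ D := (hφ q' hq').2 (by rw [he, h0]; simpa using ht.le)
  by_contra h2
  have h3 : q' ∈ frontier D := by rw [hD.1.frontier_eq]; exact ⟨h1, h2⟩
  have := (mem_frontier_iff hD.1 hφ hq').1 h3
  rw [he, h0] at this
  simp only [one_mul, zero_add] at this
  exact ht.ne' this

/-- Interior points of `D` accumulate at every boundary point, so passing to the closure of the
complement loses no boundary. This gives `D` and `closure Dᶜ` symmetric roles. -/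
theorem frontier_closure_compl : frontier (closure Dᶜ) = frontier D := by
  refine Subset.antisymm ((frontier_closure_subset).trans (frontier_compl D).subset) fun p hp => ?_
  rw [isClosed_closure.frontier_eq]
  refine ⟨hD.1.mem_closure_compl_iff.2 (Or.inr hp), ?_⟩
  rw [closure_compl, interior_compl, mem_compl_iff, not_not]
  exact hD.subset_closure_interior hp

/-- The boundary is locally a curve. -/
theorem exists_curve {p : P} (hp : p ∈ frontier D) : ∃ (γ : ℝ → P) (δ : ℝ), 0 < δ ∧
    ContinuousOn γ (Ioo (-δ) δ) ∧ γ 0 = p ∧ InjOn γ (Ioo (-δ) δ) ∧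
    (∀ t ∈ Ioo (-δ) δ, γ t ∈ frontier D) ∧
    ∀ η > 0, ∀ᶠ q in 𝓝 p, q ∈ frontier D → ∃ t ∈ Ioo (-η) η, γ t = q := by
  obtain ⟨φ, hpφ, hφ⟩ := hD.2 p hp
  have h0 := (mem_frontier_iff hD.1 hφ hpφ).1 hp
  have hcurve : Continuous fun t : ℝ => ((φ p).1 + t, (0 : ℝ)) := by fun_prop
  have hc0 : (fun t : ℝ => ((φ p).1 + t, (0 : ℝ))) 0 = φ p := Prod.ext (add_zero _) h0.symm
  have hev : ∀ᶠ t in 𝓝 (0 : ℝ), ((φ p).1 + t, (0 : ℝ)) ∈ φ.target :=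
    hcurve.continuousAt.eventually (by
      rw [hc0]; exact φ.open_target.mem_nhds (φ.map_source hpφ))
  obtain ⟨δ, hδ, hball⟩ := Metric.eventually_nhds_iff_ball.1 hev
  rw [Real.ball_eq_Ioo, zero_sub, zero_add] at hball
  refine ⟨fun t => φ.symm ((φ p).1 + t, 0), δ, hδ, ?_, ?_, ?_, ?_, fun η hη => ?_⟩
  · exact φ.continuousOn_symm.comp hcurve.continuousOn hball
  · simp only
    rw [show ((φ p).1 + 0, (0 : ℝ)) = φ p from hc0, φ.left_inv hpφ]
  · intro t ht t' ht' he
    have := φ.symm.injOn (hball t ht) (hball t' ht') he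
    simpa using this
  · intro t ht
    rw [mem_frontier_iff hD.1 hφ (φ.map_target (hball t ht)), φ.right_inv (hball t ht)]
  · have h2 : ∀ᶠ q in 𝓝 p, (φ q).1 ∈ Ioo ((φ p).1 - η) ((φ p).1 + η) :=
      (continuousAt_fst.comp (φ.continuousAt hpφ)).eventually
        (Ioo_mem_nhds (by simp [hη]) (by simp [hη]))
    filter_upwards [h2, φ.open_source.mem_nhds hpφ] with q h3 h4 hq
    have h5 := (mem_frontier_iff hD.1 hφ h4).1 hq
    refine ⟨(φ q).1 - (φ p).1, ⟨by linarith [h3.1], by linarith [h3.2]⟩, ?_⟩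
    have : ((φ p).1 + ((φ q).1 - (φ p).1), (0 : ℝ)) = φ q := Prod.ext (by simp) h5.symm
    rw [this, φ.left_inv h4]

end IsSurfaceWithBoundary

/-! ### Continuous injections and plane curves with injective projection -/

theorem ContinuousOn.invFunOn_of_isCompact {X Y : Type*} [TopologicalSpace X] [TopologicalSpace Y]
    [Nonempty X] [T2Space Y] [T2Space X] {f : X → Y} {S : Set X} (hf : ContinuousOn f S)
    (hS : IsCompact S) (hi : InjOn f S) : ContinuousOn (Function.invFunOn f S) (f '' S) := by
  rw [continuousOn_iff_isClosed]
  intro T hT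
  refine ⟨f '' (S ∩ T), ((hS.inter_right hT).image_of_continuousOn
    (hf.mono inter_subset_left)).isClosed, ?_⟩
  ext y
  constructor
  · rintro ⟨h1, x, hx, rfl⟩
    rw [mem_preimage, hi.leftInvOn_invFunOn hx] at h1
    exact ⟨⟨x, ⟨hx, h1⟩, rfl⟩, x, hx, rfl⟩
  · rintro ⟨⟨x, ⟨hx, hxT⟩, rfl⟩, h2⟩
    exact ⟨by rwa [mem_preimage, hi.leftInvOn_invFunOn hx], h2⟩

/-- A continuous and locally injective function on an interval is injective. -/
theorem ContinuousOn.injOn_of_locally_injOn {x : ℝ → ℝ} {a b : ℝ} (hx : ContinuousOn x (Icc a b))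
    (hloc : ∀ t ∈ Ioo a b, ∃ ε > 0, InjOn x (Ioo (t - ε) (t + ε))) : InjOn x (Icc a b) := by
  have key : ∀ s ∈ Icc a b, ∀ t ∈ Icc a b, s < t → x s ≠ x t := by
    intro s hs t ht hst he
    -- Equal values at two times force an interior extremum, as in Rolle's theorem, which is
    -- incompatible with the strict monotonicity given by local injectivity.
    obtain ⟨c, hc, hext⟩ := exists_isLocalExtr_Ioo hst (hx.mono (Icc_subset_Icc hs.1 ht.2)) he
    have hcab : c ∈ Ioo a b := ⟨hs.1.trans_lt hc.1, hc.2.trans_le ht.2⟩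
    obtain ⟨ε, hε, hinj⟩ := hloc c hcab
    obtain ⟨η, hη, hη1⟩ : ∃ η > 0, Ioo (c - η) (c + η) ⊆ Ioo (c - ε) (c + ε) ∩ Ioo a b := by
      have : Ioo (c - ε) (c + ε) ∩ Ioo a b ∈ 𝓝 c :=
        inter_mem (Ioo_mem_nhds (by linarith) (by linarith)) (Ioo_mem_nhds hcab.1 hcab.2)
      obtain ⟨η, hη, h⟩ := Metric.mem_nhds_iff.1 this
      exact ⟨η, hη, by rwa [← Real.ball_eq_Ioo]⟩
    have hcont : ContinuousOn x (Ioo (c - η) (c + η)) := hx.mono fun y hy => Ioo_subset_Icc_self (hη1 hy).2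
    have hinj' : InjOn x (Ioo (c - η) (c + η)) := hinj.mono fun y hy => (hη1 hy).1
    have hmem : c ∈ Ioo (c - η) (c + η) := ⟨by linarith, by linarith⟩
    have hl : ∃ᶠ y in 𝓝 c, y < c := by
      have : ∃ᶠ y in 𝓝[<] c, y < c := (eventually_mem_nhdsWithin (s := Iio c)).frequently
      exact this.filter_mono nhdsWithin_le_nhds
    have hr : ∃ᶠ y in 𝓝 c, c < y := by
      have : ∃ᶠ y in 𝓝[>] c, c < y := (eventually_mem_nhdsWithin (s := Ioi c)).frequently
      exact this.filter_mono nhdsWithin_le_nhds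
    have hn : Ioo (c - η) (c + η) ∈ 𝓝 c := Ioo_mem_nhds hmem.1 hmem.2
    rcases hcont.strictMonoOn_of_injOn_Ioo (by linarith) hinj' with hm | hm <;> rcases hext with he | he
    · obtain ⟨y, h1, h2, h3⟩ := (hl.and_eventually (he.and hn)).exists
      exact absurd (hm h3 hmem h1) h2.not_gt
    · obtain ⟨y, h1, h2, h3⟩ := (hr.and_eventually (he.and hn)).exists
      exact absurd (hm hmem h3 h1) h2.not_gt
    · obtain ⟨y, h1, h2, h3⟩ := (hr.and_eventually (he.and hn)).exists
      exact absurd (hm hmem h3 h1) h2.not_gt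
    · obtain ⟨y, h1, h2, h3⟩ := (hl.and_eventually (he.and hn)).exists
      exact absurd (hm h3 hmem h1) h2.not_gt
  intro s hs t ht he
  rcases lt_trichotomy s t with h | h | h
  · exact absurd he (key s hs t ht h)
  · exact h
  · exact absurd he.symm (key t ht s hs h)

/-- One half of a curve with injective projection is the graph of a continuous function on one
side of its origin. -/
theorem exists_half_branch {γ : ℝ → ℝ × ℝ} {η : ℝ} (hη : 0 < η) (hγ : ContinuousOn γ (Icc 0 η))
    (hinj : InjOn (fun t => (γ t).1) (Icc 0 η)) : ∃ (s : Side) (f : ℝ → ℝ),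
      (∀ᶠ x in 𝓝[s.ray (γ 0).1] (γ 0).1, ContinuousAt f x) ∧
      Tendsto f (𝓝[s.ray (γ 0).1] (γ 0).1) (𝓝 (γ 0).2) ∧
      (∀ᶠ x in 𝓝[s.ray (γ 0).1] (γ 0).1, ∃ t ∈ Ioc 0 η, γ t = (x, f x)) ∧
      ∀ t ∈ Ioc 0 η, s.Past (γ 0).1 (γ t).1 ∧ (γ t).2 = f (γ t).1 := by
  set x : ℝ → ℝ := fun t => (γ t).1 with hx
  have hxc : ContinuousOn x (Icc 0 η) := continuous_fst.comp_continuousOn hγ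
  have h0 : (0 : ℝ) ∈ Icc 0 η := ⟨le_rfl, hη.le⟩
  have h1 : η ∈ Icc 0 η := ⟨hη.le, le_rfl⟩
  set I := x '' Ioc 0 η with hI
  have hIo : I.OrdConnected :=
    (isPreconnected_Ioc.image x (hxc.mono Ioc_subset_Icc_self)).ordConnected
  have hx0 : x 0 ∉ I := by
    rintro ⟨t, ht, he⟩
    exact ht.1.ne' (hinj (Ioc_subset_Icc_self ht) h0 he)
  have hcl : x 0 ∈ closure I := by
    have : Tendsto x (𝓝[Ioc 0 η] 0) (𝓝 (x 0)) := (hxc 0 h0).mono_left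
      (nhdsWithin_mono _ Ioc_subset_Icc_self)
    have hne : (𝓝[Ioc 0 η] (0 : ℝ)).NeBot := by
      rw [nhdsWithin_Ioc_eq_nhdsGT hη]; infer_instance
    exact mem_closure_of_tendsto this (eventually_mem_nhdsWithin.mono fun t ht => ⟨t, ht, rfl⟩)
  obtain ⟨s, hs⟩ : ∃ s : Side, s.Past (x 0) (x η) := by
    rcases Side.left.past_trichotomy (x 0) (x η) with h | h | h
    exacts [⟨_, h⟩, absurd (hinj h0 h1 h) hη.ne, ⟨_, h⟩]
  have hIs : I ⊆ s.ray (x 0) := Side.subset_ray hIo hx0 ⟨η, ⟨hη, le_rfl⟩, rfl⟩ hs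
  have hev := Side.eventually_ray_subset hIo hcl hIs
  set g := Function.invFunOn x (Icc 0 η) with hg
  have hgc : ContinuousOn g (x '' Icc 0 η) := hxc.invFunOn_of_isCompact isCompact_Icc hinj
  have hgx : ∀ t ∈ Icc 0 η, g (x t) = t := fun t ht => hinj.leftInvOn_invFunOn ht
  have hfc : ContinuousOn (fun ξ => (γ (g ξ)).2) (x '' Icc 0 η) :=
    continuous_snd.comp_continuousOn (hγ.comp hgc (by
      rintro _ ⟨t, ht, rfl⟩; rw [hgx t ht]; exact ht))
  have hII : I ⊆ x '' Icc 0 η := image_mono Ioc_subset_Icc_self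
  refine ⟨s, fun ξ => (γ (g ξ)).2, ?_, ?_, ?_, ?_⟩
  · have h2 : ∀ᶠ ξ in 𝓝[s.ray (x 0)] x 0, I ∈ 𝓝 ξ := by
      have h3 := eventually_eventually_nhdsWithin.2 hev
      filter_upwards [h3, self_mem_nhdsWithin] with ξ h4 h5
      rwa [(s.isOpen_ray _).nhdsWithin_eq h5] at h4
    exact h2.mono fun ξ hξ => hfc.continuousAt (mem_of_superset hξ hII)
  · have h2 := hfc (x 0) ⟨0, h0, rfl⟩
    rw [ContinuousWithinAt, hgx 0 h0] at h2
    exact h2.mono_left (nhdsWithin_le_of_mem (mem_of_superset hev hII))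
  · filter_upwards [hev] with ξ hξ
    obtain ⟨t, ht, rfl⟩ := hξ
    refine ⟨t, ht, ?_⟩
    simp only [hgx t (Ioc_subset_Icc_self ht)]
    rfl
  · intro t ht
    refine ⟨hIs ⟨t, ht, rfl⟩, ?_⟩
    change (γ t).2 = (γ (g (x t))).2
    rw [hgx t (Ioc_subset_Icc_self ht)]

/-! ### The local structure of the boundary of a domain -/

/-- Near `p`, the set `C` is the graph of `f`. -/
structure GraphAt (C : Set (ℝ × ℝ)) (p : ℝ × ℝ) (f : ℝ → ℝ) : Prop where
  cont : ∀ᶠ x in 𝓝 p.1, ContinuousAt f x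
  eq : f p.1 = p.2
  mem_iff : ∀ᶠ q in 𝓝 p, (q ∈ C ↔ q.2 = f q.1)

/-- Near `v`, the set `C` is the union of the graphs of `f₁ < f₂` on the side `s` of `v`, which
meet at `v`. -/
structure ForkAt (C : Set (ℝ × ℝ)) (s : Side) (v : ℝ × ℝ) (f₁ f₂ : ℝ → ℝ) : Prop where
  cont : ∀ᶠ x in 𝓝[s.ray v.1] v.1, ContinuousAt f₁ x ∧ ContinuousAt f₂ x
  lim₁ : Tendsto f₁ (𝓝[s.ray v.1] v.1) (𝓝 v.2)
  lim₂ : Tendsto f₂ (𝓝[s.ray v.1] v.1) (𝓝 v.2)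
  lt : ∀ᶠ x in 𝓝[s.ray v.1] v.1, f₁ x < f₂ x
  mem_iff : ∀ᶠ q in 𝓝 v, (q ∈ C ↔ q = v ∨ s.Past v.1 q.1 ∧ (q.2 = f₁ q.1 ∨ q.2 = f₂ q.1))

theorem Side.eventually_lt_or_lt {s : Side} {a : ℝ} {f g : ℝ → ℝ}
    (hc : ∀ᶠ x in 𝓝[s.ray a] a, ContinuousAt f x ∧ ContinuousAt g x)
    (hne : ∀ᶠ x in 𝓝[s.ray a] a, f x ≠ g x) :
    (∀ᶠ x in 𝓝[s.ray a] a, f x < g x) ∨ ∀ᶠ x in 𝓝[s.ray a] a, g x < f x := by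
  obtain ⟨δ, hδ, hball⟩ := Metric.eventually_nhds_iff_ball.1
    (eventually_nhdsWithin_iff.1 (hc.and hne))
  set J : Set ℝ := s.ray a ∩ Metric.ball a δ with hJ
  have hJn : J ∈ 𝓝[s.ray a] a := inter_mem self_mem_nhdsWithin
    (mem_nhdsWithin_of_mem_nhds (Metric.ball_mem_nhds _ hδ))
  have hJo : J.OrdConnected := by
    rw [hJ, Real.ball_eq_Ioo]; exact (s.ordConnected_ray _).inter ordConnected_Ioo
  obtain ⟨x₀, hx₀⟩ : J.Nonempty := (eventually_mem_set.2 hJn).exists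
  have hcf : ContinuousOn f J := fun x hx => (hball x hx.2 hx.1).1.1.continuousWithinAt
  have hcg : ContinuousOn g J := fun x hx => (hball x hx.2 hx.1).1.2.continuousWithinAt
  have hn : ∀ x ∈ J, f x ≠ g x := fun x hx => (hball x hx.2 hx.1).2
  rcases lt_or_gt_of_ne (hn x₀ hx₀) with h | h
  · refine Or.inl (mem_of_superset hJn fun x hx => ?_)
    by_contra hlt
    obtain ⟨z, hz, hz'⟩ := hJo.isPreconnected.intermediate_value₂ hx₀ hx hcf hcg h.le (not_lt.1 hlt)
    exact hn z hz hz'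
  · refine Or.inr (mem_of_superset hJn fun x hx => ?_)
    by_contra hlt
    obtain ⟨z, hz, hz'⟩ := hJo.isPreconnected.intermediate_value₂ hx₀ hx hcg hcf h.le (not_lt.1 hlt)
    exact hn z hz hz'.symm

/-- Near `p` the boundary is an injective curve, and regularity of the nearby points makes the
projection injective on each of its two halves. So each half is a graph over one side of `p`. Halves
on opposite sides glue to a graph; halves on the same side are disjoint away from `p`, hence
ordered, and form a fork. -/
theorem IsSurfaceWithBoundary.graphAt_or_forkAt {D : Set (ℝ × ℝ)} (hD : IsSurfaceWithBoundary D)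
    {p : ℝ × ℝ} (hp : p ∈ frontier D)
    (hreg : ∀ᶠ q in 𝓝 p, q ∈ frontier D → q ≠ p → ∃ U ∈ 𝓝 q, InjOn Prod.fst (frontier D ∩ U)) :
    (∃ f, GraphAt (frontier D) p f) ∨ ∃ s f₁ f₂, ForkAt (frontier D) s p f₁ f₂ := by
  obtain ⟨γ, δ, hδ, hγ, hγ0, hinj, hmem, hsurj⟩ := hD.exists_curve hp
  have h0 : (0 : ℝ) ∈ Ioo (-δ) δ := ⟨by linarith, hδ⟩
  have hca : ∀ t ∈ Ioo (-δ) δ, ContinuousAt γ t := fun t ht =>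
    hγ.continuousAt (Ioo_mem_nhds ht.1 ht.2)
  obtain ⟨ε, hε, hεreg⟩ := Metric.eventually_nhds_iff_ball.1 ((hca 0 h0).eventually (by
    rw [hγ0]; exact hreg))
  rw [Real.ball_eq_Ioo, zero_sub, zero_add] at hεreg
  set η := min δ ε / 2 with hη
  have hη0 : 0 < η := half_pos (lt_min hδ hε)
  have hηδ : η < δ := (half_lt_self (lt_min hδ hε)).trans_le (min_le_left _ _)
  have hηε : η < ε := (half_lt_self (lt_min hδ hε)).trans_le (min_le_right _ _)
  have hloc : ∀ t, t ≠ 0 → -η < t → t < η → ∃ r > 0,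
      InjOn (fun t => (γ t).1) (Ioo (t - r) (t + r)) := by
    intro t ht0 ht1 ht2
    have htδ : t ∈ Ioo (-δ) δ := ⟨by linarith, by linarith⟩
    obtain ⟨U, hU, hUi⟩ := hεreg t ⟨by linarith, by linarith⟩ (hmem t htδ) fun he =>
      ht0 (hinj htδ h0 (he.trans hγ0.symm))
    have hev : ∀ᶠ u in 𝓝 t, γ u ∈ U ∧ u ∈ Ioo (-δ) δ :=
      ((hca t htδ).eventually hU).and (Ioo_mem_nhds htδ.1 htδ.2)
    obtain ⟨r, hr, hball⟩ := Metric.eventually_nhds_iff_ball.1 hev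
    rw [Real.ball_eq_Ioo] at hball
    refine ⟨r, hr, fun u hu w hw he => hinj (hball u hu).2 (hball w hw).2 ?_⟩
    exact hUi ⟨hmem u (hball u hu).2, (hball u hu).1⟩ ⟨hmem w (hball w hw).2, (hball w hw).1⟩ he
  have hcγ : ContinuousOn γ (Icc 0 η) := hγ.mono fun t ht => ⟨by linarith [ht.1], by linarith [ht.2]⟩
  have hcγ' : ContinuousOn (fun t => γ (-t)) (Icc 0 η) :=
    hγ.comp continuous_neg.continuousOn fun t ht => ⟨by linarith [ht.2], by linarith [ht.1]⟩
  obtain ⟨s, f, hf, hfl, hft, hfm⟩ := exists_half_branch hη0 hcγ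
    ((continuous_fst.comp_continuousOn hcγ).injOn_of_locally_injOn fun t ht =>
      hloc t ht.1.ne' (by linarith [ht.1]) ht.2)
  obtain ⟨s', f', hf', hfl', hft', hfm'⟩ := exists_half_branch (γ := fun t => γ (-t)) hη0 hcγ'
    ((continuous_fst.comp_continuousOn hcγ').injOn_of_locally_injOn fun t ht => by
      obtain ⟨r, hr, hi⟩ := hloc (-t) (neg_ne_zero.2 ht.1.ne') (by linarith [ht.2])
        (by linarith [ht.1])
      refine ⟨r, hr, fun u hu w hw he => ?_⟩
      have := hi (x₁ := -u) ⟨by linarith [hu.2], by linarith [hu.1]⟩ (x₂ := -w)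
        ⟨by linarith [hw.2], by linarith [hw.1]⟩ he
      exact neg_injective this)
  simp only [neg_zero] at hf' hfl' hft' hfm'
  rw [hγ0] at hf hfl hft hfm hf' hfl' hft' hfm'
  have hfst : ∀ {Q : ℝ → Prop} {t : Side}, (∀ᶠ x in 𝓝[t.ray p.1] p.1, Q x) →
      ∀ᶠ q : ℝ × ℝ in 𝓝 p, t.Past p.1 q.1 → Q q.1 := fun h =>
    continuousAt_fst.eventually (eventually_nhdsWithin_iff.1 h)
  have hC : ∀ᶠ q in 𝓝 p, (q ∈ frontier D ↔ q = p ∨ (s.Past p.1 q.1 ∧ q.2 = f q.1) ∨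
      (s'.Past p.1 q.1 ∧ q.2 = f' q.1)) := by
    filter_upwards [hsurj η hη0, hfst hft, hfst hft'] with q h1 h2 h3
    constructor
    · intro hq
      obtain ⟨t, ht, rfl⟩ := h1 hq
      rcases lt_trichotomy t 0 with h | h | h
      · have := hfm' (-t) ⟨by linarith, by linarith [ht.1]⟩
        rw [neg_neg] at this
        exact Or.inr (Or.inr this)
      · exact Or.inl (by rw [h, hγ0])
      · exact Or.inr (Or.inl (hfm t ⟨h, ht.2.le⟩))
    · rintro (rfl | ⟨h4, h5⟩ | ⟨h4, h5⟩)
      · exact hp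
      · obtain ⟨t, ht, he⟩ := h2 h4
        rw [← h5] at he
        rw [show q = γ t from he.symm]
        exact hmem t ⟨by linarith [ht.1], by linarith [ht.2]⟩
      · obtain ⟨t, ht, he⟩ := h3 h4
        rw [← h5] at he
        rw [show q = γ (-t) from he.symm]
        exact hmem (-t) ⟨by linarith [ht.2], by linarith [ht.1]⟩
  have hs : s' = s ∨ s' = s.flip := by cases s <;> cases s' <;> simp [Side.flip]
  rcases hs with rfl | rfl
  · have hne : ∀ᶠ x in 𝓝[s'.ray p.1] p.1, f x ≠ f' x := by
      filter_upwards [hft, hft'] with x h1 h2 he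
      obtain ⟨t, ht, h3⟩ := h1
      obtain ⟨u, hu, h4⟩ := h2
      have := hinj (x₁ := t) ⟨by linarith [ht.1], by linarith [ht.2]⟩ (x₂ := -u)
        ⟨by linarith [hu.2], by linarith [hu.1]⟩ (by rw [h3, h4, he])
      linarith [ht.1, hu.1]
    rcases Side.eventually_lt_or_lt (hf.and hf') hne with hlt | hlt
    · refine Or.inr ⟨s', f, f', hf.and hf', hfl, hfl', hlt, hC.mono fun q hq => ?_⟩
      rw [hq]; tauto
    · refine Or.inr ⟨s', f', f, hf'.and hf, hfl', hfl, hlt, hC.mono fun q hq => ?_⟩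
      rw [hq]; tauto
  · obtain ⟨k, hk, hk0, hks, hkf⟩ := s.exists_glue hf hfl hf' hfl'
    refine Or.inl ⟨k, hk, hk0, hC.mono fun q hq => ?_⟩
    rw [hq]
    rcases s.past_trichotomy p.1 q.1 with h | h | h
    · have h' : ¬ s.flip.Past p.1 q.1 := Side.flip_past_irrefl h
      have h'' : q ≠ p := fun he => s.past_irrefl p.1 (by rwa [he] at h)
      rw [hks _ h]; tauto
    · rw [← h, hk0]
      have h1 := s.past_irrefl p.1
      have h2 := s.flip.past_irrefl p.1
      have h3 : q = p ↔ q.2 = p.2 := ⟨fun he => by rw [he], fun he => Prod.ext h.symm he⟩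
      tauto
    · have h' : ¬ s.Past p.1 q.1 := fun h' => Side.flip_past_irrefl h' h
      have h'' : q ≠ p := fun he => s.flip.past_irrefl p.1 (by rwa [he] at h)
      rw [hkf _ h]; tauto

theorem exists_vertical_bound {p : ℝ × ℝ} {Q : ℝ × ℝ → Prop} (hQ : ∀ᶠ q in 𝓝 p, Q q) :
    ∃ ε > 0, ∀ᶠ x in 𝓝 p.1, ∀ y, |y - p.2| < ε → Q (x, y) := by
  obtain ⟨U, hU, W, hW, hUW⟩ := mem_nhds_prod_iff.1 (show {q | Q q} ∈ 𝓝 (p.1, p.2) from hQ)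
  obtain ⟨ε, hε, hball⟩ := Metric.mem_nhds_iff.1 hW
  refine ⟨ε, hε, mem_of_superset hU fun x hx y hy => hUW ⟨hx, hball ?_⟩⟩
  rwa [Metric.mem_ball, Real.dist_eq]

namespace GraphAt

variable {C : Set (ℝ × ℝ)} {p : ℝ × ℝ} {f : ℝ → ℝ}

theorem exists_isEmbedding (h : GraphAt C p f) (hC : IsClosed C) :
    ∃ U ∈ 𝓝 p, IsEmbedding ((C ∩ U).domRestrict (Prod.fst : ℝ × ℝ → ℝ)) := by
  obtain ⟨r, hr, hsub⟩ := Metric.nhds_basis_closedBall.mem_iff.1 h.mem_iff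
  refine ⟨Metric.closedBall p r, Metric.closedBall_mem_nhds p hr, ?_⟩
  have hcomp : CompactSpace ↑(C ∩ Metric.closedBall p r) :=
    isCompact_iff_compactSpace.1 ((isCompact_closedBall p r).inter_left hC)
  refine (Continuous.isClosedEmbedding (continuous_fst.comp continuous_subtype_val)
    (injOn_iff_injective.1 fun q hq q' hq' he => Prod.ext he ?_)).isEmbedding
  rw [(hsub hq.2).1 hq.1, (hsub hq'.2).1 hq'.1, he]

end GraphAt

theorem ForkAt.not_injOn {C : Set (ℝ × ℝ)} {s : Side} {v : ℝ × ℝ} {f₁ f₂ : ℝ → ℝ}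
    (h : ForkAt C s v f₁ f₂) {U : Set (ℝ × ℝ)} (hU : U ∈ 𝓝 v) : ¬ InjOn Prod.fst (C ∩ U) := by
  intro hi
  obtain ⟨x, ⟨h1, h2⟩, h3, h4, h5⟩ := (((tendsto_mk_of_tendsto h.lim₁).eventually
    (h.mem_iff.and hU)).and (((tendsto_mk_of_tendsto h.lim₂).eventually (h.mem_iff.and hU)).and
      (h.lt.and self_mem_nhdsWithin))).exists
  have := hi (x₁ := (x, f₁ x)) ⟨h1.2 (Or.inr ⟨h5, Or.inl rfl⟩), h2⟩ (x₂ := (x, f₂ x))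
    ⟨h3.1.2 (Or.inr ⟨h5, Or.inr rfl⟩), h3.2⟩ rfl
  exact h4.ne (Prod.ext_iff.1 this).2

/-! ### The two sides of the boundary near a point -/

theorem isPreconnected_between {J : Set ℝ} (hJ : J.OrdConnected) {a b : ℝ → ℝ}
    (ha : ContinuousOn a J) (hb : ContinuousOn b J) (hab : ∀ x ∈ J, a x < b x) :
    IsPreconnected {q : ℝ × ℝ | q.1 ∈ J ∧ a q.1 < q.2 ∧ q.2 < b q.1} := by
  have himg : {q : ℝ × ℝ | q.1 ∈ J ∧ a q.1 < q.2 ∧ q.2 < b q.1} =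
      (fun z : ℝ × ℝ => (z.1, a z.1 + z.2 * (b z.1 - a z.1))) '' (J ×ˢ Ioo 0 1) := by
    ext ⟨x, y⟩
    constructor
    · rintro ⟨hx, h1, h2⟩
      simp only at hx h1 h2
      have hpos := sub_pos.2 (hab x hx)
      refine ⟨(x, (y - a x) / (b x - a x)), ⟨hx, div_pos (by linarith) hpos,
        (div_lt_one hpos).2 (by linarith)⟩, Prod.ext rfl ?_⟩
      simp only
      rw [div_mul_cancel₀ _ hpos.ne']; ring
    · rintro ⟨⟨x', t⟩, ⟨hx, ht0, ht1⟩, he⟩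
      simp only [Prod.mk.injEq] at he hx ht0 ht1
      obtain ⟨rfl, rfl⟩ := he
      have hpos := sub_pos.2 (hab x' hx)
      have h1 := mul_pos ht0 hpos
      have h2 := mul_lt_mul_of_pos_right ht1 hpos
      exact ⟨hx, by simp only; linarith, by simp only; linarith⟩
  rw [himg]
  refine (hJ.isPreconnected.prod isPreconnected_Ioo).image _ ?_
  have ha' : ContinuousOn (fun z : ℝ × ℝ => a z.1) (J ×ˢ Ioo 0 1) :=
    ha.comp continuousOn_fst fun z hz => hz.1
  have hb' : ContinuousOn (fun z : ℝ × ℝ => b z.1) (J ×ˢ Ioo 0 1) :=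
    hb.comp continuousOn_fst fun z hz => hz.1
  exact continuousOn_fst.prodMk (ha'.add (continuousOn_snd.mul (hb'.sub ha')))

theorem IsPreconnected.subset_or_subset_compl {X : Type*} [TopologicalSpace X] {S D : Set X}
    (hS : IsPreconnected S) (hd : Disjoint S (frontier D)) : S ⊆ D ∨ S ⊆ Dᶜ := by
  by_contra hcon
  push Not at hcon
  obtain ⟨h1, h2⟩ := hcon
  obtain ⟨a, ha, haD⟩ := not_subset.1 h1
  obtain ⟨b, hb, hbD⟩ := not_subset.1 h2
  have hcl : ∀ c ∈ S, c ∈ closure D → c ∈ interior D := fun c hc h1 =>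
    by_contra fun h2 => disjoint_left.1 hd hc ⟨h1, h2⟩
  obtain ⟨c, -, h3, h4⟩ := hS _ _ isOpen_interior isClosed_closure.isOpen_compl
    (fun c hc => (em (c ∈ closure D)).imp (hcl c hc) id)
    ⟨b, hb, hcl b hb (subset_closure (by_contra hbD))⟩
    ⟨a, ha, fun h => haD (interior_subset (hcl a ha h))⟩
  exact h4 (subset_closure (interior_subset h3))

/-- If both pieces were in `D`, the boundary point `p` would be interior; if both were in the
complement, interior points of `D` could not accumulate at `p`. -/
theorem IsSurfaceWithBoundary.two_sides {P : Type*} [TopologicalSpace P] {D I O : Set P}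
    (hD : IsSurfaceWithBoundary D) {p : P} (hp : p ∈ frontier D) (hI : IsPreconnected I)
    (hO : IsPreconnected O) (hIC : Disjoint I (frontier D)) (hOC : Disjoint O (frontier D))
    (hcov : ∀ᶠ q in 𝓝 p, q ∈ frontier D ∨ q ∈ I ∨ q ∈ O) :
    (I ⊆ D ∧ O ⊆ Dᶜ) ∨ (O ⊆ D ∧ I ⊆ Dᶜ) := by
  have hCD : frontier D ⊆ D := hD.1.frontier_subset
  rcases hI.subset_or_subset_compl hIC with h1 | h1 <;>
    rcases hO.subset_or_subset_compl hOC with h2 | h2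
  · rw [hD.1.frontier_eq] at hp
    refine absurd (mem_interior_iff_mem_nhds.2 (hcov.mono fun q hq => ?_)) hp.2
    rcases hq with h | h | h
    exacts [hCD h, h1 h, h2 h]
  · exact Or.inl ⟨h1, h2⟩
  · exact Or.inr ⟨h2, h1⟩
  · obtain ⟨q, hq1, hq2⟩ := mem_closure_iff_nhds.1 (hD.subset_closure_interior hp) _ hcov
    rcases hq1 with h | h | h
    · rw [hD.1.frontier_eq] at h
      exact absurd hq2 h.2
    · exact absurd (interior_subset hq2) (h1 h)
    · exact absurd (interior_subset hq2) (h2 h)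

/-- Near `p`, the sets `D` and `E` are the two sides, above and below, of a graph. -/
def RegAt (D E : Set (ℝ × ℝ)) (p : ℝ × ℝ) : Prop :=
  ∃ f : ℝ → ℝ, (∀ᶠ x in 𝓝 p.1, ContinuousAt f x) ∧ f p.1 = p.2 ∧
    ∀ᶠ q in 𝓝 p, (q ∈ D ↔ f q.1 ≤ q.2) ∧ (q ∈ E ↔ q.2 ≤ f q.1)

/-- Near `v`, the sets `D` and `E` are the inside and the outside of two curves that issue from
`v` in the direction `s`. -/
def FoldAt (D E : Set (ℝ × ℝ)) (s : Side) (v : ℝ × ℝ) : Prop :=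
  ∃ f₁ f₂ : ℝ → ℝ, (∀ᶠ x in 𝓝[s.ray v.1] v.1, ContinuousAt f₁ x ∧ ContinuousAt f₂ x) ∧
    Tendsto f₁ (𝓝[s.ray v.1] v.1) (𝓝 v.2) ∧ Tendsto f₂ (𝓝[s.ray v.1] v.1) (𝓝 v.2) ∧
    (∀ᶠ x in 𝓝[s.ray v.1] v.1, f₁ x < f₂ x) ∧
    ∀ᶠ q in 𝓝 v, (q ∈ D ↔ q = v ∨ s.Past v.1 q.1 ∧ f₁ q.1 ≤ q.2 ∧ q.2 ≤ f₂ q.1) ∧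
      (q ∈ E ↔ ¬ (s.Past v.1 q.1 ∧ f₁ q.1 < q.2 ∧ q.2 < f₂ q.1))

theorem GraphAt.regAt {D : Set (ℝ × ℝ)} {p : ℝ × ℝ} {f : ℝ → ℝ} (h : GraphAt (frontier D) p f)
    (hD : IsSurfaceWithBoundary D) : RegAt D (closure Dᶜ) p ∨ RegAt (closure Dᶜ) D p := by
  have hp : p ∈ frontier D := h.mem_iff.self_of_nhds.2 h.eq.symm
  obtain ⟨ε, hε, hεx⟩ := exists_vertical_bound h.mem_iff
  have hval : ∀ᶠ x in 𝓝 p.1, f x ∈ Ioo (p.2 - ε) (p.2 + ε) :=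
    h.cont.self_of_nhds.eventually (by
      rw [h.eq]; exact Ioo_mem_nhds (by linarith) (by linarith))
  obtain ⟨r, hr, hball⟩ := Metric.eventually_nhds_iff_ball.1 (hεx.and (hval.and h.cont))
  have hJ : (Metric.ball p.1 r).OrdConnected := by rw [Real.ball_eq_Ioo]; exact ordConnected_Ioo
  have hfc : ContinuousOn f (Metric.ball p.1 r) := fun x hx =>
    (hball x hx).2.2.continuousWithinAt
  have hI := isPreconnected_between hJ hfc (continuousOn_const (c := p.2 + ε))
    fun x hx => (hball x hx).2.1.2
  have hO := isPreconnected_between hJ (continuousOn_const (c := p.2 - ε)) hfc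
    fun x hx => (hball x hx).2.1.1
  have hbox : ∀ᶠ q : ℝ × ℝ in 𝓝 p, q.1 ∈ Metric.ball p.1 r ∧ q.2 ∈ Ioo (p.2 - ε) (p.2 + ε) :=
    (continuousAt_fst.eventually (Metric.ball_mem_nhds _ hr)).and
      (continuousAt_snd.eventually (Ioo_mem_nhds (by linarith) (by linarith)))
  have hCiff : ∀ q : ℝ × ℝ, q.1 ∈ Metric.ball p.1 r → q.2 ∈ Ioo (p.2 - ε) (p.2 + ε) →
      (q ∈ frontier D ↔ q.2 = f q.1) := fun q h1 h2 =>
    (hball q.1 h1).1 q.2 (abs_lt.2 ⟨by linarith [h2.1], by linarith [h2.2]⟩)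
  have key := hD.two_sides hp hI hO
    (disjoint_left.2 fun q hq hqC => by
      have h1 := (hball q.1 hq.1).2.1
      exact hq.2.1.ne' ((hCiff q hq.1 ⟨h1.1.trans hq.2.1, hq.2.2⟩).1 hqC))
    (disjoint_left.2 fun q hq hqC => by
      have h1 := (hball q.1 hq.1).2.1
      exact hq.2.2.ne ((hCiff q hq.1 ⟨hq.2.1, hq.2.2.trans h1.2⟩).1 hqC))
    (hbox.mono fun q hq => by
      rcases lt_trichotomy q.2 (f q.1) with h1 | h1 | h1
      · exact Or.inr (Or.inr ⟨hq.1, hq.2.1, h1⟩)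
      · exact Or.inl ((hCiff q hq.1 hq.2).2 h1)
      · exact Or.inr (Or.inl ⟨hq.1, h1, hq.2.2⟩))
  have hCD : frontier D ⊆ D := hD.1.frontier_subset
  rcases key with ⟨hi, ho⟩ | ⟨ho, hi⟩
  · refine Or.inl ⟨f, h.cont, h.eq, hbox.mono fun q hq => ?_⟩
    have hC := hCiff q hq.1 hq.2
    have hqD : q ∈ D ↔ f q.1 ≤ q.2 := by
      constructor
      · intro hqD
        by_contra hlt
        exact ho ⟨hq.1, hq.2.1, not_le.1 hlt⟩ hqD
      · intro hle
        rcases hle.eq_or_lt with h1 | h1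
        · exact hCD (hC.2 h1.symm)
        · exact hi ⟨hq.1, h1, hq.2.2⟩
    refine ⟨hqD, ?_⟩
    rw [hD.1.mem_closure_compl_iff, hqD, hC, not_le, le_iff_lt_or_eq]
  · refine Or.inr ⟨f, h.cont, h.eq, hbox.mono fun q hq => ?_⟩
    have hC := hCiff q hq.1 hq.2
    have hqD : q ∈ D ↔ q.2 ≤ f q.1 := by
      constructor
      · intro hqD
        by_contra hlt
        exact hi ⟨hq.1, not_le.1 hlt, hq.2.2⟩ hqD
      · intro hle
        rcases hle.eq_or_lt with h1 | h1
        · exact hCD (hC.2 h1)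
        · exact ho ⟨hq.1, hq.2.1, h1⟩
    refine ⟨?_, hqD⟩
    rw [hD.1.mem_closure_compl_iff, hqD, hC, not_le, le_iff_lt_or_eq, eq_comm]

/-- In a small box the complement of the fork has two connected parts: the region between the
branches, and the union of the regions below, above and behind the fork. By `two_sides` the domain
occupies exactly one of them. -/
theorem ForkAt.foldAt {D : Set (ℝ × ℝ)} {s : Side} {v : ℝ × ℝ} {f₁ f₂ : ℝ → ℝ}
    (h : ForkAt (frontier D) s v f₁ f₂) (hD : IsSurfaceWithBoundary D) :
    FoldAt D (closure Dᶜ) s v ∨ FoldAt (closure Dᶜ) D s v := by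
  have hv : v ∈ frontier D := h.mem_iff.self_of_nhds.2 (Or.inl rfl)
  obtain ⟨ε, hε, hεx⟩ := exists_vertical_bound h.mem_iff
  -- The branches are extended behind `v` by the constant `v.2`, so that all the regions are
  -- described over one interval around `v.1`.
  obtain ⟨k₁, hk₁, hk₁0, hk₁s, hk₁f⟩ := s.exists_glue (b := fun _ => v.2)
    (h.cont.mono fun x hx => hx.1) h.lim₁ (Eventually.of_forall fun x => continuousAt_const)
    tendsto_const_nhds
  obtain ⟨k₂, hk₂, hk₂0, hk₂s, hk₂f⟩ := s.exists_glue (b := fun _ => v.2)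
    (h.cont.mono fun x hx => hx.2) h.lim₂ (Eventually.of_forall fun x => continuousAt_const)
    tendsto_const_nhds
  have hval : ∀ {k : ℝ → ℝ}, (∀ᶠ x in 𝓝 v.1, ContinuousAt k x) → k v.1 = v.2 →
      ∀ᶠ x in 𝓝 v.1, k x ∈ Ioo (v.2 - ε) (v.2 + ε) := fun hk h0 =>
    hk.self_of_nhds.eventually (by rw [h0]; exact Ioo_mem_nhds (by linarith) (by linarith))
  obtain ⟨r, hr, hball⟩ := Metric.eventually_nhds_iff_ball.1 (hεx.and
    ((hval hk₁ hk₁0).and ((hval hk₂ hk₂0).and (hk₁.and (hk₂.and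
      (eventually_nhdsWithin_iff.1 h.lt))))))
  set J := Metric.ball v.1 r with hJdef
  have hJ : J.OrdConnected := by rw [hJdef, Real.ball_eq_Ioo]; exact ordConnected_Ioo
  have hc₁ : ContinuousOn k₁ J := fun x hx => (hball x hx).2.2.2.1.continuousWithinAt
  have hc₂ : ContinuousOn k₂ J := fun x hx => (hball x hx).2.2.2.2.1.continuousWithinAt
  have hm₁ : ∀ x ∈ J, k₁ x ∈ Ioo (v.2 - ε) (v.2 + ε) := fun x hx => (hball x hx).2.1
  have hm₂ : ∀ x ∈ J, k₂ x ∈ Ioo (v.2 - ε) (v.2 + ε) := fun x hx => (hball x hx).2.2.1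
  have hlt : ∀ x ∈ J, s.Past v.1 x → k₁ x < k₂ x := fun x hx hs => by
    rw [hk₁s x hs, hk₂s x hs]; exact (hball x hx).2.2.2.2.2 hs
  have hnp : ∀ x, ¬ s.Past v.1 x → k₁ x = v.2 ∧ k₂ x = v.2 := fun x hx => by
    rcases s.past_trichotomy v.1 x with h1 | h1 | h1
    · exact absurd h1 hx
    · rw [← h1]; exact ⟨hk₁0, hk₂0⟩
    · exact ⟨hk₁f x h1, hk₂f x h1⟩
  have hbox : ∀ᶠ q : ℝ × ℝ in 𝓝 v, q.1 ∈ J ∧ q.2 ∈ Ioo (v.2 - ε) (v.2 + ε) :=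
    (continuousAt_fst.eventually (Metric.ball_mem_nhds _ hr)).and
      (continuousAt_snd.eventually (Ioo_mem_nhds (by linarith) (by linarith)))
  have hCiff : ∀ q : ℝ × ℝ, q.1 ∈ J → q.2 ∈ Ioo (v.2 - ε) (v.2 + ε) →
      (q ∈ frontier D ↔ q = v ∨ s.Past v.1 q.1 ∧ (q.2 = k₁ q.1 ∨ q.2 = k₂ q.1)) := fun q h1 h2 => by
    rw [(hball q.1 h1).1 q.2 (abs_lt.2 ⟨by linarith [h2.1], by linarith [h2.2]⟩)]
    refine or_congr_right (and_congr_right fun hs => ?_)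
    rw [hk₁s _ hs, hk₂s _ hs]
  -- the inside
  have hI := isPreconnected_between (J := J ∩ s.ray v.1) (hJ.inter (s.ordConnected_ray _))
    (hc₁.mono inter_subset_left) (hc₂.mono inter_subset_left) fun x hx => hlt x hx.1 hx.2
  -- the outside
  have hO₁ := isPreconnected_between hJ (continuousOn_const (c := v.2 - ε)) hc₁
    fun x hx => (hm₁ x hx).1
  have hO₂ := isPreconnected_between (J := J ∩ s.flip.ray v.1)
    (hJ.inter (s.flip.ordConnected_ray _)) (continuousOn_const (c := v.2 - ε))
    (continuousOn_const (c := v.2 + ε)) fun x hx => by linarith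
  have hO₃ := isPreconnected_between hJ hc₂ (continuousOn_const (c := v.2 + ε))
    fun x hx => (hm₂ x hx).2
  obtain ⟨x₀, hx₀J, hx₀⟩ : ∃ x₀ ∈ J, s.flip.Past v.1 x₀ := by
    have : ∀ᶠ x in 𝓝[s.flip.ray v.1] v.1, x ∈ J ∧ s.flip.Past v.1 x :=
      inter_mem (mem_nhdsWithin_of_mem_nhds (Metric.ball_mem_nhds _ hr)) self_mem_nhdsWithin
    exact this.exists
  have hO₁₂ := IsPreconnected.union (x₀, v.2 - ε / 2)
    (by exact ⟨hx₀J, by simp only; linarith, by simp only [hk₁f x₀ hx₀]; linarith⟩)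
    (by exact ⟨⟨hx₀J, hx₀⟩, by simp only; linarith, by simp only; linarith⟩) hO₁ hO₂
  have hO := IsPreconnected.union (x₀, v.2 + ε / 2)
    (by exact Or.inr ⟨⟨hx₀J, hx₀⟩, by simp only; linarith, by simp only; linarith⟩)
    (by exact ⟨hx₀J, by simp only [hk₂f x₀ hx₀]; linarith, by simp only; linarith⟩) hO₁₂ hO₃
  set I := {q : ℝ × ℝ | q.1 ∈ J ∩ s.ray v.1 ∧ k₁ q.1 < q.2 ∧ q.2 < k₂ q.1} with hIdef
  set O := {q : ℝ × ℝ | q.1 ∈ J ∧ v.2 - ε < q.2 ∧ q.2 < k₁ q.1} ∪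
    {q : ℝ × ℝ | q.1 ∈ J ∩ s.flip.ray v.1 ∧ v.2 - ε < q.2 ∧ q.2 < v.2 + ε} ∪
    {q : ℝ × ℝ | q.1 ∈ J ∧ k₂ q.1 < q.2 ∧ q.2 < v.2 + ε} with hOdef
  have hIiff : ∀ q : ℝ × ℝ, q.1 ∈ J → q.2 ∈ Ioo (v.2 - ε) (v.2 + ε) →
      (q ∈ I ↔ s.Past v.1 q.1 ∧ k₁ q.1 < q.2 ∧ q.2 < k₂ q.1) := fun q h1 h2 =>
    ⟨fun h => ⟨h.1.2, h.2⟩, fun h => ⟨⟨h1, h.1⟩, h.2⟩⟩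
  have hOiff : ∀ q : ℝ × ℝ, q.1 ∈ J → q.2 ∈ Ioo (v.2 - ε) (v.2 + ε) →
      (q ∈ O ↔ q.2 < k₁ q.1 ∨ s.flip.Past v.1 q.1 ∨ k₂ q.1 < q.2) := fun q h1 h2 => by
    constructor
    · rintro ((h | h) | h)
      exacts [Or.inl h.2.2, Or.inr (Or.inl h.1.2), Or.inr (Or.inr h.2.1)]
    · rintro (h | h | h)
      exacts [Or.inl (Or.inl ⟨h1, h2.1, h⟩), Or.inl (Or.inr ⟨⟨h1, h⟩, h2⟩), Or.inr ⟨h1, h, h2.2⟩]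
  -- the three parts of the box
  have hpart : ∀ q : ℝ × ℝ, q.1 ∈ J → q.2 ∈ Ioo (v.2 - ε) (v.2 + ε) →
      (q ∈ frontier D ∧ q ∉ I ∧ q ∉ O) ∨ (q ∉ frontier D ∧ q ∈ I ∧ q ∉ O) ∨
      (q ∉ frontier D ∧ q ∉ I ∧ q ∈ O) := by
    intro q h1 h2
    rw [hCiff q h1 h2, hIiff q h1 h2, hOiff q h1 h2]
    rcases s.past_trichotomy v.1 q.1 with hs | hs | hs
    · have h3 : ¬ s.flip.Past v.1 q.1 := Side.flip_past_irrefl hs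
      have h4 : q ≠ v := fun he => s.past_irrefl v.1 (by rwa [he] at hs)
      have h5 := hlt q.1 h1 hs
      simp only [h3, h4, hs, true_and, false_or]
      rcases lt_trichotomy q.2 (k₁ q.1) with h6 | h6 | h6
      · right; right
        refine ⟨?_, fun h => by linarith [h.1], Or.inl h6⟩
        rintro (h | h) <;> linarith
      · left
        refine ⟨Or.inl h6, fun h => by linarith [h.1], ?_⟩
        rintro (h | h) <;> linarith
      · rcases lt_trichotomy q.2 (k₂ q.1) with h7 | h7 | h7
        · right; left
          refine ⟨?_, ⟨h6, h7⟩, ?_⟩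
          · rintro (h | h) <;> linarith
          · rintro (h | h) <;> linarith
        · left
          refine ⟨Or.inr h7, fun h => by linarith [h.2], ?_⟩
          rintro (h | h) <;> linarith
        · right; right
          refine ⟨?_, fun h => by linarith [h.2], Or.inr h7⟩
          rintro (h | h) <;> linarith
    · have h3 : ¬ s.Past v.1 q.1 := by rw [← hs]; exact s.past_irrefl _
      have h3' : ¬ s.flip.Past v.1 q.1 := by rw [← hs]; exact s.flip.past_irrefl _
      obtain ⟨h4, h5⟩ := hnp q.1 h3
      rw [h4, h5]
      have h6 : q = v ↔ q.2 = v.2 := ⟨fun he => by rw [he], fun he => Prod.ext hs.symm he⟩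
      simp only [h3, h3', h6, false_and, or_false, false_or]
      rcases lt_trichotomy q.2 v.2 with h7 | h7 | h7
      · exact Or.inr (Or.inr ⟨h7.ne, id, Or.inl h7⟩)
      · exact Or.inl ⟨h7, id, by rw [h7]; simp⟩
      · exact Or.inr (Or.inr ⟨h7.ne', id, Or.inr h7⟩)
    · have h3 : ¬ s.Past v.1 q.1 := fun h' => Side.flip_past_irrefl h' hs
      have h4 : q ≠ v := fun he => s.flip.past_irrefl v.1 (by rwa [he] at hs)
      right; right
      simp only [h3, h4, hs, false_and, or_false, true_or, or_true, not_false_iff, and_self]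
  have hinbox : ∀ q, q ∈ I ∨ q ∈ O → q.1 ∈ J ∧ q.2 ∈ Ioo (v.2 - ε) (v.2 + ε) := by
    rintro q (h | ((h | h) | h))
    · exact ⟨h.1.1, (hm₁ _ h.1.1).1.trans h.2.1, h.2.2.trans (hm₂ _ h.1.1).2⟩
    · exact ⟨h.1, h.2.1, h.2.2.trans (hm₁ _ h.1).2⟩
    · exact ⟨h.1.1, h.2⟩
    · exact ⟨h.1, (hm₂ _ h.1).1.trans h.2.1, h.2.2⟩
  have key := hD.two_sides hv hI hO
    (disjoint_left.2 fun q hq hqC => by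
      have h1 := hinbox q (Or.inl hq)
      have := hpart q h1.1 h1.2
      tauto)
    (disjoint_left.2 fun q hq hqC => by
      have h1 := hinbox q (Or.inr hq)
      have := hpart q h1.1 h1.2
      tauto)
    (hbox.mono fun q hq => by
      have := hpart q hq.1 hq.2
      tauto)
  have hCD : frontier D ⊆ D := hD.1.frontier_subset
  -- the two closed regions
  have hin : ∀ q : ℝ × ℝ, q.1 ∈ J → q.2 ∈ Ioo (v.2 - ε) (v.2 + ε) →
      ((q ∈ frontier D ∨ q ∈ I) ↔ q = v ∨ s.Past v.1 q.1 ∧ f₁ q.1 ≤ q.2 ∧ q.2 ≤ f₂ q.1) := by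
    intro q h1 h2
    rw [hCiff q h1 h2, hIiff q h1 h2, or_assoc, ← and_or_left]
    refine or_congr_right (and_congr_right fun hs => ?_)
    have h3 := hlt q.1 h1 hs
    rw [← hk₁s _ hs, ← hk₂s _ hs]
    constructor
    · rintro ((h | h) | h)
      · exact ⟨h.ge, h.trans_le h3.le⟩
      · exact ⟨h3.le.trans h.ge, h.le⟩
      · exact ⟨h.1.le, h.2.le⟩
    · rintro ⟨h4, h5⟩
      rcases h4.eq_or_lt with h6 | h6
      · exact Or.inl (Or.inl h6.symm)
      · rcases h5.eq_or_lt with h7 | h7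
        · exact Or.inl (Or.inr h7)
        · exact Or.inr ⟨h6, h7⟩
  have hout : ∀ q : ℝ × ℝ, q.1 ∈ J → q.2 ∈ Ioo (v.2 - ε) (v.2 + ε) →
      (q ∉ I ↔ ¬ (s.Past v.1 q.1 ∧ f₁ q.1 < q.2 ∧ q.2 < f₂ q.1)) := by
    intro q h1 h2
    rw [hIiff q h1 h2]
    refine not_congr (and_congr_right fun hs => ?_)
    rw [hk₁s _ hs, hk₂s _ hs]
  rcases key with ⟨hi, ho⟩ | ⟨ho, hi⟩
  · refine Or.inl ⟨f₁, f₂, h.cont, h.lim₁, h.lim₂, h.lt, hbox.mono fun q hq => ?_⟩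
    have h1 := hpart q hq.1 hq.2
    have h2 := @hi q
    have h3 := @ho q
    have h4 := @hCD q
    rw [← hin q hq.1 hq.2, ← hout q hq.1 hq.2, hD.1.mem_closure_compl_iff]
    rw [mem_compl_iff] at h3
    tauto
  · refine Or.inr ⟨f₁, f₂, h.cont, h.lim₁, h.lim₂, h.lt, hbox.mono fun q hq => ?_⟩
    have h1 := hpart q hq.1 hq.2
    have h2 := @hi q
    have h3 := @ho q
    have h4 := @hCD q
    rw [← hin q hq.1 hq.2, ← hout q hq.1 hq.2, hD.1.mem_closure_compl_iff]
    rw [mem_compl_iff] at h2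
    tauto

/-- Two closed sets that cover the plane and meet along a curve, with folds at the points
of `V`. -/
structure DomainPair (D E V : Set (ℝ × ℝ)) : Prop where
  closedD : IsClosed D
  closedE : IsClosed E
  cover : ∀ p, p ∈ D ∨ p ∈ E
  finite : V.Finite
  inj : InjOn Prod.fst V
  bdd : ∀ x, ∃ R, ∀ᶠ x' in 𝓝 x, ∀ y, (x', y) ∈ D ∩ E → |y| ≤ R
  reg : ∀ p ∈ D ∩ E, p ∉ V → RegAt D E p ∨ RegAt E D p
  fold : ∀ v ∈ V, ∃ s, FoldAt D E s v ∨ FoldAt E D s v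

/-- A fork is not injective under the projection near its tip, whereas a graph is locally embedded
by it. So forks occur exactly at the topological critical points. -/
theorem VerticalPlane.IsGenericDomain.domainPair {D : Set (ℝ × ℝ)}
    (hD : stdPlane.IsGenericDomain D) :
    DomainPair D (closure Dᶜ) (stdPlane.topCrit (frontier D)) := by
  have hDc := hD.surface.1
  set V := stdPlane.topCrit (frontier D) with hV
  have hmem : ∀ p, p ∈ D ∩ closure Dᶜ ↔ p ∈ frontier D := fun p => by
    have : p ∈ frontier D → p ∈ D := fun h => hDc.frontier_subset h
    rw [mem_inter_iff, hDc.mem_closure_compl_iff]; tauto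
  have hinj : ∀ q ∈ frontier D, q ∉ V → ∃ U ∈ 𝓝 q, InjOn Prod.fst (frontier D ∩ U) := by
    intro q hq hqV
    by_contra hcon
    refine hqV ⟨hq, fun ⟨U, hU, hemb⟩ => hcon ⟨U, hU, injOn_iff_injective.2 hemb.injective⟩⟩
  have hloc : ∀ p ∈ frontier D,
      (∃ f, GraphAt (frontier D) p f) ∨ ∃ s f₁ f₂, ForkAt (frontier D) s p f₁ f₂ := by
    intro p hp
    refine hD.surface.graphAt_or_forkAt hp ?_
    filter_upwards [eventually_notMem_finite hD.finite_crit p] with q h1 h2 h3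
    exact hinj q h2 fun h => h3 (h1 h)
  refine ⟨hDc, isClosed_closure, fun p => ?_, hD.finite_crit, hD.generic, fun x => ?_, ?_, ?_⟩
  · rw [hDc.mem_closure_compl_iff]; tauto
  · obtain ⟨R, hR⟩ := exists_bound_of_isProperMap hD.proper x
    exact ⟨R, hR.mono fun x' h y hy => h y ((hmem _).1 hy)⟩
  · intro p hp hpV
    rw [hmem] at hp
    rcases hloc p hp with ⟨f, hf⟩ | ⟨s, f₁, f₂, hf⟩
    · exact hf.regAt hD.surface
    · obtain ⟨U, hU, hi⟩ := hinj p hp hpV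
      exact absurd hi (hf.not_injOn hU)
  · intro v hv
    rcases hloc v hv.1 with ⟨f, hf⟩ | ⟨s, f₁, f₂, hf⟩
    · exact absurd (hf.exists_isEmbedding isClosed_frontier) hv.2
    · exact ⟨s, hf.foldAt hD.surface⟩

/-! ### Vertical segments and fibrewise retractions -/

/-- The vertical segment from `p` to `q` is contained in `D`. -/
def VRel (D : Set (ℝ × ℝ)) (p q : ℝ × ℝ) : Prop := p.1 = q.1 ∧ ∀ y ∈ uIcc p.2 q.2, (p.1, y) ∈ D

namespace VRel

variable {D : Set (ℝ × ℝ)} {p q w : ℝ × ℝ}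

theorem refl (hp : p ∈ D) : VRel D p p := ⟨rfl, fun y hy => by
  rw [uIcc_self, mem_singleton_iff] at hy; rwa [hy]⟩

theorem symm (h : VRel D p q) : VRel D q p :=
  ⟨h.1.symm, fun y hy => h.1 ▸ h.2 y (uIcc_comm q.2 p.2 ▸ hy)⟩

theorem trans (h : VRel D p q) (h' : VRel D q w) : VRel D p w := by
  refine ⟨h.1.trans h'.1, fun y hy => ?_⟩
  rcases uIcc_subset_uIcc_union_uIcc (b := q.2) hy with h1 | h1
  · exact h.2 y h1
  · rw [h.1]; exact h'.2 y h1

theorem left_mem (h : VRel D p q) : p ∈ D := h.2 p.2 left_mem_uIcc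

theorem right_mem (h : VRel D p q) : q ∈ D := h.symm.left_mem

theorem mid (h : VRel D p q) {y : ℝ} (hy : y ∈ uIcc p.2 q.2) : VRel D p (p.1, y) :=
  ⟨rfl, fun z hz => h.2 z (uIcc_subset_uIcc_left hy hz)⟩

theorem of_forall {x y z : ℝ} (h : ∀ t ∈ uIcc y z, (x, t) ∈ D) : VRel D (x, y) (x, z) := ⟨rfl, h⟩

end VRel

/-- With the segment parametrized affinely by `[0, 1]`, the relation is an intersection of closed
conditions on the two endpoints. -/
theorem isClosed_vRel {D : Set (ℝ × ℝ)} (hD : IsClosed D) :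
    IsClosed {z : (ℝ × ℝ) × (ℝ × ℝ) | VRel D z.1 z.2} := by
  have : {z : (ℝ × ℝ) × (ℝ × ℝ) | VRel D z.1 z.2} = {z | z.1.1 = z.2.1} ∩
      ⋂ t ∈ Icc (0 : ℝ) 1, {z | (z.1.1, z.1.2 + t * (z.2.2 - z.1.2)) ∈ D} := by
    ext z
    simp only [mem_inter_iff, mem_iInter, mem_ofPred_eq, VRel]
    refine and_congr_right fun _ => ?_
    rw [← segment_eq_uIcc, segment_eq_image']
    simp only [forall_mem_image, smul_eq_mul]
  rw [this]
  refine (isClosed_eq (by fun_prop) (by fun_prop)).inter (isClosed_biInter fun t _ => ?_)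
  exact hD.preimage (by fun_prop)

/-- Near `p`, the set `D` is convex in the vertical direction. -/
def VConvexAt (D : Set (ℝ × ℝ)) (p : ℝ × ℝ) : Prop :=
  ∀ᶠ z in 𝓝 (p, p), z.1 ∈ D → z.2 ∈ D → z.1.1 = z.2.1 → VRel D z.1 z.2

/-- There is a continuous selection of points of `D` through `p`. -/
def SelectionAt (D : Set (ℝ × ℝ)) (p : ℝ × ℝ) : Prop :=
  ∃ h : ℝ → ℝ, (∀ᶠ x in 𝓝 p.1, ContinuousAt h x) ∧ h p.1 = p.2 ∧ ∀ᶠ x in 𝓝 p.1, (x, h x) ∈ D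

theorem VConvexAt.of_eventually {D : Set (ℝ × ℝ)} {p : ℝ × ℝ} {Q : ℝ → ℝ → Prop}
    (hQ : ∀ x y z t, t ∈ uIcc y z → Q x y → Q x z → Q x t)
    (h : ∀ᶠ q in 𝓝 p, q ∈ D ↔ Q q.1 q.2) : VConvexAt D p := by
  obtain ⟨ε, hε, hεx⟩ := exists_vertical_bound h
  have h1 : ∀ᶠ z : (ℝ × ℝ) × (ℝ × ℝ) in 𝓝 (p, p),
      ∀ y, |y - p.2| < ε → ((z.1.1, y) ∈ D ↔ Q z.1.1 y) :=
    (show ContinuousAt (fun z : (ℝ × ℝ) × (ℝ × ℝ) => z.1.1) (p, p) by fun_prop).eventually hεx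
  have h2 : ∀ᶠ q : ℝ × ℝ in 𝓝 p, q.2 ∈ Ioo (p.2 - ε) (p.2 + ε) :=
    continuousAt_snd.eventually (Ioo_mem_nhds (by linarith) (by linarith))
  have h3 : ∀ᶠ z : (ℝ × ℝ) × (ℝ × ℝ) in 𝓝 (p, p), z.1.2 ∈ Ioo (p.2 - ε) (p.2 + ε) :=
    (show ContinuousAt (fun z : (ℝ × ℝ) × (ℝ × ℝ) => z.1) (p, p) by fun_prop).eventually h2
  have h4 : ∀ᶠ z : (ℝ × ℝ) × (ℝ × ℝ) in 𝓝 (p, p), z.2.2 ∈ Ioo (p.2 - ε) (p.2 + ε) :=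
    (show ContinuousAt (fun z : (ℝ × ℝ) × (ℝ × ℝ) => z.2) (p, p) by fun_prop).eventually h2
  filter_upwards [h1, h3, h4] with z a1 a3 a4 b1 b2 b3
  have key : ∀ t ∈ Ioo (p.2 - ε) (p.2 + ε), ((z.1.1, t) ∈ D ↔ Q z.1.1 t) := fun t ht =>
    a1 t (abs_lt.2 ⟨by linarith [ht.1], by linarith [ht.2]⟩)
  refine ⟨b3, fun t ht => (key t ?_).2 (hQ _ _ _ t ht ((key _ a3).1 b1) ((key _ a4).1 ?_))⟩
  · exact ordConnected_Ioo.uIcc_subset a3 a4 ht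
  · rw [b3]; exact b2

theorem frontier_subset_inter {D E : Set (ℝ × ℝ)} (hD : IsClosed D) (hE : IsClosed E)
    (hc : ∀ p, p ∈ D ∨ p ∈ E) : frontier D ⊆ D ∩ E := by
  rw [frontier_eq_closure_inter_closure]
  exact inter_subset_inter hD.closure_eq.subset
    (closure_minimal (fun p hp => (hc p).resolve_left hp) hE)

namespace DomainPair

variable {D E V : Set (ℝ × ℝ)} (P : DomainPair D E V)
include P

theorem symm : DomainPair E D V :=
  ⟨P.closedE, P.closedD, fun p => (P.cover p).symm, P.finite, P.inj, fun x => by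
    simpa only [inter_comm E D] using P.bdd x, fun p hp hpV => (P.reg p hp.symm hpV).symm,
    fun v hv => (P.fold v hv).imp fun _ h => h.symm⟩

theorem subset : V ⊆ D ∩ E := by
  intro v hv
  obtain ⟨s, ⟨f₁, f₂, -, -, -, -, h⟩ | ⟨f₁, f₂, -, -, -, -, h⟩⟩ := P.fold v hv
  · exact ⟨h.self_of_nhds.1.2 (Or.inl rfl), h.self_of_nhds.2.2 fun h => s.past_irrefl _ h.1⟩
  · exact ⟨h.self_of_nhds.2.2 fun h => s.past_irrefl _ h.1, h.self_of_nhds.1.2 (Or.inl rfl)⟩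

theorem eventually_mem {p : ℝ × ℝ} (hp : p ∉ E) : ∀ᶠ q in 𝓝 p, q ∈ D := by
  have h : ∀ᶠ q in 𝓝 p, q ∈ Eᶜ := P.closedE.isOpen_compl.mem_nhds hp
  exact h.mono fun q hq => (P.cover q).resolve_right hq

/-- The points of `V` must be excluded: for the domain that surrounds a fold, two points of one
fibre arbitrarily close to the tip can be separated by the fold. -/
theorem vConvexAt {p : ℝ × ℝ} (hp : p ∈ D) (hpV : p ∉ V) : VConvexAt D p := by
  by_cases hpE : p ∈ E
  · rcases P.reg p ⟨hp, hpE⟩ hpV with ⟨f, -, -, hf⟩ | ⟨f, -, -, hf⟩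
    · exact VConvexAt.of_eventually (Q := fun x y => f x ≤ y)
        (fun x y z t ht h1 h2 => (le_min h1 h2).trans ht.1) (hf.mono fun q hq => hq.1)
    · exact VConvexAt.of_eventually (Q := fun x y => y ≤ f x)
        (fun x y z t ht h1 h2 => ht.2.trans (max_le h1 h2)) (hf.mono fun q hq => hq.2)
  · exact VConvexAt.of_eventually (Q := fun _ _ => True) (fun _ _ _ _ _ _ _ => trivial)
      ((P.eventually_mem hpE).mono fun q hq => iff_true_intro hq)

theorem selectionAt {p : ℝ × ℝ} (hp : p ∈ D) (hpV : p ∉ V) : SelectionAt D p := by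
  by_cases hpE : p ∈ E
  · rcases P.reg p ⟨hp, hpE⟩ hpV with ⟨f, hf1, hf2, hf⟩ | ⟨f, hf1, hf2, hf⟩
    · exact ⟨f, hf1, hf2, (eventually_mk hf1.self_of_nhds hf2 hf).mono fun x hx => hx.1.2 le_rfl⟩
    · exact ⟨f, hf1, hf2, (eventually_mk hf1.self_of_nhds hf2 hf).mono fun x hx => hx.2.2 le_rfl⟩
  · exact ⟨fun _ => p.2, Eventually.of_forall fun x => continuousAt_const, rfl,
      eventually_mk continuousAt_const rfl (P.eventually_mem hpE)⟩

/-- A vertical segment of `D` that avoids `V` is stable. -/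
theorem eventually_vRel {p q : ℝ × ℝ} (h : VRel D p q) (hV : ∀ y ∈ uIcc p.2 q.2, (p.1, y) ∉ V) :
    ∀ᶠ z in 𝓝 (p, q), z.1 ∈ D → z.2 ∈ D → z.1.1 = z.2.1 → VRel D z.1 z.2 := by
  let R : ℝ → ℝ → Prop := fun y y' => ∀ᶠ z in 𝓝 ((p.1, y), (p.1, y')),
    z.1 ∈ D → z.2 ∈ D → z.1.1 = z.2.1 → VRel D z.1 z.2
  have hsymm : ∀ y y', R y y' → R y' y := by
    intro y y' hR
    have h1 := (continuous_swap.tendsto ((p.1, y'), (p.1, y))).eventually hR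
    exact h1.mono fun z hz h1 h2 h3 => (hz h2 h1 h3.symm).symm
  have key : R p.2 q.2 := by
    refine isPreconnected_uIcc.induction₂' (fun y y' => R y y') (s := uIcc p.2 q.2) ?_ ?_
      left_mem_uIcc right_mem_uIcc
    · intro y hy
      have h1 := eventually_eventually_nhds.2 (P.vConvexAt (h.2 y hy) (hV y hy))
      have h2 : Tendsto (fun y' : ℝ => ((p.1, y), (p.1, y'))) (𝓝 y) (𝓝 ((p.1, y), (p.1, y))) :=
        Continuous.tendsto (by fun_prop) y
      have h3 : ∀ᶠ y' in 𝓝 y, R y y' := h2.eventually h1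
      exact nhdsWithin_le_nhds (h3.mono fun y' h4 => ⟨h4, hsymm _ _ h4⟩)
    -- Transitivity needs an intermediate point over each nearby abscissa: it is supplied by a
    -- continuous selection through `(p.1, y')`.
    · intro y y' y'' hy hy' hy'' h1 h2
      obtain ⟨k, hk, hk0, hkD⟩ := P.selectionAt (h.2 y' hy') (hV y' hy')
      have t1 : Tendsto (fun z : (ℝ × ℝ) × (ℝ × ℝ) => z.1.1) (𝓝 ((p.1, y), (p.1, y''))) (𝓝 p.1) :=
        Continuous.tendsto (f := fun z : (ℝ × ℝ) × (ℝ × ℝ) => z.1.1) (by fun_prop) _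
      have t2 : Tendsto (fun z : (ℝ × ℝ) × (ℝ × ℝ) => (z.1.1, k z.1.1))
          (𝓝 ((p.1, y), (p.1, y''))) (𝓝 (p.1, y')) := by
        refine t1.prodMk_nhds ?_
        have := hk.self_of_nhds.tendsto.comp t1
        simp only at hk0
        rwa [hk0] at this
      filter_upwards [((continuous_fst.tendsto _).prodMk_nhds t2).eventually h1,
        (t2.prodMk_nhds (continuous_snd.tendsto _)).eventually h2, t1.eventually hkD]
        with z h3 h4 h5 h6 h7 h8
      exact (h3 h6 h5 rfl).trans (h4 h5 h7 h8)
  have hq : (p.1, q.2) = q := Prod.ext h.1 rfl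
  simp only [R, hq] at key
  exact key

theorem not_eventually_fibre {p : ℝ × ℝ} (hp : p ∈ D ∩ E) (hpV : p ∉ V) :
    ¬ ∀ᶠ y in 𝓝 p.2, (p.1, y) ∈ D := by
  intro h
  have t : Tendsto (fun y => (p.1, y)) (𝓝 p.2) (𝓝 p) := Continuous.tendsto (by fun_prop) p.2
  rcases P.reg p hp hpV with ⟨f, -, hf2, hf⟩ | ⟨f, -, hf2, hf⟩
  · have h1 : ∃ᶠ y in 𝓝 p.2, y < p.2 :=
      ((eventually_mem_nhdsWithin (s := Iio p.2)).frequently).filter_mono nhdsWithin_le_nhds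
    obtain ⟨y, h2, h3, h4⟩ := (h1.and_eventually (h.and (t.eventually hf))).exists
    have := h4.1.1 h3
    rw [hf2] at this
    exact this.not_gt h2
  · have h1 : ∃ᶠ y in 𝓝 p.2, p.2 < y :=
      ((eventually_mem_nhdsWithin (s := Ioi p.2)).frequently).filter_mono nhdsWithin_le_nhds
    obtain ⟨y, h2, h3, h4⟩ := (h1.and_eventually (h.and (t.eventually hf))).exists
    have := h4.2.1 h3
    rw [hf2] at this
    exact this.not_gt h2

/-- Over a neighbourhood of `x₀`, far above and far below, there are no points of the common
boundary. -/
theorem exists_far (x₀ : ℝ) : ∃ R : ℝ,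
    ((∀ᶠ x in 𝓝 x₀, ∀ y, R < y → (x, y) ∈ D) ∨ ∀ᶠ x in 𝓝 x₀, ∀ y, R < y → (x, y) ∉ D) ∧
    ((∀ᶠ x in 𝓝 x₀, ∀ y, y < -R → (x, y) ∈ D) ∨ ∀ᶠ x in 𝓝 x₀, ∀ y, y < -R → (x, y) ∉ D) := by
  obtain ⟨R, hR⟩ := P.bdd x₀
  obtain ⟨r, hr, hball⟩ := Metric.eventually_nhds_iff_ball.1 hR
  have hJ : (Metric.ball x₀ r).OrdConnected := by rw [Real.ball_eq_Ioo]; exact ordConnected_Ioo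
  have hfr := frontier_subset_inter P.closedD P.closedE P.cover
  have hn : Metric.ball x₀ r ∈ 𝓝 x₀ := Metric.ball_mem_nhds _ hr
  refine ⟨R, ?_, ?_⟩
  · refine (IsPreconnected.subset_or_subset_compl (D := D) (S := Metric.ball x₀ r ×ˢ Ioi R)
      (hJ.isPreconnected.prod isPreconnected_Ioi) (disjoint_left.2 fun q hq hqf => ?_)).imp ?_ ?_
    · exact hq.2.not_ge ((le_abs_self _).trans (hball q.1 hq.1 q.2 (hfr hqf)))
    · exact fun h => mem_of_superset hn fun x hx y hy => h ⟨hx, hy⟩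
    · exact fun h => mem_of_superset hn fun x hx y hy => h ⟨hx, hy⟩
  · refine (IsPreconnected.subset_or_subset_compl (D := D) (S := Metric.ball x₀ r ×ˢ Iio (-R))
      (hJ.isPreconnected.prod isPreconnected_Iio) (disjoint_left.2 fun q hq hqf => ?_)).imp ?_ ?_
    · have h1 := (neg_le_abs q.2).trans (hball q.1 hq.1 q.2 (hfr hqf))
      have h2 : q.2 < -R := hq.2
      linarith
    · exact fun h => mem_of_superset hn fun x hx y hy => h ⟨hx, hy⟩
    · exact fun h => mem_of_superset hn fun x hx y hy => h ⟨hx, hy⟩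

end DomainPair

/-- A continuous choice of a point in each connected component of the fibres of `D`. -/
structure Retraction (D : Set (ℝ × ℝ)) (r : ℝ × ℝ → ℝ × ℝ) : Prop where
  cont : ContinuousOn r D
  rel : ∀ p ∈ D, VRel D p (r p)
  const : ∀ p q, VRel D p q → r p = r q

namespace Retraction

variable {D E V : Set (ℝ × ℝ)} {r : ℝ × ℝ → ℝ × ℝ} (hr : Retraction D r)
include hr

theorem fst {p : ℝ × ℝ} (hp : p ∈ D) : (r p).1 = p.1 := (hr.rel p hp).1.symm

theorem mem_image_iff {q : ℝ × ℝ} : q ∈ r '' D ↔ q ∈ D ∧ r q = q := by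
  constructor
  · rintro ⟨p, hp, rfl⟩
    exact ⟨(hr.rel p hp).right_mem, (hr.const _ _ (hr.rel p hp)).symm⟩
  · rintro ⟨h1, h2⟩
    exact ⟨q, h1, h2⟩

theorem eq_of_vRel {p q : ℝ × ℝ} (hp : p ∈ r '' D) (hq : q ∈ r '' D) (h : VRel D p q) : p = q := by
  rw [← (hr.mem_image_iff.1 hp).2, ← (hr.mem_image_iff.1 hq).2, hr.const p q h]

theorem isClosed_image (hD : IsClosed D) : IsClosed (r '' D) := by
  have : r '' D = D ∩ (fun p => (r p, p)) ⁻¹' {z | z.1 = z.2} := by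
    ext q; exact hr.mem_image_iff
  rw [this]
  exact (hr.cont.prodMk continuousOn_id).preimage_isClosed_of_isClosed hD
    (isClosed_eq continuous_fst continuous_snd)

theorem continuousAt_comp {h : ℝ → ℝ} {x : ℝ} (hc : ContinuousAt h x)
    (hD : ∀ᶠ x' in 𝓝 x, (x', h x') ∈ D) : ContinuousAt (fun x' => (r (x', h x')).2) x := by
  have h1 : Tendsto (fun x' => (x', h x')) (𝓝 x) (𝓝[D] (x, h x)) :=
    tendsto_nhdsWithin_iff.2 ⟨tendsto_id.prodMk_nhds hc, hD⟩
  exact (continuous_snd.tendsto _).comp ((hr.cont _ hD.self_of_nhds).tendsto.comp h1)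

/-- Near `p`, vertical convexity joins every point of the graph to a continuous selection `h` by a
segment in `D`. Since `r` is constant on segments, the graph is locally the image of `h` under `r`.
-/
theorem graph_loc (P : DomainPair D E V) {p : ℝ × ℝ} (hp : p ∈ r '' D) (hpV : p ∉ V) :
    ∃ f : ℝ → ℝ, (∀ᶠ x in 𝓝 p.1, ContinuousAt f x) ∧ ∀ᶠ q in 𝓝 p, (q ∈ r '' D ↔ q.2 = f q.1) := by
  obtain ⟨hpD, hrp⟩ := hr.mem_image_iff.1 hp
  obtain ⟨h, hc, h0, hD⟩ := P.selectionAt hpD hpV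
  refine ⟨fun x => (r (x, h x)).2, ?_, ?_⟩
  · filter_upwards [hc, eventually_eventually_nhds.2 hD] with x h1 h2
    exact hr.continuousAt_comp h1 h2
  · have t : Tendsto (fun q : ℝ × ℝ => (q, (q.1, h q.1))) (𝓝 p) (𝓝 (p, p)) := by
      refine tendsto_id.prodMk_nhds ?_
      have := (continuousAt_fst (p := p)).prodMk_nhds (hc.self_of_nhds.tendsto.comp
        (continuous_fst.tendsto p))
      simp only [h0] at this
      exact this
    filter_upwards [t.eventually (P.vConvexAt hpD hpV), continuousAt_fst.eventually hD]
      with q h1 h2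
    constructor
    · intro hq
      obtain ⟨h3, h4⟩ := hr.mem_image_iff.1 hq
      rw [← hr.const _ _ (h1 h3 h2 rfl), h4]
    · intro hq
      refine ⟨(q.1, h q.1), h2, Prod.ext (hr.fst h2) hq.symm⟩

/-! ### The vertices -/

theorem tendsto_branch {s : Side} {v : ℝ × ℝ} (hv : v ∈ D) {f : ℝ → ℝ}
    (hc : ∀ᶠ x in 𝓝[s.ray v.1] v.1, ContinuousAt f x)
    (hl : Tendsto f (𝓝[s.ray v.1] v.1) (𝓝 v.2)) (hD : ∀ᶠ x in 𝓝[s.ray v.1] v.1, (x, f x) ∈ D) :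
    (∀ᶠ x in 𝓝[s.ray v.1] v.1, ContinuousAt (fun x => (r (x, f x)).2) x) ∧
    Tendsto (fun x => (r (x, f x)).2) (𝓝[s.ray v.1] v.1) (𝓝 (r v).2) := by
  constructor
  · filter_upwards [hc, eventually_eventually_nhdsWithin.2 hD, self_mem_nhdsWithin] with x h1 h2 h3
    rw [(s.isOpen_ray _).nhdsWithin_eq h3] at h2
    exact hr.continuousAt_comp h1 h2
  · have h1 : Tendsto (fun x => (x, f x)) (𝓝[s.ray v.1] v.1) (𝓝[D] v) :=
      tendsto_nhdsWithin_iff.2 ⟨tendsto_mk_of_tendsto hl, hD⟩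
    exact (continuous_snd.tendsto _).comp ((hr.cont v hv).tendsto.comp h1)

end Retraction

theorem VRel.eq_of_isolated {D : Set (ℝ × ℝ)} {v w : ℝ × ℝ} (h : VRel D v w)
    (hi : ∀ᶠ q in 𝓝 v, q ∈ D → q.1 = v.1 → q = v) : w = v := by
  by_contra hne
  have hne2 : w.2 ≠ v.2 := fun he => hne (Prod.ext h.1.symm he)
  have t : Tendsto (fun t : ℝ => (v.1, v.2 + t * (w.2 - v.2))) (𝓝[>] 0) (𝓝 v) := by
    have h1 : Continuous fun t : ℝ => (v.1, v.2 + t * (w.2 - v.2)) := by fun_prop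
    have h2 := h1.tendsto 0
    simp only [zero_mul, add_zero] at h2
    exact h2.mono_left nhdsWithin_le_nhds
  obtain ⟨c, h1, h2⟩ := ((t.eventually hi).and (Ioo_mem_nhdsGT one_pos)).exists
  have h3 := h1 (h.2 _ (by
    rw [← segment_eq_uIcc, segment_eq_image']
    exact ⟨c, ⟨h2.1.le, h2.2.le⟩, rfl⟩)) rfl
  have h4 := (Prod.ext_iff.1 h3).2
  simp only [add_eq_left, mul_eq_zero] at h4
  rcases h4 with h4 | h4
  · exact h2.1.ne' h4
  · exact hne2 (sub_eq_zero.1 h4)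

/-! ### Reeb graphs near the folds -/

namespace FoldAt

variable {D E : Set (ℝ × ℝ)} {s : Side} {v : ℝ × ℝ}

/-- A fold, seen in a box. -/
theorem exists_box (h : FoldAt D E s v) : ∃ (f₁ f₂ : ℝ → ℝ) (B : Set ℝ), B.OrdConnected ∧ v.2 ∈ B ∧
    ((∀ᶠ x in 𝓝[s.ray v.1] v.1, ContinuousAt f₁ x) ∧
      (∀ᶠ x in 𝓝[s.ray v.1] v.1, ContinuousAt f₂ x)) ∧
    (Tendsto f₁ (𝓝[s.ray v.1] v.1) (𝓝 v.2) ∧ Tendsto f₂ (𝓝[s.ray v.1] v.1) (𝓝 v.2)) ∧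
    (∀ᶠ x in 𝓝[s.ray v.1] v.1, f₁ x < f₂ x ∧ f₁ x ∈ B ∧ f₂ x ∈ B ∧
      ∀ y ∈ B, ((x, y) ∈ D ↔ f₁ x ≤ y ∧ y ≤ f₂ x) ∧ ((x, y) ∈ E ↔ ¬ (f₁ x < y ∧ y < f₂ x))) ∧
    (∀ᶠ q in 𝓝 v, q.2 ∈ B) ∧
    ∀ᶠ x in 𝓝 v.1, ¬ s.Past v.1 x → ∀ y ∈ B, (x, y) ∈ E ∧ ((x, y) ∈ D → (x, y) = v) := by
  obtain ⟨f₁, f₂, hc, hl₁, hl₂, hlt, hm⟩ := h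
  obtain ⟨ε, hε, hεx⟩ := exists_vertical_bound hm
  set B := Metric.ball v.2 ε with hB
  have hBi : ∀ y, y ∈ B ↔ |y - v.2| < ε := fun y => by rw [hB, Metric.mem_ball, Real.dist_eq]
  have hBn : B ∈ 𝓝 v.2 := Metric.ball_mem_nhds _ hε
  refine ⟨f₁, f₂, B, by rw [hB, Real.ball_eq_Ioo]; exact ordConnected_Ioo, mem_of_mem_nhds hBn,
    ⟨hc.mono fun x hx => hx.1, hc.mono fun x hx => hx.2⟩, ⟨hl₁, hl₂⟩, ?_,
    continuousAt_snd.eventually hBn, ?_⟩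
  · filter_upwards [hlt, hl₁.eventually hBn, hl₂.eventually hBn, mem_nhdsWithin_of_mem_nhds hεx,
      self_mem_nhdsWithin] with x h1 h2 h3 h4 h5
    have hx : s.Past v.1 x := h5
    refine ⟨h1, h2, h3, fun y hy => ?_⟩
    have h6 := h4 y ((hBi y).1 hy)
    have hne : (x, y) ≠ v := fun he => s.past_irrefl v.1 (by rw [← he] at hx ⊢; exact hx)
    simpa only [hne, hx, false_or, true_and] using h6
  · filter_upwards [hεx] with x h4 h5 y hy
    have h6 := h4 y ((hBi y).1 hy)
    simp only [h5, false_and, or_false, not_false_iff, iff_true] at h6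
    exact ⟨h6.2, h6.1.1⟩

end FoldAt

/-- The points of `V` are isolated on their fibres. -/
theorem Retraction.eq_vertex_inside {D E : Set (ℝ × ℝ)} {s : Side} {v : ℝ × ℝ} {r : ℝ × ℝ → ℝ × ℝ}
    (hr : Retraction D r) (hv : v ∈ D) (h : FoldAt D E s v) :
    r v = v ∧ ∀ᶠ q in 𝓝 v, q ∈ r '' D → q.1 = v.1 → q = v := by
  obtain ⟨f₁, f₂, B, -, -, -, -, -, hB, hx⟩ := h.exists_box
  have key : ∀ᶠ q in 𝓝 v, q ∈ D → q.1 = v.1 → q = v := by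
    filter_upwards [hB, continuousAt_fst.eventually hx] with q h1 h2 h3 h4
    exact (h2 (by rw [h4]; exact s.past_irrefl _) q.2 h1).2 h3
  exact ⟨(hr.rel v hv).eq_of_isolated key, key.mono fun q hq h1 =>
    hq (hr.mem_image_iff.1 h1).1⟩

/-- The branches of a Reeb graph at a fold that is filled by the domain. -/
theorem Retraction.branches_inside {D E : Set (ℝ × ℝ)} {s : Side} {v : ℝ × ℝ}
    {r : ℝ × ℝ → ℝ × ℝ} (hr : Retraction D r) (hv : v ∈ D) {f₁ f₂ : ℝ → ℝ} {B : Set ℝ}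
    (hBo : B.OrdConnected) (hrv : r v = v)
    (hc : ∀ᶠ x in 𝓝[s.ray v.1] v.1, ContinuousAt f₁ x)
    (hl : Tendsto f₁ (𝓝[s.ray v.1] v.1) (𝓝 v.2))
    (hs : ∀ᶠ x in 𝓝[s.ray v.1] v.1, f₁ x < f₂ x ∧ f₁ x ∈ B ∧ f₂ x ∈ B ∧
      ∀ y ∈ B, ((x, y) ∈ D ↔ f₁ x ≤ y ∧ y ≤ f₂ x) ∧ ((x, y) ∈ E ↔ ¬ (f₁ x < y ∧ y < f₂ x)))
    (hB : ∀ᶠ q in 𝓝 v, q.2 ∈ B)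
    (hx : ∀ᶠ x in 𝓝 v.1, ¬ s.Past v.1 x → ∀ y ∈ B, (x, y) ∈ E ∧ ((x, y) ∈ D → (x, y) = v)) :
    ∃ g : ℝ → ℝ, (HasBranches (r '' D) s v fun _ : Unit => g) ∧
      (HasBranches (r '' D) s.flip v fun i : Empty => i.elim) ∧
      ∀ᶠ x in 𝓝[s.ray v.1] v.1, f₁ x ≤ g x ∧ g x ≤ f₂ x := by
  have hsel : ∀ᶠ x in 𝓝[s.ray v.1] v.1, (x, f₁ x) ∈ D :=
    hs.mono fun x h => (h.2.2.2 _ h.2.1).1.2 ⟨le_rfl, h.1.le⟩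
  obtain ⟨b1, b2⟩ := hr.tendsto_branch hv hc hl hsel
  rw [hrv] at b2
  refine ⟨fun x => (r (x, f₁ x)).2, ⟨fun _ => b1, fun _ => b2, ?_⟩, ⟨fun i => i.elim,
    fun i => i.elim, ?_⟩, ?_⟩
  · filter_upwards [hB, continuousAt_fst.eventually (eventually_nhdsWithin_iff.1 (hs.and hsel))]
      with q h1 h2 h3
    obtain ⟨⟨h4, h5, h6, h7⟩, h8⟩ := h2 h3
    constructor
    · intro hq
      obtain ⟨h9, h10⟩ := hr.mem_image_iff.1 hq
      have h11 := (h7 q.2 h1).1.1 h9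
      have h12 : VRel D (q.1, f₁ q.1) q := ⟨rfl, fun y hy => by
        rw [uIcc_of_le h11.1] at hy
        exact (h7 y (hBo.out h5 h1 hy)).1.2 ⟨hy.1, hy.2.trans h11.2⟩⟩
      exact ⟨(), by rw [hr.const _ _ h12, h10]⟩
    · rintro ⟨-, hq⟩
      exact ⟨_, h8, Prod.ext (hr.fst h8) hq.symm⟩
  · filter_upwards [hB, continuousAt_fst.eventually hx] with q h1 h2 h3
    refine ⟨fun hq => ?_, fun ⟨i, _⟩ => i.elim⟩
    have h4 := (h2 (fun h => Side.flip_past_irrefl h h3) q.2 h1).2 (hr.mem_image_iff.1 hq).1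
    exact absurd h3 (by rw [show q.1 = v.1 from congrArg Prod.fst h4]; exact s.flip.past_irrefl _)
  · filter_upwards [hs, hsel, (tendsto_mk_of_tendsto b2).eventually hB] with x h1 h2 h3
    have h4 : (x, (r (x, f₁ x)).2) ∈ D := by
      have : (x, (r (x, f₁ x)).2) = r (x, f₁ x) := Prod.ext (hr.fst h2).symm rfl
      rw [this]; exact (hr.rel _ h2).right_mem
    exact (h1.2.2.2 _ h3).1.1 h4

/-- On the side of a fold, the segments of the outer domain do not cross the fold. -/
theorem outside_not_cross {E : Set (ℝ × ℝ)} {x a b : ℝ} {B : Set ℝ} (hBo : B.OrdConnected)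
    (hab : a < b) (ha : a ∈ B) (hb : b ∈ B) (hE : ∀ y ∈ B, ((x, y) ∈ E ↔ ¬ (a < y ∧ y < b))) :
    (∀ w, VRel E (x, a) w → w.2 ≤ a) ∧ ∀ w, VRel E (x, b) w → b ≤ w.2 := by
  have hmem : ∀ y, a < y → y < b → (x, y) ∉ E := fun y h1 h2 h3 =>
    (hE y (hBo.out ha hb ⟨h1.le, h2.le⟩)).1 h3 ⟨h1, h2⟩
  constructor
  · intro w hw
    by_contra hlt
    have h1 : a < w.2 := not_le.1 hlt
    have h2 : a < min b w.2 := lt_min hab h1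
    refine hmem ((a + min b w.2) / 2) (by linarith) (by linarith [min_le_left b w.2]) (hw.2 _ ?_)
    exact Icc_subset_uIcc ⟨by simp only; linarith, by linarith [min_le_right b w.2]⟩
  · intro w hw
    by_contra hlt
    have h1 : w.2 < b := not_le.1 hlt
    have h2 : max a w.2 < b := max_lt hab h1
    refine hmem ((b + max a w.2) / 2) (by linarith [le_max_left a w.2]) (by linarith) (hw.2 _ ?_)
    exact Icc_subset_uIcc' ⟨by linarith [le_max_right a w.2], by simp only; linarith⟩

/-- Segments of `E` cannot cross the fold, so `r` sends the lower branch weakly below itself and the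
upper branch weakly above itself. Both branches tend to `v`, and continuity of `r` forces `r v = v`.
Over `v.1` all points of a small box are on one segment with `v`, hence the isolation. -/
theorem Retraction.eq_vertex_outside {D E : Set (ℝ × ℝ)} {s : Side} {v : ℝ × ℝ}
    {r : ℝ × ℝ → ℝ × ℝ} (hr : Retraction E r) (hv : v ∈ E) (h : FoldAt D E s v) :
    r v = v ∧ ∀ᶠ q in 𝓝 v, q ∈ r '' E → q.1 = v.1 → q = v := by
  obtain ⟨f₁, f₂, B, hBo, hv2, hc, hl, hs, hB, hx⟩ := h.exists_box
  have hcross := hs.mono fun x h =>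
    outside_not_cross hBo h.1 h.2.1 h.2.2.1 fun y hy => (h.2.2.2 y hy).2
  have hsel₁ : ∀ᶠ x in 𝓝[s.ray v.1] v.1, (x, f₁ x) ∈ E :=
    hs.mono fun x h => (h.2.2.2 _ h.2.1).2.2 fun h' => lt_irrefl _ h'.1
  have hsel₂ : ∀ᶠ x in 𝓝[s.ray v.1] v.1, (x, f₂ x) ∈ E :=
    hs.mono fun x h => (h.2.2.2 _ h.2.2.1).2.2 fun h' => lt_irrefl _ h'.2
  have b1 := (hr.tendsto_branch hv hc.1 hl.1 hsel₁).2
  have b2 := (hr.tendsto_branch hv hc.2 hl.2 hsel₂).2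
  have hrv : r v = v := by
    refine Prod.ext (hr.fst hv) (le_antisymm ?_ ?_)
    · refine le_of_tendsto_of_tendsto b1 hl.1 ?_
      filter_upwards [hcross, hsel₁] with x h1 h2
      exact h1.1 _ (hr.rel _ h2)
    · refine le_of_tendsto_of_tendsto hl.2 b2 ?_
      filter_upwards [hcross, hsel₂] with x h1 h2
      exact h1.2 _ (hr.rel _ h2)
  refine ⟨hrv, ?_⟩
  filter_upwards [hB, continuousAt_fst.eventually hx] with q h1 h2 h3 h4
  obtain ⟨h5, h6⟩ := hr.mem_image_iff.1 h3
  have h7 := h2 (by rw [h4]; exact s.past_irrefl _)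
  rw [← h6, ← hrv]
  exact hr.const _ _ ⟨h4, fun y hy => (h7 y (hBo.uIcc_subset h1 hv2 hy)).1⟩

/-- The branches of a Reeb graph at a fold that is outside the domain. -/
theorem Retraction.branches_outside {D E : Set (ℝ × ℝ)} {s : Side} {v : ℝ × ℝ}
    {r : ℝ × ℝ → ℝ × ℝ} (hr : Retraction E r) (hv : v ∈ E) {f₁ f₂ : ℝ → ℝ} {B : Set ℝ}
    (hBo : B.OrdConnected) (hv2 : v.2 ∈ B) (hrv : r v = v)
    (hc : (∀ᶠ x in 𝓝[s.ray v.1] v.1, ContinuousAt f₁ x) ∧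
      ∀ᶠ x in 𝓝[s.ray v.1] v.1, ContinuousAt f₂ x)
    (hl : Tendsto f₁ (𝓝[s.ray v.1] v.1) (𝓝 v.2) ∧ Tendsto f₂ (𝓝[s.ray v.1] v.1) (𝓝 v.2))
    (hs : ∀ᶠ x in 𝓝[s.ray v.1] v.1, f₁ x < f₂ x ∧ f₁ x ∈ B ∧ f₂ x ∈ B ∧
      ∀ y ∈ B, ((x, y) ∈ D ↔ f₁ x ≤ y ∧ y ≤ f₂ x) ∧ ((x, y) ∈ E ↔ ¬ (f₁ x < y ∧ y < f₂ x)))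
    (hB : ∀ᶠ q in 𝓝 v, q.2 ∈ B)
    (hx : ∀ᶠ x in 𝓝 v.1, ¬ s.Past v.1 x → ∀ y ∈ B, (x, y) ∈ E ∧ ((x, y) ∈ D → (x, y) = v)) :
    ∃ h₀ h₁ h₂ : ℝ → ℝ, (HasBranches (r '' E) s.flip v fun _ : Unit => h₀) ∧
      (HasBranches (r '' E) s v fun b : Bool => if b then h₂ else h₁) ∧
      ∀ᶠ x in 𝓝[s.ray v.1] v.1, h₁ x ≤ f₁ x ∧ f₂ x ≤ h₂ x := by
  have hcross := hs.mono fun x h =>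
    outside_not_cross hBo h.1 h.2.1 h.2.2.1 fun y hy => (h.2.2.2 y hy).2
  have hsel₁ : ∀ᶠ x in 𝓝[s.ray v.1] v.1, (x, f₁ x) ∈ E :=
    hs.mono fun x h => (h.2.2.2 _ h.2.1).2.2 fun h' => lt_irrefl _ h'.1
  have hsel₂ : ∀ᶠ x in 𝓝[s.ray v.1] v.1, (x, f₂ x) ∈ E :=
    hs.mono fun x h => (h.2.2.2 _ h.2.2.1).2.2 fun h' => lt_irrefl _ h'.2
  have hx' : ∀ᶠ x in 𝓝 v.1, s.flip.Past v.1 x → ∀ y ∈ B, (x, y) ∈ E :=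
    hx.mono fun x h h1 y hy => (h (fun h2 => Side.flip_past_irrefl h2 h1) y hy).1
  have hsel₀ : ∀ᶠ x in 𝓝[s.flip.ray v.1] v.1, (x, v.2) ∈ E := by
    filter_upwards [mem_nhdsWithin_of_mem_nhds hx', self_mem_nhdsWithin] with x h1 h2
    exact h1 h2 _ hv2
  have b1 := hr.tendsto_branch hv hc.1 hl.1 hsel₁
  have b2 := hr.tendsto_branch hv hc.2 hl.2 hsel₂
  have b0 := hr.tendsto_branch (s := s.flip) hv (f := fun _ => v.2)
    (Eventually.of_forall fun x => continuousAt_const) tendsto_const_nhds hsel₀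
  rw [hrv] at b1 b2 b0
  refine ⟨fun x => (r (x, v.2)).2, fun x => (r (x, f₁ x)).2, fun x => (r (x, f₂ x)).2,
    ⟨fun _ => b0.1, fun _ => b0.2, ?_⟩, ⟨?_, ?_, ?_⟩, ?_⟩
  · filter_upwards [hB, continuousAt_fst.eventually hx'] with q h1 h2 h3
    have h4 := h2 h3
    constructor
    · intro hq
      obtain ⟨h9, h10⟩ := hr.mem_image_iff.1 hq
      have h12 : VRel E (q.1, v.2) q :=
        ⟨rfl, fun y hy => h4 y (hBo.uIcc_subset hv2 h1 hy)⟩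
      exact ⟨(), by rw [hr.const _ _ h12, h10]⟩
    · rintro ⟨-, hq⟩
      exact ⟨_, h4 _ hv2, Prod.ext (hr.fst (h4 _ hv2)) hq.symm⟩
  · rintro (_ | _)
    exacts [b1.1, b2.1]
  · rintro (_ | _)
    exacts [b1.2, b2.2]
  · filter_upwards [hB, continuousAt_fst.eventually (eventually_nhdsWithin_iff.1
      (hs.and (hsel₁.and hsel₂)))] with q h1 h2 h3
    obtain ⟨⟨h4, h5, h6, h7⟩, h8, h8'⟩ := h2 h3
    constructor
    · intro hq
      obtain ⟨h9, h10⟩ := hr.mem_image_iff.1 hq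
      have h11 := (h7 q.2 h1).2.1 h9
      rcases le_or_gt q.2 (f₁ q.1) with hle | hlt
      · have h12 : VRel E (q.1, f₁ q.1) q := ⟨rfl, fun y hy => by
          rw [uIcc_of_ge hle] at hy
          exact (h7 y (hBo.out h1 h5 hy)).2.2 fun h => h.1.not_ge hy.2⟩
        exact ⟨false, by simp [hr.const _ _ h12, h10]⟩
      · have hle : f₂ q.1 ≤ q.2 := not_lt.1 fun h => h11 ⟨hlt, h⟩
        have h12 : VRel E (q.1, f₂ q.1) q := ⟨rfl, fun y hy => by
          rw [uIcc_of_le hle] at hy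
          exact (h7 y (hBo.out h6 h1 hy)).2.2 fun h => h.2.not_ge hy.1⟩
        exact ⟨true, by simp [hr.const _ _ h12, h10]⟩
    · rintro ⟨_ | _, hq⟩
      · exact ⟨_, h8, Prod.ext (hr.fst h8) hq.symm⟩
      · exact ⟨_, h8', Prod.ext (hr.fst h8') hq.symm⟩
  · filter_upwards [hcross, hsel₁, hsel₂] with x h1 h2 h3
    exact ⟨h1.1 _ (hr.rel _ h2), h1.2 _ (hr.rel _ h3)⟩

namespace Retraction

variable {D E V : Set (ℝ × ℝ)} {r : ℝ × ℝ → ℝ × ℝ} (hr : Retraction D r) (P : DomainPair D E V)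
include hr P

theorem eq_vertex {v : ℝ × ℝ} (hv : v ∈ V) :
    r v = v ∧ ∀ᶠ q in 𝓝 v, q ∈ r '' D → q.1 = v.1 → q = v := by
  obtain ⟨s, h | h⟩ := P.fold v hv
  · exact hr.eq_vertex_inside (P.subset hv).1 h
  · exact hr.eq_vertex_outside (P.subset hv).1 h

theorem avoid {p q : ℝ × ℝ} (h : VRel D p q) (hp : r p ∉ V) : ∀ y ∈ uIcc p.2 q.2, (p.1, y) ∉ V := by
  intro y hy hV
  rw [hr.const _ _ (h.mid hy), (hr.eq_vertex P hV).1] at hp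
  exact hp hV

/-- Far above and far below, nearby fibres are either disjoint from `D` or contained in it. In the
second case that part of the fibre is a single segment, with one graph point depending continuously
on `x`, which bounds the graph. The fibres are then compact and discrete, hence finite. -/
theorem graphLike : GraphLike (r '' D) V := by
  have hcl := hr.isClosed_image P.closedD
  have hbdd : ∀ x, ∃ R, ∀ᶠ x' in 𝓝 x, ∀ y, (x', y) ∈ r '' D → |y| ≤ R := by
    intro x₀
    obtain ⟨R, hup, hdown⟩ := P.exists_far x₀
    obtain ⟨M, hM⟩ : ∃ M, ∀ᶠ x in 𝓝 x₀, ∀ y, R < y → (x, y) ∈ r '' D → |y| ≤ M := by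
      rcases hup with h | h
      · have hc := hr.continuousAt_comp (x := x₀) (h := fun _ => R + 1) continuousAt_const
          (h.mono fun x hx => hx _ (by linarith))
        refine ⟨|(r (x₀, R + 1)).2| + 1, ?_⟩
        filter_upwards [h, hc.abs.eventually (Iio_mem_nhds (lt_add_one _))] with x h1 h2 y hy hG
        have h3 : VRel D (x, R + 1) (x, y) := ⟨rfl, fun t ht => h1 t (by
          rcases le_total (R + 1) y with h | h
          · rw [uIcc_of_le h] at ht; linarith [ht.1]
          · rw [uIcc_of_ge h] at ht; linarith [ht.1])⟩
        have h4 := hr.const _ _ h3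
        rw [(hr.mem_image_iff.1 hG).2] at h4
        rw [h4] at h2
        exact h2.le
      · exact ⟨0, h.mono fun x hx y hy hG => absurd (hr.mem_image_iff.1 hG).1 (hx y hy)⟩
    obtain ⟨M', hM'⟩ : ∃ M, ∀ᶠ x in 𝓝 x₀, ∀ y, y < -R → (x, y) ∈ r '' D → |y| ≤ M := by
      rcases hdown with h | h
      · have hc := hr.continuousAt_comp (x := x₀) (h := fun _ => -R - 1) continuousAt_const
          (h.mono fun x hx => hx _ (by linarith))
        refine ⟨|(r (x₀, -R - 1)).2| + 1, ?_⟩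
        filter_upwards [h, hc.abs.eventually (Iio_mem_nhds (lt_add_one _))] with x h1 h2 y hy hG
        have h3 : VRel D (x, -R - 1) (x, y) := ⟨rfl, fun t ht => h1 t (by
          rcases le_total (-R - 1) y with h | h
          · rw [uIcc_of_le h] at ht; linarith [ht.2]
          · rw [uIcc_of_ge h] at ht; linarith [ht.2])⟩
        have h4 := hr.const _ _ h3
        rw [(hr.mem_image_iff.1 hG).2] at h4
        rw [h4] at h2
        exact h2.le
      · exact ⟨0, h.mono fun x hx y hy hG => absurd (hr.mem_image_iff.1 hG).1 (hx y hy)⟩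
    refine ⟨max |R| (max M M'), ?_⟩
    filter_upwards [hM, hM'] with x h1 h2 y hy
    by_cases h3 : R < y
    · exact (h1 y h3 hy).trans ((le_max_left _ _).trans (le_max_right _ _))
    · by_cases h4 : y < -R
      · exact (h2 y h4 hy).trans ((le_max_right _ _).trans (le_max_right _ _))
      · refine le_trans ?_ (le_max_left _ _)
        exact (abs_le.2 ⟨not_lt.1 h4, not_lt.1 h3⟩).trans (le_abs_self R)
  refine ⟨hcl, fun v hv => ⟨v, (P.subset hv).1, (hr.eq_vertex P hv).1⟩, P.finite, fun x => ?_, hbdd,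
    fun p hp => hr.graph_loc P hp.1 hp.2⟩
  have hiso : ∀ y, (x, y) ∈ r '' D → ∀ᶠ z in 𝓝 y, (x, z) ∈ r '' D → z = y := by
    intro y hy
    have t : Tendsto (fun z => (x, z)) (𝓝 y) (𝓝 (x, y)) := Continuous.tendsto (by fun_prop) y
    by_cases hV : (x, y) ∈ V
    · exact (t.eventually (hr.eq_vertex P hV).2).mono fun z hz h => (Prod.ext_iff.1 (hz h rfl)).2
    · obtain ⟨f, -, hf⟩ := hr.graph_loc P hy hV
      have h0 := hf.self_of_nhds.1 hy
      exact (t.eventually hf).mono fun z hz h => (hz.1 h).trans h0.symm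
  obtain ⟨R, hR⟩ := hbdd x
  have hcomp : IsCompact {y | (x, y) ∈ r '' D} := by
    refine (isCompact_Icc (a := -R) (b := R)).of_isClosed_subset
      (hcl.preimage (by fun_prop : Continuous fun y : ℝ => (x, y))) fun y hy => ?_
    exact abs_le.1 (hR.self_of_nhds y hy)
  obtain ⟨t, ht, hcov⟩ := hcomp.elim_nhds_subcover (fun y => {z | (x, z) ∈ r '' D → z = y})
    fun y hy => hiso y hy
  refine t.finite_toSet.subset fun z hz => ?_
  obtain ⟨y, hy, hzy⟩ := mem_iUnion₂.1 (hcov hz)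
  have : z = y := hzy hz
  exact this ▸ hy

end Retraction

/-! ### The trident completion of a Reeb graph by a Reeb graph of the complement -/

/-- The points above `p` are in `D`. -/
def UpIn (D : Set (ℝ × ℝ)) (p : ℝ × ℝ) : Prop := ∀ y, p.2 < y → (p.1, y) ∈ D

/-- The points below `p` are in `D`. -/
def DownIn (D : Set (ℝ × ℝ)) (p : ℝ × ℝ) : Prop := ∀ y, y < p.2 → (p.1, y) ∈ D

/-- The Poincaré–Reeb graph that is the image of the retraction `r`. -/
structure IsReeb (D V : Set (ℝ × ℝ)) (r : ℝ × ℝ → ℝ × ℝ) (G : EnrichedGraph (ℝ × ℝ)) : Prop where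
  retr : Retraction D r
  carrier : G.carrier = r '' D
  vertices : G.vertices = V
  up : ∀ E, E ∈ G.up ↔ E ∈ stdPlane.arrowEdges G ∧ ∀ p ∈ E, UpIn D p
  down : ∀ E, E ∈ G.down ↔ E ∈ stdPlane.arrowEdges G ∧ ∀ p ∈ E, DownIn D p

namespace DomainPair

variable {D E V : Set (ℝ × ℝ)} (P : DomainPair D E V)
include P

theorem notMem_of_mem_interior {x y : ℝ} {S : Set ℝ} (hS : S ∈ 𝓝 y) (hD : ∀ z ∈ S, (x, z) ∈ D)
    (hV : (x, y) ∉ V) : (x, y) ∉ E := fun hE =>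
  P.not_eventually_fibre ⟨hD y (mem_of_mem_nhds hS), hE⟩ hV (mem_of_superset hS hD)

/-- The point `b` is the upper end of the component of `(x, y)` in the fibre of `D`. As it is a
regular boundary point with `D` below it, segments of `E` through `b` can only go up. -/
theorem exists_top {x y : ℝ} (hV : ∀ y, (x, y) ∉ V) (hy : (x, y) ∈ D) (hup : ¬ UpIn D (x, y)) :
    ∃ b, y ≤ b ∧ VRel D (x, y) (x, b) ∧ (x, b) ∈ E ∧ ∀ w, VRel E (x, b) w → b ≤ w.2 := by
  obtain ⟨y₁, hyy₁, hy₁⟩ : ∃ y₁, y < y₁ ∧ (x, y₁) ∉ D := by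
    rw [UpIn] at hup; push Not at hup; exact hup
  let S : Set ℝ := {t | VRel D (x, y) (x, t)} ∩ Ici y
  have hSc : IsClosed S := ((isClosed_vRel P.closedD).preimage
    (by fun_prop : Continuous fun t : ℝ => ((x, y), (x, t)))).inter isClosed_Ici
  have hSb : ∀ t ∈ S, t < y₁ := by
    intro t ht
    by_contra hle
    exact hy₁ (ht.1.2 y₁ (Icc_subset_uIcc ⟨hyy₁.le, not_lt.1 hle⟩))
  have hSbdd : BddAbove S := ⟨y₁, fun t ht => (hSb t ht).le⟩
  have hbS : sSup S ∈ S := hSc.csSup_mem ⟨y, VRel.refl hy, self_mem_Ici⟩ hSbdd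
  set b := sSup S with hb
  have hbD : (x, b) ∈ D := hbS.1.right_mem
  -- The segment cannot be prolonged beyond its supremum. This excludes that `b` is off `E`, and
  -- that `D` is above `b` locally.
  have hext : ¬ ∀ᶠ t in 𝓝[>] b, ∀ z, b < z → z ≤ t → (x, z) ∈ D := by
    intro h
    obtain ⟨t, ht, hbt⟩ := (h.and self_mem_nhdsWithin).exists
    have hbt' : b < t := hbt
    have : t ∈ S := ⟨hbS.1.trans (VRel.of_forall fun z hz => by
      rw [uIcc_of_le hbt'.le] at hz
      rcases hz.1.eq_or_lt with h1 | h1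
      · rwa [← h1]
      · exact ht z h1 hz.2), hbS.2.trans hbt'.le⟩
    exact hbt'.not_ge (le_csSup hSbdd this)
  have hbE : (x, b) ∈ E := by
    by_contra hbE
    obtain ⟨ε, hε, h1⟩ := exists_vertical_bound (P.eventually_mem hbE)
    refine hext ?_
    filter_upwards [Ioo_mem_nhdsGT (show b < b + ε by linarith)] with t ht z hz hzt
    refine h1.self_of_nhds z (abs_lt.2 ⟨?_, ?_⟩) <;> simp only <;> linarith [ht.2]
  refine ⟨b, hbS.2, hbS.1, hbE, fun w hw => ?_⟩
  rcases P.reg _ ⟨hbD, hbE⟩ (hV b) with ⟨f, -, hf2, hf⟩ | ⟨f, -, hf2, hf⟩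
  · exfalso
    obtain ⟨ε, hε, h1⟩ := exists_vertical_bound hf
    refine hext ?_
    filter_upwards [Ioo_mem_nhdsGT (show b < b + ε by linarith)] with t ht z hz hzt
    have h2 := h1.self_of_nhds z (abs_lt.2 ⟨by simp only; linarith, by simp only; linarith [ht.2]⟩)
    refine h2.1.2 ?_
    simp only at hf2 ⊢
    rw [hf2]; exact hz.le
  · by_contra hlt
    obtain ⟨ε, hε, h1⟩ := exists_vertical_bound hf
    have hwb : w.2 < b := not_le.1 hlt
    have hmax : max w.2 (b - ε) < b := max_lt hwb (by linarith)
    have hz1 := le_max_left w.2 (b - ε)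
    have hz2 := le_max_right w.2 (b - ε)
    set z := (max w.2 (b - ε) + b) / 2 with hz
    have hzb : z < b := by linarith
    have h2 := h1.self_of_nhds z (abs_lt.2 ⟨by simp only; linarith, by simp only; linarith⟩)
    have h3 := h2.1.1 (hw.2 z (Icc_subset_uIcc' ⟨by linarith, hzb.le⟩))
    simp only at hf2 h3
    rw [hf2] at h3
    exact h3.not_gt hzb

theorem exists_bot {x y : ℝ} (hV : ∀ y, (x, y) ∉ V) (hy : (x, y) ∈ D) (hup : ¬ DownIn D (x, y)) :
    ∃ b, b ≤ y ∧ VRel D (x, y) (x, b) ∧ (x, b) ∈ E ∧ ∀ w, VRel E (x, b) w → w.2 ≤ b := by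
  obtain ⟨y₁, hyy₁, hy₁⟩ : ∃ y₁, y₁ < y ∧ (x, y₁) ∉ D := by
    rw [DownIn] at hup; push Not at hup; exact hup
  let S : Set ℝ := {t | VRel D (x, y) (x, t)} ∩ Iic y
  have hSc : IsClosed S := ((isClosed_vRel P.closedD).preimage
    (by fun_prop : Continuous fun t : ℝ => ((x, y), (x, t)))).inter isClosed_Iic
  have hSb : ∀ t ∈ S, y₁ < t := by
    intro t ht
    by_contra hle
    exact hy₁ (ht.1.2 y₁ (Icc_subset_uIcc' ⟨not_lt.1 hle, hyy₁.le⟩))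
  have hSbdd : BddBelow S := ⟨y₁, fun t ht => (hSb t ht).le⟩
  have hbS : sInf S ∈ S := hSc.csInf_mem ⟨y, VRel.refl hy, self_mem_Iic⟩ hSbdd
  set b := sInf S with hb
  have hbD : (x, b) ∈ D := hbS.1.right_mem
  have hext : ¬ ∀ᶠ t in 𝓝[<] b, ∀ z, z < b → t ≤ z → (x, z) ∈ D := by
    intro h
    obtain ⟨t, ht, hbt⟩ := (h.and self_mem_nhdsWithin).exists
    have hbt' : t < b := hbt
    have : t ∈ S := ⟨hbS.1.trans (VRel.of_forall fun z hz => by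
      rw [uIcc_of_ge hbt'.le] at hz
      rcases hz.2.eq_or_lt with h1 | h1
      · rwa [h1]
      · exact ht z h1 hz.1), hbt'.le.trans hbS.2⟩
    exact hbt'.not_ge (csInf_le hSbdd this)
  have hbE : (x, b) ∈ E := by
    by_contra hbE
    obtain ⟨ε, hε, h1⟩ := exists_vertical_bound (P.eventually_mem hbE)
    refine hext ?_
    filter_upwards [Ioo_mem_nhdsLT (show b - ε < b by linarith)] with t ht z hz hzt
    refine h1.self_of_nhds z (abs_lt.2 ⟨?_, ?_⟩) <;> simp only <;> linarith [ht.1]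
  refine ⟨b, hbS.2, hbS.1, hbE, fun w hw => ?_⟩
  rcases P.reg _ ⟨hbD, hbE⟩ (hV b) with ⟨f, -, hf2, hf⟩ | ⟨f, -, hf2, hf⟩
  · by_contra hlt
    obtain ⟨ε, hε, h1⟩ := exists_vertical_bound hf
    have hwb : b < w.2 := not_le.1 hlt
    have hmax : b < min w.2 (b + ε) := lt_min hwb (by linarith)
    have hz1 := min_le_left w.2 (b + ε)
    have hz2 := min_le_right w.2 (b + ε)
    set z := (min w.2 (b + ε) + b) / 2 with hz
    have hzb : b < z := by linarith
    have h2 := h1.self_of_nhds z (abs_lt.2 ⟨by simp only; linarith, by simp only; linarith⟩)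
    have h3 := h2.2.1 (hw.2 z (Icc_subset_uIcc ⟨hzb.le, by linarith⟩))
    simp only at hf2 h3
    rw [hf2] at h3
    exact h3.not_gt hzb
  · exfalso
    obtain ⟨ε, hε, h1⟩ := exists_vertical_bound hf
    refine hext ?_
    filter_upwards [Ioo_mem_nhdsLT (show b - ε < b by linarith)] with t ht z hz hzt
    have h2 := h1.self_of_nhds z (abs_lt.2 ⟨by simp only; linarith [ht.1], by simp only; linarith⟩)
    refine h2.2.2 ?_
    simp only at hf2 ⊢
    rw [hf2]; exact hz.le

end DomainPair

namespace Retraction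

variable {D E V : Set (ℝ × ℝ)} {r r' : ℝ × ℝ → ℝ × ℝ} (hr : Retraction D r)
include hr

/-- The upper end `b` of the segment of `D` through `(x, y)` is the lower end of a segment of `E`,
whose graph point is `r' (x, b)`. Between the two graph points there are only parts of these two
segments, and each segment contains just one point of its graph. -/
theorem fibre_up (P : DomainPair D E V) (hr' : Retraction E r') (hint : r '' D ∩ r' '' E ⊆ V)
    {x y : ℝ} (hV : ∀ y, (x, y) ∉ V) (hy : (x, y) ∈ r '' D) :
    (¬ UpIn D (x, y) → ∃ y', (x, y') ∈ r' '' E ∧ y < y' ∧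
      ∀ z, (x, z) ∈ r '' D ∪ r' '' E → ¬ (y < z ∧ z < y')) ∧
    (UpIn D (x, y) → ∀ z, (x, z) ∈ r '' D ∪ r' '' E → ¬ y < z) := by
  have hyD := (hr.mem_image_iff.1 hy).1
  constructor
  · intro hup
    obtain ⟨b, hyb, hrel, hbE, hbw⟩ := P.exists_top hV hyD hup
    have hrelb := hr'.rel _ hbE
    have hb' := hbw _ hrelb
    have hpt : (x, (r' (x, b)).2) = r' (x, b) := Prod.ext (hr'.fst hbE).symm rfl
    have hG' : (x, (r' (x, b)).2) ∈ r' '' E := by rw [hpt]; exact mem_image_of_mem _ hbE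
    refine ⟨(r' (x, b)).2, hG', lt_of_le_of_ne (hyb.trans hb') fun he => ?_, ?_⟩
    · exact hV y (hint ⟨hy, by rw [he]; exact hG'⟩)
    · rintro z hz ⟨hyz, hzy'⟩
      rcases hz with hz | hz
      · rcases le_or_gt z b with hzb | hzb
        · have := hr.eq_of_vRel hy hz (hrel.mid (Icc_subset_uIcc ⟨hyz.le, hzb⟩))
          exact hyz.ne (Prod.ext_iff.1 this).2
        · refine P.symm.notMem_of_mem_interior (Ioo_mem_nhds hzb hzy') (fun t ht => ?_) (hV z)
            (hr.mem_image_iff.1 hz).1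
          exact hrelb.2 t (Icc_subset_uIcc ⟨ht.1.le, ht.2.le⟩)
      · rcases le_or_gt b z with hzb | hzb
        · have h1 : VRel E (x, b) (x, z) := hrelb.mid (Icc_subset_uIcc ⟨hzb, hzy'.le⟩)
          have := hr'.eq_of_vRel hG' hz (hpt ▸ hrelb.symm.trans h1)
          exact hzy'.ne (Prod.ext_iff.1 this).2.symm
        · refine P.notMem_of_mem_interior (Ioo_mem_nhds hyz hzb) (fun t ht => ?_) (hV z)
            (hr'.mem_image_iff.1 hz).1
          exact hrel.2 t (Icc_subset_uIcc ⟨ht.1.le, ht.2.le⟩)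
  · intro hup z hz hyz
    rcases hz with hz | hz
    · have : VRel D (x, y) (x, z) := VRel.of_forall fun t ht => by
        rw [uIcc_of_le hyz.le] at ht
        rcases ht.1.eq_or_lt with h | h
        · rwa [← h]
        · exact hup t h
      exact hyz.ne (Prod.ext_iff.1 (hr.eq_of_vRel hy hz this)).2
    · exact P.notMem_of_mem_interior (Ioi_mem_nhds hyz) (fun t ht => hup t ht) (hV z)
        (hr'.mem_image_iff.1 hz).1

theorem fibre_down (P : DomainPair D E V) (hr' : Retraction E r') (hint : r '' D ∩ r' '' E ⊆ V)
    {x y : ℝ} (hV : ∀ y, (x, y) ∉ V) (hy : (x, y) ∈ r '' D) :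
    (¬ DownIn D (x, y) → ∃ y', (x, y') ∈ r' '' E ∧ y' < y ∧
      ∀ z, (x, z) ∈ r '' D ∪ r' '' E → ¬ (y' < z ∧ z < y)) ∧
    (DownIn D (x, y) → ∀ z, (x, z) ∈ r '' D ∪ r' '' E → ¬ z < y) := by
  have hyD := (hr.mem_image_iff.1 hy).1
  constructor
  · intro hup
    obtain ⟨b, hyb, hrel, hbE, hbw⟩ := P.exists_bot hV hyD hup
    have hrelb := hr'.rel _ hbE
    have hb' := hbw _ hrelb
    have hpt : (x, (r' (x, b)).2) = r' (x, b) := Prod.ext (hr'.fst hbE).symm rfl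
    have hG' : (x, (r' (x, b)).2) ∈ r' '' E := by rw [hpt]; exact mem_image_of_mem _ hbE
    refine ⟨(r' (x, b)).2, hG', lt_of_le_of_ne (hb'.trans hyb) fun he => ?_, ?_⟩
    · exact hV y (hint ⟨hy, by rw [← he]; exact hG'⟩)
    · rintro z hz ⟨hzy', hyz⟩
      rcases hz with hz | hz
      · rcases le_or_gt b z with hzb | hzb
        · have := hr.eq_of_vRel hy hz (hrel.mid (Icc_subset_uIcc' ⟨hzb, hyz.le⟩))
          exact hyz.ne (Prod.ext_iff.1 this).2.symm
        · refine P.symm.notMem_of_mem_interior (Ioo_mem_nhds hzy' hzb) (fun t ht => ?_) (hV z)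
            (hr.mem_image_iff.1 hz).1
          exact hrelb.2 t (Icc_subset_uIcc' ⟨ht.1.le, ht.2.le⟩)
      · rcases le_or_gt z b with hzb | hzb
        · have h1 : VRel E (x, b) (x, z) := hrelb.mid (Icc_subset_uIcc' ⟨hzy'.le, hzb⟩)
          have := hr'.eq_of_vRel hG' hz (hpt ▸ hrelb.symm.trans h1)
          exact hzy'.ne (Prod.ext_iff.1 this).2
        · refine P.notMem_of_mem_interior (Ioo_mem_nhds hzb hyz) (fun t ht => ?_) (hV z)
            (hr'.mem_image_iff.1 hz).1
          exact hrel.2 t (Icc_subset_uIcc' ⟨ht.1.le, ht.2.le⟩)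
  · intro hup z hz hyz
    rcases hz with hz | hz
    · have : VRel D (x, y) (x, z) := VRel.of_forall fun t ht => by
        rw [uIcc_of_ge hyz.le] at ht
        rcases ht.2.eq_or_lt with h | h
        · rwa [h]
        · exact hup t h
      exact hyz.ne (Prod.ext_iff.1 (hr.eq_of_vRel hy hz this)).2.symm
    · exact P.notMem_of_mem_interior (Iio_mem_nhds hyz) (fun t ht => hup t ht) (hV z)
        (hr'.mem_image_iff.1 hz).1

/-- If high points belong to `D`, being unbounded upwards means being joined in `D` to a fixed large
height `T`. This is a closed condition, and also an open one along the graph off `V`, since the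
segment then avoids `V`. It is therefore constant on each edge, and feathers can be read on a single
fibre. -/
theorem eventually_upIn_iff (P : DomainPair D E V) {p : ℝ × ℝ} (hp : p ∈ r '' D) (hpV : p ∉ V) :
    ∀ᶠ q in 𝓝 p, q ∈ r '' D → (UpIn D p ↔ UpIn D q) := by
  obtain ⟨hpD, hrp⟩ := hr.mem_image_iff.1 hp
  obtain ⟨R, hfar, -⟩ := P.exists_far p.1
  rcases hfar with hfar | hfar
  · set T := max R p.2 + 1 with hT
    have hRT : R < T := (le_max_left _ _).trans_lt (lt_add_one _)
    have hpT : p.2 < T := (le_max_right _ _).trans_lt (lt_add_one _)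
    have key : ∀ q : ℝ × ℝ, q ∈ D → (∀ y, R < y → (q.1, y) ∈ D) → q.2 < T →
        (UpIn D q ↔ VRel D q (q.1, T)) := by
      intro q hq hqf hqT
      constructor
      · refine fun h => ⟨rfl, fun y hy => ?_⟩
        rw [uIcc_of_le hqT.le] at hy
        rcases hy.1.eq_or_lt with h1 | h1
        · rwa [← h1]
        · exact h y h1
      · intro h y hy
        rcases le_or_gt y T with h1 | h1
        · exact h.2 y (Icc_subset_uIcc ⟨hy.le, h1⟩)
        · exact hqf y (hRT.trans h1)
    have t : Tendsto (fun q : ℝ × ℝ => (q, (q.1, T))) (𝓝 p) (𝓝 (p, (p.1, T))) :=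
      Continuous.tendsto (by fun_prop) p
    have hev : ∀ᶠ q in 𝓝 p, (∀ y, R < y → (q.1, y) ∈ D) ∧ q.2 < T :=
      (continuousAt_fst.eventually hfar).and (continuousAt_snd.eventually (Iio_mem_nhds hpT))
    by_cases hup : VRel D p (p.1, T)
    · filter_upwards [hev, t.eventually (P.eventually_vRel hup
        (hr.avoid P hup (by rwa [hrp])))] with q h1 h2 hq
      have hqD := (hr.mem_image_iff.1 hq).1
      rw [key p hpD hfar.self_of_nhds hpT, key q hqD h1.1 h1.2]
      exact iff_of_true hup (h2 hqD (h1.1 T hRT) rfl)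
    · have h3 : ∀ᶠ z in 𝓝 (p, (p.1, T)), ¬ VRel D z.1 z.2 :=
        (isClosed_vRel P.closedD).isOpen_compl.mem_nhds hup
      filter_upwards [hev, t.eventually h3] with q h1 h2 hq
      have hqD := (hr.mem_image_iff.1 hq).1
      rw [key p hpD hfar.self_of_nhds hpT, key q hqD h1.1 h1.2]
      exact iff_of_false hup h2
  · have key : ∀ q : ℝ × ℝ, (∀ y, R < y → (q.1, y) ∉ D) → ¬ UpIn D q := fun q h1 h2 =>
      h1 (max R q.2 + 1) ((le_max_left _ _).trans_lt (lt_add_one _))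
        (h2 _ ((le_max_right _ _).trans_lt (lt_add_one _)))
    filter_upwards [continuousAt_fst.eventually hfar] with q h1 _
    exact iff_of_false (key p hfar.self_of_nhds) (key q h1)

theorem eventually_downIn_iff (P : DomainPair D E V) {p : ℝ × ℝ} (hp : p ∈ r '' D) (hpV : p ∉ V) :
    ∀ᶠ q in 𝓝 p, q ∈ r '' D → (DownIn D p ↔ DownIn D q) := by
  obtain ⟨hpD, hrp⟩ := hr.mem_image_iff.1 hp
  obtain ⟨R, -, hfar⟩ := P.exists_far p.1
  rcases hfar with hfar | hfar
  · set T := min (-R) p.2 - 1 with hT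
    have hRT : T < -R := by linarith [min_le_left (-R) p.2]
    have hpT : T < p.2 := by linarith [min_le_right (-R) p.2]
    have key : ∀ q : ℝ × ℝ, q ∈ D → (∀ y, y < -R → (q.1, y) ∈ D) → T < q.2 →
        (DownIn D q ↔ VRel D q (q.1, T)) := by
      intro q hq hqf hqT
      constructor
      · refine fun h => ⟨rfl, fun y hy => ?_⟩
        rw [uIcc_of_ge hqT.le] at hy
        rcases hy.2.eq_or_lt with h1 | h1
        · rwa [h1]
        · exact h y h1
      · intro h y hy
        rcases le_or_gt T y with h1 | h1
        · exact h.2 y (Icc_subset_uIcc' ⟨h1, hy.le⟩)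
        · exact hqf y (h1.trans hRT)
    have t : Tendsto (fun q : ℝ × ℝ => (q, (q.1, T))) (𝓝 p) (𝓝 (p, (p.1, T))) :=
      Continuous.tendsto (by fun_prop) p
    have hev : ∀ᶠ q in 𝓝 p, (∀ y, y < -R → (q.1, y) ∈ D) ∧ T < q.2 :=
      (continuousAt_fst.eventually hfar).and (continuousAt_snd.eventually (Ioi_mem_nhds hpT))
    by_cases hup : VRel D p (p.1, T)
    · filter_upwards [hev, t.eventually (P.eventually_vRel hup
        (hr.avoid P hup (by rwa [hrp])))] with q h1 h2 hq
      have hqD := (hr.mem_image_iff.1 hq).1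
      rw [key p hpD hfar.self_of_nhds hpT, key q hqD h1.1 h1.2]
      exact iff_of_true hup (h2 hqD (h1.1 T hRT) rfl)
    · have h3 : ∀ᶠ z in 𝓝 (p, (p.1, T)), ¬ VRel D z.1 z.2 :=
        (isClosed_vRel P.closedD).isOpen_compl.mem_nhds hup
      filter_upwards [hev, t.eventually h3] with q h1 h2 hq
      have hqD := (hr.mem_image_iff.1 hq).1
      rw [key p hpD hfar.self_of_nhds hpT, key q hqD h1.1 h1.2]
      exact iff_of_false hup h2
  · have key : ∀ q : ℝ × ℝ, (∀ y, y < -R → (q.1, y) ∉ D) → ¬ DownIn D q := fun q h1 h2 =>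
      h1 (min (-R) q.2 - 1) (by linarith [min_le_left (-R) q.2])
        (h2 _ (by linarith [min_le_right (-R) q.2]))
    filter_upwards [continuousAt_fst.eventually hfar] with q h1 _
    exact iff_of_false (key p hfar.self_of_nhds) (key q h1)

end Retraction

namespace IsReeb

variable {D E V : Set (ℝ × ℝ)} {r r' : ℝ × ℝ → ℝ × ℝ} {G G' : EnrichedGraph (ℝ × ℝ)}

section

variable (P : DomainPair D E V) (h : IsReeb D V r G)
include P h

theorem graphLike : GraphLike G.carrier G.vertices := by
  rw [h.carrier, h.vertices]
  exact h.retr.graphLike P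

theorem isTransversalGraph : stdPlane.IsTransversalGraph G :=
  (h.graphLike P).isTransversalGraph (fun E hE => ((h.up E).1 hE).1)
    fun E hE => ((h.down E).1 hE).1

omit P in
theorem edge_const {F : Set (ℝ × ℝ)} (hF : F ∈ G.openEdges) {Q : ℝ × ℝ → Prop}
    (hQ : ∀ p ∈ r '' D, p ∉ V → ∀ᶠ q in 𝓝 p, q ∈ r '' D → (Q p ↔ Q q)) {p q : ℝ × ℝ} (hp : p ∈ F)
    (hq : q ∈ F) : Q p ↔ Q q := by
  have hsub := EnrichedGraph.subset_of_mem_openEdges hF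
  have hpre : IsPreconnected F := by
    obtain ⟨w, -, rfl⟩ := hF
    exact isPreconnected_connectedComponentIn
  rw [h.carrier, h.vertices] at hsub
  refine hpre.induction₂' (fun p q => Q p ↔ Q q) ?_ ?_ hp hq
  · intro w hw
    filter_upwards [mem_nhdsWithin_of_mem_nhds (hQ w (hsub hw).1 (hsub hw).2), self_mem_nhdsWithin]
      with z h1 h2
    exact ⟨h1 (hsub h2).1, (h1 (hsub h2).1).symm⟩
  · exact fun a b c _ _ _ h1 h2 => h1.trans h2

theorem fibreRule (h' : IsReeb E V r' G') (hint : G.carrier ∩ G'.carrier ⊆ V) {s : Side} {x : ℝ}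
    (hx : Beyond V s x) : FibreRule G G' x := by
  rw [h.carrier, h'.carrier] at hint
  intro F hF y hy
  have hsub := EnrichedGraph.subset_of_mem_openEdges hF
  have hyG : (x, y) ∈ r '' D := h.carrier ▸ (hsub hy).1
  have hFa : F ∈ stdPlane.arrowEdges G :=
    ⟨s, ((h.graphLike P).mem_arrows_iff (h.vertices.symm ▸ hx) hF).2 ⟨y, hy⟩⟩
  have hup : F ∈ G.up ↔ UpIn D (x, y) := by
    rw [h.up]
    exact ⟨fun h1 => h1.2 _ hy, fun h1 => ⟨hFa, fun p hp =>
      (h.edge_const hF (fun p hp hpV => h.retr.eventually_upIn_iff P hp hpV) hy hp).1 h1⟩⟩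
  have hdown : F ∈ G.down ↔ DownIn D (x, y) := by
    rw [h.down]
    exact ⟨fun h1 => h1.2 _ hy, fun h1 => ⟨hFa, fun p hp =>
      (h.edge_const hF (fun p hp hpV => h.retr.eventually_downIn_iff P hp hpV) hy hp).1 h1⟩⟩
  have h1 := h.retr.fibre_up P h'.retr hint hx.notMem hyG
  have h2 := h.retr.fibre_down P h'.retr hint hx.notMem hyG
  rw [hup, hdown, h.carrier, h'.carrier]
  exact ⟨h1.1, h1.2, h2.1, h2.2⟩

/-- The filling domain gives one branch `g` between the fold branches `f₁` and `f₂`; the surrounding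
one gives `h₁` and `h₂` weakly outside them. The inequalities between `g` and the outer branches
become strict because the graphs meet only at vertices. -/
theorem trident (h' : IsReeb E V r' G') (hint : G.carrier ∩ G'.carrier ⊆ V) {s : Side} {v : ℝ × ℝ}
    (hv : v ∈ V) (hf : FoldAt D E s v) : stdPlane.Trident G G' s v := by
  obtain ⟨f₁, f₂, B, hBo, hv2, hc, hl, hs, hB, hx⟩ := hf.exists_box
  have hrv := (h.retr.eq_vertex P hv).1
  have hrv' := (h'.retr.eq_vertex P.symm hv).1
  obtain ⟨g, b1, b2, hg⟩ :=
    h.retr.branches_inside (P.subset hv).1 hBo hrv hc.1 hl.1 hs hB hx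
  obtain ⟨h₀, h₁, h₂, b3, b4, hh⟩ :=
    h'.retr.branches_outside (P.subset hv).2 hBo hv2 hrv' hc hl hs hB hx
  refine trident_of_hasBranches (h.graphLike P) (h'.graphLike P.symm) (h.vertices.symm ▸ hv)
    (h'.vertices.symm ▸ hv) (g := g) (h₀ := h₀) (h₁ := h₁) (h₂ := h₂) (h.carrier.symm ▸ b1)
    (h.carrier.symm ▸ b2) (h'.carrier.symm ▸ b3) (h'.carrier.symm ▸ b4) ?_
  rw [h.carrier, h'.carrier] at hint
  have hgl : Tendsto g (𝓝[s.ray v.1] v.1) (𝓝 v.2) := b1.lim ()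
  have hh₁ : Tendsto h₁ (𝓝[s.ray v.1] v.1) (𝓝 v.2) := b4.lim false
  have hh₂ : Tendsto h₂ (𝓝[s.ray v.1] v.1) (𝓝 v.2) := b4.lim true
  filter_upwards [hg, hh, (tendsto_mk_of_tendsto hgl).eventually b1.mem_iff,
    (tendsto_mk_of_tendsto hh₁).eventually b4.mem_iff,
    (tendsto_mk_of_tendsto hh₂).eventually b4.mem_iff,
    eventually_notMem_of_finite P.finite hgl, self_mem_nhdsWithin] with x a1 a2 a3 a4 a5 a6 a7
  have c1 : (x, g x) ∈ r '' D := (a3 a7).2 ⟨(), rfl⟩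
  have c2 : (x, h₁ x) ∈ r' '' E := (a4 a7).2 ⟨false, rfl⟩
  have c3 : (x, h₂ x) ∈ r' '' E := (a5 a7).2 ⟨true, rfl⟩
  refine ⟨lt_of_le_of_ne (a2.1.trans a1.1) fun he => ?_,
    lt_of_le_of_ne (a1.2.trans a2.2) fun he => ?_⟩
  · exact a6 (hint ⟨c1, he ▸ c2⟩)
  · exact a6 (hint ⟨c1, he.symm ▸ c3⟩)

end

theorem isTridentCompletion (P : DomainPair D E V) (h : IsReeb D V r G) (h' : IsReeb E V r' G')
    (hint : G.carrier ∩ G'.carrier ⊆ V) : stdPlane.IsTridentCompletion G G' := by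
  have hint' : G'.carrier ∩ G.carrier ⊆ V := by rwa [inter_comm]
  refine ⟨h'.isTransversalGraph P.symm, h'.vertices.trans h.vertices.symm,
    h.vertices.symm ▸ hint, fun v hv => ?_, fun s => ?_⟩
  · rw [h.vertices] at hv
    obtain ⟨s, hs | hs⟩ := P.fold v hv
    · exact ⟨s, Or.inl (h.trident P h' hint hv hs)⟩
    · exact ⟨s, Or.inr (h'.trident P.symm h hint' hv hs)⟩
  · obtain ⟨x, hx⟩ := exists_beyond P.finite s
    have hx1 : Beyond G.vertices s x := h.vertices.symm ▸ hx
    have hx2 : Beyond G'.vertices s x := h'.vertices.symm ▸ hx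
    exact ⟨((h.graphLike P).arrowRule_iff (h'.graphLike P.symm) hx1 hx2
        (h.vertices.symm ▸ hint)).2 (h.fibreRule P h' hint hx),
      ((h'.graphLike P.symm).arrowRule_iff (h.graphLike P) hx2 hx1
        (h'.vertices.symm ▸ hint')).2 (h'.fibreRule P.symm h hint' hx)⟩

end IsReeb

/-! ### Pushing a Reeb graph inside the domain -/

/-- The vertical translation by `σ * t`. -/
def vshift (σ t : ℝ) (p : ℝ × ℝ) : ℝ × ℝ := (p.1, p.2 + σ * t)

/-- The length, at most `e p`, of the vertical segment of `D` that issues from `p` in the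
direction `σ`. -/
noncomputable def reach (D : Set (ℝ × ℝ)) (e : ℝ × ℝ → ℝ) (σ : ℝ) (p : ℝ × ℝ) : ℝ :=
  sSup {t | t ∈ Icc 0 (e p) ∧ VRel D p (vshift σ t p)}

theorem vshift_zero (σ : ℝ) (p : ℝ × ℝ) : vshift σ 0 p = p := by simp [vshift]

theorem continuous_vshift (σ t : ℝ) : Continuous (vshift σ t) := by unfold vshift; fun_prop

section

variable {D : Set (ℝ × ℝ)} {e : ℝ × ℝ → ℝ} {σ : ℝ}

theorem VRel.vshift_of_le {p : ℝ × ℝ} {t u : ℝ} (h : VRel D p (vshift σ u p)) (ht : 0 ≤ t)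
    (htu : t ≤ u) : VRel D p (vshift σ t p) := by
  refine h.mid ?_
  rw [vshift, mem_uIcc]
  rcases le_total 0 σ with hσ | hσ
  · left; constructor <;> nlinarith
  · right; constructor <;> nlinarith

theorem bddAbove_reach (p : ℝ × ℝ) : BddAbove {t | t ∈ Icc 0 (e p) ∧ VRel D p (vshift σ t p)} :=
  ⟨e p, fun _ ht => ht.1.2⟩

theorem le_reach {p : ℝ × ℝ} {t : ℝ} (ht : 0 ≤ t) (hte : t ≤ e p)
    (h : VRel D p (vshift σ t p)) : t ≤ reach D e σ p :=
  le_csSup (bddAbove_reach p) ⟨⟨ht, hte⟩, h⟩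

theorem reach_mem (hD : IsClosed D) {p : ℝ × ℝ} (hp : p ∈ D) (he : 0 ≤ e p) :
    reach D e σ p ∈ Icc 0 (e p) ∧ VRel D p (vshift σ (reach D e σ p) p) := by
  have hc : IsClosed {t | t ∈ Icc 0 (e p) ∧ VRel D p (vshift σ t p)} :=
    isClosed_Icc.inter ((isClosed_vRel hD).preimage
      (by unfold vshift; fun_prop : Continuous fun t : ℝ => (p, vshift σ t p)))
  refine hc.csSup_mem ⟨0, ⟨le_rfl, he⟩, ?_⟩ (bddAbove_reach p)
  rw [vshift_zero]
  exact VRel.refl hp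

/-- Upper semicontinuity: a limit of vertical segments in a closed set is again a segment of that
set. -/
theorem eventually_reach_lt (hD : IsClosed D) (hec : Continuous e) (he : ∀ p, 0 ≤ e p) {p : ℝ × ℝ}
    (hp : p ∈ D) {c : ℝ} (hc : reach D e σ p < c) : ∀ᶠ q in 𝓝[D] p, reach D e σ q < c := by
  obtain ⟨d, hd, hdc⟩ := exists_between hc
  have h0 := (reach_mem (σ := σ) hD hp (he p)).1.1
  have hcl : IsClosed {q : ℝ × ℝ | VRel D q (vshift σ d q) ∧ d ≤ e q} :=
    ((isClosed_vRel hD).preimage (continuous_id.prodMk (continuous_vshift σ d))).inter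
      (isClosed_le continuous_const hec)
  have hn : p ∉ {q : ℝ × ℝ | VRel D q (vshift σ d q) ∧ d ≤ e q} := fun h =>
    hd.not_ge (le_reach (h0.trans hd.le) h.2 h.1)
  have hev : ∀ᶠ q in 𝓝 p, q ∉ {q : ℝ × ℝ | VRel D q (vshift σ d q) ∧ d ≤ e q} :=
    hcl.isOpen_compl.mem_nhds hn
  filter_upwards [mem_nhdsWithin_of_mem_nhds hev, self_mem_nhdsWithin] with q h1 hq
  by_contra hlt
  obtain ⟨h2, h3⟩ := reach_mem (σ := σ) hD hq (he q)
  have hdr : d ≤ reach D e σ q := hdc.le.trans (not_lt.1 hlt)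
  exact h1 ⟨h3.vshift_of_le (h0.trans hd.le) hdr, hdr.trans h2.2⟩

end

namespace Retraction

variable {D E V : Set (ℝ × ℝ)} {r : ℝ × ℝ → ℝ × ℝ} {e : ℝ × ℝ → ℝ} {σ : ℝ}

/-- Lower semicontinuity holds along the image of `r`: a segment through a graph point off `V`
avoids `V`, hence is stable. At the points of `V` the cap `e` vanishes, and only negative `c`
remain. -/
theorem eventually_lt_reach (hr : Retraction D r) (P : DomainPair D E V) (hec : Continuous e)
    (he : ∀ p, 0 ≤ e p) (heV : ∀ p ∈ V, e p = 0) (hσ : σ * σ = 1) {p : ℝ × ℝ} (hp : p ∈ r '' D)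
    {c : ℝ} (hc : c < reach D e σ p) : ∀ᶠ q in 𝓝[r '' D] p, c < reach D e σ q := by
  have hsub : ∀ q ∈ r '' D, q ∈ D := fun q hq => (hr.mem_image_iff.1 hq).1
  rcases lt_or_ge c 0 with hc0 | hc0
  · filter_upwards [self_mem_nhdsWithin] with q hq
    exact hc0.trans_le (reach_mem P.closedD (hsub q hq) (he q)).1.1
  obtain ⟨hpD, hrp⟩ := hr.mem_image_iff.1 hp
  obtain ⟨h1, h2⟩ := reach_mem (σ := σ) P.closedD hpD (he p)
  obtain ⟨t, hct, htu⟩ := exists_between hc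
  have ht0 : 0 < t := hc0.trans_lt hct
  have hpV : p ∉ V := fun h => by
    have := heV p h
    linarith [h1.2]
  have hrel : VRel D p (vshift σ t p) := h2.vshift_of_le ht0.le htu.le
  have havoid := hr.avoid P hrel (by rwa [hrp])
  -- The shortened segment ends in the interior of a longer one and off `V`, thus off `E`. Its end
  -- therefore stays in `D` when `p` moves slightly.
  have hnE : vshift σ t p ∉ E := by
    refine P.notMem_of_mem_interior (S := (fun z => σ * (z - p.2)) ⁻¹' Ioo 0 (reach D e σ p))
      ?_ (fun z hz => ?_) (havoid _ right_mem_uIcc)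
    · have hcont : Continuous fun z => σ * (z - p.2) := by fun_prop
      refine hcont.continuousAt.preimage_mem_nhds ?_
      have : σ * ((vshift σ t p).2 - p.2) = t := by simp only [vshift]; linear_combination t * hσ
      change Ioo _ _ ∈ 𝓝 (σ * ((vshift σ t p).2 - p.2))
      rw [this]
      exact Ioo_mem_nhds ht0 htu
    · have h3 := (h2.vshift_of_le (t := σ * (z - p.2)) hz.1.le hz.2.le).right_mem
      have : vshift σ (σ * (z - p.2)) p = (p.1, z) :=
        Prod.ext rfl (by simp only [vshift]; linear_combination (z - p.2) * hσ)
      rwa [this] at h3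
  have ts : Tendsto (vshift σ t) (𝓝 p) (𝓝 (vshift σ t p)) := (continuous_vshift σ t).tendsto p
  have h4 := (tendsto_id.prodMk_nhds ts).eventually (P.eventually_vRel hrel havoid)
  have h5 : ∀ᶠ q in 𝓝 p, t < e q := hec.continuousAt.eventually (Ioi_mem_nhds (htu.trans_le h1.2))
  filter_upwards [mem_nhdsWithin_of_mem_nhds h4, mem_nhdsWithin_of_mem_nhds h5,
    mem_nhdsWithin_of_mem_nhds (ts.eventually (P.eventually_mem hnE)), self_mem_nhdsWithin]
    with q h6 h7 h8 hq
  exact hct.trans_le (le_reach ht0.le h7.le (h6 (hsub q hq) h8 rfl))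

theorem continuousOn_reach (hr : Retraction D r) (P : DomainPair D E V) (hec : Continuous e)
    (he : ∀ p, 0 ≤ e p) (heV : ∀ p ∈ V, e p = 0) (hσ : σ * σ = 1) :
    ContinuousOn (reach D e σ) (r '' D) := by
  have hsub : r '' D ⊆ D := fun q hq => (hr.mem_image_iff.1 hq).1
  intro p hp
  refine tendsto_order.2 ⟨fun c hc => hr.eventually_lt_reach P hec he heV hσ hp hc, fun c hc => ?_⟩
  exact (eventually_reach_lt P.closedD hec he (hsub hp) hc).filter_mono (nhdsWithin_mono p hsub)

/-- The point of the vertical segment of `D` through `p` obtained by moving `p` away from the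
ends of the segment. -/
noncomputable def _root_.inward (D : Set (ℝ × ℝ)) (e : ℝ × ℝ → ℝ) (p : ℝ × ℝ) : ℝ × ℝ :=
  -- The factor `1/3` puts the new point strictly between the two extremities as soon as one of the
  -- reaches is positive.
  (p.1, p.2 + (reach D e 1 p - reach D e (-1) p) / 3)

theorem _root_.inward_spec (hD : IsClosed D) (he : ∀ p, 0 ≤ e p) {p : ℝ × ℝ} (hp : p ∈ D) {y : ℝ}
    (h1 : p.2 - reach D e (-1) p ≤ y) (h2 : y ≤ p.2 + reach D e 1 p) : VRel D p (p.1, y) := by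
  rcases le_total p.2 y with h | h
  · have := (reach_mem (σ := 1) hD hp (he p)).2.vshift_of_le (t := y - p.2) (by linarith)
      (by linarith)
    rwa [vshift, one_mul, add_sub_cancel] at this
  · have := (reach_mem (σ := -1) hD hp (he p)).2.vshift_of_le (t := p.2 - y) (by linarith)
      (by linarith)
    rwa [vshift, neg_one_mul, neg_sub, add_sub_cancel] at this

theorem _root_.DomainPair.exists_vshift_mem (P : DomainPair D E V) {p : ℝ × ℝ} (hp : p ∈ D)
    (hpV : p ∉ V) : ∃ σ : ℝ, (σ = 1 ∨ σ = -1) ∧ ∀ᶠ t in 𝓝[≥] (0 : ℝ), vshift σ t p ∈ D := by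
  have ts : ∀ σ, Tendsto (fun t => vshift σ t p) (𝓝[≥] (0 : ℝ)) (𝓝 p) := by
    intro σ
    have : Continuous fun t => vshift σ t p := by unfold vshift; fun_prop
    have h := this.tendsto 0
    rw [vshift_zero] at h
    exact h.mono_left nhdsWithin_le_nhds
  by_cases hE : p ∈ E
  · rcases P.reg p ⟨hp, hE⟩ hpV with ⟨f, -, hf2, hf⟩ | ⟨f, -, hf2, hf⟩
    · refine ⟨1, Or.inl rfl, ?_⟩
      filter_upwards [(ts 1).eventually hf, self_mem_nhdsWithin] with t h1 h2
      refine h1.1.2 ?_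
      have h2' : 0 ≤ t := h2
      simp only [vshift, hf2]; linarith
    · refine ⟨-1, Or.inr rfl, ?_⟩
      filter_upwards [(ts (-1)).eventually hf, self_mem_nhdsWithin] with t h1 h2
      refine h1.2.2 ?_
      have h2' : 0 ≤ t := h2
      simp only [vshift, hf2]; linarith
  · exact ⟨1, Or.inl rfl, (ts 1).eventually (P.eventually_mem hE)⟩

theorem _root_.DomainPair.reach_pos (P : DomainPair D E V) {p : ℝ × ℝ} (hp : p ∈ D)
    (hpV : p ∉ V) (hep : 0 < e p) : 0 < reach D e 1 p ∨ 0 < reach D e (-1) p := by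
  obtain ⟨σ, hσ, hev⟩ := P.exists_vshift_mem hp hpV
  obtain ⟨d, hd, hd2⟩ := (mem_nhdsGE_iff_exists_Ico_subset).1 hev
  have hd' : (0 : ℝ) < d := hd
  set t := min (d / 2) (e p) with ht
  have ht0 : 0 < t := lt_min (by linarith) hep
  have htd : t < d := (min_le_left _ _).trans_lt (by linarith)
  have hrel : VRel D p (vshift σ t p) := by
    refine ⟨rfl, fun y hy => ?_⟩
    have h1 : σ * (y - p.2) ∈ Ico 0 d := by
      rcases hσ with rfl | rfl
      · rw [vshift, uIcc_of_le (by simp only; linarith)] at hy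
        constructor <;> linarith [hy.1, hy.2]
      · rw [vshift, uIcc_of_ge (by simp only; linarith)] at hy
        constructor <;> linarith [hy.1, hy.2]
    have h2 : vshift σ (σ * (y - p.2)) p ∈ D := hd2 h1
    have h3 : vshift σ (σ * (y - p.2)) p = (p.1, y) := by
      rcases hσ with rfl | rfl <;> exact Prod.ext rfl (by simp only [vshift]; ring)
    rwa [h3] at h2
  have := ht0.trans_le (le_reach ht0.le (min_le_right _ _) hrel)
  rcases hσ with rfl | rfl
  exacts [Or.inl this, Or.inr this]

theorem _root_.DomainPair.inward_notMem (P : DomainPair D E V) (he : ∀ p, 0 ≤ e p) {p : ℝ × ℝ}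
    (hp : p ∈ D) (hpV : p ∉ V) (hep : 0 < e p) (hV : inward D e p ∉ V) : inward D e p ∉ E := by
  have h1 := (reach_mem (σ := 1) P.closedD hp (he p)).1.1
  have h2 := (reach_mem (σ := -1) P.closedD hp (he p)).1.1
  have h3 : 0 < reach D e 1 p + reach D e (-1) p := by
    rcases P.reach_pos hp hpV hep with h | h <;> linarith
  exact P.notMem_of_mem_interior (S := Ioo (p.2 - reach D e (-1) p) (p.2 + reach D e 1 p))
    (Ioo_mem_nhds (by linarith) (by linarith))
    (fun z hz => (inward_spec P.closedD he hp hz.1.le hz.2.le).right_mem) hV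

/-- Every retraction can be pushed to one whose image meets the boundary only in `V`. -/
theorem exists_inside (hr : Retraction D r) (P : DomainPair D E V) :
    ∃ r', Retraction D r' ∧ r' '' D ∩ E ⊆ V := by
  -- This cap is continuous and vanishes exactly on `V`. It makes the reaches finite on unbounded
  -- segments, and it leaves the vertices in place.
  let e : ℝ × ℝ → ℝ := fun p => ∏ v ∈ P.finite.toFinset, dist p v
  have hec : Continuous e := continuous_finsetProd _ fun v _ => by fun_prop
  have he : ∀ p, 0 ≤ e p := fun p => Finset.prod_nonneg fun v _ => dist_nonneg
  have heV : ∀ p, e p = 0 ↔ p ∈ V := by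
    intro p
    simp only [e, Finset.prod_eq_zero_iff, Finite.mem_toFinset, dist_eq_zero]
    exact ⟨fun ⟨v, hv, h⟩ => h ▸ hv, fun h => ⟨p, h, rfl⟩⟩
  have hin : ∀ p ∈ D, VRel D p (inward D e p) := by
    intro p hp
    have h1 := (reach_mem (σ := 1) P.closedD hp (he p)).1.1
    have h2 := (reach_mem (σ := -1) P.closedD hp (he p)).1.1
    exact inward_spec P.closedD he hp (by linarith) (by linarith)
  have hcin : ContinuousOn (inward D e) (r '' D) := by
    refine continuousOn_fst.prodMk (continuousOn_snd.add (ContinuousOn.div_const (.sub ?_ ?_) 3))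
    · exact hr.continuousOn_reach P hec he (fun p hp => (heV p).2 hp) (by norm_num)
    · exact hr.continuousOn_reach P hec he (fun p hp => (heV p).2 hp) (by norm_num)
  have hr' : Retraction D (fun p => inward D e (r p)) := by
    refine ⟨hcin.comp hr.cont (mapsTo_image r D), fun p hp => ?_, fun p q h => ?_⟩
    · exact (hr.rel p hp).trans (hin _ (hr.rel p hp).right_mem)
    · rw [hr.const p q h]
  refine ⟨_, hr', ?_⟩
  rintro _ ⟨⟨p, hp, rfl⟩, hE⟩
  by_contra hV
  have hrD : r p ∈ D := (hr.rel p hp).right_mem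
  -- Both retractions fix the vertices, so if `r p` were a vertex, its pushed point would be the
  -- same vertex.
  have hrV : r p ∉ V := by
    intro h
    have h1 := (hr'.eq_vertex P h).1
    rw [(hr.mem_image_iff.1 (mem_image_of_mem r hp)).2] at h1
    exact hV (by simpa only [h1] using h)
  refine P.inward_notMem he hrD hrV ?_ hV hE
  exact lt_of_le_of_ne (he _) fun h => hrV ((heV _).1 h.symm)

end Retraction

/-- The Reeb graph of a retraction. -/
def reebGraph (D V : Set (ℝ × ℝ)) (r : ℝ × ℝ → ℝ × ℝ) : EnrichedGraph (ℝ × ℝ) where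
  carrier := r '' D
  vertices := V
  up := {E | E ∈ stdPlane.arrowEdges ⟨r '' D, V, ∅, ∅⟩ ∧ ∀ p ∈ E, UpIn D p}
  down := {E | E ∈ stdPlane.arrowEdges ⟨r '' D, V, ∅, ∅⟩ ∧ ∀ p ∈ E, DownIn D p}

theorem Retraction.isReeb {D V : Set (ℝ × ℝ)} {r : ℝ × ℝ → ℝ × ℝ} (hr : Retraction D r) :
    IsReeb D V r (reebGraph D V r) := ⟨hr, rfl, rfl, fun _ => Iff.rfl, fun _ => Iff.rfl⟩

/-! ### Domains and Poincaré–Reeb graphs in coordinates -/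

namespace VerticalEquiv

variable {P P' : Type*} [TopologicalSpace P] [TopologicalSpace P']
  {A : VerticalPlane P} {A' : VerticalPlane P'} (Φ : VerticalEquiv A A')

theorem symm_image_image (S : Set P) : Φ.symm.toHomeo '' (Φ.toHomeo '' S) = S := by
  rw [image_image]
  exact (image_congr fun p _ => Φ.toHomeo.symm_apply_apply p).trans (image_id S)

theorem mem_topCrit_image {C : Set P} {p : P} (hp : p ∈ A.topCrit C) :
    Φ.toHomeo p ∈ A'.topCrit (Φ.toHomeo '' C) := by
  refine ⟨mem_image_of_mem _ hp.1, fun ⟨U, hU, hemb⟩ => hp.2 ⟨Φ.toHomeo ⁻¹' U,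
    Φ.toHomeo.continuous.continuousAt hU, ?_⟩⟩
  have h := Φ.symm.isEmbedding_image hemb
  rwa [← Φ.symm_image_image (C ∩ Φ.toHomeo ⁻¹' U), image_inter_preimage]

theorem topCrit_image (C : Set P) : A'.topCrit (Φ.toHomeo '' C) = Φ.toHomeo '' A.topCrit C := by
  ext q
  constructor
  · intro hq
    have h := Φ.symm.mem_topCrit_image hq
    rw [Φ.symm_image_image] at h
    exact ⟨_, h, Φ.toHomeo.apply_symm_apply q⟩
  · rintro ⟨p, hp, rfl⟩
    exact Φ.mem_topCrit_image hp

theorem isSurfaceWithBoundary_image {D : Set P} (hD : IsSurfaceWithBoundary D) :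
    IsSurfaceWithBoundary (Φ.toHomeo '' D) := by
  refine ⟨Φ.toHomeo.isClosedMap _ hD.1, ?_⟩
  rw [← Φ.toHomeo.image_frontier]
  rintro _ ⟨p, hp, rfl⟩
  obtain ⟨φ, h1, h2⟩ := hD.2 p hp
  refine ⟨Φ.toHomeo.symm.transOpenPartialHomeomorph φ, by simpa using h1, fun q hq => ?_⟩
  have := h2 (Φ.toHomeo.symm q) (by simpa using hq)
  rw [← Φ.toHomeo.preimage_symm]
  simpa using this

theorem isGenericDomain_image {D : Set P} (hD : A.IsGenericDomain D) :
    A'.IsGenericDomain (Φ.toHomeo '' D) where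
  surface := Φ.isSurfaceWithBoundary_image hD.surface
  boundary_nonempty := by
    rw [← Φ.toHomeo.image_frontier]
    exact hD.boundary_nonempty.image _
  proper := by
    rw [← Φ.toHomeo.image_frontier]
    exact Φ.isProperMap_image hD.proper
  finite_crit := by
    rw [← Φ.toHomeo.image_frontier, Φ.topCrit_image]
    exact hD.finite_crit.image _
  generic := by
    rw [← Φ.toHomeo.image_frontier, Φ.topCrit_image]
    rintro _ ⟨p, hp, rfl⟩ _ ⟨q, hq, rfl⟩ h
    rw [Φ.proj_comm, Φ.proj_comm] at h
    rw [hD.generic hp hq (Φ.base.injective h)]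

theorem domainPair {P : Type*} [TopologicalSpace P] {A : VerticalPlane P}
    (Φ : VerticalEquiv A stdPlane) {D : Set P} (hD : A.IsGenericDomain D) :
    DomainPair (Φ.toHomeo '' D) (Φ.toHomeo '' closure Dᶜ) (Φ.toHomeo '' A.topCrit (frontier D)) := by
  have h := (Φ.isGenericDomain_image hD).domainPair
  rwa [← Φ.toHomeo.image_frontier, Φ.topCrit_image, ← image_compl_eq Φ.toHomeo.bijective,
    ← Φ.toHomeo.image_closure] at h

end VerticalEquiv

theorem mem_connectedComponentIn_iff_vRel {S : Set (ℝ × ℝ)} {p q : ℝ × ℝ} (hp : p ∈ S) :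
    q ∈ connectedComponentIn (Prod.fst ⁻¹' {p.1} ∩ S) p ↔ VRel S p q := by
  have hp' : p ∈ Prod.fst ⁻¹' {p.1} ∩ S := ⟨rfl, hp⟩
  constructor
  · intro hq
    have hsub := connectedComponentIn_subset (Prod.fst ⁻¹' {p.1} ∩ S) p
    have hord := (isPreconnected_connectedComponentIn (F := Prod.fst ⁻¹' {p.1} ∩ S) (x := p)).image
      Prod.snd continuous_snd.continuousOn |>.ordConnected
    refine ⟨(hsub hq).1.symm, fun y hy => ?_⟩
    obtain ⟨c, hc, rfl⟩ := hord.uIcc_subset (mem_image_of_mem _ (mem_connectedComponentIn hp'))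
      (mem_image_of_mem _ hq) hy
    rw [← show c.1 = p.1 from (hsub hc).1]
    exact (hsub hc).2
  · intro h
    have hpre : IsPreconnected ((fun y => (p.1, y)) '' uIcc p.2 q.2) :=
      isPreconnected_uIcc.image _ (by fun_prop)
    refine hpre.subset_connectedComponentIn (mem_image_of_mem _ left_mem_uIcc) ?_
      ⟨q.2, right_mem_uIcc, Prod.ext h.1 rfl⟩
    rintro _ ⟨y, hy, rfl⟩
    exact ⟨rfl, h.2 y hy⟩

theorem VerticalEquiv.collapse_eq_iff {P : Type*} [TopologicalSpace P] {A : VerticalPlane P}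
    (Φ : VerticalEquiv A stdPlane) {D : Set P} {p q : P} (hp : p ∈ D) :
    A.collapse D p = A.collapse D q ↔ VRel (Φ.toHomeo '' D) (Φ.toHomeo p) (Φ.toHomeo q) := by
  have hproj : ∀ p, (Φ.toHomeo p).1 = Φ.base (A.proj p) := Φ.proj_comm
  have hfib : Φ.toHomeo '' (A.proj ⁻¹' {A.proj p} ∩ D) =
      Prod.fst ⁻¹' {(Φ.toHomeo p).1} ∩ Φ.toHomeo '' D := by
    rw [inter_comm _ D, inter_comm _ (Φ.toHomeo '' D), ← image_inter_preimage]
    congr 2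
    ext z
    simp only [mem_preimage, mem_singleton_iff, hproj, Φ.base.injective.eq_iff]
  rw [← mem_connectedComponentIn_iff_vRel (mem_image_of_mem _ hp), ← hfib,
    ← Φ.toHomeo.image_connectedComponentIn (s := A.proj ⁻¹' {A.proj p} ∩ D) ⟨rfl, hp⟩, Φ.toHomeo.injective.mem_set_image]
  refine Quotient.eq.trans ⟨?_, fun h => ⟨?_, Or.inl h⟩⟩
  · rintro ⟨-, h | h⟩
    exacts [h, absurd hp h.2]
  · exact (connectedComponentIn_subset _ _ h).1.symm

/-- Collapsing followed by the section is a retraction of `D`: in coordinates two points have the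
same collapse exactly if a vertical segment of `D` joins them. -/
theorem VerticalPlane.IsPRGraph.exists_isReeb {P : Type*} [TopologicalSpace P]
    {A : VerticalPlane P} (Φ : VerticalEquiv A stdPlane) {D : Set P} {E : Set (ℝ × ℝ)}
    (hP : DomainPair (Φ.toHomeo '' D) E (Φ.toHomeo '' A.topCrit (frontier D)))
    {G : EnrichedGraph P} (hG : A.IsPRGraph D G) :
    ∃ r, IsReeb (Φ.toHomeo '' D) (Φ.toHomeo '' A.topCrit (frontier D)) r (G.map Φ.toHomeo) := by
  classical
  obtain ⟨σ, hσ, hcar, hver, hup, hdown⟩ := hG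
  have hS : ∀ q : Φ.toHomeo '' D, Φ.toHomeo.symm q ∈ D := by
    rintro ⟨_, p, hp, rfl⟩
    simpa using hp
  let f : Φ.toHomeo '' D → ℝ × ℝ := fun q =>
    Φ.toHomeo (σ ⟨A.collapse D (Φ.toHomeo.symm q), mem_image_of_mem _ (hS q)⟩)
  have hf : Continuous f := by
    refine Φ.toHomeo.continuous.comp (continuous_subtype_val.comp (σ.continuous.comp
      (Continuous.subtype_mk ?_ _)))
    exact continuous_quotient_mk'.comp (Φ.toHomeo.symm.continuous.comp continuous_subtype_val)
  let r : ℝ × ℝ → ℝ × ℝ := fun q => if h : q ∈ Φ.toHomeo '' D then f ⟨q, h⟩ else q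
  have hrΦ : ∀ p (hp : p ∈ D),
      r (Φ.toHomeo p) = Φ.toHomeo (σ ⟨A.collapse D p, mem_image_of_mem _ hp⟩) := by
    intro p hp
    simp only [r, f, dif_pos (mem_image_of_mem Φ.toHomeo hp), Homeomorph.symm_apply_apply]
  have hfix : ∀ a, r (Φ.toHomeo (σ a)) = Φ.toHomeo (σ a) := by
    intro a
    rw [hrΦ _ (σ a).2]
    congr 3
    exact Subtype.ext (hσ a)
  have hr : Retraction (Φ.toHomeo '' D) r := by
    constructor
    · rw [continuousOn_iff_continuous_domRestrict]
      convert hf using 1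
      funext q
      simp only [domRestrict_apply, r, dif_pos q.2]
    · rintro _ ⟨p, hp, rfl⟩
      rw [hrΦ p hp]
      exact (Φ.collapse_eq_iff hp).1 (hσ ⟨A.collapse D p, mem_image_of_mem _ hp⟩).symm
    · intro p q h
      obtain ⟨p, hp, rfl⟩ := h.left_mem
      obtain ⟨q, hq, rfl⟩ := h.right_mem
      rw [hrΦ p hp, hrΦ q hq]
      congr 3
      exact Subtype.ext ((Φ.collapse_eq_iff hp).2 h)
  have hi := image_injective.2 Φ.toHomeo.injective
  refine ⟨r, hr, ?_, ?_, fun F => ?_, fun F => ?_⟩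
  · ext q
    constructor
    · rintro ⟨p, hp, rfl⟩
      rw [hcar] at hp
      obtain ⟨a, rfl⟩ := hp
      exact ⟨_, mem_image_of_mem _ (σ a).2, hfix a⟩
    · rintro ⟨_, ⟨p, hp, rfl⟩, rfl⟩
      rw [hrΦ p hp]
      refine mem_image_of_mem _ ?_
      rw [hcar]
      exact ⟨_, rfl⟩
  -- The vertices are defined as values of the section. Since a retraction fixes the folds, these
  -- values are the critical points themselves.
  · have key : ∀ v ∈ A.topCrit (frontier D), ∀ a : A.PRSet D, A.collapse D v = a →
        (σ a : P) = v := by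
      intro v hv a ha
      obtain ⟨v', hv', he⟩ := (hP.subset (mem_image_of_mem _ hv)).1
      obtain rfl := Φ.toHomeo.injective he
      have h1 := (hr.eq_vertex hP (mem_image_of_mem _ hv)).1
      rw [hrΦ _ hv'] at h1
      rw [← Φ.toHomeo.injective h1]
      congr 2
      exact Subtype.ext ha.symm
    refine congrArg (fun S => Φ.toHomeo '' S) ?_
    rw [hver]
    ext p
    constructor
    · rintro ⟨a, ⟨v, hv, ha⟩, rfl⟩
      rwa [key v hv a ha]
    · intro hp
      obtain ⟨p', hp', he⟩ := (hP.subset (mem_image_of_mem _ hp)).1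
      obtain rfl := Φ.toHomeo.injective he
      exact ⟨⟨A.collapse D p', mem_image_of_mem _ hp'⟩, ⟨p', hp, rfl⟩, key _ hp _ rfl⟩
  · obtain ⟨F, rfl⟩ : ∃ S, Φ.toHomeo '' S = F := ⟨Φ.toHomeo ⁻¹' F, by simp⟩
    rw [show (G.map Φ.toHomeo).up = (fun S => Φ.toHomeo '' S) '' G.up from rfl,
      Φ.arrowEdges_map, hi.mem_set_image (f := fun S => Φ.toHomeo '' S),
      hi.mem_set_image (f := fun S => Φ.toHomeo '' S), hup, forall_mem_image]
    refine and_congr_right fun _ => forall₂_congr fun p _ => ⟨fun h y hy => ?_, fun h q hq => ?_⟩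
    · obtain ⟨q, hq⟩ := Φ.toHomeo.surjective ((Φ.toHomeo p).1, y)
      rw [← hq]
      refine mem_image_of_mem _ (h q ((Φ.below_iff p q).1 ?_))
      rw [hq]
      exact ⟨rfl, hy⟩
    · have h1 := stdPlane_below.1 ((Φ.below_iff p q).2 hq)
      have h2 := h _ h1.2
      rwa [← h1.1, Prod.mk.eta, Φ.toHomeo.injective.mem_set_image] at h2
  · obtain ⟨F, rfl⟩ : ∃ S, Φ.toHomeo '' S = F := ⟨Φ.toHomeo ⁻¹' F, by simp⟩
    rw [show (G.map Φ.toHomeo).down = (fun S => Φ.toHomeo '' S) '' G.down from rfl,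
      Φ.arrowEdges_map, hi.mem_set_image (f := fun S => Φ.toHomeo '' S),
      hi.mem_set_image (f := fun S => Φ.toHomeo '' S), hdown, forall_mem_image]
    refine and_congr_right fun _ => forall₂_congr fun p _ => ⟨fun h y hy => ?_, fun h q hq => ?_⟩
    · obtain ⟨q, hq⟩ := Φ.toHomeo.surjective ((Φ.toHomeo p).1, y)
      rw [← hq]
      refine mem_image_of_mem _ (h q ((Φ.below_iff q p).1 ?_))
      rw [hq]
      exact ⟨rfl, hy⟩
    · have h1 := stdPlane_below.1 ((Φ.below_iff q p).2 hq)
      have h2 := h _ h1.2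
      rwa [h1.1, Prod.mk.eta, Φ.toHomeo.injective.mem_set_image] at h2

/-! ### The exterior graph -/

theorem IsReeb.carrier_subset {D V : Set (ℝ × ℝ)} {r : ℝ × ℝ → ℝ × ℝ} {G : EnrichedGraph (ℝ × ℝ)}
    (h : IsReeb D V r G) : G.carrier ⊆ D := by
  rw [h.carrier]
  exact fun q hq => (h.retr.mem_image_iff.1 hq).1

/-- The graphs `G` and `G'` may cross, so the completion is the pushed graph of `E`, which meets
`D`, and hence `G`, only in `V`. It is compared with `G'` through the pushed graph of `D`: that one
meets `E` only in `V`, so both graphs of `E` are completions of it. -/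
theorem IsReeb.exists_isTridentCompletion {D E V : Set (ℝ × ℝ)} {r r' : ℝ × ℝ → ℝ × ℝ}
    {G G' : EnrichedGraph (ℝ × ℝ)} (P : DomainPair D E V) (h : IsReeb D V r G)
    (h' : IsReeb E V r' G') : ∃ M', stdPlane.IsTridentCompletion G M' ∧
      (D.Nonempty → stdPlane.VerticallyIsotopic M' G') := by
  obtain ⟨s, hs, hsV⟩ := h.retr.exists_inside P
  obtain ⟨s', hs', hsV'⟩ := h'.retr.exists_inside P.symm
  have hM := hs.isReeb (V := V)
  have hM' := hs'.isReeb (V := V)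
  refine ⟨reebGraph E V s', h.isTridentCompletion P hM' ?_, fun hne => ?_⟩
  · exact fun q hq => hsV' ⟨hq.2, h.carrier_subset hq.1⟩
  · refine (hM.isTridentCompletion P hM' ?_).verticallyIsotopic (hM.isTransversalGraph P)
      (hne.image s) (hM.isTridentCompletion P h' ?_)
    · exact fun q hq => hsV ⟨hq.1, hM'.carrier_subset hq.2⟩
    · exact fun q hq => hsV ⟨hq.1, h'.carrier_subset hq.2⟩

namespace VerticalPlane

variable {P : Type*} [TopologicalSpace P] {A : VerticalPlane P} {D : Set P} {G Gc : EnrichedGraph P}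

theorem IsGenericDomain.exists_reebPair (hD : A.IsGenericDomain D) (hG : A.IsPRGraph D G)
    (hGc : A.IsPRGraph (closure Dᶜ) Gc) : ∃ (Φ : VerticalEquiv A stdPlane) (E V : Set (ℝ × ℝ))
      (r r' : ℝ × ℝ → ℝ × ℝ), DomainPair (Φ.toHomeo '' D) E V ∧
      IsReeb (Φ.toHomeo '' D) V r (G.map Φ.toHomeo) ∧ IsReeb E V r' (Gc.map Φ.toHomeo) := by
  obtain ⟨F, hF⟩ := A.exists_isHeight
  let Φ := A.coordEquiv hF F.continuous
  have hP := Φ.domainPair hD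
  have hP' := hP.symm
  obtain ⟨r, hr⟩ := hG.exists_isReeb Φ hP
  -- The exterior graph refers to critical points of the frontier of `closure Dᶜ`; this is the
  -- frontier of `D`, so both graphs share the set `V`.
  rw [← hD.surface.frontier_closure_compl] at hP'
  obtain ⟨r', hr'⟩ := hGc.exists_isReeb Φ hP'
  rw [hD.surface.frontier_closure_compl] at hr'
  exact ⟨Φ, _, _, r, r', hP, hr, hr'⟩

theorem IsGenericDomain.isTridentCompletion (hD : A.IsGenericDomain D) (hG : A.IsPRGraph D G)
    (hGc : A.IsPRGraph (closure Dᶜ) Gc) : Gc.vertices = G.vertices ∧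
      (G.carrier ∩ Gc.carrier ⊆ G.vertices → A.IsTridentCompletion G Gc) := by
  obtain ⟨Φ, E, V, r, r', hP, h, h'⟩ := hD.exists_reebPair hG hGc
  refine ⟨Φ.toHomeo.injective.image_injective (h'.vertices.trans h.vertices.symm), fun hint => ?_⟩
  have := Φ.symm.isTridentCompletion_map (h.isTridentCompletion hP h' ?_)
  · rwa [Φ.map_map_symm, Φ.map_map_symm] at this
  · rw [← h.vertices]
    simp only [EnrichedGraph.map, ← image_inter Φ.toHomeo.injective]
    exact image_mono hint

theorem IsGenericDomain.exists_isTridentCompletion (hD : A.IsGenericDomain D)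
    (hG : A.IsPRGraph D G) (hGc : A.IsPRGraph (closure Dᶜ) Gc) : A.IsTransversalGraph G ∧
      G.carrier.Nonempty ∧ ∃ H, A.IsTridentCompletion G H ∧ A.VerticallyIsotopic H Gc := by
  obtain ⟨Φ, E, V, r, r', hP, h, h'⟩ := hD.exists_reebPair hG hGc
  have hne : (Φ.toHomeo '' D).Nonempty :=
    (hD.boundary_nonempty.mono hD.surface.1.frontier_subset).image _
  obtain ⟨H, h1, h2⟩ := h.exists_isTridentCompletion hP h'
  have h3 := Φ.symm.isTransversalGraph_map (h.isTransversalGraph hP)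
  have h4 := Φ.symm.isTridentCompletion_map h1
  have h5 := (h2 hne).map Φ.symm
  rw [Φ.map_map_symm] at h3 h4 h5
  refine ⟨h3, ?_, _, h4, h5⟩
  have h6 : (Φ.toHomeo '' G.carrier).Nonempty := by
    rw [show Φ.toHomeo '' G.carrier = r '' (Φ.toHomeo '' D) from h.carrier]
    exact hne.image r
  exact h6.of_image

theorem IsGenericDomain.verticallyIsotopic (hD : A.IsGenericDomain D) (hG : A.IsPRGraph D G)
    (hGc : A.IsPRGraph (closure Dᶜ) Gc) {H : EnrichedGraph P} (hH : A.IsTridentCompletion G H) :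
    A.VerticallyIsotopic H Gc := by
  obtain ⟨h1, h2, K, h3, h4⟩ := hD.exists_isTridentCompletion hG hGc
  exact (hH.verticallyIsotopic h1 h2 h3).trans h4

/-- A completion `H` of `G` mediates: its image completes the image of `G`, hence is isotopic to
`Gc'`, while it is isotopic to the image of `Gc` by transport. -/
theorem IsGenericDomain.verticallyIsotopic_map {P' : Type*} [TopologicalSpace P']
    {A' : VerticalPlane P'} {D' : Set P'} {Gc' : EnrichedGraph P'} (hD : A.IsGenericDomain D)
    (hG : A.IsPRGraph D G) (hGc : A.IsPRGraph (closure Dᶜ) Gc) (hD' : A'.IsGenericDomain D')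
    (Φ : VerticalEquiv A A') (hG' : A'.IsPRGraph D' (G.map Φ.toHomeo))
    (hGc' : A'.IsPRGraph (closure D'ᶜ) Gc') : A'.VerticallyIsotopic (Gc.map Φ.toHomeo) Gc' := by
  obtain ⟨-, -, H, h1, h2⟩ := hD.exists_isTridentCompletion hG hGc
  exact (h2.map Φ).symm.trans
    (hD'.verticallyIsotopic hG' hGc' (Φ.isTridentCompletion_map h1))

end VerticalPlane

theorem mainTheorem12 {P : Type u} [TopologicalSpace P] (A : VerticalPlane P)
    (D : Set P) (hD : A.IsGenericDomain D)
    (G Gc : EnrichedGraph P) (hG : A.IsPRGraph D G) (hGc : A.IsPRGraph (closure Dᶜ) Gc) :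
    Gc.vertices = G.vertices ∧
    (G.carrier ∩ Gc.carrier ⊆ G.vertices → A.IsTridentCompletion G Gc) ∧
    (∃ H : EnrichedGraph P, A.IsTridentCompletion G H) ∧
    (∀ H : EnrichedGraph P, A.IsTridentCompletion G H → A.VerticallyIsotopic H Gc) ∧
    (∀ (P' : Type v) [TopologicalSpace P'] (A' : VerticalPlane P')
      (D' : Set P') (_ : A'.IsGenericDomain D') (G' Gc' : EnrichedGraph P')
      (_ : A'.IsPRGraph D' G') (_ : A'.IsPRGraph (closure D'ᶜ) Gc'),
      (∀ Φ : VerticalEquiv A A', G.map Φ.toHomeo = G' →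
        A'.VerticallyIsotopic (Gc.map Φ.toHomeo) Gc') ∧
      (A.VerticallyEquivalent A' G G' → A.VerticallyEquivalent A' Gc Gc')) := by
  obtain ⟨h1, h2⟩ := hD.isTridentCompletion hG hGc
  obtain ⟨-, -, H, h3, -⟩ := hD.exists_isTridentCompletion hG hGc
  refine ⟨h1, h2, ⟨H, h3⟩, fun H hH => hD.verticallyIsotopic hG hGc hH, ?_⟩
  intro P' _ A' D' hD' G' Gc' hG' hGc'
  have key : ∀ Φ : VerticalEquiv A A', G.map Φ.toHomeo = G' →
      A'.VerticallyIsotopic (Gc.map Φ.toHomeo) Gc' := by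
    rintro Φ rfl
    exact hD.verticallyIsotopic_map hG hGc hD' Φ hG' hGc'
  refine ⟨key, ?_⟩
  rintro ⟨Φ, hΦ⟩
  -- The end of the isotopy is a vertical equivalence of the second plane, which corrects `Φ` so
  -- that it carries `Gc` exactly onto `Gc'`.
  obtain ⟨Ψ, -, hΨ⟩ := (key Φ hΦ).exists_verticalEquiv
  exact ⟨Φ.trans Ψ, by rw [← hΨ, EnrichedGraph.map_map]; rfl⟩
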